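/- Let $\Lambda\subset\mathbb R^{24}$ be the Leech lattice. For a sublattice $M\subset\Lambda$ let $t_M$ be the orthogonal transformation of $\mathbb R^{24}$ that is $-1$ on $M$ and $1$ on $M^\perp$; call $M$ an $EE_8$-sublattice if it is isometric to $\sqrt2$ times the $E_8$ root lattice. Let $M,N$ be $EE_8$-sublattices of $\Lambda$ such that $M+N$ is of type $DIH_6(14)$, that is, $t_M$ and $t_N$ generate a dihedral group of order $6$ and $M+N$ has rank $14$. Let $R=\mathrm{ann}_\Lambda(M+N)$ be the lattice of all vectors of $\Lambda$ orthogonal to $M+N$, and let $O(R)$ be its isometry group. Let $\omega=(-1+\sqrt{-3})/2$. Then: (i) $R$ has rank $10$, and it is isometric to the lattice obtained by gluing $AA_2^5$ (five orthogonal copies of $AA_2$, the lattice $\sqrt2$ times the $A_2$ root lattice) along the code $\mathcal C=\mathrm{span}_{\mathbb F_4}\{(1,1,1,1,0),(1,0,\omega,\omega^2,1)\}$, namely to $\{x\in\mathbb Z[\omega]^5 : x \bmod 2\in\mathcal C\}$, where $\mathbb F_4=\mathbb Z[\omega]/2\mathbb Z[\omega]$ and the bilinear form is the real part of the standard Hermitian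 form; (ii) $|O(R)|=2^8\cdot3^5\cdot5$; (iii) $O(R)$ has the shape $6.PSU(4,2).2$: there are normal subgroups $Z\le B$ of $O(R)$ such that $Z$ is cyclic of order $6$, $B/Z\cong PSU(4,2)$, and $B$ has index $2$ in $O(R)$. -/

import Mathlib

noncomputable section

/-! Lattices are `ℤ`-submodules of a real inner product space. -/

section Lattices

variable {V : Type*} [NormedAddCommGroup V] [InnerProductSpace ℝ V]

/-- `M` is isometric to `√2` times the root lattice of type `E₈`: it has a `ℤ`-basis whose
Gram matrix is twice the Cartan matrix of type `E₈`. -/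
def IsEE8 (M : Submodule ℤ V) : Prop :=
  ∃ b : Module.Basis (Fin 8) ℤ M,
    ∀ i j, inner ℝ (b i : V) (b j : V) = 2 * (CartanMatrix.E₈ i j : ℝ)

/-- `ann_L(X)`: the vectors of the lattice `L` that are orthogonal to `X`. -/
def latticeAnn (L X : Submodule ℤ V) : Submodule ℤ V where
  carrier := {v | v ∈ L ∧ ∀ x ∈ X, inner ℝ v x = 0}
  zero_mem' := ⟨L.zero_mem, fun x _ => inner_zero_left x⟩
  add_mem' := by
    rintro a b ⟨ha, ha'⟩ ⟨hb, hb'⟩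
    exact ⟨L.add_mem ha hb, fun x hx => by rw [inner_add_left, ha' x hx, hb' x hx, add_zero]⟩
  smul_mem' := by
    rintro c a ⟨ha, ha'⟩
    refine ⟨L.smul_mem c ha, fun x hx => ?_⟩
    rw [← Int.cast_smul_eq_zsmul ℝ, real_inner_smul_left, ha' x hx, mul_zero]

/-- `t_M`: the orthogonal transformation that is `-1` on `M` and `1` on the orthogonal
complement of `M`. -/
def latticeInvolution [FiniteDimensional ℝ V] (M : Submodule ℤ V) : V ≃ₗᵢ[ℝ] V :=
  (Submodule.span ℝ (M : Set V))ᗮ.reflection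

/-- The sum `M + N` is of type `DIH_{2h}(k)`: `M` and `N` are `EE₈`-lattices, `t_M` and `t_N`
generate a dihedral group of order `2h`, and `M + N` has rank `k`. -/
structure IsDIHPair [FiniteDimensional ℝ V] (h k : ℕ) (M N : Submodule ℤ V) : Prop where
  left_isEE8 : IsEE8 M
  right_isEE8 : IsEE8 N
  dihedral : Nonempty
    (Subgroup.closure {latticeInvolution M, latticeInvolution N} ≃* DihedralGroup h)
  rank_eq : Module.finrank ℤ (M ⊔ N : Submodule ℤ V) = k

/-- The isometry group `O(L)` of a lattice `L`. -/
def latticeO (L : Submodule ℤ V) : Subgroup (L ≃ₗ[ℤ] L) where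
  carrier := {f | ∀ x y : L, inner ℝ (f x : V) (f y : V) = inner ℝ (x : V) (y : V)}
  one_mem' := fun _ _ => rfl
  mul_mem' := by
    intro f g hf hg x y
    exact (hf (g x) (g y)).trans (hg x y)
  inv_mem' := by
    intro f hf x y
    have h := hf (f⁻¹ x) (f⁻¹ y)
    have e : ∀ z, f (f⁻¹ z) = z := fun z => f.apply_symm_apply z
    rw [e, e] at h
    exact h.symm

end Lattices

/-! The Leech lattice. -/

/-- The 24 coordinates: the projective line over the field of 23 elements, with `none` as the
point at infinity. -/
abbrev ProjLine23 : Type := Option (ZMod 23)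

/-- The extended binary Golay code, as the extended quadratic residue code modulo 23: it is
spanned by the all-one word and the translates of the 12-set consisting of infinity and the
quadratic non-residues. -/
def golayCode : Submodule (ZMod 2) (ProjLine23 → ZMod 2) :=
  Submodule.span (ZMod 2) ({fun _ => 1} ∪ Set.range fun (t : ZMod 23) (i : ProjLine23) =>
    i.elim 1 fun s => if IsSquare (s - t) then 0 else 1)

/-- The Leech lattice: the vectors `z / √8` with `z` integral such that, for some integer `m`,
all `z i` are congruent to `m` modulo 2, the reduction of `(z i - m) / 2` modulo 2 is a Golay
codeword, and the sum of the `z i` is congruent to `4 m` modulo 8. -/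
def leechLattice : Submodule ℤ (EuclideanSpace ℝ ProjLine23) where
  carrier := {v | ∃ (m : ℤ) (z c : ProjLine23 → ℤ),
    (∀ i, v i = (z i : ℝ) / √8) ∧ (∀ i, z i = m + 2 * c i) ∧
    (fun i => (c i : ZMod 2)) ∈ golayCode ∧ ∑ i, z i ≡ 4 * m [ZMOD 8]}
  zero_mem' := ⟨0, 0, 0, by simp, by simp, by
    convert golayCode.zero_mem using 1
    funext i; simp, by simp⟩
  add_mem' := by
    rintro v w ⟨m, z, c, hv, hz, hc, hs⟩ ⟨m', z', c', hw, hz', hc', hs'⟩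
    refine ⟨m + m', z + z', c + c', fun i => ?_, fun i => ?_, ?_, ?_⟩
    · simp [hv, hw, add_div]
    · simp only [Pi.add_apply, hz, hz']; ring
    · convert golayCode.add_mem hc hc' using 1
      funext i; simp
    · simp only [Pi.add_apply, Finset.sum_add_distrib, mul_add]
      exact hs.add hs'
  smul_mem' := by
    rintro a v ⟨m, z, c, hv, hz, hc, hs⟩
    refine ⟨a * m, fun i => a * z i, fun i => a * c i, fun i => ?_, fun i => ?_, ?_, ?_⟩
    · rw [← Int.cast_smul_eq_zsmul ℝ]
      simp [hv, mul_div_assoc]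
    · simp only [hz]; ring
    · convert golayCode.smul_mem (a : ZMod 2) hc using 1
      funext i; simp
    · rw [← Finset.mul_sum, show 4 * (a * m) = a * (4 * m) by ring]
      exact hs.mul_left a

/-! The lattice obtained by gluing five copies of `AA₂` along a quaternary code. -/

/-- The primitive cube root of unity `(-1 + √-3) / 2`. -/
def eisensteinOmega : ℂ := (-1 + √3 * Complex.I) / 2

/-- The ring `ℤ[ω]` of Eisenstein integers. -/
def eisensteinIntegers : Subalgebra ℤ ℂ := Algebra.adjoin ℤ {eisensteinOmega}

/-- The vectors of `ℤ[ω]⁵` whose reduction modulo 2 lies in the code over `𝔽₄ = ℤ[ω] / 2` spanned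
by `(1, 1, 1, 1, 0)` and `(1, 0, ω, ω², 1)`, written as the `ℤ[ω]`-span of lifts of these two
words and of `(2 ℤ[ω])⁵`. With the real part of the standard Hermitian form, `2 ℤ[ω]` is a copy
of `AA₂`, so this is `AA₂⁵` glued along that code. -/
def gluedAA2Lattice : Submodule ℤ (EuclideanSpace ℂ (Fin 5)) :=
  (Submodule.span eisensteinIntegers
    ({!₂[1, 1, 1, 1, 0], !₂[1, 0, eisensteinOmega, eisensteinOmega ^ 2, 1]} ∪
      Set.range fun i : Fin 5 => EuclideanSpace.single i (2 : ℂ))).restrictScalars ℤ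

/-! The projective special unitary groups over fields with `p²` elements. -/

/-- `A*`, the transpose of `A` with all entries raised to the power `p`. -/
def frobeniusAdjoint {n p : ℕ} [Fact p.Prime] (A : Matrix (Fin n) (Fin n) (GaloisField p 2)) :
    Matrix (Fin n) (Fin n) (GaloisField p 2) :=
  (A.map (frobenius (GaloisField p 2) p)).transpose

theorem frobeniusAdjoint_one {n p : ℕ} [Fact p.Prime] :
    frobeniusAdjoint (1 : Matrix (Fin n) (Fin n) (GaloisField p 2)) = 1 := by
  rw [frobeniusAdjoint, Matrix.map_one _ (map_zero _) (map_one _), Matrix.transpose_one]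

theorem frobeniusAdjoint_mul {n p : ℕ} [Fact p.Prime]
    (A B : Matrix (Fin n) (Fin n) (GaloisField p 2)) :
    frobeniusAdjoint (A * B) = frobeniusAdjoint B * frobeniusAdjoint A := by
  rw [frobeniusAdjoint, Matrix.map_mul, Matrix.transpose_mul]; rfl

/-- `SU(n, p)`: the matrices `A` of determinant 1 over the field with `p²` elements with
`A* A = 1`. -/
def SUGroup (n p : ℕ) [Fact p.Prime] :
    Subgroup (Matrix.SpecialLinearGroup (Fin n) (GaloisField p 2)) where
  carrier := {A | frobeniusAdjoint A.val * A.val = 1}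
  one_mem' := by
    change frobeniusAdjoint (1 : Matrix (Fin n) (Fin n) (GaloisField p 2)) * 1 = 1
    rw [frobeniusAdjoint_one, Matrix.one_mul]
  mul_mem' := by
    intro A B (hA : frobeniusAdjoint A.val * A.val = 1) (hB : frobeniusAdjoint B.val * B.val = 1)
    change frobeniusAdjoint (A.val * B.val) * (A.val * B.val) = 1
    calc _ = frobeniusAdjoint B.val * (frobeniusAdjoint A.val * A.val) * B.val := by
          rw [frobeniusAdjoint_mul]; simp only [Matrix.mul_assoc]
      _ = 1 := by rw [hA, Matrix.mul_one, hB]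
  inv_mem' := by
    intro A (hA : frobeniusAdjoint A.val * A.val = 1)
    change frobeniusAdjoint A⁻¹.val * A⁻¹.val = 1
    have h1 : A.val * A⁻¹.val = 1 := congrArg Subtype.val (mul_inv_cancel A)
    have h2 : frobeniusAdjoint A⁻¹.val * frobeniusAdjoint A.val = 1 := by
      rw [← frobeniusAdjoint_mul, h1, frobeniusAdjoint_one]
    rwa [left_inv_eq_right_inv hA h1] at h2

/-- `PSU(n, p)`: the quotient of `SU(n, p)` by its center. -/
abbrev PSUGroup (n p : ℕ) [Fact p.Prime] : Type :=
  SUGroup n p ⧸ Subgroup.center (SUGroup n p)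

/-- The group `G` has the shape `m.H.k`: it has normal subgroups `Z ≤ B` with `Z` cyclic of
order `m`, `B / Z` isomorphic to `H`, and `G / B` cyclic of order `k`. -/
def HasShape (G : Type*) [Group G] (m : ℕ) (H : Type*) [Group H] (k : ℕ) : Prop :=
  ∃ (Z B : Subgroup G) (_ : Z.Normal) (_ : B.Normal), Z ≤ B ∧
    IsCyclic Z ∧ Nat.card Z = m ∧
    Nonempty (B ⧸ Z.subgroupOf B ≃* H) ∧
    IsCyclic (G ⧸ B) ∧ Nat.card (G ⧸ B) = k

end

/-! Put g = t_M t_N, an isometry of Λ of order three. It acts without nonzero fixed vectors on a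
12-dimensional space J and trivially on its orthogonal complement. The lattice R is found inside the
annihilator K' = Λ ∩ J^⊥, and K' is understood by counting its minimal vectors, not by constructing
them.

The pair has only one shape. The vectors of M fixed by g form a lattice F of rank 16 - 14 = 2. Every
functional on F extends to M and is half a product with a vector of M, and the g-orbit sum of that
vector lies in F; so 6 times the inverse Gram matrix of F is integral. With reduction theory this
gives F ≅ AA_2 (`exists_fixed_pair`). The Weyl group moves such a sublattice of EE_8 to a standard
position (`IsEE8Basis.exists_adapted`), after which all products of the vectors b_i and g b_j are
known integers (`exists_dihedralFrame`). Integer arithmetic in these coordinates produces six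
orthogonal minimal vectors f_i whose lattices Z[g] f_i are glued along the hexacode, orthogonal to a
basis r, s of F (`IsDihedralFrame.isHexaFrame`). They span J.

Write K for the glued lattice in J (the Coxeter-Todd lattice). Every class of K modulo 1 - g has a
representative of norm at most 8, and (1 - g)Λ ⊆ K. So a vector of Λ can be changed by K until its
J-component has norm at most 8/3. As Λ has minimum 4, this shows K = Λ ∩ J, and vectors of Λ outside
J have a component of norm at least 4/3 in J^⊥. For a minimal vector the norm of the J-component can
therefore only be 0, 4/3, 2, 8/3 or 4. The sixth moment of the minimal vectors of Λ is proportional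
to the cube of the norm (`sum_minimalVectors_pow_six`); since J and J^⊥ have the same dimension, a
suitable odd cubic shows that they contain equally many minimal vectors (`card_minimalVectors_eq`).
For K there are at least 756 (`card_minimalVectors_span_ge`).

Now reduce the form of K' modulo 3. The quotient by the radical has dimension at most 6, nonzero
vectors of the radical have norm at least 12, so a class contains at most three minimal vectors; and
a senary form over the field with three elements takes the value 1 at most 252 times. Since 756 = 3
· 252, every class of norm 1 is a full triple spanning an AA_2, and the form is a sum of six squares
(`exists_classes`). The orthogonal complement of the class of r has an orthonormal basis, which
gives five orthogonal triples, all orthogonal to r and s. The classes (1,1,1,1,0) and (1,0,1,1,1)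
supply the glue, whose relative position is forced by minimum 4 (`exists_isTripleFrame`), and the
same minimum forbids any further glue (`IsHexaFrame.exists_annihilator_eq`). This is (i).

For (ii) and (iii), let L be the code lattice over Z[ω] with half the standard Hermitian form. For
an isometry f the map f ω f⁻¹ sends each basis vector to its multiple by ω or ω², by a norm estimate
modulo 1 - ω; so f is linear or antilinear (`map_omega_cases`). Modulo 2 the Hermitian form has a
radical with quotient the standard unitary space of dimension 4 over the field with four elements.
Linear isometries acting trivially on it are ±1 (`eq_sign_of_glueRed`), and Hermitian reflections in
norm 2 vectors (for the halved form), with the scalars, induce all of GU(4,2)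
(`glueRep_surjective`). Hence the order is 2 · 2 · 77760. Rescaling to determinant one maps GU(4,2)
onto SU(4,2), and the kernel of the resulting map to PSU(4,2) consists of the six unit scalars
(`ker_gluePSU`). -/

set_option maxRecDepth 4000

local notation "E24" => EuclideanSpace ℝ ProjLine23

/-! ### The extended Golay code by bit masks -/

namespace ProjLine23

/-- The position of a coordinate in a bit mask. -/
def index : ProjLine23 → ℕ
  | none => 23
  | some s => s.val

theorem index_lt (i : ProjLine23) : i.index < 24 := by
  cases i with
  | none => decide
  | some s => exact lt_trans (ZMod.val_lt s) (by norm_num)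

theorem index_injective : Function.Injective index := by
  rintro (_ | s) (_ | t) h
  · rfl
  · exact absurd h (ZMod.val_lt t).ne'
  · exact absurd h (ZMod.val_lt s).ne
  · exact congrArg some (ZMod.val_injective 23 h)

theorem sum_index {A : Type*} [AddCommMonoid A] (f : ℕ → A) :
    ∑ i : ProjLine23, f i.index = ∑ k ∈ Finset.range 24, f k := by
  rw [Fintype.sum_option, Finset.sum_range_succ, add_comm, ← Fin.sum_univ_eq_sum_range f 23]
  rfl

/-- The word over `ZMod 2` with a given bit mask. -/
def word (n : ℕ) (i : ProjLine23) : ZMod 2 := if n.testBit i.index then 1 else 0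

theorem word_xor (m n : ℕ) : word (m ^^^ n) = word m + word n := by
  funext i
  simp only [word, Nat.testBit_xor, Pi.add_apply]
  cases m.testBit i.index <;> cases n.testBit i.index <;> decide

theorem word_zero : word 0 = 0 := by
  funext i
  simp [word]

/-- The masks of all sums of a list of words. -/
def spanMasks : List ℕ → List ℕ
  | [] => [0]
  | g :: l => spanMasks l ++ (spanMasks l).map (g ^^^ ·)

/-- Each generator doubles the list, so membership in a span over `ZMod 2` becomes membership in an
explicit list that can be searched by evaluation. -/
theorem mem_span_word_iff (l : List ℕ) (c : ProjLine23 → ZMod 2) :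
    c ∈ Submodule.span (ZMod 2) (word '' {n | n ∈ l}) ↔ ∃ n ∈ spanMasks l, word n = c := by
  induction l generalizing c with
  | nil => simp [spanMasks, word_zero, eq_comm]
  | cons g l ih =>
    have h : word '' {n | n ∈ g :: l} = insert (word g) (word '' {n | n ∈ l}) := by
      ext x
      simp only [Set.mem_image, Set.mem_ofPred_eq, List.mem_cons, Set.mem_insert_iff]
      constructor
      · rintro ⟨n, rfl | hn, rfl⟩
        · exact Or.inl rfl
        · exact Or.inr ⟨n, hn, rfl⟩
      · rintro (rfl | ⟨n, hn, rfl⟩)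
        · exact ⟨g, Or.inl rfl, rfl⟩
        · exact ⟨n, Or.inr hn, rfl⟩
    rw [h, Submodule.mem_span_insert]
    simp only [spanMasks, List.mem_append, List.mem_map]
    constructor
    · rintro ⟨a, z, hz, rfl⟩
      obtain ⟨n, hn, rfl⟩ := (ih z).1 hz
      fin_cases a
      · exact ⟨n, Or.inl hn, by
          rw [show (⟨0, by norm_num⟩ : Fin 2) = (0 : ZMod 2) from rfl, zero_smul, zero_add]⟩
      · exact ⟨g ^^^ n, Or.inr ⟨n, hn, rfl⟩, by
          rw [word_xor, show (⟨1, by norm_num⟩ : Fin 2) = (1 : ZMod 2) from rfl, one_smul]⟩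
    · rintro ⟨n, hn | ⟨m, hm, rfl⟩, rfl⟩
      · exact ⟨0, word n, (ih _).2 ⟨n, hn, rfl⟩, by simp⟩
      · exact ⟨1, word m, (ih _).2 ⟨m, hm, rfl⟩, by rw [word_xor]; simp⟩

end ProjLine23

open ProjLine23


/-- The masks of the translates of the generating word of the Golay code. -/
def golayTranslates : List ℕ :=
  [16436384, 16095553, 15413891, 14050567, 11323919, 14259230, 11741245, 15093882, 13410549,
    10043883, 11699158, 15009708, 13242201, 9707187, 11025766, 13662924, 10548633, 12708658,
    8640101, 8891594, 9394580, 10400552, 12412496]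

/-- The masks of a basis of the Golay code. -/
def golayBasis : List ℕ :=
  [16777215, 16436384, 16095553, 15413891, 14050567, 11323919, 14259230, 11741245, 15093882,
    13410549, 10043883, 11699158]

/-- The masks of the codewords of the Golay code. -/
def golayMasks : List ℕ := spanMasks golayBasis

theorem word_golayTranslates (t : ZMod 23) : word (golayTranslates.getD t.val 0) =
    fun i : ProjLine23 => i.elim 1 fun s => if IsSquare (s - t) then 0 else 1 := by
  funext i
  revert t i
  decide +kernel

theorem word_ones : word 16777215 = fun _ => 1 := by
  funext i
  revert i
  decide +kernel

/-- The all-one word and eleven translates already span the code: the other translates occur in the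
enumeration of their span. -/
theorem golayCode_eq_span :
    golayCode = Submodule.span (ZMod 2) (word '' {n | n ∈ golayBasis}) := by
  apply le_antisymm
  · rw [golayCode, Submodule.span_le]
    rintro _ (rfl | ⟨t, rfl⟩)
    · exact Submodule.subset_span ⟨16777215, by decide, word_ones⟩
    · change (fun i : ProjLine23 => i.elim 1 fun s => if IsSquare (s - t) then 0 else 1) ∈ _
      rw [← word_golayTranslates]
      refine (mem_span_word_iff golayBasis _).2 ?_
      refine ⟨_, ?_, rfl⟩
      have h : ∀ k < 23, (spanMasks golayBasis).elem (golayTranslates.getD k 0) = true := by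
        decide +kernel
      exact List.elem_iff.1 (h t.val (ZMod.val_lt t))
  · rw [Submodule.span_le]
    rintro _ ⟨n, hn, rfl⟩
    have h : ∀ n ∈ golayBasis, n = 16777215 ∨ ∃ k < 23, n = golayTranslates.getD k 0 := by
      decide
    obtain rfl | ⟨k, hk, rfl⟩ := h n hn
    · exact Submodule.subset_span (Or.inl word_ones)
    · refine Submodule.subset_span (Or.inr ⟨(k : ZMod 23), ?_⟩)
      have := word_golayTranslates (k : ZMod 23)
      rw [ZMod.val_natCast, Nat.mod_eq_of_lt hk] at this
      exact this.symm

theorem mem_golayCode_iff (c : ProjLine23 → ZMod 2) :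
    c ∈ golayCode ↔ ∃ n ∈ golayMasks, word n = c := by
  rw [golayCode_eq_span, mem_span_word_iff, golayMasks]

/-- The number of ones among the lowest 24 bits. -/
def popCount (n : ℕ) : ℕ :=
  (List.range 24).foldl (fun a k => a + (n.testBit k).toNat) 0

theorem popCount_eq_card (n : ℕ) :
    popCount n = (Finset.univ.filter fun i : ProjLine23 => word n i = 1).card := by
  have h1 : (Finset.univ.filter fun i : ProjLine23 => word n i = 1).card =
      ∑ i : ProjLine23, (n.testBit i.index).toNat := by
    rw [Finset.card_filter]
    refine Finset.sum_congr rfl fun i _ => ?_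
    unfold word
    cases n.testBit i.index <;> simp
  rw [h1, sum_index fun k => (n.testBit k).toNat]
  simp [popCount, Finset.sum_range_succ, List.range_succ]

/-- The support of a word. -/
def wordSupport (c : ProjLine23 → ZMod 2) : Finset ProjLine23 :=
  Finset.univ.filter fun i => c i = 1

/-- The set bits of `0x1011101` are 0, 8, 12, 16 and 24, the admissible weights. -/
theorem popCount_golayMasks : (golayMasks.all fun n => (0x1011101).testBit (popCount n)) = true := by
  decide +kernel

theorem golay_weight {c : ProjLine23 → ZMod 2} (hc : c ∈ golayCode) :
    (wordSupport c).card = 0 ∨ (wordSupport c).card = 8 ∨ (wordSupport c).card = 12 ∨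
      (wordSupport c).card = 16 ∨ (wordSupport c).card = 24 := by
  obtain ⟨n, hn, rfl⟩ := (mem_golayCode_iff c).1 hc
  have h1 : (wordSupport (word n)).card ≤ 24 := Finset.card_le_univ _
  rw [wordSupport, ← popCount_eq_card] at h1 ⊢
  have h2 := List.all_eq_true.1 popCount_golayMasks n hn
  generalize popCount n = k at h1 h2
  revert h2
  interval_cases k <;> decide

theorem sum_mul_golay {c d : ProjLine23 → ZMod 2} (hc : c ∈ golayCode) (hd : d ∈ golayCode) :
    ∑ i, c i * d i = 0 := by
  have h : ∀ m ∈ golayBasis, ∀ n ∈ golayBasis, ∑ i, word m i * word n i = 0 := by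
    decide +kernel
  rw [golayCode_eq_span] at hc hd
  induction hc using Submodule.span_induction with
  | mem x hx =>
    obtain ⟨m, hm, rfl⟩ := hx
    induction hd using Submodule.span_induction with
    | mem y hy =>
      obtain ⟨n, hn, rfl⟩ := hy
      exact h m hm n hn
    | zero => simp
    | add y z _ _ hy hz => simp [mul_add, Finset.sum_add_distrib, hy, hz]
    | smul a y _ hy => simp [mul_left_comm _ a, ← Finset.mul_sum, hy]
  | zero => simp
  | add y z _ _ hy hz => simp [add_mul, Finset.sum_add_distrib, hy, hz]
  | smul a y _ hy => simp [mul_assoc, ← Finset.mul_sum, hy]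

theorem word_mem_golayCode {n : ℕ} (hn : n ∈ golayBasis) : word n ∈ golayCode := by
  rw [golayCode_eq_span]
  exact Submodule.subset_span ⟨n, hn, rfl⟩

/-- The masks of the functionals dual to the basis of the Golay code. -/
def golayDual : Fin 12 → ℕ :=
  ![1315, 3941, 1328, 2656, 95, 190, 3609, 1992, 245, 490, 3249, 3581]

/-- The words of the basis of the Golay code. -/
def golayWord (k : Fin 12) : ProjLine23 → ZMod 2 := word (golayBasis.get k)

theorem golayWord_mem (k : Fin 12) : golayWord k ∈ golayCode :=
  word_mem_golayCode (List.get_mem golayBasis k)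

/-- The identity matrix is the sum of the projection onto the code given by the dual functionals and
a matrix whose rows are codewords. The second part annihilates every vector orthogonal to the code,
so such a vector is its own projection; in particular the dual code lies in the code. -/
theorem eq_sum_golayWord {c : ProjLine23 → ZMod 2}
    (hc : ∀ d ∈ golayCode, ∑ i, d i * c i = 0) :
    c = ∑ k, (∑ j, word (golayDual k) j * c j) • golayWord k := by
  -- The dual functionals live on the first twelve coordinates, an information set, so only the last
  -- twelve rows need a correction by codewords.
  let Q : Fin 24 → ℕ := ![0, 0, 0, 0, 0, 0, 0, 0, 0, 0, 0, 0, 691, 1381, 2170, 1331, 2262, 1752,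
    3843, 3010, 579, 1157, 3002, 3373]
  have key : ∀ i j : ProjLine23, (if i = j then 1 else 0 : ZMod 2) =
      ∑ k, golayWord k i * word (golayDual k) j +
        ∑ k : Fin 12, (if (Q ⟨i.index, i.index_lt⟩).testBit k then 1 else 0) * golayWord k j := by
    decide +kernel
  funext i
  have h1 : c i = ∑ j, (if i = j then 1 else 0 : ZMod 2) * c j := by simp
  rw [h1]
  simp only [key, add_mul, Finset.sum_add_distrib, Finset.sum_mul, Finset.sum_apply,
    Pi.smul_apply, smul_eq_mul]
  rw [Finset.sum_comm, Finset.sum_comm (s := Finset.univ (α := ProjLine23))]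
  have h2 : ∀ k : Fin 12, ∑ j, (if (Q ⟨i.index, i.index_lt⟩).testBit k then 1 else 0) *
      golayWord k j * c j = 0 := by
    intro k
    simp only [mul_assoc, ← Finset.mul_sum, hc _ (golayWord_mem k), mul_zero]
  rw [Finset.sum_congr rfl fun k _ => h2 k, Finset.sum_const_zero, add_zero]
  exact Finset.sum_congr rfl fun k _ => Finset.sum_congr rfl fun j _ => by ring

theorem mem_golayCode_of_orthogonal {c : ProjLine23 → ZMod 2}
    (hc : ∀ d ∈ golayCode, ∑ i, d i * c i = 0) : c ∈ golayCode := by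
  rw [eq_sum_golayWord hc]
  exact Submodule.sum_mem _ fun k _ => Submodule.smul_mem _ _ (golayWord_mem k)

theorem sum_golayDual_mul (k l : Fin 12) :
    ∑ j, word (golayDual k) j * golayWord l j = if k = l then 1 else 0 := by
  revert k l
  decide +kernel

/-! ### The octads and the numbers of octads through given points. -/

set_option maxRecDepth 10000 in
/-- The masks of the codewords of weight 8. -/
def octadMasks : List ℕ :=
  [78514, 10021376, 39257, 9204992, 1312345, 1351424, 4213932, 8849458, 6379592, 8796800, 3416079,
    6406417, 4850476, 2019456, 675712, 2168036, 2106966, 9610624, 11028004, 8619033, 3189796,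
    8592704, 2372388, 5902343, 7397512, 2425238, 9929280, 15207048, 1009728, 298027, 14828808,
    337856, 267634, 1161408, 1084018, 10619300, 1053483, 8999616, 7221256, 4505735, 8937586,
    1122713, 9769376, 806987, 9708306, 2531524, 12698124, 15335473, 837906, 5842956, 8398155,
    1664160, 1594898, 8490656, 8436754, 1186194, 10525252, 1256224, 7145475, 3698756, 1212619,
    10486557, 9158944, 11797828, 427666, 504864, 6915112, 4343317, 1445088, 5652556, 11608708,
    237906, 168928, 11538486, 2738308, 133817, 210955, 580704, 9451104, 542009, 9503954, 2328324,
    4721045, 8694112, 3610628, 6447171, 8716939, 1852256, 8663097, 4755660, 9078992, 3672838,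
    4597797, 9048457, 1265762, 10543366, 1204944, 16056344, 418953, 14747201, 2921478, 12587685,
    832080, 884962, 9748745, 12656663, 9721936, 797449, 7473194, 8439632, 3294342, 1618953,
    1584464, 8412681, 593097, 9456930, 628112, 7767041, 567074, 1903248, 1849378, 6429441, 4800613,
    13631886, 6455896, 8773776, 8704546, 6837377, 4367374, 1525008, 14950785, 10093218, 2654580,
    213833, 10170384, 190626, 252432, 2627629, 11282452, 6326497, 2031657, 3457556, 8798658,
    6365962, 6295992, 2120980, 668866, 2147405, 722544, 57883, 2826278, 5571333, 9998658, 2757268,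
    118953, 84464, 9963547, 31554, 1369154, 4261212, 4299781, 9178690, 290352, 351362, 5252293,
    10257456, 8919856, 8989058, 1075305, 1110320, 4526126, 4465308, 8946281, 1164162, 10698836,
    6554826, 8611330, 8541360, 1805314, 987906, 7417889, 12747077, 7340691, 926128, 12720156,
    2377830, 6432416, 8733800, 1836419, 6493202, 563843, 12912836, 632881, 2255372, 9465987,
    602472, 12222476, 525274, 9519665, 2631052, 185603, 150618, 14949408, 10768524, 4403780,
    15762208, 4325622, 9347075, 6842656, 1460739, 14682450, 5409412, 416040, 2949708, 442481,
    13262980, 14716939, 9055272, 4593028, 1230376, 3736597, 8414120, 1647171, 6750560, 13938692,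
    1577201, 8474906, 8505411, 1608104, 5003780, 792232, 861210, 5817604, 12594948, 1100945,
    1070536, 8983587, 4490852, 8922769, 14919680, 314056, 5249380, 8077824, 5275709, 352547,
    10232008, 283537, 951624, 924689, 7409024, 6594610, 11010247, 1737489, 3227948, 8581192,
    6656640, 8546577, 1710664, 9652360, 657763, 7612992, 692282, 2183687, 2121909, 762504,
    15515712, 6302745, 13829156, 6337856, 15864000, 4231958, 1405448, 9240913, 1327290, 4301220,
    9279496, 4196943, 18147, 10028808, 95313, 126216, 5508118, 9835530, 7357552, 2363013, 6570537,
    5210132, 1728778, 8593633, 3182981, 8524371, 3147996, 8555274, 1121336, 1060490, 10630149,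
    8963210, 1148257, 13142054, 272595, 334433, 5268006, 361272, 3031301, 307594, 5329044, 4223245,
    1413139, 1352353, 6979970, 14156372, 9193633, 1378634, 4253780, 42232, 13370381, 104010, 69395,
    15777, 9607201, 2173253, 7622914, 684577, 2207772, 2130606, 9568632, 737427, 6344194, 8783649,
    16262146, 10110017, 198058, 145176, 175681, 1454401, 6820450, 6889680, 10846245, 9323032,
    4409606, 1484824, 8654232, 4785798, 8688833, 4731956, 555160, 608810, 2263063, 9440193,
    2232654, 9474712, 12861748, 582081, 9543722, 3277413, 8421811, 1687640, 4989254, 8499969,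
    8464984, 6703248, 1661185, 8394986, 12604486, 902657, 2491452, 9776129, 493953, 7903248,
    402026, 14762146, 7864649, 14709264, 463064, 10554382, 1250945, 1188915, 7079696, 1573998,
    8471941, 5785794, 12650793, 2605066, 786999, 12624578, 7479572, 12685424, 864389, 2892897,
    14714004, 5375810, 3678776, 1302533, 4587803, 10506593, 3739786, 9112069, 10537016, 4626498,
    153797, 2664522, 2634003, 5640752, 5709954, 11551306, 180636, 2687905, 4361520, 10765331,
    4330601, 1839388, 4845570, 6488205, 4768432, 8675909, 13703682, 13641904, 1869893, 12944642,
    9462812, 530245, 2313249, 560668, 4271202, 4202192, 4229001, 1332261, 5511305, 2820376, 52005,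
    21116, 2854977, 9969957, 90318, 5538256, 15073798, 689317, 2180760, 12985424, 2126890, 4870480,
    3489985, 11272490, 13771273, 6305926, 4900873, 6359604, 919694, 2422785, 7438406, 12780432,
    2384216, 12325377, 12726562, 11046145, 11015256, 5129250, 3172097, 4563017, 10666625, 1065303,
    8978620, 8925710, 4459426, 3811457, 1103886, 4536592, 5280930, 5350928, 280334, 13192208,
    2204803, 2135601, 742412, 2101096, 3444840, 8855820, 6308804, 13811730, 4921504, 3410225,
    4860434, 6949956, 1410188, 4220306, 4282144, 72588, 10558, 5621792, 13373586, 45159, 2769128,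
    11731203, 99029, 13443616, 4538962, 1090380, 10625178, 8966165, 10687016, 4485344, 1116327,
    8931660, 1063445, 5325835, 13108704, 304405, 277580, 12733024, 2435240, 2365978, 5939296,
    9830549, 2392899, 15274244, 3152963, 6644740, 3179802, 8521420, 13276672, 459847, 5405696,
    3719203, 10584520, 1245726, 4645632, 1192108, 10496547, 14551296, 10557585, 8391797, 5024896,
    8426796, 3351624, 13911680, 9701932, 12638592, 2564625, 843820, 5833010, 12599513, 5780352,
    2494627, 4788761, 6475812, 13721920, 4726955, 8683614, 3539848, 8657159, 4819776, 2229713,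
    9471495, 6100032, 551943, 2268296, 11548936, 231532, 2640465, 2675464, 201013, 8126628, 140167,
    11575377, 3951624, 4441280, 10790408, 5296705, 13148440, 10305542, 262637, 301236, 13121601,
    5262104, 371206, 1050548, 10650722, 1127686, 4510744, 4476225, 3246601, 1722420, 8622214,
    3216208, 5112513, 3154402, 8561204, 11100169, 2460752, 5899416, 2430217, 3421328, 3474978,
    4924673, 705094, 12075408, 2162811, 13062145, 2110153, 2141072, 9578566, 2201890, 36294,
    11669008, 5279, 2810896, 75309, 10881097, 4287105, 4216883, 1384564, 14254209, 4243818,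
    10916112, 1315526, 6062602, 2269481, 615188, 545190, 9506893, 12871690, 9537812, 2296514,
    2242672, 8721940, 4752467, 8660134, 4726026, 15747077, 4415544, 6857221, 10748656, 1474854,
    10825794, 4346506, 138790, 208020, 11535529, 2704706, 10560816, 1217620, 10491778, 1182989,
    2969648, 430605, 2908802, 13303882, 5390753, 11831426, 396116, 2501890, 5770785, 804052,
    12641313, 11163650, 8431757, 4982904, 5017889, 3322370, 8401364, 1589901, 8455014, 3375280,
    4336072, 10832640, 4424227, 6832158, 4038912, 9310308, 4370577, 2702848, 2624690, 11654144,
    157028, 6053905, 9486564, 2245426, 622863, 2322816, 12849992, 12880401, 535268, 596054,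
    13636881, 4744776, 11469952, 13667400, 855332, 12584506, 12661896, 2512448, 8484900, 8407702,
    3328320, 3297305, 1675812, 11150144, 1613974, 13893731, 5063048, 9045270, 3704512, 10513600,
    4656648, 5476616, 421910, 475812, 2916505, 14688364, 2890176, 5441617, 3168928, 6588684,
    3237906, 11055264, 6557781, 8536111, 1769924, 11108882, 12717187, 2409888, 7345676, 381252,
    5255258, 5309160, 13124355, 11952160, 5286147, 3050016, 346141, 4523185, 9020484, 3806496,
    4470275, 1134148, 9968772, 63108, 2754059, 115766, 5514536, 1337732, 4294810, 4241960, 4063314,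
    9208708, 4203377, 4264387, 14176296, 1975812, 6292775, 8834052, 663645, 2220640, 13009064,
    9589508, 2150610, 12126304, 2115979, 702724]

theorem octadMasks_eq : octadMasks = golayMasks.filter fun n => popCount n == 8 := by
  decide +kernel

/-- The position of a codeword in the enumeration of the Golay code, from its products with the
dual basis. -/
def golayRank (n : ℕ) : ℕ :=
  (List.ofFn golayDual).foldl (fun a d => 2 * a + (fun x : ℕ => (fun y : ℕ =>
    -- The number 27030 is 0x6996, the parity table of four bits; the two shifts fold twelve bits
    -- onto four.
    (27030 >>> (y &&& 15)) &&& 1) (x ^^^ (x >>> 4) ^^^ (x >>> 8))) (n &&& d)) 0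

/-- The values of `golayRank` increase strictly along the list, which takes one comparison per
neighbouring pair instead of one per pair. -/
theorem octadMasks_nodup : octadMasks.Nodup := by
  refine List.Nodup.of_map golayRank ?_
  have h : (octadMasks.map golayRank).IsChain (· < ·) := by decide +kernel
  exact (List.isChain_iff_pairwise.1 h).imp ne_of_lt

theorem mem_octadMasks_iff (n : ℕ) :
    n ∈ octadMasks ↔ n ∈ golayMasks ∧ (wordSupport (word n)).card = 8 := by
  rw [octadMasks_eq, List.mem_filter, wordSupport, ← popCount_eq_card, beq_iff_eq]

theorem golayMasks_lt {n : ℕ} (hn : n ∈ golayMasks) : n < 2 ^ 24 := by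
  have h : (golayMasks.all fun n => decide (n < 2 ^ 24)) = true := by decide +kernel
  exact of_decide_eq_true (List.all_eq_true.1 h n hn)

theorem word_injOn {m n : ℕ} (hm : m < 2 ^ 24) (hn : n < 2 ^ 24) (h : word m = word n) :
    m = n := by
  have key : ∀ i : ProjLine23, m.testBit i.index = n.testBit i.index := by
    intro i
    have := congrFun h i
    unfold word at this
    cases h1 : m.testBit i.index <;> cases h2 : n.testBit i.index <;> simp_all
  refine Nat.eq_of_testBit_eq fun k => ?_
  by_cases hk : k < 24
  · rcases Nat.lt_succ_iff_lt_or_eq.1 hk with h1 | rfl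
    · have := key (some (k : ZMod 23))
      rwa [index, ZMod.val_natCast, Nat.mod_eq_of_lt h1] at this
    · exact key none
  · have h24 : 2 ^ 24 ≤ 2 ^ k := Nat.pow_le_pow_right (by norm_num) (not_lt.1 hk)
    rw [Nat.testBit_lt_two_pow (hm.trans_le h24), Nat.testBit_lt_two_pow (hn.trans_le h24)]

/-- In the Steiner system of the octads, a point, a pair and a triple lie in 253, 77 and 21 octads,
and 21 + 56 = 77, 21 + 3 · 56 + 64 = 253. Filtering successively, and only for decreasing triples,
keeps the evaluation small. -/
theorem octadMasks_count : ((List.range 24).all fun a => (fun l : List ℕ =>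
    (List.range (a + 1)).all fun b => (fun l' : List ℕ => (List.range (b + 1)).all fun c =>
      (l'.filter fun n => n.testBit c).length ==
        21 + 56 * ((if a = b then 1 else 0) + (if b = c then 1 else 0) + (if a = c then 1 else 0)) +
        64 * (if a = b ∧ b = c then 1 else 0))
      (l.filter fun n => n.testBit b)) (octadMasks.filter fun n => n.testBit a)) = true := by
  decide +kernel

theorem card_filter_word {l : List ℕ} (hl : l.Nodup) (i j k : ProjLine23) :
    (l.toFinset.filter fun n => word n i = 1 ∧ word n j = 1 ∧ word n k = 1).card =
      (((l.filter fun n => n.testBit i.index).filter fun n => n.testBit j.index).filter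
        fun n => n.testBit k.index).length := by
  rw [← List.toFinset_card_of_nodup (((hl.filter _).filter _).filter _)]
  congr 1
  ext n
  rw [Finset.mem_filter]
  simp only [List.mem_toFinset, List.mem_filter, word]
  cases n.testBit i.index <;> cases n.testBit j.index <;> cases n.testBit k.index <;> simp

theorem eq_of_symmetric_of_sorted {N : ProjLine23 → ProjLine23 → ProjLine23 → ℤ}
    {N' : ProjLine23 → ProjLine23 → ProjLine23 → ℤ}
    (h1 : ∀ i j k, N i j k = N j i k) (h2 : ∀ i j k, N i j k = N i k j)
    (h1' : ∀ i j k, N' i j k = N' j i k) (h2' : ∀ i j k, N' i j k = N' i k j)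
    (h : ∀ i j k, k.index ≤ j.index → j.index ≤ i.index → N i j k = N' i j k)
    (i j k : ProjLine23) : N i j k = N' i j k := by
  rcases le_total j.index i.index with h3 | h3 <;> rcases le_total k.index j.index with h4 | h4 <;>
    rcases le_total k.index i.index with h5 | h5
  · exact h i j k h4 h3
  · exact h i j k h4 h3
  · rw [h2, h2', h _ _ _ h4 h5]
  · rw [h2, h2', h1, h1', h _ _ _ h3 h5]
  · rw [h1, h1', h _ _ _ h5 h3]
  · rw [h1, h1', h2, h2', h _ _ _ h5 h4]
  · rw [h2, h1, h2, h2', h1', h2', h _ _ _ h3 h4]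
  · rw [h2, h1, h2, h2', h1', h2', h _ _ _ h3 h4]

/-- The number of octads through three points. -/
theorem octad_count (i j k : ProjLine23) :
    ((octadMasks.toFinset.filter fun n => word n i = 1 ∧ word n j = 1 ∧ word n k = 1).card : ℤ) =
      21 + 56 * ((if i = j then 1 else 0) + (if j = k then 1 else 0) + (if i = k then 1 else 0)) +
        64 * (if i = j ∧ j = k then 1 else 0) := by
  have hl := octadMasks_nodup
  have hc := octadMasks_count
  generalize octadMasks = l at hl hc
  refine eq_of_symmetric_of_sorted (N := fun i j k => ((l.toFinset.filter fun n =>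
    word n i = 1 ∧ word n j = 1 ∧ word n k = 1).card : ℤ)) (N' := fun i j k => 21 + 56 *
    ((if i = j then 1 else 0) + (if j = k then 1 else 0) + (if i = k then 1 else 0)) +
        64 * (if i = j ∧ j = k then 1 else 0)) ?_ ?_ ?_ ?_ ?_ i j k
  · intro i j k
    simp only [and_left_comm]
  · intro i j k
    simp only [and_comm]
  · intro i j k
    by_cases h1 : i = j
    · subst h1; rfl
    · by_cases h2 : j = k
      · subst h2; simp [h1, Ne.symm h1]
      · simp [h1, Ne.symm h1, h2, Ne.symm h2]
  · intro i j k
    by_cases h1 : j = k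
    · subst h1; rfl
    · by_cases h2 : i = j
      · subst h2; simp [h1, Ne.symm h1]
      · simp [h1, Ne.symm h1, h2, Ne.symm h2]
  · intro i j k hkj hji
    have h1 := List.all_eq_true.1 hc i.index (List.mem_range.2 i.index_lt)
    have h2 := List.all_eq_true.1 h1 j.index (List.mem_range.2 (Nat.lt_succ_of_le hji))
    have h3 := List.all_eq_true.1 h2 k.index (List.mem_range.2 (Nat.lt_succ_of_le hkj))
    rw [beq_iff_eq, ← card_filter_word hl] at h3
    rw [h3]
    simp only [index_injective.eq_iff]
    push_cast
    rfl

attribute [irreducible] octadMasks golayMasks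

/-! ### Basic properties of the Leech lattice -/

/-- The vector `z / √8`. -/
noncomputable def scaledVector (z : ProjLine23 → ℤ) : EuclideanSpace ℝ ProjLine23 :=
  WithLp.toLp 2 fun i => (z i : ℝ) / √8

theorem scaledVector_apply (z : ProjLine23 → ℤ) (i : ProjLine23) :
    scaledVector z i = (z i : ℝ) / √8 := rfl

/-- The integral coordinate vectors of the Leech lattice. -/
def IsLeech (z : ProjLine23 → ℤ) : Prop :=
  ∃ (m : ℤ) (c : ProjLine23 → ℤ), (∀ i, z i = m + 2 * c i) ∧
    (fun i => (c i : ZMod 2)) ∈ golayCode ∧ ∑ i, z i ≡ 4 * m [ZMOD 8]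

theorem mem_leechLattice_iff (v : EuclideanSpace ℝ ProjLine23) :
    v ∈ leechLattice ↔ ∃ z, IsLeech z ∧ v = scaledVector z := by
  constructor
  · rintro ⟨m, z, c, hv, hz, hc, hs⟩
    exact ⟨z, ⟨m, c, hz, hc, hs⟩, PiLp.ext hv⟩
  · rintro ⟨z, ⟨m, c, hz, hc, hs⟩, rfl⟩
    exact ⟨m, z, c, fun i => rfl, hz, hc, hs⟩

theorem sqrt_eight_mul_self : √8 * √8 = 8 := Real.mul_self_sqrt (by norm_num)

theorem inner_scaledVector_left (z : ProjLine23 → ℤ) (v : EuclideanSpace ℝ ProjLine23) :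
    inner ℝ (scaledVector z) v = (∑ i, (z i : ℝ) * v i) / √8 := by
  rw [PiLp.inner_apply, Finset.sum_div]
  refine Finset.sum_congr rfl fun i _ => ?_
  rw [scaledVector_apply]
  simp
  ring

theorem inner_scaledVector (z w : ProjLine23 → ℤ) :
    inner ℝ (scaledVector z) (scaledVector w) = ((∑ i, z i * w i : ℤ) : ℝ) / 8 := by
  have : ∑ i, (z i : ℝ) * scaledVector w i = ((∑ i, z i * w i : ℤ) : ℝ) / √8 := by
    push_cast
    rw [Finset.sum_div]
    exact Finset.sum_congr rfl fun i _ => by rw [scaledVector_apply, mul_div_assoc]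
  rw [inner_scaledVector_left, this, div_div, sqrt_eight_mul_self]

theorem intCast_zmod_two_mem_ones : (fun _ => 1 : ProjLine23 → ZMod 2) ∈ golayCode :=
  Submodule.subset_span (Or.inl rfl)

theorem sum_const_projLine (m : ℤ) : ∑ _i : ProjLine23, m = 24 * m := by
  rw [Finset.sum_const, nsmul_eq_mul]
  rfl

/-- Expanding z = m + 2c and w = n + 2d leaves the two sum congruences modulo 8 and four times the
product of c and d, which is even because the Golay code is self-orthogonal. -/
theorem IsLeech.eight_dvd {z w : ProjLine23 → ℤ} (hz : IsLeech z) (hw : IsLeech w) :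
    8 ∣ ∑ i, z i * w i := by
  obtain ⟨m, c, hz, hc, hzs⟩ := hz
  obtain ⟨n, d, hw, hd, hws⟩ := hw
  have h1 : ∑ i, z i = 24 * m + 2 * ∑ i, c i := by
    simp only [hz, Finset.sum_add_distrib, ← Finset.mul_sum, sum_const_projLine]
  have h2 : ∑ i, w i = 24 * n + 2 * ∑ i, d i := by
    simp only [hw, Finset.sum_add_distrib, ← Finset.mul_sum, sum_const_projLine]
  have h3 : ∑ i, z i * w i = n * ∑ i, z i + m * ∑ i, w i - 24 * m * n + 4 * ∑ i, c i * d i := by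
    rw [h1, h2]
    have : ∀ i, z i * w i = m * n + 2 * n * c i + 2 * m * d i + 4 * (c i * d i) := by
      intro i
      rw [hz, hw]
      ring
    simp only [this, Finset.sum_add_distrib, ← Finset.mul_sum, sum_const_projLine]
    ring
  have h4 : (2 : ℤ) ∣ ∑ i, c i * d i := by
    refine (ZMod.intCast_zmod_eq_zero_iff_dvd _ 2).1 ?_
    push_cast
    exact sum_mul_golay hc hd
  obtain ⟨a, ha⟩ := hzs.symm.dvd
  obtain ⟨b, hb⟩ := hws.symm.dvd
  obtain ⟨e, he⟩ := h4
  exact ⟨n * a + m * b - 2 * m * n + e, by rw [h3, he]; linear_combination n * ha + m * hb⟩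

theorem wordSupport_card_intCast (c : ProjLine23 → ℤ) :
    ((wordSupport fun i => (c i : ZMod 2)).card : ℤ) = ∑ i, if Odd (c i) then 1 else 0 := by
  rw [wordSupport, Finset.card_filter]
  push_cast
  refine Finset.sum_congr rfl fun i _ => ?_
  simp only [← ZMod.intCast_eq_one_iff_odd]

/-- The extra factor 2 for squares comes from the weights: the sum of the c_i² is congruent modulo 4
to the weight of the codeword, and all weights are divisible by 4. -/
theorem IsLeech.sixteen_dvd {z : ProjLine23 → ℤ} (hz : IsLeech z) : 16 ∣ ∑ i, z i * z i := by
  obtain ⟨m, c, hz, hc, hzs⟩ := hz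
  have h1 : ∑ i, z i = 24 * m + 2 * ∑ i, c i := by
    simp only [hz, Finset.sum_add_distrib, ← Finset.mul_sum, sum_const_projLine]
  have h3 : ∑ i, z i * z i = 2 * m * ∑ i, z i - 24 * m * m + 4 * ∑ i, c i * c i := by
    rw [h1]
    have : ∀ i, z i * z i = m * m + 4 * m * c i + 4 * (c i * c i) := by
      intro i
      rw [hz]
      ring
    simp only [this, Finset.sum_add_distrib, ← Finset.mul_sum, sum_const_projLine]
    ring
  have h4 : (4 : ℤ) ∣ ∑ i, c i * c i := by
    have h5 : (4 : ℤ) ∣ ∑ i, c i * c i - ((wordSupport fun i => (c i : ZMod 2)).card : ℤ) := by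
      rw [wordSupport_card_intCast, ← Finset.sum_sub_distrib]
      refine Finset.dvd_sum fun i _ => ?_
      split_ifs with h
      · obtain ⟨k, hk⟩ := h
        exact ⟨k * k + k, by rw [hk]; ring⟩
      · obtain ⟨k, hk⟩ := Int.not_odd_iff_even.1 h
        exact ⟨k * k, by rw [hk]; ring⟩
    have h6 : (4 : ℤ) ∣ ((wordSupport fun i => (c i : ZMod 2)).card : ℤ) := by
      rcases golay_weight hc with h | h | h | h | h <;> rw [h] <;> norm_num
    exact (dvd_sub_left h6).1 h5
  obtain ⟨a, ha⟩ := hzs.symm.dvd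
  obtain ⟨e, he⟩ := h4
  exact ⟨m * a - m * m + e, by rw [h3, he]; linear_combination 2 * m * ha⟩

/-- The three shapes of vectors of the Leech lattice. -/
theorem IsLeech.trichotomy {z : ProjLine23 → ℤ} (hz : IsLeech z) :
    (∃ e ∈ golayCode, (∀ i, Odd (z i) ∧ (e i = 0 ↔ z i % 4 = 1))) ∨
      ∃ y : ProjLine23 → ℤ, (∀ i, z i = 2 * y i) ∧ (fun i => (y i : ZMod 2)) ∈ golayCode ∧
        4 ∣ ∑ i, y i := by
  obtain ⟨m, c, hz, hc, hzs⟩ := hz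
  rcases Int.even_or_odd m with ⟨k, hk⟩ | ⟨k, hk⟩
  · right
    refine ⟨fun i => k + c i, fun i => by rw [hz, hk]; ring, ?_, ?_⟩
    · have : (fun i => ((k + c i : ℤ) : ZMod 2)) =
          (k : ZMod 2) • (fun _ => 1 : ProjLine23 → ZMod 2) + fun i => (c i : ZMod 2) := by
        funext i
        simp
      rw [this]
      exact golayCode.add_mem (golayCode.smul_mem _ intCast_zmod_two_mem_ones) hc
    · obtain ⟨a, ha⟩ := hzs.symm.dvd
      have : ∑ i, z i = 2 * ∑ i, (k + c i) := by
        rw [Finset.mul_sum]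
        exact Finset.sum_congr rfl fun i _ => by rw [hz, hk]; ring
      rw [this] at ha
      exact ⟨a + k, by linarith⟩
  · left
    refine ⟨(k : ZMod 2) • (fun _ => 1 : ProjLine23 → ZMod 2) + fun i => (c i : ZMod 2),
      golayCode.add_mem (golayCode.smul_mem _ intCast_zmod_two_mem_ones) hc, fun i => ?_⟩
    constructor
    · exact ⟨k + c i, by rw [hz, hk]; ring⟩
    · have : ((k : ZMod 2) • (fun _ => 1 : ProjLine23 → ZMod 2) + fun i => (c i : ZMod 2)) i =
          ((k + c i : ℤ) : ZMod 2) := by simp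
      rw [this, ZMod.intCast_zmod_eq_zero_iff_dvd, hz, hk]
      push_cast
      omega

theorem sum_sq_ge_wordSupport (y : ProjLine23 → ℤ) :
    ((wordSupport fun i => (y i : ZMod 2)).card : ℤ) ≤ ∑ i, y i * y i := by
  rw [wordSupport_card_intCast]
  refine Finset.sum_le_sum fun i _ => ?_
  split_ifs with h
  · obtain ⟨k, hk⟩ := h
    nlinarith [sq_nonneg (y i), show 1 ≤ y i * y i from by
      rcases Int.lt_or_le k 0 with h1 | h1 <;> nlinarith]
  · exact mul_self_nonneg _

theorem even_of_wordSupport_card_eq_zero {y : ProjLine23 → ℤ}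
    (h : (wordSupport fun i => (y i : ZMod 2)).card = 0) (i : ProjLine23) : Even (y i) := by
  by_contra h1
  rw [Int.not_even_iff_odd, ← ZMod.intCast_eq_one_iff_odd] at h1
  rw [Finset.card_eq_zero] at h
  have : i ∈ wordSupport fun i => (y i : ZMod 2) := Finset.mem_filter.2 ⟨Finset.mem_univ _, h1⟩
  rw [h] at this
  exact absurd this (Finset.notMem_empty _)

/-- Only the value 16 has to be excluded. Odd coordinates contribute at least 24. For z = 2y the sum
of the y_i² would be 4, below the minimum weight 8, so y = 2x with x of square sum 1; but then the
sum of the x_i is odd, against the condition that 4 divides the sum of the y_i. -/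
theorem IsLeech.sum_sq_ge {z : ProjLine23 → ℤ} (hz : IsLeech z) (h0 : z ≠ 0) :
    32 ≤ ∑ i, z i * z i := by
  obtain ⟨i₀, hi₀⟩ : ∃ i, z i ≠ 0 := by
    by_contra! h
    exact h0 (funext h)
  have hpos : 0 < ∑ i, z i * z i :=
    Finset.sum_pos' (fun i _ => mul_self_nonneg _) ⟨i₀, Finset.mem_univ _, mul_self_pos.2 hi₀⟩
  obtain ⟨a, ha⟩ := hz.sixteen_dvd
  by_contra! hlt
  have ha1 : ∑ i, z i * z i = 16 := by omega
  rcases hz.trichotomy with ⟨e, he, h⟩ | ⟨y, hy, hyG, hys⟩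
  · have : ∑ i : ProjLine23, (1 : ℤ) ≤ ∑ i, z i * z i := by
      refine Finset.sum_le_sum fun i _ => ?_
      obtain ⟨k, hk⟩ := (h i).1
      rcases Int.lt_or_le k 0 with h1 | h1 <;> nlinarith
    rw [ha1] at this
    simp at this
  · have h4 : ∑ i, y i * y i = 4 := by
      have : ∑ i, z i * z i = 4 * ∑ i, y i * y i := by
        rw [Finset.mul_sum]
        exact Finset.sum_congr rfl fun i _ => by rw [hy]; ring
      omega
    have h5 := sum_sq_ge_wordSupport y
    have h6 : (wordSupport fun i => (y i : ZMod 2)).card = 0 := by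
      rcases golay_weight hyG with h | h | h | h | h <;> omega
    choose x hx using even_of_wordSupport_card_eq_zero h6
    have h7 : ∑ i, x i * x i = 1 := by
      have : ∑ i, y i * y i = 4 * ∑ i, x i * x i := by
        rw [Finset.mul_sum]
        exact Finset.sum_congr rfl fun i _ => by rw [hx]; ring
      omega
    have h8 : (2 : ℤ) ∣ ∑ i, x i * x i := by
      have h9 : (2 : ℤ) ∣ ∑ i, x i := by
        have : ∑ i, y i = 2 * ∑ i, x i := by
          rw [Finset.mul_sum]
          exact Finset.sum_congr rfl fun i _ => by rw [hx]; ring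
        omega
      have h10 : (2 : ℤ) ∣ ∑ i, x i * x i - ∑ i, x i := by
        rw [← Finset.sum_sub_distrib]
        refine Finset.dvd_sum fun i _ => ?_
        rw [← mul_sub_one]
        exact (Int.even_mul_pred_self _).two_dvd
      exact (dvd_sub_left h9).1 h10
    omega

theorem leech_inner_int {x y : EuclideanSpace ℝ ProjLine23} (hx : x ∈ leechLattice)
    (hy : y ∈ leechLattice) : ∃ n : ℤ, inner ℝ x y = n := by
  obtain ⟨z, hz, rfl⟩ := (mem_leechLattice_iff x).1 hx
  obtain ⟨w, hw, rfl⟩ := (mem_leechLattice_iff y).1 hy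
  obtain ⟨n, hn⟩ := hz.eight_dvd hw
  exact ⟨n, by rw [inner_scaledVector, hn]; push_cast; ring⟩

theorem leech_norm_even {x : EuclideanSpace ℝ ProjLine23} (hx : x ∈ leechLattice) :
    ∃ n : ℤ, inner ℝ x x = 2 * n := by
  obtain ⟨z, hz, rfl⟩ := (mem_leechLattice_iff x).1 hx
  obtain ⟨n, hn⟩ := hz.sixteen_dvd
  exact ⟨n, by rw [inner_scaledVector, hn]; push_cast; ring⟩

theorem leech_norm_ge {x : EuclideanSpace ℝ ProjLine23} (hx : x ∈ leechLattice) (h0 : x ≠ 0) :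
    4 ≤ inner ℝ x x := by
  obtain ⟨z, hz, rfl⟩ := (mem_leechLattice_iff x).1 hx
  have : z ≠ 0 := by
    rintro rfl
    exact h0 (PiLp.ext fun i => by simp [scaledVector_apply])
  have h := hz.sum_sq_ge this
  rw [inner_scaledVector, le_div_iff₀ (by norm_num)]
  exact_mod_cast (by linarith : 4 * 8 ≤ ∑ i, z i * z i)

/-! ### Unimodularity -/

/-- The vector with entries `4` and `±4` in two places. -/
theorem isLeech_of_even {y : ProjLine23 → ℤ} (hy : (fun i => (y i : ZMod 2)) ∈ golayCode)
    (hs : 4 ∣ ∑ i, y i) : IsLeech fun i => 2 * y i := by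
  refine ⟨0, y, fun i => by ring, hy, ?_⟩
  rw [← Finset.mul_sum, mul_zero]
  obtain ⟨k, hk⟩ := hs
  exact Int.modEq_zero_iff_dvd.2 ⟨k, by rw [hk]; ring⟩

theorem isLeech_single_eight (i : ProjLine23) : IsLeech (Pi.single i 8) := by
  have := isLeech_of_even (y := Pi.single i 4) (by
    convert golayCode.zero_mem using 1
    funext j
    by_cases h : j = i
    · subst h
      have h4 : (4 : ZMod 2) = 0 := rfl
      simp [h4]
    · simp [h]) (by simp)
  convert this using 1
  funext j
  by_cases h : j = i
  · subst h; simp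
  · simp [h]

theorem isLeech_pair (i j : ProjLine23) (a : ℤ) (ha : Odd a) :
    IsLeech (Pi.single i 4 + Pi.single j (4 * a)) := by
  have := isLeech_of_even (y := Pi.single i 2 + Pi.single j (2 * a)) (by
    convert golayCode.zero_mem using 1
    funext k
    have h2 : (2 : ZMod 2) = 0 := rfl
    by_cases h : k = i <;> by_cases h' : k = j <;> simp [Pi.single_apply, h, h', h2]) (by
    obtain ⟨k, hk⟩ := ha
    simp only [Pi.add_apply, Finset.sum_add_distrib, Finset.sum_pi_single', Finset.mem_univ,
      if_true]
    exact ⟨k + 1, by rw [hk]; ring⟩)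
  convert this using 1
  funext k
  simp only [Pi.add_apply, Pi.single_apply]
  split_ifs <;> ring

theorem isLeech_golay {c : ProjLine23 → ZMod 2} (hc : c ∈ golayCode) :
    IsLeech fun i => 2 * (if c i = 1 then 1 else 0) := by
  refine isLeech_of_even ?_ ?_
  · convert hc using 1
    funext i
    generalize c i = a
    revert a
    decide
  · have : ∑ i, (if c i = 1 then 1 else 0 : ℤ) = (wordSupport c).card := by
      rw [wordSupport, Finset.card_filter]
      push_cast
      rfl
    rw [this]
    rcases golay_weight hc with h | h | h | h | h <;> rw [h] <;> norm_num

theorem isLeech_odd (i : ProjLine23) : IsLeech (1 + Pi.single i (-4)) := by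
  refine ⟨1, Pi.single i (-2), fun k => ?_, ?_, ?_⟩
  · by_cases h : k = i
    · subst h; simp
    · simp [h]
  · convert golayCode.zero_mem using 1
    funext k
    have h2 : (2 : ZMod 2) = 0 := rfl
    by_cases h : k = i <;> simp [Pi.single_apply, h, h2]
  · simp [Finset.sum_add_distrib]
    decide

/-- Each defining condition is a pairing with lattice vectors: those with two entries 4 make the
coordinates integral of equal parity, those supported on codewords put the reduction in the dual of
the Golay code, which is the code, and the vector with entries -3, 1, ..., 1 gives the congruence
modulo 8. -/
theorem leech_mem_of_dual {y : EuclideanSpace ℝ ProjLine23}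
    (hy : ∀ x ∈ leechLattice, ∃ n : ℤ, inner ℝ x y = n) : y ∈ leechLattice := by
  have h8 : √8 ≠ 0 := by positivity
  have key : ∀ z, IsLeech z → ∃ n : ℤ, ∑ i, (z i : ℝ) * (√8 * y i) = 8 * n := by
    intro z hz
    obtain ⟨n, hn⟩ := hy _ ((mem_leechLattice_iff _).2 ⟨z, hz, rfl⟩)
    refine ⟨n, ?_⟩
    rw [← hn, inner_scaledVector_left]
    simp only [mul_left_comm _ √8, ← Finset.mul_sum]
    rw [mul_div_assoc', eq_div_iff h8, mul_right_comm, sqrt_eight_mul_self]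
  set u : ProjLine23 → ℝ := fun i => √8 * y i with hu
  have hpair : ∀ i j, ∃ n : ℤ, u i + u j = 2 * n := by
    intro i j
    obtain ⟨n, hn⟩ := key _ (isLeech_pair i j 1 odd_one)
    refine ⟨n, ?_⟩
    simp only [Pi.add_apply, Int.cast_add, add_mul, Finset.sum_add_distrib, Pi.single_apply,
      Int.cast_ite, Int.cast_zero, ite_mul, zero_mul, Finset.sum_ite_eq', Finset.mem_univ,
      if_true] at hn
    push_cast at hn
    linarith
  have hint : ∀ i, ∃ n : ℤ, u i = n := by
    intro i
    obtain ⟨n, hn⟩ := hpair i i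
    exact ⟨n, by linarith⟩
  choose w hw using hint
  have hpar : ∀ i, ∃ k : ℤ, w i = w none + 2 * k := by
    intro i
    obtain ⟨n, hn⟩ := hpair i none
    rw [hw, hw] at hn
    have : w i + w none = 2 * n := by exact_mod_cast hn
    exact ⟨n - w none, by linarith⟩
  choose c hc using hpar
  have hkey : ∀ z, IsLeech z → ∃ n : ℤ, ∑ i, z i * w i = 8 * n := by
    intro z hz
    obtain ⟨n, hn⟩ := key z hz
    refine ⟨n, ?_⟩
    have : ∑ i, (z i : ℝ) * (w i : ℝ) = 8 * n := by
      rw [← hn]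
      exact Finset.sum_congr rfl fun i _ => by rw [← hw i]
    exact_mod_cast this
  refine (mem_leechLattice_iff y).2 ⟨w, ⟨w none, c, hc, ?_, ?_⟩, PiLp.ext fun i => ?_⟩
  · refine mem_golayCode_of_orthogonal fun d hd => ?_
    obtain ⟨n, hn⟩ := hkey _ (isLeech_golay hd)
    have h1 : ∑ i, 2 * (if d i = 1 then 1 else 0) * w i =
        2 * w none * (wordSupport d).card + 4 * ∑ i, (if d i = 1 then 1 else 0) * c i := by
      rw [wordSupport, Finset.card_filter]
      push_cast
      rw [Finset.mul_sum, Finset.mul_sum, ← Finset.sum_add_distrib]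
      refine Finset.sum_congr rfl fun i _ => ?_
      rw [hc i]
      split_ifs <;> ring
    have h2 : ((∑ i, (if d i = 1 then 1 else 0) * c i : ℤ) : ZMod 2) = ∑ i, d i * (c i : ZMod 2) := by
      push_cast
      refine Finset.sum_congr rfl fun i _ => ?_
      congr 1
      generalize d i = a
      revert a
      decide
    rw [← h2, ZMod.intCast_zmod_eq_zero_iff_dvd]
    rw [h1] at hn
    push_cast
    rcases golay_weight hd with h | h | h | h | h <;> rw [h] at hn <;> push_cast at hn <;> omega
  · obtain ⟨n, hn⟩ := hkey _ (isLeech_odd none)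
    simp only [Pi.add_apply, Pi.one_apply, add_mul, one_mul, Finset.sum_add_distrib,
      Pi.single_apply, ite_mul, zero_mul, Finset.sum_ite_eq', Finset.mem_univ, if_true] at hn
    exact Int.ModEq.symm ((Int.modEq_iff_dvd).2 ⟨n, by linarith⟩)
  · rw [scaledVector_apply, ← hw, hu]
    field_simp

/-- Every functional on the Leech lattice is the inner product with a vector of the lattice. -/
theorem leech_functional (φ : leechLattice →ₗ[ℤ] ℤ) :
    ∃ y ∈ leechLattice, ∀ x : leechLattice, inner ℝ (x : EuclideanSpace ℝ ProjLine23) y = φ x := by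
  have h8 : √8 ≠ 0 := by positivity
  have hu : ∀ i, scaledVector (Pi.single i 8) ∈ leechLattice :=
    fun i => (mem_leechLattice_iff _).2 ⟨_, isLeech_single_eight i, rfl⟩
  set y : EuclideanSpace ℝ ProjLine23 :=
    WithLp.toLp 2 fun i => (φ ⟨_, hu i⟩ : ℝ) / √8 with hy
  have key : ∀ x : leechLattice, inner ℝ (x : EuclideanSpace ℝ ProjLine23) y = φ x := by
    rintro ⟨x, hx⟩
    obtain ⟨z, hz, rfl⟩ := (mem_leechLattice_iff x).1 hx
    have h1 : (8 : ℤ) • (⟨_, hx⟩ : leechLattice) = ∑ i, z i • (⟨_, hu i⟩ : leechLattice) := by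
      apply Subtype.ext
      rw [Submodule.coe_smul, Submodule.coe_sum]
      refine PiLp.ext fun j => ?_
      simp only [Submodule.coe_smul, ← Int.cast_smul_eq_zsmul ℝ, PiLp.smul_apply, smul_eq_mul]
      rw [WithLp.ofLp_sum, Finset.sum_apply, Finset.sum_eq_single j]
      · rw [PiLp.smul_apply, scaledVector_apply, scaledVector_apply, Pi.single_eq_same, smul_eq_mul]
        push_cast
        ring
      · intro i _ hi
        simp [scaledVector_apply, Pi.single_apply, Ne.symm hi]
      · simp
    have h2 := congrArg φ h1
    rw [map_smul, map_sum] at h2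
    simp only [map_smul, smul_eq_mul] at h2
    have h3 : (8 : ℝ) * φ ⟨_, hx⟩ = ∑ i, (z i : ℝ) * φ ⟨_, hu i⟩ := by exact_mod_cast h2
    dsimp only
    rw [inner_scaledVector_left]
    have h4 : ∑ i, (z i : ℝ) * y i = (∑ i, (z i : ℝ) * φ ⟨_, hu i⟩) / √8 := by
      rw [Finset.sum_div]
      exact Finset.sum_congr rfl fun i _ => by rw [hy]; simp [mul_div_assoc]
    rw [h4, ← h3, div_div, sqrt_eight_mul_self]
    ring
  exact ⟨y, leech_mem_of_dual fun x hx => ⟨φ ⟨x, hx⟩, key ⟨x, hx⟩⟩, key⟩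

/-! ### Sixth moments of balanced sets of signs -/

/-- The nontrivial sign character of `ZMod 2`. -/
def signChar (a : ZMod 2) : ℤ := if a = 0 then 1 else -1

theorem signChar_add (a b : ZMod 2) : signChar (a + b) = signChar a * signChar b := by
  revert a b
  decide

theorem signChar_mul_self (a : ZMod 2) : signChar a * signChar a = 1 := by
  revert a
  decide

theorem signChar_sum {ι : Type*} (s : Finset ι) (f : ι → ZMod 2) :
    signChar (∑ i ∈ s, f i) = ∏ i ∈ s, signChar (f i) := by
  classical
  induction s using Finset.induction_on with
  | empty => rfl
  | insert a s ha ih => rw [Finset.sum_insert ha, Finset.prod_insert ha, signChar_add, ih]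

theorem signChar_injective : Function.Injective signChar := by decide

theorem sign_add_add_self {ι : Type*} (c d : ι → ZMod 2) : c + d + d = c := by
  funext i
  rw [Pi.add_apply, Pi.add_apply, add_assoc, CharTwo.add_self_eq_zero, add_zero]

section Moments

variable {ι : Type*} [DecidableEq ι] [Fintype ι]

theorem sum_eq_zero_of_shift {A : Finset (ι → ZMod 2)} {d : ι → ZMod 2}
    (hd : ∀ c ∈ A, c + d ∈ A) {F : (ι → ZMod 2) → ℝ} (hF : ∀ c ∈ A, F (c + d) = -F c) :
    ∑ c ∈ A, F c = 0 := by
  have h : ∑ c ∈ A, F c = ∑ c ∈ A, F (c + d) := by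
    refine Finset.sum_nbij' (fun c => c + d) (fun c => c + d) hd hd
      (fun c _ => sign_add_add_self c d) (fun c _ => sign_add_add_self c d)
      fun c _ => by rw [sign_add_add_self]
  rw [Finset.sum_congr rfl hF, Finset.sum_neg_distrib] at h
  linarith

/-- Adding one coordinate at a time, the terms with an odd power of the new sign cancel under
flipping that sign, so each moment of the larger sum is a polynomial in the moments of the smaller
one. -/
theorem sum_sign_moments (w : ι → ℝ) (O : Finset ι) :
    ∑ c : ι → ZMod 2, (∑ j ∈ O, (signChar (c j) : ℝ) * w j) ^ 2 =
        Fintype.card (ι → ZMod 2) * ∑ j ∈ O, w j ^ 2 ∧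
    ∑ c : ι → ZMod 2, (∑ j ∈ O, (signChar (c j) : ℝ) * w j) ^ 4 =
        Fintype.card (ι → ZMod 2) * (3 * (∑ j ∈ O, w j ^ 2) ^ 2 - 2 * ∑ j ∈ O, w j ^ 4) ∧
    ∑ c : ι → ZMod 2, (∑ j ∈ O, (signChar (c j) : ℝ) * w j) ^ 6 =
        Fintype.card (ι → ZMod 2) * (15 * (∑ j ∈ O, w j ^ 2) ^ 3 -
          30 * (∑ j ∈ O, w j ^ 2) * (∑ j ∈ O, w j ^ 4) + 16 * ∑ j ∈ O, w j ^ 6) := by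
  induction O using Finset.induction_on with
  | empty => simp
  | insert a O ha ih =>
    obtain ⟨h2, h4, h6⟩ := ih
    set T : (ι → ZMod 2) → ℝ := fun c => ∑ j ∈ O, (signChar (c j) : ℝ) * w j with hT
    change ∑ c, T c ^ 2 = _ at h2
    change ∑ c, T c ^ 4 = _ at h4
    change ∑ c, T c ^ 6 = _ at h6
    have hodd : ∀ k : ℕ, ∑ c, (signChar (c a) : ℝ) * T c ^ k = 0 := by
      intro k
      refine sum_eq_zero_of_shift (d := Pi.single a 1) (fun c _ => Finset.mem_univ _) ?_
      intro c _
      have h1 : T (c + Pi.single a 1) = T c := by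
        refine Finset.sum_congr rfl fun j hj => ?_
        have : j ≠ a := fun h => ha (h ▸ hj)
        rw [Pi.add_apply, Pi.single_eq_of_ne this, add_zero]
      have h2 : (signChar 1 : ℤ) = -1 := rfl
      rw [h1, Pi.add_apply, Pi.single_eq_same, signChar_add, h2]
      push_cast
      ring
    have hs : ∀ c : ι → ZMod 2, (signChar (c a) : ℝ) ^ 2 = 1 := by
      intro c
      rw [sq]
      exact_mod_cast signChar_mul_self (c a)
    have e2 : ∀ c, ((signChar (c a) : ℝ) * w a + T c) ^ 2 =
        T c ^ 2 + 2 * w a * ((signChar (c a) : ℝ) * T c ^ 1) + w a ^ 2 := by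
      intro c
      linear_combination w a ^ 2 * hs c
    have e4 : ∀ c, ((signChar (c a) : ℝ) * w a + T c) ^ 4 =
        T c ^ 4 + 4 * w a * ((signChar (c a) : ℝ) * T c ^ 3) + 6 * w a ^ 2 * T c ^ 2 +
          4 * w a ^ 3 * ((signChar (c a) : ℝ) * T c ^ 1) + w a ^ 4 := by
      intro c
      linear_combination (6 * w a ^ 2 * T c ^ 2 + 4 * w a ^ 3 * (signChar (c a) : ℝ) * T c +
        w a ^ 4 * ((signChar (c a) : ℝ) ^ 2 + 1)) * hs c
    have e6 : ∀ c, ((signChar (c a) : ℝ) * w a + T c) ^ 6 =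
        T c ^ 6 + 6 * w a * ((signChar (c a) : ℝ) * T c ^ 5) + 15 * w a ^ 2 * T c ^ 4 +
          20 * w a ^ 3 * ((signChar (c a) : ℝ) * T c ^ 3) + 15 * w a ^ 4 * T c ^ 2 +
          6 * w a ^ 5 * ((signChar (c a) : ℝ) * T c ^ 1) + w a ^ 6 := by
      intro c
      set s : ℝ := (signChar (c a) : ℝ)
      linear_combination (15 * w a ^ 2 * T c ^ 4 + 20 * w a ^ 3 * s * T c ^ 3 +
        15 * w a ^ 4 * T c ^ 2 * (s ^ 2 + 1) + 6 * w a ^ 5 * T c * s * (s ^ 2 + 1) +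
        w a ^ 6 * (s ^ 4 + s ^ 2 + 1)) * hs c
    simp only [Finset.sum_insert ha]
    refine ⟨?_, ?_, ?_⟩
    · rw [Finset.sum_congr rfl fun c _ => e2 c]
      simp only [Finset.sum_add_distrib, ← Finset.mul_sum, hodd, h2, Finset.sum_const,
        Finset.card_univ, nsmul_eq_mul]
      ring
    · rw [Finset.sum_congr rfl fun c _ => e4 c]
      simp only [Finset.sum_add_distrib, ← Finset.mul_sum, hodd, h2, h4, Finset.sum_const,
        Finset.card_univ, nsmul_eq_mul]
      ring
    · rw [Finset.sum_congr rfl fun c _ => e6 c]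
      simp only [Finset.sum_add_distrib, ← Finset.mul_sum, hodd, h2, h4, h6, Finset.sum_const,
        Finset.card_univ, nsmul_eq_mul]
      ring

/-- Every coordinate occurs an even number of times among the values of `f`. -/
def EvenFibers (f : Fin 6 → ι) : Prop :=
  ∀ i, Even (Finset.univ.filter fun k => f k = i).card

theorem prod_signChar_eq (c : ι → ZMod 2) (f : Fin 6 → ι) :
    ∏ k, signChar (c (f k)) = ∏ i, signChar (c i) ^ (Finset.univ.filter fun k => f k = i).card := by
  rw [← Finset.prod_fiberwise_of_maps_to (s := Finset.univ) (t := Finset.univ) (g := f)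
    (fun _ _ => Finset.mem_univ _)]
  refine Finset.prod_congr rfl fun i _ => ?_
  rw [Finset.prod_congr rfl fun k hk => by rw [(Finset.mem_filter.1 hk).2], Finset.prod_const]

theorem EvenFibers.prod_signChar {f : Fin 6 → ι} (hf : EvenFibers f) (c : ι → ZMod 2) :
    ∏ k, signChar (c (f k)) = 1 := by
  rw [prod_signChar_eq]
  refine Finset.prod_eq_one fun i _ => ?_
  obtain ⟨m, hm⟩ := hf i
  rw [hm, ← two_mul, pow_mul, sq, signChar_mul_self, one_pow]

/-- A set of signs whose products over sixfold tuples of coordinates in `O` cancel, unless they are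
trivially equal to one. -/
def BalancedSigns (A : Finset (ι → ZMod 2)) (O : Finset ι) : Prop :=
  ∀ f : Fin 6 → ι, (∀ k, f k ∈ O) → ¬ EvenFibers f →
    ∃ d : ι → ZMod 2, (∀ c ∈ A, c + d ∈ A) ∧ ∏ k, signChar (d (f k)) = -1

theorem balancedSigns_univ (O : Finset ι) : BalancedSigns Finset.univ O := by
  intro f _ hf
  obtain ⟨i, hi⟩ := not_forall.1 hf
  refine ⟨Pi.single i 1, fun _ _ => Finset.mem_univ _, ?_⟩
  rw [prod_signChar_eq, Finset.prod_eq_single i]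
  · rw [Pi.single_eq_same, show signChar 1 = -1 from rfl, (Nat.not_even_iff_odd.1 hi).neg_one_pow]
  · intro j _ hj
    rw [Pi.single_eq_of_ne hj, show signChar 0 = 1 from rfl, one_pow]
  · exact fun h => absurd (Finset.mem_univ i) h

/-- Expand the sixth power over sixfold tuples. A tuple with an odd fiber cancels under the shift
provided by balancedness, and every other tuple has sign product 1. The mean thus depends on w
alone, so it can be computed from the set of all signs. -/
theorem BalancedSigns.sum_pow_six_eq {A : Finset (ι → ZMod 2)} {O : Finset ι} (hA : BalancedSigns A O)
    (w : ι → ℝ) :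
    ∃ S : ℝ, (∀ B : Finset (ι → ZMod 2), BalancedSigns B O →
      ∑ c ∈ B, (∑ j ∈ O, (signChar (c j) : ℝ) * w j) ^ 6 = B.card * S) := by
  classical
  refine ⟨∑ f ∈ Fintype.piFinset fun _ : Fin 6 => O, if EvenFibers f then ∏ k, w (f k) else 0,
    fun B hB => ?_⟩
  have h1 : ∀ c : ι → ZMod 2, (∑ j ∈ O, (signChar (c j) : ℝ) * w j) ^ 6 =
      ∑ f ∈ Fintype.piFinset fun _ : Fin 6 => O,
        (∏ k, (signChar (c (f k)) : ℝ)) * ∏ k, w (f k) := by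
    intro c
    rw [← Fin.prod_const, Finset.prod_univ_sum]
    exact Finset.sum_congr rfl fun f _ => Finset.prod_mul_distrib
  rw [Finset.sum_congr rfl fun c _ => h1 c, Finset.sum_comm, Finset.mul_sum]
  refine Finset.sum_congr rfl fun f hf => ?_
  rw [← Finset.sum_mul]
  split_ifs with h
  · have : ∀ c : ι → ZMod 2, ∏ k, (signChar (c (f k)) : ℝ) = 1 := by
      intro c
      exact_mod_cast h.prod_signChar c
    rw [Finset.sum_congr rfl fun c _ => this c, Finset.sum_const, nsmul_eq_mul, mul_one]
  · obtain ⟨d, hd, hd'⟩ := hB f (fun k => Fintype.mem_piFinset.1 hf k) h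
    rw [sum_eq_zero_of_shift hd, zero_mul, mul_zero]
    intro c _
    have : ∏ k, (signChar ((c + d) (f k))) = -∏ k, signChar (c (f k)) := by
      simp only [Pi.add_apply, signChar_add, Finset.prod_mul_distrib, hd', mul_neg_one]
    exact_mod_cast this

theorem BalancedSigns.sum_pow_six {A : Finset (ι → ZMod 2)} {O : Finset ι} (hA : BalancedSigns A O)
    (w : ι → ℝ) :
    ∑ c ∈ A, (∑ j ∈ O, (signChar (c j) : ℝ) * w j) ^ 6 =
      A.card * (15 * (∑ j ∈ O, w j ^ 2) ^ 3 -
          30 * (∑ j ∈ O, w j ^ 2) * (∑ j ∈ O, w j ^ 4) + 16 * ∑ j ∈ O, w j ^ 6) := by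
  obtain ⟨S, hS⟩ := hA.sum_pow_six_eq w
  have h1 := hS _ (balancedSigns_univ O)
  rw [(sum_sign_moments w O).2.2, Finset.card_univ] at h1
  rw [hS A hA]
  congr 1
  refine (mul_left_cancel₀ ?_ h1).symm
  exact_mod_cast Fintype.card_ne_zero

end Moments

/-! ### The signs of the Golay code and of an octad -/

/-- The finite set of codewords of the Golay code. -/
noncomputable def golayFinset : Finset (ProjLine23 → ZMod 2) :=
  (golayCode : Set (ProjLine23 → ZMod 2)).toFinite.toFinset

theorem mem_golayFinset (c : ProjLine23 → ZMod 2) : c ∈ golayFinset ↔ c ∈ golayCode := by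
  rw [golayFinset, Set.Finite.mem_toFinset, SetLike.mem_coe]

theorem not_evenFibers_iff {f : Fin 6 → ProjLine23} (hf : ¬ EvenFibers f) :
    ∃ e : ProjLine23 → ZMod 2, (∀ d : ProjLine23 → ZMod 2, ∑ i, d i * e i = ∑ k, d (f k)) ∧
      (wordSupport e).card ≠ 0 ∧ (wordSupport e).card ≤ 6 := by
  refine ⟨∑ k, Pi.single (f k) 1, fun d => ?_, ?_, ?_⟩
  · simp only [Finset.sum_apply, Finset.mul_sum]
    rw [Finset.sum_comm]
    refine Finset.sum_congr rfl fun k _ => ?_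
    rw [Finset.sum_eq_single (f k)]
    · simp
    · intro i _ hi
      rw [Pi.single_eq_of_ne hi, mul_zero]
    · exact fun h => absurd (Finset.mem_univ _) h
  · obtain ⟨i, hi⟩ := not_forall.1 hf
    refine Finset.card_ne_zero.2 ⟨i, Finset.mem_filter.2 ⟨Finset.mem_univ _, ?_⟩⟩
    rw [Finset.sum_apply]
    simp only [Pi.single_apply]
    rw [Finset.sum_boole]
    simp only [eq_comm (a := i)]
    exact (ZMod.natCast_eq_one_iff_odd).2 (Nat.not_even_iff_odd.1 hi)
  · have : wordSupport (∑ k, Pi.single (f k) 1) ⊆ Finset.univ.image f := by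
      intro i hi
      by_contra h
      have h1 := (Finset.mem_filter.1 hi).2
      rw [Finset.sum_apply, Finset.sum_eq_zero] at h1
      · exact absurd h1 (by decide)
      · intro k _
        refine Pi.single_eq_of_ne ?_ _
        rintro rfl
        exact h (Finset.mem_image_of_mem _ (Finset.mem_univ _))
    exact (Finset.card_le_card this).trans Finset.card_image_le

/-- A tuple with an odd fiber defines a word of weight between 1 and 6. This is no codeword, hence
by self-duality some codeword has product 1 with it. -/
theorem balancedSigns_golay (O : Finset ProjLine23) : BalancedSigns golayFinset O := by
  intro f _ hf
  obtain ⟨e, he, h0, h6⟩ := not_evenFibers_iff hf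
  have hG : e ∉ golayCode := by
    intro h
    rcases golay_weight h with h | h | h | h | h <;> omega
  have : ∃ d ∈ golayCode, ∑ i, d i * e i ≠ 0 := by
    by_contra! h
    exact hG (mem_golayCode_of_orthogonal h)
  obtain ⟨d, hd, hd'⟩ := this
  refine ⟨d, fun c hc => ?_, ?_⟩
  · rw [mem_golayFinset] at hc ⊢
    exact golayCode.add_mem hc hd
  · rw [← signChar_sum, ← he]
    generalize ∑ i, d i * e i = a at hd'
    revert a
    decide

theorem card_golayFinset : golayFinset.card = 4096 := by
  have hP : ∀ (x : Fin 12 → ZMod 2) k,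
      ∑ j, word (golayDual k) j * (∑ l, x l • golayWord l) j = x k := by
    intro x k
    simp only [Finset.sum_apply, Pi.smul_apply, smul_eq_mul, Finset.mul_sum]
    rw [Finset.sum_comm]
    simp only [mul_left_comm, ← Finset.mul_sum, sum_golayDual_mul]
    simp
  have h1 : golayFinset = Finset.univ.image fun x : Fin 12 → ZMod 2 => ∑ l, x l • golayWord l := by
    ext c
    rw [mem_golayFinset, Finset.mem_image]
    constructor
    · intro hc
      exact ⟨fun k => ∑ j, word (golayDual k) j * c j, Finset.mem_univ _, 
        (eq_sum_golayWord fun d hd => sum_mul_golay hd hc).symm⟩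
    · rintro ⟨x, _, rfl⟩
      exact Submodule.sum_mem _ fun k _ => Submodule.smul_mem _ _ (golayWord_mem k)
  rw [h1, Finset.card_image_of_injective]
  · simp
  · intro x y hxy
    funext k
    rw [← hP x, ← hP y]
    simp only at hxy
    rw [hxy]

/-- The even sets of signs on `O`. -/
def evenSigns (O : Finset ProjLine23) : Finset (ProjLine23 → ZMod 2) :=
  (Fintype.piFinset fun i => if i ∈ O then Finset.univ else {0}).filter fun c => ∑ i, c i = 0

theorem mem_evenSigns {O : Finset ProjLine23} {c : ProjLine23 → ZMod 2} :
    c ∈ evenSigns O ↔ (∀ i, i ∉ O → c i = 0) ∧ ∑ i, c i = 0 := by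
  rw [evenSigns, Finset.mem_filter, Fintype.mem_piFinset]
  refine and_congr_left fun _ => forall_congr' fun i => ?_
  by_cases h : i ∈ O <;> simp [h]

/-- Flip a coordinate of odd multiplicity together with one that the tuple misses; the second flip
restores evenness and exists because O has more than six elements. -/
theorem balancedSigns_evenSigns {O : Finset ProjLine23} (hO : 6 < O.card) :
    BalancedSigns (evenSigns O) O := by
  intro f hf hne
  obtain ⟨i, hi⟩ := not_forall.1 hne
  have hiO : i ∈ O := by
    by_contra h
    refine hi ?_
    rw [Finset.filter_false_of_mem]
    · exact ⟨0, rfl⟩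
    · rintro k _ rfl
      exact h (hf k)
  obtain ⟨j, hjO, hj⟩ : ∃ j ∈ O, j ∉ Finset.univ.image f := by
    by_contra! h
    have := (Finset.card_le_card h).trans Finset.card_image_le
    rw [Finset.card_univ, Fintype.card_fin] at this
    omega
  have hij : i ≠ j := by
    rintro rfl
    refine hi ?_
    rw [Finset.filter_false_of_mem]
    · exact ⟨0, rfl⟩
    · rintro k _ rfl
      exact hj (Finset.mem_image_of_mem _ (Finset.mem_univ _))
  refine ⟨Pi.single i 1 + Pi.single j 1, fun c hc => ?_, ?_⟩
  · rw [mem_evenSigns] at hc ⊢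
    refine ⟨fun k hk => ?_, ?_⟩
    · have h1 : k ≠ i := fun h => hk (h ▸ hiO)
      have h2 : k ≠ j := fun h => hk (h ▸ hjO)
      simp [hc.1 k hk, h1, h2]
    · simp only [Pi.add_apply, Finset.sum_add_distrib, hc.2, Finset.sum_pi_single',
        Finset.mem_univ, if_true]
      decide
  · have h1 : ∀ k, (Pi.single i 1 + Pi.single j 1 : ProjLine23 → ZMod 2) (f k) =
        (Pi.single i 1 : ProjLine23 → ZMod 2) (f k) := by
      intro k
      have : f k ≠ j := fun h => hj (h ▸ Finset.mem_image_of_mem _ (Finset.mem_univ _))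
      rw [Pi.add_apply, Pi.single_eq_of_ne this, add_zero]
    simp only [h1]
    rw [prod_signChar_eq, Finset.prod_eq_single i]
    · rw [Pi.single_eq_same, show signChar 1 = -1 from rfl,
        (Nat.not_even_iff_odd.1 hi).neg_one_pow]
    · intro k _ hk
      rw [Pi.single_eq_of_ne hk, show signChar 0 = 1 from rfl, one_pow]
    · exact fun h => absurd (Finset.mem_univ i) h

theorem card_evenSigns {O : Finset ProjLine23} (hO : O.card = 8) : (evenSigns O).card = 128 := by
  set A := Fintype.piFinset fun i : ProjLine23 => if i ∈ O then (Finset.univ : Finset (ZMod 2))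
    else {0} with hA
  have h1 : A.card = 256 := by
    rw [hA, Fintype.card_piFinset]
    have : ∀ i, (if i ∈ O then (Finset.univ : Finset (ZMod 2)) else {0}).card =
        if i ∈ O then 2 else 1 := by
      intro i
      split_ifs <;> rfl
    rw [Finset.prod_congr rfl fun i _ => this i, Finset.prod_ite]
    simp [hO]
  obtain ⟨i, hi⟩ : O.Nonempty := Finset.card_pos.1 (by omega)
  have hmem : ∀ c ∈ A, c + Pi.single i 1 ∈ A := by
    intro c hc
    rw [hA, Fintype.mem_piFinset] at hc ⊢
    intro k
    by_cases hk : k ∈ O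
    · simp [hk]
    · have h1 := hc k
      have h2 : k ≠ i := fun h => hk (h ▸ hi)
      simp only [hk, if_false, Finset.mem_singleton] at h1
      simp [hk, h1, h2]
  have hsum : ∀ c : ProjLine23 → ZMod 2, ∑ k, (c + Pi.single i 1 : ProjLine23 → ZMod 2) k = ∑ k, c k + 1 := by
    intro c
    simp [Finset.sum_add_distrib, Finset.sum_pi_single', -Fintype.sum_option]
  have h2 : (A.filter fun c => ∑ k, c k = 0).card = (A.filter fun c => ¬ ∑ k, c k = 0).card := by
    refine Finset.card_nbij' (fun c => c + Pi.single i 1) (fun c => c + Pi.single i 1) ?_ ?_ ?_ ?_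
    · intro c hc
      rw [Finset.mem_coe, Finset.mem_filter] at hc ⊢
      refine ⟨hmem c hc.1, ?_⟩
      rw [hsum, hc.2]
      decide
    · intro c hc
      rw [Finset.mem_coe, Finset.mem_filter] at hc ⊢
      refine ⟨hmem c hc.1, ?_⟩
      rw [hsum]
      have := hc.2
      generalize ∑ k, c k = a at this
      revert a
      decide
    · exact fun c _ => sign_add_add_self c _
    · exact fun c _ => sign_add_add_self c _
  have h3 := Finset.card_filter_add_card_filter_not (s := A) fun c => ∑ k, c k = 0
  change (A.filter fun c => ∑ k, c k = 0).card = 128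
  omega

/-! ### The minimal vectors of the Leech lattice -/

/-- The vectors with two nonzero entries `±4`. -/
def pairVector (p : (ProjLine23 × ProjLine23) × (ZMod 2 × ZMod 2)) (k : ProjLine23) : ℤ :=
  if k = p.1.1 then 4 * signChar p.2.1 else if k = p.1.2 then 4 * signChar p.2.2 else 0

/-- The vectors with entries `±2` on an octad. -/
def octadVector (p : (_ : ℕ) × (ProjLine23 → ZMod 2)) (k : ProjLine23) : ℤ :=
  if word p.1 k = 1 then 2 * signChar (p.2 k) else 0

/-- The vectors with one entry `±3` and all others `±1`. -/
def oddVector (p : (ProjLine23 → ZMod 2) × ProjLine23) (k : ProjLine23) : ℤ :=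
  signChar (p.1 k) * (if k = p.2 then -3 else 1)

/-- The pairs of coordinates, with signs. -/
def pairIndices : Finset ((ProjLine23 × ProjLine23) × (ZMod 2 × ZMod 2)) :=
  (Finset.univ.filter fun p => p.1.index < p.2.index) ×ˢ Finset.univ

theorem mem_pairIndices {p : (ProjLine23 × ProjLine23) × (ZMod 2 × ZMod 2)} :
    p ∈ pairIndices ↔ p.1.1.index < p.1.2.index := by
  rw [pairIndices, Finset.mem_product, Finset.mem_filter]
  exact ⟨fun h => h.1.2, fun h => ⟨⟨Finset.mem_univ _, h⟩, Finset.mem_univ _⟩⟩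

/-- The octads, with an even set of signs. -/
def octadIndices : Finset ((_ : ℕ) × (ProjLine23 → ZMod 2)) :=
  octadMasks.toFinset.sigma fun n => evenSigns (wordSupport (word n))

/-- The integral coordinates of the minimal vectors. -/
noncomputable def minimalCoords : Finset (ProjLine23 → ℤ) :=
  pairIndices.image pairVector ∪
    (octadIndices.image octadVector ∪ (golayFinset ×ˢ Finset.univ).image oddVector)

theorem signChar_eq (a : ZMod 2) : signChar a = 1 ∨ signChar a = -1 := by
  revert a
  decide

theorem signChar_ne_zero (a : ZMod 2) : signChar a ≠ 0 := by
  revert a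
  decide

theorem pairVector_injOn : Set.InjOn pairVector (pairIndices : Set _) := by
  rintro ⟨⟨i, j⟩, a, b⟩ hp ⟨⟨i', j'⟩, a', b'⟩ hp' h
  have hij : i.index < j.index := mem_pairIndices.1 hp
  have hij' : i'.index < j'.index := mem_pairIndices.1 hp'
  have hne : j ≠ i := by rintro rfl; exact lt_irrefl _ hij
  have hne' : j' ≠ i' := by rintro rfl; exact lt_irrefl _ hij'
  have h1 := congrFun h i
  have h2 := congrFun h j
  have h3 := congrFun h i'
  simp only [pairVector, if_true, hne, if_false] at h1 h2 h3
  have ha := signChar_ne_zero a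
  have hb := signChar_ne_zero b
  have ha' := signChar_ne_zero a'
  have hi : i = i' := by
    by_contra hii
    simp only [hii, Ne.symm hii, if_false] at h1 h3
    by_cases hij1 : i = j'
    · by_cases hij2 : i' = j
      · subst hij1 hij2
        exact lt_asymm hij hij'
      · simp [hij2, ha'] at h3
    · simp [hij1, ha] at h1
  subst hi
  have hj : j = j' := by
    by_contra hjj
    simp [hjj, hne, hb] at h2
  subst hj
  simp only [if_true, hne, if_false] at h1 h2
  have e1 : a = a' := signChar_injective (by linarith)
  have e2 : b = b' := signChar_injective (by linarith)
  rw [e1, e2]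

theorem octadVector_injOn : Set.InjOn octadVector (octadIndices : Set _) := by
  rintro ⟨n, c⟩ hp ⟨n', c'⟩ hp' h
  rw [Finset.mem_coe, octadIndices, Finset.mem_sigma] at hp hp'
  obtain ⟨hn, hc⟩ := hp
  obtain ⟨hn', hc'⟩ := hp'
  rw [List.mem_toFinset, mem_octadMasks_iff] at hn hn'
  rw [mem_evenSigns] at hc hc'
  have h2 : word n = word n' := by
    funext k
    have h1 := congrFun h k
    simp only [octadVector] at h1
    have ha := signChar_ne_zero (c k)
    have hb := signChar_ne_zero (c' k)
    by_cases e1 : word n k = 1 <;> by_cases e2 : word n' k = 1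
    · rw [e1, e2]
    · simp [e1, e2, ha] at h1
    · simp [e1, e2, eq_comm, hb] at h1
    · revert e1 e2
      generalize word n k = x
      generalize word n' k = y
      revert x y
      decide
  obtain rfl := word_injOn (golayMasks_lt hn.1) (golayMasks_lt hn'.1) h2
  congr 1
  funext k
  by_cases e1 : word n k = 1
  · have h1 := congrFun h k
    simp only [octadVector, e1, if_true] at h1
    exact signChar_injective (by linarith)
  · have : k ∉ wordSupport (word n) := fun h => e1 (Finset.mem_filter.1 h).2
    dsimp only at hc hc'
    rw [hc.1 k this, hc'.1 k this]

theorem oddVector_injective : Function.Injective oddVector := by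
  rintro ⟨c, i⟩ ⟨c', i'⟩ h
  have h1 : c = c' := by
    funext k
    have h1 := congrFun h k
    simp only [oddVector] at h1
    apply signChar_injective
    rcases signChar_eq (c k) with h2 | h2 <;> rcases signChar_eq (c' k) with h3 | h3 <;>
      rw [h2, h3] at h1 <;> split_ifs at h1 <;> omega
  subst h1
  have h1 := congrFun h i
  simp only [oddVector, if_true] at h1
  have h2 := mul_left_cancel₀ (signChar_ne_zero _) h1
  by_cases h3 : i = i'
  · rw [h3]
  · simp [h3] at h2

theorem isLeech_pairVector (p : (ProjLine23 × ProjLine23) × (ZMod 2 × ZMod 2))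
    (hp : p ∈ pairIndices) :
    IsLeech (pairVector p) ∧ ∑ k, pairVector p k * pairVector p k = 32 := by
  obtain ⟨⟨i, j⟩, a, b⟩ := p
  have hij : i.index < j.index := mem_pairIndices.1 hp
  have hne : j ≠ i := by rintro rfl; exact lt_irrefl _ hij
  have h2 : pairVector ((i, j), a, b) =
      Pi.single i (4 * signChar a) + Pi.single j (4 * signChar b) := by
    funext k
    simp only [pairVector, Pi.add_apply, Pi.single_apply]
    by_cases h : k = i
    · subst h
      simp [hne.symm]
    · simp [h]
  constructor
  · have := isLeech_of_even (y := Pi.single i (2 * signChar a) + Pi.single j (2 * signChar b)) (by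
      convert golayCode.zero_mem using 1
      funext k
      have h2 : (2 : ZMod 2) = 0 := rfl
      by_cases h : k = i <;> by_cases h' : k = j <;> simp [Pi.single_apply, h, h', h2]) (by
      simp only [Pi.add_apply, Finset.sum_add_distrib, Finset.sum_pi_single', Finset.mem_univ,
        if_true]
      rcases signChar_eq a with h | h <;> rcases signChar_eq b with h' | h' <;> rw [h, h'] <;>
        norm_num)
    convert this using 1
    rw [h2]
    funext k
    simp only [Pi.add_apply, Pi.single_apply]
    split_ifs <;> ring
  · have h3 : ∀ k, pairVector ((i, j), a, b) k * pairVector ((i, j), a, b) k =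
        (Pi.single i 16 : ProjLine23 → ℤ) k + (Pi.single j 16 : ProjLine23 → ℤ) k := by
      intro k
      simp only [pairVector, Pi.single_apply]
      by_cases h : k = i
      · subst h
        simp only [if_true, hne.symm, if_false]
        linear_combination 16 * signChar_mul_self a
      · by_cases h' : k = j
        · simp only [h, h', if_true, if_false, hne]
          linear_combination 16 * signChar_mul_self b
        · simp [h, h']
    simp only [h3, Finset.sum_add_distrib, Finset.sum_pi_single', Finset.mem_univ, if_true]
    norm_num

theorem sum_signChar (s : Finset ProjLine23) (c : ProjLine23 → ZMod 2) :
    ∑ k ∈ s, signChar (c k) = s.card - 2 * (s.filter fun k => c k = 1).card := by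
  rw [Finset.card_filter]
  push_cast
  rw [Finset.card_eq_sum_ones, Finset.mul_sum]
  push_cast
  rw [← Finset.sum_sub_distrib]
  refine Finset.sum_congr rfl fun k _ => ?_
  generalize c k = a
  revert a
  decide

theorem sum_eq_card_filter (c : ProjLine23 → ZMod 2) :
    ∑ k, c k = ((Finset.univ.filter fun k => c k = 1).card : ZMod 2) := by
  rw [Finset.card_filter]
  push_cast
  refine Finset.sum_congr rfl fun k _ => ?_
  generalize c k = a
  revert a
  decide

theorem filter_eq_one_eq {O : Finset ProjLine23} {c : ProjLine23 → ZMod 2}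
    (hc : ∀ i, i ∉ O → c i = 0) :
    (O.filter fun k => c k = 1) = Finset.univ.filter fun k => c k = 1 := by
  ext k
  rw [Finset.mem_filter, Finset.mem_filter]
  refine ⟨fun h => ⟨Finset.mem_univ _, h.2⟩, fun h => ⟨?_, h.2⟩⟩
  by_contra hk
  rw [hc k hk] at h
  exact absurd h.2 (by decide)

theorem isLeech_octadVector (p : (_ : ℕ) × (ProjLine23 → ZMod 2)) (hp : p ∈ octadIndices) :
    IsLeech (octadVector p) ∧ ∑ k, octadVector p k * octadVector p k = 32 := by
  obtain ⟨n, c⟩ := p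
  rw [octadIndices, Finset.mem_sigma, List.mem_toFinset, mem_octadMasks_iff, mem_evenSigns] at hp
  obtain ⟨⟨hn, h8⟩, hc, hc0⟩ := hp
  dsimp only at hn h8 hc hc0
  constructor
  · have := isLeech_of_even (y := fun k => if word n k = 1 then signChar (c k) else 0) (by
      convert (mem_golayCode_iff _).2 ⟨n, hn, rfl⟩ using 1
      funext k
      generalize c k = a
      generalize word n k = b
      revert a b
      decide) (by
      have h1 : ∑ k, (if word n k = 1 then signChar (c k) else 0) =
          ∑ k ∈ wordSupport (word n), signChar (c k) := by
        rw [wordSupport, Finset.sum_filter]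
      rw [h1, sum_signChar, h8, filter_eq_one_eq hc]
      rw [sum_eq_card_filter, ZMod.natCast_eq_zero_iff] at hc0
      obtain ⟨m, hm⟩ := hc0
      rw [hm]
      push_cast
      omega)
    convert this using 1
    funext k
    simp only [octadVector]
    split_ifs <;> ring
  · have h1 : ∀ k, octadVector ⟨n, c⟩ k * octadVector ⟨n, c⟩ k = if word n k = 1 then 4 else 0 := by
      intro k
      simp only [octadVector]
      split_ifs
      · linear_combination 4 * signChar_mul_self (c k)
      · ring
    rw [Finset.sum_congr rfl fun k _ => h1 k, ← Finset.sum_filter, Finset.sum_const]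
    change (wordSupport (word n)).card • (4 : ℤ) = 32
    rw [h8]
    norm_num

theorem isLeech_oddVector (p : (ProjLine23 → ZMod 2) × ProjLine23) (hp : p.1 ∈ golayCode) :
    IsLeech (oddVector p) ∧ ∑ k, oddVector p k * oddVector p k = 32 := by
  obtain ⟨c, i⟩ := p
  dsimp only at hp
  constructor
  · refine ⟨1, fun k => (if c k = 1 then -1 else 0) + (if k = i then -2 * signChar (c k) else 0),
      fun k => ?_, ?_, ?_⟩
    · simp only [oddVector]
      generalize c k = a
      by_cases h : k = i
      · simp only [h, if_true]
        revert a
        decide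
      · simp only [h, if_false]
        revert a
        decide
    · convert hp using 1
      funext k
      by_cases h : k = i
      · subst h
        simp only [if_true]
        generalize c k = a
        revert a
        decide
      · simp only [h, if_false]
        generalize c k = a
        revert a
        decide
    · have h1 : ∀ k, oddVector (c, i) k =
          signChar (c k) + (Pi.single i (-4 * signChar (c i)) : ProjLine23 → ℤ) k := by
        intro k
        simp only [oddVector, Pi.single_apply]
        by_cases h : k = i
        · subst h
          simp only [if_true]
          ring
        · simp [h]
      simp only [h1, Finset.sum_add_distrib, Finset.sum_pi_single', Finset.mem_univ, if_true]
      rw [sum_signChar]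
      change (24 : ℤ) - 2 * (wordSupport c).card + _ ≡ _ [ZMOD 8]
      refine Int.ModEq.symm (Int.modEq_iff_dvd.2 ?_)
      rcases signChar_eq (c i) with h | h <;> rw [h] <;>
        rcases golay_weight hp with h' | h' | h' | h' | h' <;> rw [h'] <;> norm_num
  · have h1 : ∀ k, oddVector (c, i) k * oddVector (c, i) k =
        1 + (Pi.single i 8 : ProjLine23 → ℤ) k := by
      intro k
      simp only [oddVector, Pi.single_apply]
      split_ifs
      · linear_combination 9 * signChar_mul_self (c k)
      · linear_combination signChar_mul_self (c k)
    simp only [h1, Finset.sum_add_distrib, Finset.sum_pi_single', Finset.mem_univ, if_true,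
      sum_const_projLine]
    norm_num

theorem eq_one_or_neg_one_of_sq {a : ℤ} (h : a * a = 1) : a = 1 ∨ a = -1 :=
  mul_self_eq_one_iff.1 h

/-- The terms z_i² - 1 add up to 8, and each is 0 or at least 8, so exactly one entry is ±3. The
signs are then determined by the residues modulo 4. -/
theorem odd_mem_minimalCoords {z : ProjLine23 → ℤ} (h32 : ∑ i, z i * z i = 32)
    {e : ProjLine23 → ZMod 2} (he : e ∈ golayCode)
    (h : ∀ i, Odd (z i) ∧ (e i = 0 ↔ z i % 4 = 1)) : z ∈ minimalCoords := by
  have hsq : ∀ i, z i * z i = 1 ∨ 9 ≤ z i * z i := by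
    intro i
    obtain ⟨k, hk⟩ := (h i).1
    rcases lt_trichotomy k 0 with h1 | h1 | h1
    · rcases Int.lt_or_le k (-1) with h2 | h2
      · right; nlinarith
      · left; rw [hk, show k = -1 by omega]; norm_num
    · left; rw [hk, h1]; norm_num
    · right; nlinarith
  obtain ⟨i, hi⟩ : ∃ i, z i * z i ≠ 1 := by
    by_contra! h1
    rw [Finset.sum_congr rfl fun i _ => h1 i, sum_const_projLine] at h32
    norm_num at h32
  have hi9 := (hsq i).resolve_left hi
  have hsplit : ∑ k, (z k * z k - 1) = 8 := by
    rw [Finset.sum_sub_distrib, h32, sum_const_projLine]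
    norm_num
  have hnn : ∀ k, 0 ≤ z k * z k - 1 := by
    intro k
    rcases hsq k with h | h <;> omega
  rw [← Finset.add_sum_erase _ _ (Finset.mem_univ i)] at hsplit
  have h0 : ∑ k ∈ Finset.univ.erase i, (z k * z k - 1) = 0 :=
    le_antisymm (by linarith) (Finset.sum_nonneg fun k _ => hnn k)
  have h1 : ∀ k, k ≠ i → z k * z k = 1 := by
    intro k hk
    have := (Finset.sum_eq_zero_iff_of_nonneg fun k _ => hnn k).1 h0 k
      (Finset.mem_erase.2 ⟨hk, Finset.mem_univ _⟩)
    linarith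
  have h9 : z i = 3 ∨ z i = -3 := by
    have : (z i - 3) * (z i + 3) = 0 := by linarith
    rcases mul_eq_zero.1 this with h | h
    · left; linarith
    · right; linarith
  refine Finset.mem_union_right _ (Finset.mem_union_right _ (Finset.mem_image.2 ⟨(e, i), ?_, ?_⟩))
  · exact Finset.mem_product.2 ⟨(mem_golayFinset e).2 he, Finset.mem_univ _⟩
  · funext k
    simp only [oddVector]
    have h2 := (h k).2
    by_cases hk : k = i
    · subst hk
      rcases h9 with h3 | h3 <;> rw [h3] at h2 ⊢ <;> norm_num at h2 <;> simp [signChar, h2]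
    · rcases eq_one_or_neg_one_of_sq (h1 k hk) with h3 | h3 <;> rw [h3] at h2 ⊢ <;>
        norm_num at h2 <;> simp [signChar, h2, hk]

theorem octad_mem_minimalCoords {y : ProjLine23 → ℤ} (h8 : ∑ i, y i * y i = 8)
    (hG : (fun i => (y i : ZMod 2)) ∈ golayCode) (hs : 4 ∣ ∑ i, y i)
    (hw : (wordSupport fun i => (y i : ZMod 2)).card = 8) :
    (fun i => 2 * y i) ∈ minimalCoords := by
  have hle : ∀ k, 0 ≤ y k * y k - if Odd (y k) then 1 else 0 := by
    intro k
    split_ifs with h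
    · obtain ⟨m, hm⟩ := h
      rcases Int.lt_or_le m 0 with h1 | h1 <;> nlinarith
    · linarith [mul_self_nonneg (y k)]
  have h0 : ∑ k, (y k * y k - if Odd (y k) then 1 else 0) = 0 := by
    rw [Finset.sum_sub_distrib, h8, ← wordSupport_card_intCast, hw]
    norm_num
  have h1 : ∀ k, y k * y k = if Odd (y k) then 1 else 0 := by
    intro k
    have := (Finset.sum_eq_zero_iff_of_nonneg fun k _ => hle k).1 h0 k (Finset.mem_univ _)
    linarith
  obtain ⟨n, hn, hny⟩ := (mem_golayCode_iff _).1 hG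
  have hodd : ∀ k, word n k = 1 ↔ Odd (y k) := by
    intro k
    rw [hny, ZMod.intCast_eq_one_iff_odd]
  have hval : ∀ k, (word n k = 1 ∧ (y k = 1 ∨ y k = -1)) ∨ (word n k ≠ 1 ∧ y k = 0) := by
    intro k
    have h2 := h1 k
    by_cases h : word n k = 1
    · rw [if_pos ((hodd k).1 h)] at h2
      exact Or.inl ⟨h, eq_one_or_neg_one_of_sq h2⟩
    · rw [if_neg (fun h' => h ((hodd k).2 h'))] at h2
      exact Or.inr ⟨h, mul_self_eq_zero.1 h2⟩
  set c : ProjLine23 → ZMod 2 := fun k => if y k = -1 then 1 else 0 with hc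
  have hcO : ∀ i, i ∉ wordSupport (word n) → c i = 0 := by
    intro k hk
    rcases hval k with h | h
    · exact absurd (Finset.mem_filter.2 ⟨Finset.mem_univ k, h.1⟩ : k ∈ wordSupport (word n)) hk
    · simp [hc, h.2]
  have hyc : ∀ k, y k = if word n k = 1 then signChar (c k) else 0 := by
    intro k
    rcases hval k with ⟨h, h' | h'⟩ | ⟨h, h'⟩
    · simp [hc, h, h', signChar]
    · simp [hc, h, h', signChar]
    · simp [h, h']
  have hw' : (wordSupport (word n)).card = 8 := by rw [hny]; exact hw
  refine Finset.mem_union_right _ (Finset.mem_union_left _ (Finset.mem_image.2 ⟨⟨n, c⟩, ?_, ?_⟩))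
  · rw [octadIndices, Finset.mem_sigma, List.mem_toFinset, mem_octadMasks_iff, mem_evenSigns]
    refine ⟨⟨hn, hw'⟩, hcO, ?_⟩
    have h2 : ∑ k, y k = ∑ k ∈ wordSupport (word n), signChar (c k) := by
      rw [wordSupport, Finset.sum_filter]
      exact Finset.sum_congr rfl fun k _ => hyc k
    rw [h2, sum_signChar, hw', filter_eq_one_eq hcO] at hs
    dsimp only
    rw [sum_eq_card_filter, ZMod.natCast_eq_zero_iff]
    push_cast at hs
    omega
  · funext k
    simp only [octadVector]
    rw [hyc k]
    split_ifs <;> ring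

theorem pair_mem_minimalCoords {x : ProjLine23 → ℤ} (h2 : ∑ i, x i * x i = 2) :
    (fun i => 4 * x i) ∈ minimalCoords := by
  have hnn : ∀ (s : Finset ProjLine23), ∀ k ∈ s, 0 ≤ x k * x k := fun _ k _ => mul_self_nonneg _
  obtain ⟨i, hi⟩ : ∃ i, x i ≠ 0 := by
    by_contra! h
    simp [h] at h2
  have hsq : ∀ k, x k ≠ 0 → 1 ≤ x k * x k := fun k hk => by
    have := mul_self_pos.2 hk
    omega
  have hfour : ∀ k, x k * x k ≤ 2 → x k ≠ 0 → x k * x k = 1 := by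
    intro k h h'
    have h1 := hsq k h'
    have h3 : x k ≤ 1 := by nlinarith
    have h4 : -1 ≤ x k := by nlinarith
    interval_cases x k <;> simp_all
  rw [← Finset.add_sum_erase _ _ (Finset.mem_univ i)] at h2
  have hi1 : x i * x i = 1 := by
    refine hfour i ?_ hi
    have := Finset.sum_nonneg (hnn (Finset.univ.erase i))
    linarith
  obtain ⟨j, hj, hj0⟩ : ∃ j ∈ Finset.univ.erase i, x j ≠ 0 := by
    by_contra! h
    rw [Finset.sum_congr rfl fun k hk => by rw [h k hk]] at h2
    simp [hi1] at h2
  have hji : j ≠ i := (Finset.mem_erase.1 hj).1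
  rw [← Finset.add_sum_erase _ _ hj, hi1] at h2
  have hrest := Finset.sum_nonneg (hnn ((Finset.univ.erase i).erase j))
  have hj1 : x j * x j = 1 := hfour j (by linarith) hj0
  have h0 : ∀ k, k ≠ i → k ≠ j → x k = 0 := by
    intro k hki hkj
    have h3 : ∑ k ∈ (Finset.univ.erase i).erase j, x k * x k = 0 := by linarith
    exact mul_self_eq_zero.1 ((Finset.sum_eq_zero_iff_of_nonneg (hnn _)).1 h3 k
      (Finset.mem_erase.2 ⟨hkj, Finset.mem_erase.2 ⟨hki, Finset.mem_univ _⟩⟩))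
  have hsign : ∀ k, x k * x k = 1 → ∃ a, signChar a = x k := by
    intro k hk
    rcases eq_one_or_neg_one_of_sq hk with h | h
    · exact ⟨0, by rw [h]; rfl⟩
    · exact ⟨1, by rw [h]; rfl⟩
  obtain ⟨a, ha⟩ := hsign i hi1
  obtain ⟨b, hb⟩ := hsign j hj1
  refine Finset.mem_union_left _ (Finset.mem_image.2 ?_)
  rcases lt_trichotomy i.index j.index with h | h | h
  · refine ⟨((i, j), a, b), mem_pairIndices.2 h, ?_⟩
    funext k
    simp only [pairVector]
    split_ifs with h1 h2
    · rw [h1, ha]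
    · rw [h2, hb]
    · rw [h0 k h1 h2, mul_zero]
  · exact absurd (index_injective h).symm hji
  · refine ⟨((j, i), b, a), mem_pairIndices.2 h, ?_⟩
    funext k
    simp only [pairVector]
    split_ifs with h1 h2
    · rw [h1, hb]
    · rw [h2, ha]
    · rw [h0 k h2 h1, mul_zero]

theorem mem_minimalCoords_iff (z : ProjLine23 → ℤ) :
    z ∈ minimalCoords ↔ IsLeech z ∧ ∑ i, z i * z i = 32 := by
  constructor
  · intro h
    rw [minimalCoords, Finset.mem_union, Finset.mem_union, Finset.mem_image, Finset.mem_image,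
      Finset.mem_image] at h
    rcases h with ⟨p, hp, rfl⟩ | ⟨p, hp, rfl⟩ | ⟨p, hp, rfl⟩
    · exact isLeech_pairVector p hp
    · exact isLeech_octadVector p hp
    · exact isLeech_oddVector p ((mem_golayFinset _).1 (Finset.mem_product.1 hp).1)
  · rintro ⟨hz, h32⟩
    rcases hz.trichotomy with ⟨e, he, h⟩ | ⟨y, hy, hyG, hys⟩
    · exact odd_mem_minimalCoords h32 he h
    · obtain rfl : z = fun i => 2 * y i := funext hy
      have h8 : ∑ i, y i * y i = 8 := by
        have : ∑ i, 2 * y i * (2 * y i) = 4 * ∑ i, y i * y i := by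
          rw [Finset.mul_sum]
          exact Finset.sum_congr rfl fun i _ => by ring
        have h32' : ∑ i, 2 * y i * (2 * y i) = 32 := h32
        omega
      have h5 := sum_sq_ge_wordSupport y
      have h6 : (wordSupport fun i => (y i : ZMod 2)).card = 0 ∨
          (wordSupport fun i => (y i : ZMod 2)).card = 8 := by
        rcases golay_weight hyG with h | h | h | h | h <;> omega
      rcases h6 with h6 | h6
      · choose x hx using even_of_wordSupport_card_eq_zero h6
        have h7 : ∑ i, x i * x i = 2 := by
          have : ∑ i, y i * y i = 4 * ∑ i, x i * x i := by
            rw [Finset.mul_sum]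
            exact Finset.sum_congr rfl fun i _ => by rw [hx]; ring
          omega
        have : (fun i => 2 * y i) = fun i => 4 * x i := by
          funext i
          rw [hx]
          ring
        rw [this]
        exact pair_mem_minimalCoords h7
      · exact octad_mem_minimalCoords h8 hyG hys h6

/-! ### The sixth moment of the minimal vectors -/

/-- For a fixed exceptional place i these are signed sums over the Golay code of v with its i-th
entry multiplied by -3. The power sums change by (-3)^m - 1 = 8, 80, 728 times v_i^m for m = 2, 4,
6. -/
theorem sum_oddVector_pow_six (v : ProjLine23 → ℝ) :
    ∑ p ∈ golayFinset ×ˢ Finset.univ, (∑ k, (oddVector p k : ℝ) * v k) ^ 6 =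
      4096 * (720 * (∑ k, v k ^ 2) ^ 3 - 480 * (∑ k, v k ^ 2) * (∑ k, v k ^ 4) +
        512 * ∑ k, v k ^ 6) := by
  rw [Finset.sum_product_right]
  have h1 : ∀ i : ProjLine23, ∑ c ∈ golayFinset, (∑ k, (oddVector (c, i) k : ℝ) * v k) ^ 6 =
      4096 * (15 * ((∑ k, v k ^ 2) + 8 * v i ^ 2) ^ 3 -
        30 * ((∑ k, v k ^ 2) + 8 * v i ^ 2) * ((∑ k, v k ^ 4) + 80 * v i ^ 4) +
        16 * ((∑ k, v k ^ 6) + 728 * v i ^ 6)) := by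
    intro i
    have h2 : ∀ m : ℕ, ∑ k, ((if k = i then -3 else 1) * v k) ^ m =
        ∑ k, v k ^ m + ((-3) ^ m - 1) * v i ^ m := by
      intro m
      have : ∀ k, ((if k = i then -3 else 1) * v k) ^ m =
          v k ^ m + if k = i then ((-3) ^ m - 1) * v i ^ m else 0 := by
        intro k
        split_ifs with h
        · rw [h, mul_pow]; ring
        · rw [one_mul, add_zero]
      rw [Finset.sum_congr rfl fun k _ => this k, Finset.sum_add_distrib,
        Finset.sum_ite_eq' Finset.univ i, if_pos (Finset.mem_univ i)]
    have h3 := (balancedSigns_golay Finset.univ).sum_pow_six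
      fun k => (if k = i then -3 else 1) * v k
    rw [card_golayFinset, h2, h2, h2] at h3
    rw [← Finset.sum_congr rfl fun c _ => congrArg (· ^ 6) (Finset.sum_congr rfl fun k _ =>
      show (signChar (c k) : ℝ) * ((if k = i then -3 else 1) * v k) =
        (oddVector (c, i) k : ℝ) * v k by
          simp only [oddVector]; push_cast; rw [mul_assoc]), h3]
    norm_num
  rw [Finset.sum_congr rfl fun i _ => h1 i, ← Finset.mul_sum]
  generalize hp2 : ∑ k, v k ^ 2 = p2
  generalize hp4 : ∑ k, v k ^ 4 = p4
  generalize hp6 : ∑ k, v k ^ 6 = p6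
  congr 1
  rw [Finset.sum_congr rfl fun i _ =>
    show 15 * (p2 + 8 * v i ^ 2) ^ 3 - 30 * (p2 + 8 * v i ^ 2) * (p4 + 80 * v i ^ 4) +
        16 * (p6 + 728 * v i ^ 6) =
      (15 * p2 ^ 3 - 30 * p2 * p4 + 16 * p6) + (360 * p2 ^ 2 - 240 * p4) * v i ^ 2 +
        (2880 * p2 - 2400 * p2) * v i ^ 4 + (7680 - 19200 + 11648) * v i ^ 6 by ring,
    Finset.sum_add_distrib, Finset.sum_add_distrib, Finset.sum_add_distrib, ← Finset.mul_sum,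
    ← Finset.mul_sum, ← Finset.mul_sum, hp2, hp4, hp6, Finset.sum_const, Finset.card_univ,
    nsmul_eq_mul, show (Fintype.card ProjLine23 : ℝ) = 24 by
      rw [show Fintype.card ProjLine23 = 24 from rfl]; norm_num]
  ring

/-- The product of three sums over an octad runs over triples of its points, so summing over octads
weights each triple by the number of octads through it. -/
theorem sum_octads_mul_mul (f g h : ProjLine23 → ℝ) :
    ∑ n ∈ octadMasks.toFinset, (∑ i ∈ wordSupport (word n), f i) *
        (∑ i ∈ wordSupport (word n), g i) * (∑ i ∈ wordSupport (word n), h i) =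
      21 * ((∑ i, f i) * (∑ i, g i) * (∑ i, h i)) +
        56 * ((∑ i, f i * g i) * (∑ i, h i) + (∑ i, f i) * (∑ i, g i * h i) +
          (∑ i, f i * h i) * (∑ i, g i)) + 64 * ∑ i, f i * g i * h i := by
  have hcount := octad_count
  generalize octadMasks.toFinset = l at hcount
  have h1 : ∀ (f : ProjLine23 → ℝ) n, ∑ i ∈ wordSupport (word n), f i =
      ∑ i, if word n i = 1 then f i else 0 := by
    intro f n
    rw [wordSupport, Finset.sum_filter]
  have h2 : ∀ n, (∑ i ∈ wordSupport (word n), f i) *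
        (∑ i ∈ wordSupport (word n), g i) * (∑ i ∈ wordSupport (word n), h i) =
      ∑ i, ∑ j, ∑ k, if word n i = 1 ∧ word n j = 1 ∧ word n k = 1 then f i * g j * h k else 0 := by
    intro n
    rw [h1, h1, h1, Finset.sum_mul_sum, Finset.sum_mul]
    refine Finset.sum_congr rfl fun i _ => ?_
    rw [Finset.sum_mul_sum]
    refine Finset.sum_congr rfl fun j _ => Finset.sum_congr rfl fun k _ => ?_
    by_cases e1 : word n i = 1 <;> by_cases e2 : word n j = 1 <;> by_cases e3 : word n k = 1 <;>
      simp [e1, e2, e3]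
  rw [Finset.sum_congr rfl fun n _ => h2 n, Finset.sum_comm]
  have h3 : ∀ i j k : ProjLine23,
      (∑ n ∈ l, if word n i = 1 ∧ word n j = 1 ∧ word n k = 1 then f i * g j * h k else 0) =
        21 * (f i * g j * h k) + (56 * (if i = j then f i * g j * h k else 0) +
          56 * (if j = k then f i * g j * h k else 0) +
          56 * (if i = k then f i * g j * h k else 0)) +
        64 * (if i = j then (if j = k then f i * g j * h k else 0) else 0) := by
    intro i j k
    rw [← Finset.sum_filter, Finset.sum_const, nsmul_eq_mul]
    have := congrArg (Int.cast : ℤ → ℝ) (hcount i j k)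
    rw [Int.cast_natCast] at this
    rw [this]
    push_cast
    by_cases e1 : i = j
    · subst e1
      by_cases e2 : i = k
      · subst e2
        simp only [if_true, and_self]
        ring
      · simp only [e2, if_true, if_false, and_false]
        ring
    · by_cases e2 : j = k
      · subst e2
        simp only [e1, if_true, if_false, false_and]
        ring
      · by_cases e3 : i = k
        · subst e3
          simp only [e1, e2, if_true, if_false, false_and]
          ring
        · simp only [e1, e2, e3, if_false, false_and]
          ring
  have h4 : ∀ i : ProjLine23, (∑ n ∈ l, ∑ j, ∑ k,
      if word n i = 1 ∧ word n j = 1 ∧ word n k = 1 then f i * g j * h k else 0) =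
      ∑ j, ∑ k, (21 * (f i * g j * h k) + (56 * (if i = j then f i * g j * h k else 0) +
          56 * (if j = k then f i * g j * h k else 0) +
          56 * (if i = k then f i * g j * h k else 0)) +
        64 * (if i = j then (if j = k then f i * g j * h k else 0) else 0)) := by
    intro i
    rw [Finset.sum_comm]
    refine Finset.sum_congr rfl fun j _ => ?_
    rw [Finset.sum_comm]
    exact Finset.sum_congr rfl fun k _ => h3 i j k
  rw [Finset.sum_congr rfl fun i _ => h4 i]
  simp only [Finset.sum_add_distrib, ← Finset.mul_sum]
  have k1 : ∑ i, ∑ j, f i * g j * ∑ k, h k = (∑ i, f i) * (∑ i, g i) * (∑ i, h i) := by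
    rw [Finset.sum_mul_sum, Finset.sum_mul]
    exact Finset.sum_congr rfl fun i _ => by rw [Finset.sum_mul]
  have k2 : (∑ i, ∑ j, ∑ k, if i = j then f i * g j * h k else 0) =
      (∑ i, f i * g i) * (∑ i, h i) := by
    rw [Finset.sum_mul_sum]
    refine Finset.sum_congr rfl fun i _ => ?_
    rw [Finset.sum_comm]
    exact Finset.sum_congr rfl fun k _ => by
      rw [Finset.sum_ite_eq Finset.univ i, if_pos (Finset.mem_univ i)]
  have k3 : (∑ i, ∑ j, ∑ k, if j = k then f i * g j * h k else 0) =
      (∑ i, f i) * (∑ i, g i * h i) := by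
    rw [Finset.sum_mul_sum]
    refine Finset.sum_congr rfl fun i _ => Finset.sum_congr rfl fun j _ => ?_
    rw [Finset.sum_ite_eq Finset.univ j, if_pos (Finset.mem_univ j), mul_assoc]
  have k4 : (∑ i, ∑ j, ∑ k, if i = k then f i * g j * h k else 0) =
      (∑ i, f i * h i) * (∑ i, g i) := by
    rw [Finset.sum_mul_sum]
    refine Finset.sum_congr rfl fun i _ => Finset.sum_congr rfl fun j _ => ?_
    rw [Finset.sum_ite_eq Finset.univ i, if_pos (Finset.mem_univ i)]
    ring
  have k5 : (∑ i, ∑ j, ∑ k, if i = j then (if j = k then f i * g j * h k else 0) else 0) =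
      ∑ i, f i * g i * h i := by
    refine Finset.sum_congr rfl fun i _ => ?_
    rw [Finset.sum_comm, Finset.sum_congr rfl fun k _ => Finset.sum_ite_eq Finset.univ i _]
    simp only [Finset.mem_univ, if_true]
    rw [Finset.sum_ite_eq Finset.univ i, if_pos (Finset.mem_univ i)]
  rw [k1, k2, k3, k4, k5]
  ring

theorem card_octad {n : ℕ} (hn : n ∈ octadMasks.toFinset) : (wordSupport (word n)).card = 8 := by
  rw [List.mem_toFinset, mem_octadMasks_iff] at hn
  exact hn.2

theorem sum_octads_mul (f g : ProjLine23 → ℝ) :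
    ∑ n ∈ octadMasks.toFinset, (∑ i ∈ wordSupport (word n), f i) *
        (∑ i ∈ wordSupport (word n), g i) =
      77 * ((∑ i, f i) * (∑ i, g i)) + 176 * ∑ i, f i * g i := by
  have h := sum_octads_mul_mul f g fun _ => 1
  rw [Finset.sum_congr rfl fun n hn => by
    rw [Finset.sum_const, card_octad hn, nsmul_eq_mul], ← Finset.sum_mul] at h
  simp only [mul_one, Finset.sum_const, Finset.card_univ, nsmul_eq_mul,
    show (Fintype.card ProjLine23 : ℝ) = 24 by
      rw [show Fintype.card ProjLine23 = 24 from rfl]; norm_num] at h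
  push_cast at h
  linarith

theorem sum_octads (f : ProjLine23 → ℝ) :
    ∑ n ∈ octadMasks.toFinset, (∑ i ∈ wordSupport (word n), f i) = 253 * ∑ i, f i := by
  have h := sum_octads_mul f fun _ => 1
  rw [Finset.sum_congr rfl fun n hn => by
    rw [Finset.sum_const, card_octad hn, nsmul_eq_mul], ← Finset.sum_mul] at h
  simp only [mul_one, Finset.sum_const, Finset.card_univ, nsmul_eq_mul,
    show (Fintype.card ProjLine23 : ℝ) = 24 by
      rw [show Fintype.card ProjLine23 = 24 from rfl]; norm_num] at h
  push_cast at h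
  linarith

theorem sum_octadVector_pow_six (v : ProjLine23 → ℝ) :
    ∑ p ∈ octadIndices, (∑ k, (octadVector p k : ℝ) * v k) ^ 6 =
      8192 * (315 * (∑ k, v k ^ 2) ^ 3 + 210 * (∑ k, v k ^ 2) * (∑ k, v k ^ 4) -
        272 * ∑ k, v k ^ 6) := by
  rw [octadIndices, Finset.sum_sigma]
  have h1 : ∀ n ∈ octadMasks.toFinset, (∑ c ∈ evenSigns (wordSupport (word n)),
      (∑ k, (octadVector ⟨n, c⟩ k : ℝ) * v k) ^ 6) =
      8192 * (15 * ((∑ j ∈ wordSupport (word n), v j ^ 2) * (∑ j ∈ wordSupport (word n), v j ^ 2) *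
        (∑ j ∈ wordSupport (word n), v j ^ 2)) -
          30 * ((∑ j ∈ wordSupport (word n), v j ^ 2) * (∑ j ∈ wordSupport (word n), v j ^ 4)) +
          16 * ∑ j ∈ wordSupport (word n), v j ^ 6) := by
    intro n hn
    have h8 := card_octad hn
    have h3 := (balancedSigns_evenSigns (O := wordSupport (word n)) (by omega)).sum_pow_six v
    rw [card_evenSigns h8] at h3
    have h4 : ∀ c : ProjLine23 → ZMod 2, (∑ k, (octadVector ⟨n, c⟩ k : ℝ) * v k) ^ 6 =
        64 * (∑ j ∈ wordSupport (word n), (signChar (c j) : ℝ) * v j) ^ 6 := by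
      intro c
      have : ∑ k, (octadVector ⟨n, c⟩ k : ℝ) * v k =
          2 * ∑ j ∈ wordSupport (word n), (signChar (c j) : ℝ) * v j := by
        rw [wordSupport, Finset.sum_filter, Finset.mul_sum]
        refine Finset.sum_congr rfl fun k _ => ?_
        simp only [octadVector]
        split_ifs
        · push_cast; ring
        · simp
      rw [this]
      ring
    rw [Finset.sum_congr rfl fun c _ => h4 c, ← Finset.mul_sum, h3]
    push_cast
    ring
  rw [Finset.sum_congr rfl h1, ← Finset.mul_sum, Finset.sum_add_distrib, Finset.sum_sub_distrib,
    ← Finset.mul_sum, ← Finset.mul_sum, ← Finset.mul_sum, sum_octads_mul_mul, sum_octads_mul,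
    sum_octads, Finset.sum_congr rfl fun k _ => show v k ^ 2 * v k ^ 2 * v k ^ 2 = v k ^ 6 by ring,
    Finset.sum_congr rfl fun k _ => show v k ^ 2 * v k ^ 2 = v k ^ 4 by ring,
    Finset.sum_congr rfl fun k _ => show v k ^ 2 * v k ^ 4 = v k ^ 6 by ring]
  ring

theorem sum_lt_index_of_symmetric (F : ProjLine23 → ProjLine23 → ℝ) (hF : ∀ i j, F i j = F j i) :
    2 * ∑ p ∈ (Finset.univ : Finset (ProjLine23 × ProjLine23)).filter
      (fun p => p.1.index < p.2.index), F p.1 p.2 = ∑ i, ∑ j, F i j - ∑ i, F i i := by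
  have h1 : ∑ i, ∑ j, F i j = ∑ i, ∑ j, ((if i.index < j.index then F i j else 0) +
      (if j.index < i.index then F i j else 0) + if i = j then F i j else 0) := by
    refine Finset.sum_congr rfl fun i _ => Finset.sum_congr rfl fun j _ => ?_
    rcases lt_trichotomy i.index j.index with h | h | h
    · have : i ≠ j := by rintro rfl; exact lt_irrefl _ h
      simp [h, h.not_gt, this]
    · have := index_injective h
      simp [this]
    · have : i ≠ j := by rintro rfl; exact lt_irrefl _ h
      simp [h, h.not_gt, this]
  simp only [Finset.sum_add_distrib] at h1
  have h2 : (∑ i, ∑ j, if j.index < i.index then F i j else 0) =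
      ∑ i : ProjLine23, ∑ j : ProjLine23, if i.index < j.index then F i j else 0 := by
    rw [Finset.sum_comm]
    exact Finset.sum_congr rfl fun i _ => Finset.sum_congr rfl fun j _ => by rw [hF]
  have h3 : (∑ i, ∑ j, if i = j then F i j else 0) = ∑ i, F i i :=
    Finset.sum_congr rfl fun i _ => by
      rw [Finset.sum_ite_eq Finset.univ i, if_pos (Finset.mem_univ i)]
  rw [h1, h2, h3, Finset.sum_filter, Fintype.sum_prod_type]
  ring

theorem sum_zmod_two (F : ZMod 2 → ℝ) : ∑ a, F a = F 0 + F 1 := Fin.sum_univ_two F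

theorem sum_pairVector_pow_six (v : ProjLine23 → ℝ) :
    ∑ p ∈ pairIndices, (∑ k, (pairVector p k : ℝ) * v k) ^ 6 =
      16384 * (15 * (∑ k, v k ^ 2) * (∑ k, v k ^ 4) + 8 * ∑ k, v k ^ 6) := by
  rw [pairIndices, Finset.sum_product]
  have h1 : ∀ p ∈ (Finset.univ : Finset (ProjLine23 × ProjLine23)).filter
      (fun p => p.1.index < p.2.index),
      ∑ q : ZMod 2 × ZMod 2, (∑ k, (pairVector (p, q) k : ℝ) * v k) ^ 6 =
      16384 * (v p.1 ^ 6 + 15 * (v p.1 ^ 2 * v p.2 ^ 4) + 15 * (v p.1 ^ 4 * v p.2 ^ 2) +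
        v p.2 ^ 6) := by
    rintro ⟨i, j⟩ hp
    have hij : i.index < j.index := (Finset.mem_filter.1 hp).2
    have hne : j ≠ i := by rintro rfl; exact lt_irrefl _ hij
    have h2 : ∀ a b : ZMod 2, ∑ k, (pairVector ((i, j), a, b) k : ℝ) * v k =
        4 * (signChar a : ℝ) * v i + 4 * (signChar b : ℝ) * v j := by
      intro a b
      have : ∀ k, (pairVector ((i, j), a, b) k : ℝ) * v k =
          (if k = i then 4 * (signChar a : ℝ) * v i else 0) +
          (if k = j then 4 * (signChar b : ℝ) * v j else 0) := by
        intro k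
        simp only [pairVector]
        by_cases e1 : k = i
        · subst e1
          simp [hne.symm]
        · by_cases e2 : k = j
          · subst e2
            simp [hne]
          · simp [e1, e2]
      rw [Finset.sum_congr rfl fun k _ => this k, Finset.sum_add_distrib,
        Finset.sum_ite_eq' Finset.univ i, Finset.sum_ite_eq' Finset.univ j,
        if_pos (Finset.mem_univ i), if_pos (Finset.mem_univ j)]
    rw [Fintype.sum_prod_type, sum_zmod_two, sum_zmod_two, sum_zmod_two, h2, h2, h2, h2,
      show signChar 0 = 1 from rfl, show signChar 1 = -1 from rfl]
    push_cast
    ring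
  rw [Finset.sum_congr rfl h1, ← Finset.mul_sum]
  have h3 := sum_lt_index_of_symmetric (fun i j => v i ^ 6 + 15 * (v i ^ 2 * v j ^ 4) +
    15 * (v i ^ 4 * v j ^ 2) + v j ^ 6) fun i j => by ring
  have h4 : ∑ i, ∑ j, (v i ^ 6 + 15 * (v i ^ 2 * v j ^ 4) + 15 * (v i ^ 4 * v j ^ 2) + v j ^ 6) =
      48 * ∑ k, v k ^ 6 + 30 * (∑ k, v k ^ 2) * (∑ k, v k ^ 4) := by
    simp only [Finset.sum_add_distrib, ← Finset.mul_sum, ← Finset.sum_mul, Finset.sum_const,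
      Finset.card_univ, nsmul_eq_mul, show (Fintype.card ProjLine23 : ℝ) = 24 by
      rw [show Fintype.card ProjLine23 = 24 from rfl]; norm_num]
    ring
  have h5 : ∑ i, (v i ^ 6 + 15 * (v i ^ 2 * v i ^ 4) + 15 * (v i ^ 4 * v i ^ 2) + v i ^ 6) =
      32 * ∑ k, v k ^ 6 := by
    rw [Finset.mul_sum]
    exact Finset.sum_congr rfl fun k _ => by ring
  rw [h4, h5] at h3
  linarith

theorem disjoint_image_pairVector :
    Disjoint (pairIndices.image pairVector)
      (octadIndices.image octadVector ∪ (golayFinset ×ˢ Finset.univ).image oddVector) := by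
  rw [Finset.disjoint_left]
  intro z hz hz'
  obtain ⟨⟨⟨i, j⟩, a, b⟩, hp, rfl⟩ := Finset.mem_image.1 hz
  have h1 := signChar_eq a
  rcases Finset.mem_union.1 hz' with h | h <;> obtain ⟨⟨n, c⟩, hp', h⟩ := Finset.mem_image.1 h
  · have h2 := congrFun h i
    have h3 := signChar_eq (c i)
    simp only [octadVector, pairVector, if_true] at h2
    split_ifs at h2 <;> omega
  · have h2 := congrFun h i
    have h3 := signChar_eq (n i)
    simp only [oddVector, pairVector, if_true] at h2
    split_ifs at h2 <;> omega

theorem disjoint_image_octadVector :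
    Disjoint (octadIndices.image octadVector)
      ((golayFinset ×ˢ Finset.univ).image oddVector) := by
  rw [Finset.disjoint_left]
  intro z hz hz'
  obtain ⟨⟨n, c⟩, hp, rfl⟩ := Finset.mem_image.1 hz
  obtain ⟨⟨d, j⟩, hp', h⟩ := Finset.mem_image.1 hz'
  have h2 := congrFun h j
  have h3 := signChar_eq (c j)
  have h4 := signChar_eq (d j)
  simp only [oddVector, octadVector, if_true] at h2
  split_ifs at h2 <;> omega

/-- Among the three shapes the contributions of the products of second and fourth power sums and of
the sixth power sums cancel; only the rotation-invariant term survives. This is the degree six part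
of the spherical design property. -/
theorem sum_minimalCoords_pow_six (v : ProjLine23 → ℝ) :
    ∑ z ∈ minimalCoords, (∑ k, (z k : ℝ) * v k) ^ 6 = 5529600 * (∑ k, v k ^ 2) ^ 3 := by
  rw [minimalCoords, Finset.sum_union disjoint_image_pairVector,
    Finset.sum_union disjoint_image_octadVector, Finset.sum_image pairVector_injOn,
    Finset.sum_image octadVector_injOn, Finset.sum_image oddVector_injective.injOn,
    sum_pairVector_pow_six, sum_octadVector_pow_six, sum_oddVector_pow_six]
  ring

/-- The minimal vectors of the Leech lattice. -/
noncomputable def minimalVectors : Finset (EuclideanSpace ℝ ProjLine23) :=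
  minimalCoords.image scaledVector

theorem scaledVector_injective : Function.Injective scaledVector := by
  intro z w h
  funext k
  have h1 := congrArg (fun v : EuclideanSpace ℝ ProjLine23 => v k) h
  simp only [scaledVector_apply] at h1
  have h8 : (√8 : ℝ) ≠ 0 := by positivity
  exact_mod_cast (div_left_inj' h8).1 h1

theorem mem_minimalVectors (x : EuclideanSpace ℝ ProjLine23) :
    x ∈ minimalVectors ↔ x ∈ leechLattice ∧ inner ℝ x x = 4 := by
  rw [minimalVectors, Finset.mem_image, mem_leechLattice_iff]
  constructor
  · rintro ⟨z, hz, rfl⟩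
    obtain ⟨h1, h2⟩ := (mem_minimalCoords_iff z).1 hz
    refine ⟨⟨z, h1, rfl⟩, ?_⟩
    rw [inner_scaledVector, h2]
    norm_num
  · rintro ⟨⟨z, hz, rfl⟩, h⟩
    refine ⟨z, (mem_minimalCoords_iff z).2 ⟨hz, ?_⟩, rfl⟩
    rw [inner_scaledVector] at h
    have : ((∑ i, z i * z i : ℤ) : ℝ) = 32 := by linarith
    exact_mod_cast this

theorem sum_minimalVectors_pow_six (v : EuclideanSpace ℝ ProjLine23) :
    ∑ x ∈ minimalVectors, (inner ℝ x v) ^ 6 = 10800 * (inner ℝ v v) ^ 3 := by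
  rw [minimalVectors, Finset.sum_image scaledVector_injective.injOn,
    Finset.sum_congr rfl fun z _ => by rw [inner_scaledVector_left, div_pow], ← Finset.sum_div,
    sum_minimalCoords_pow_six]
  have h : (√8 : ℝ) ^ 6 = 512 := by
    rw [show (√8 : ℝ) ^ 6 = (√8 * √8) ^ 3 by ring, sqrt_eight_mul_self]
    norm_num
  have h1 : inner ℝ v v = ∑ k, v k ^ 2 := by
    rw [PiLp.inner_apply]
    exact Finset.sum_congr rfl fun k _ => by simp [sq]
  rw [h, h1]
  ring

/-! ### Polarization of the sixth moment -/

section Moments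

variable {V : Type*} [NormedAddCommGroup V] [InnerProductSpace ℝ V]

/-- The sixth powers of the combinations of a, b, c with coefficients 0 and ±1 isolate the monomial
a²b²c². The right side is the sum over the 15 pairings of a, a, b, b, c, c, counted as 1 + 6 + 8. -/
theorem sum_sq_mul_sq_mul_sq {X : Finset V} {C : ℝ}
    (hX : ∀ v, ∑ x ∈ X, (inner ℝ x v) ^ 6 = C * (inner ℝ v v) ^ 3) (a b c : V) :
    15 * ∑ x ∈ X, (inner ℝ x a) ^ 2 * (inner ℝ x b) ^ 2 * (inner ℝ x c) ^ 2 =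
      C * (inner ℝ a a * inner ℝ b b * inner ℝ c c + 2 * (inner ℝ a a * (inner ℝ b c) ^ 2 +
        inner ℝ b b * (inner ℝ a c) ^ 2 + inner ℝ c c * (inner ℝ a b) ^ 2) +
        8 * (inner ℝ a b * inner ℝ b c * inner ℝ a c)) := by
  have h1 : ∀ x : V, 360 * ((inner ℝ x a) ^ 2 * (inner ℝ x b) ^ 2 * (inner ℝ x c) ^ 2) =
      (inner ℝ x (a + b + c)) ^ 6 + (inner ℝ x (a + b - c)) ^ 6 + (inner ℝ x (a - b + c)) ^ 6 +
        (inner ℝ x (a - b - c)) ^ 6 + (-2) * (inner ℝ x (a + b)) ^ 6 +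
        (-2) * (inner ℝ x (a - b)) ^ 6 + (-2) * (inner ℝ x (b + c)) ^ 6 +
        (-2) * (inner ℝ x (b - c)) ^ 6 + (-2) * (inner ℝ x (a + c)) ^ 6 +
        (-2) * (inner ℝ x (a - c)) ^ 6 + 4 * (inner ℝ x a) ^ 6 + 4 * (inner ℝ x b) ^ 6 +
        4 * (inner ℝ x c) ^ 6 := by
    intro x
    simp only [inner_add_right, inner_sub_right]
    ring
  have h2 := Finset.sum_congr rfl fun x (_ : x ∈ X) => h1 x
  simp only [Finset.sum_add_distrib, ← Finset.mul_sum, hX] at h2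
  simp only [inner_add_right, inner_sub_right, inner_add_left, inner_sub_left,
    real_inner_comm a b, real_inner_comm a c, real_inner_comm b c] at h2
  linarith

/-- In orthonormal bases of the two subspaces, products of squared norms become sums of the
polarized moments. These depend only on Gram matrices, which do not change when the two bases of
equal length are exchanged. -/
theorem sum_norm_starProjection_cube_eq [FiniteDimensional ℝ V] {X : Finset V} {C : ℝ}
    (hX : ∀ v, ∑ x ∈ X, (inner ℝ x v) ^ 6 = C * (inner ℝ v v) ^ 3) (J : Submodule ℝ V)
    (hJ : Module.finrank ℝ J = Module.finrank ℝ Jᗮ) :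
    ∑ x ∈ X, ((‖J.starProjection x‖ ^ 2) ^ 3 - (‖Jᗮ.starProjection x‖ ^ 2) ^ 3) = 0 ∧
    ∑ x ∈ X, ((‖J.starProjection x‖ ^ 2) ^ 2 * ‖Jᗮ.starProjection x‖ ^ 2 -
      ‖J.starProjection x‖ ^ 2 * (‖Jᗮ.starProjection x‖ ^ 2) ^ 2) = 0 := by
  let e := stdOrthonormalBasis ℝ J
  let f := (stdOrthonormalBasis ℝ Jᗮ).reindex (finCongr hJ.symm)
  have hnorm : ∀ (K : Submodule ℝ V) (b : OrthonormalBasis (Fin (Module.finrank ℝ J)) ℝ K) (x : V),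
      ‖K.starProjection x‖ ^ 2 = ∑ i, (inner ℝ x (b i : V)) ^ 2 := by
    intro K b x
    rw [Submodule.starProjection_apply, ← Submodule.coe_norm, ← b.sum_sq_norm_inner_right]
    refine Finset.sum_congr rfl fun i _ => ?_
    rw [Real.norm_eq_abs, sq_abs, Submodule.coe_inner, ← Submodule.starProjection_apply,
      real_inner_comm, Submodule.inner_starProjection_left_eq_right,
      Submodule.starProjection_eq_self_iff.2 (b i).2]
  have hee : ∀ i j, inner ℝ (e i : V) (e j : V) = if i = j then (1 : ℝ) else 0 := fun i j =>
    orthonormal_iff_ite.1 e.orthonormal i j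
  have hff : ∀ i j, inner ℝ (f i : V) (f j : V) = if i = j then (1 : ℝ) else 0 := fun i j =>
    orthonormal_iff_ite.1 f.orthonormal i j
  have hef : ∀ i j, inner ℝ (e i : V) (f j : V) = 0 := fun i j =>
    Submodule.inner_right_of_mem_orthogonal (e i).2 (f j).2
  have hfe : ∀ i j, inner ℝ (f i : V) (e j : V) = 0 := fun i j => by
    rw [real_inner_comm, hef]
  have hT : ∀ (b c d : Fin (Module.finrank ℝ J) → V), ∑ x ∈ X, (∑ i, (inner ℝ x (b i)) ^ 2) *
      (∑ i, (inner ℝ x (c i)) ^ 2) * (∑ i, (inner ℝ x (d i)) ^ 2) =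
      ∑ i, ∑ j, ∑ k, ∑ x ∈ X, (inner ℝ x (b i)) ^ 2 * (inner ℝ x (c j)) ^ 2 *
        (inner ℝ x (d k)) ^ 2 := by
    intro b c d
    rw [Finset.sum_congr rfl fun i _ => Finset.sum_congr rfl fun j _ => Finset.sum_comm,
      Finset.sum_congr rfl fun i _ => Finset.sum_comm, Finset.sum_comm]
    refine Finset.sum_congr rfl fun x _ => ?_
    rw [Finset.sum_mul_sum, Finset.sum_mul]
    exact Finset.sum_congr rfl fun i _ => by rw [Finset.sum_mul_sum]
  constructor
  · rw [Finset.sum_sub_distrib, sub_eq_zero]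
    simp only [hnorm J e, hnorm Jᗮ f, pow_succ _ 2, sq (∑ i, (inner ℝ _ _) ^ 2)]
    rw [hT, hT]
    refine Finset.sum_congr rfl fun i _ => Finset.sum_congr rfl fun j _ =>
      Finset.sum_congr rfl fun k _ => ?_
    have h1 := sum_sq_mul_sq_mul_sq hX (e i : V) (e j) (e k)
    have h2 := sum_sq_mul_sq_mul_sq hX (f i : V) (f j) (f k)
    simp only [hee, hff] at h1 h2
    linarith
  · rw [Finset.sum_sub_distrib, sub_eq_zero]
    have h3 : ∀ x, ‖J.starProjection x‖ ^ 2 * (‖Jᗮ.starProjection x‖ ^ 2) ^ 2 =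
      (‖Jᗮ.starProjection x‖ ^ 2) ^ 2 * ‖J.starProjection x‖ ^ 2 := fun x => mul_comm _ _
    rw [Finset.sum_congr rfl fun x _ => h3 x]
    simp only [hnorm J e, hnorm Jᗮ f, sq (∑ i, (inner ℝ _ _) ^ 2)]
    rw [hT, hT]
    refine Finset.sum_congr rfl fun i _ => Finset.sum_congr rfl fun j _ =>
      Finset.sum_congr rfl fun k _ => ?_
    have h1 := sum_sq_mul_sq_mul_sq hX (e i : V) (e j) (f k)
    have h2 := sum_sq_mul_sq_mul_sq hX (f i : V) (f j) (e k)
    simp only [hee, hff, hef, hfe] at h1 h2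
    linarith

end Moments

/-- If the norms of the projections of the minimal vectors to a `12`-dimensional subspace are
`0`, `4/3`, `2`, `8/3` or `4`, then it contains as many of them as its orthogonal complement. -/
theorem card_minimalVectors_eq (J : Submodule ℝ (EuclideanSpace ℝ ProjLine23))
    (hJ : Module.finrank ℝ J = 12)
    (h : ∀ x ∈ minimalVectors, ‖J.starProjection x‖ ^ 2 = 0 ∨ ‖J.starProjection x‖ ^ 2 = 4 / 3 ∨
      ‖J.starProjection x‖ ^ 2 = 2 ∨ ‖J.starProjection x‖ ^ 2 = 8 / 3 ∨
      ‖J.starProjection x‖ ^ 2 = 4) :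
    Nat.card {x // x ∈ minimalVectors ∧ x ∈ J} = Nat.card {x // x ∈ minimalVectors ∧ x ∈ Jᗮ} := by
  classical
  have h24 : Module.finrank ℝ (EuclideanSpace ℝ ProjLine23) = 24 := by
    rw [finrank_euclideanSpace]
    rfl
  have hJ' : Module.finrank ℝ J = Module.finrank ℝ Jᗮ := by
    have := J.finrank_add_finrank_orthogonal
    omega
  obtain ⟨h1, h2⟩ := sum_norm_starProjection_cube_eq sum_minimalVectors_pow_six J hJ'
  have hsum : ∀ x ∈ minimalVectors,
      ‖J.starProjection x‖ ^ 2 + ‖Jᗮ.starProjection x‖ ^ 2 = 4 := by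
    intro x hx
    have h3 := Submodule.norm_sq_eq_add_norm_sq_starProjection x J
    rw [← h3, ← real_inner_self_eq_norm_sq, ((mem_minimalVectors x).1 hx).2]
  have h0 : ∀ (K : Submodule ℝ (EuclideanSpace ℝ ProjLine23)) x,
      x ∈ Kᗮ ↔ ‖K.starProjection x‖ ^ 2 = 0 := by
    intro K x
    rw [sq_eq_zero_iff, norm_eq_zero, Submodule.starProjection_apply_eq_zero_iff]
  have h3 : ∑ x ∈ minimalVectors, ((if x ∈ J then (1 : ℝ) else 0) - if x ∈ Jᗮ then 1 else 0) = 0 := by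
    -- With a and b the squared norms of the two components, the cubic 2(a³ - b³) - 7(a²b - ab²) is
    -- (a - b)(2a - b)(a - 2b). On a + b = 4 it vanishes at a = 4/3, 2, 8/3 and equals ±128 at a = 4
    -- and a = 0.
    have : ∀ x ∈ minimalVectors, ((if x ∈ J then (1 : ℝ) else 0) - if x ∈ Jᗮ then 1 else 0) =
        1 / 128 * (2 * ((‖J.starProjection x‖ ^ 2) ^ 3 - (‖Jᗮ.starProjection x‖ ^ 2) ^ 3) -
          7 * ((‖J.starProjection x‖ ^ 2) ^ 2 * ‖Jᗮ.starProjection x‖ ^ 2 -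
            ‖J.starProjection x‖ ^ 2 * (‖Jᗮ.starProjection x‖ ^ 2) ^ 2)) := by
      intro x hx
      have hJx := h0 Jᗮ x
      rw [Submodule.orthogonal_orthogonal] at hJx
      rw [if_congr hJx rfl rfl, if_congr (h0 J x) rfl rfl]
      have h4 : ‖Jᗮ.starProjection x‖ ^ 2 = 4 - ‖J.starProjection x‖ ^ 2 := by
        linarith [hsum x hx]
      rw [h4]
      rcases h x hx with h5 | h5 | h5 | h5 | h5 <;> rw [h5] <;> norm_num
    rw [Finset.sum_congr rfl this, ← Finset.mul_sum, Finset.sum_sub_distrib, ← Finset.mul_sum,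
      ← Finset.mul_sum, h1, h2]
    norm_num
  rw [Finset.sum_sub_distrib, Finset.sum_boole, Finset.sum_boole, sub_eq_zero] at h3
  have h4 : ∀ K : Submodule ℝ (EuclideanSpace ℝ ProjLine23),
      Nat.card {x // x ∈ minimalVectors ∧ x ∈ K} = (minimalVectors.filter (· ∈ K)).card := by
    intro K
    exact Nat.subtype_card _ fun x => Finset.mem_filter
  rw [h4, h4]
  exact_mod_cast h3

/-! ### Extension of functionals -/

/-- Saturation makes the quotient torsion-free, hence free, so S is a direct summand and the
functional can be composed with a projection onto it. -/
theorem exists_extension_int {L : Type*} [AddCommGroup L] [Module.Finite ℤ L] (S : Submodule ℤ L)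
    (hS : ∀ (n : ℤ) (x : L), n ≠ 0 → n • x ∈ S → x ∈ S) (φ : S →ₗ[ℤ] ℤ) :
    ∃ ψ : L →ₗ[ℤ] ℤ, ∀ x : S, ψ x = φ x := by
  have : Module.IsTorsionFree ℤ (L ⧸ S) := by
    refine ⟨fun n hn x y hxy => ?_⟩
    obtain ⟨x, rfl⟩ := S.mkQ_surjective x
    obtain ⟨y, rfl⟩ := S.mkQ_surjective y
    have h1 : n • (x - y) ∈ S := by
      rw [← Submodule.ker_mkQ S, LinearMap.mem_ker, map_smul, map_sub, smul_sub]
      exact sub_eq_zero.2 hxy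
    have h2 := hS n _ hn.ne_zero h1
    rw [← Submodule.ker_mkQ S, LinearMap.mem_ker, map_sub] at h2
    exact sub_eq_zero.1 h2
  obtain ⟨s, hs⟩ := S.mkQ.exists_rightInverse_of_surjective
    (LinearMap.range_eq_top.2 S.mkQ_surjective)
  have hmem : ∀ x, (LinearMap.id - s ∘ₗ S.mkQ : L →ₗ[ℤ] L) x ∈ S := by
    intro x
    refine (Submodule.Quotient.mk_eq_zero S).1 ?_
    change S.mkQ _ = 0
    rw [LinearMap.sub_apply, map_sub]
    exact sub_eq_zero.2 (LinearMap.congr_fun hs (S.mkQ x)).symm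
  refine ⟨φ ∘ₗ (LinearMap.id - s ∘ₗ S.mkQ : L →ₗ[ℤ] L).codRestrict S hmem, fun x => ?_⟩
  rw [LinearMap.comp_apply]
  congr 1
  ext
  rw [LinearMap.codRestrict_apply, LinearMap.sub_apply, LinearMap.comp_apply,
    show S.mkQ x = 0 from (Submodule.Quotient.mk_eq_zero S).2 x.2, map_zero, sub_zero]
  rfl

theorem scaledVector_add (z w : ProjLine23 → ℤ) :
    scaledVector (z + w) = scaledVector z + scaledVector w := by
  ext i
  rw [PiLp.add_apply, scaledVector_apply, scaledVector_apply, scaledVector_apply, Pi.add_apply]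
  push_cast
  ring

instance : Module.Finite ℤ leechLattice := by
  let f : (ProjLine23 → ℤ) →ₗ[ℤ] EuclideanSpace ℝ ProjLine23 :=
    (AddMonoidHom.mk' scaledVector scaledVector_add).toIntLinearMap
  have h : leechLattice ≤ LinearMap.range f := by
    intro v hv
    obtain ⟨z, -, rfl⟩ := (mem_leechLattice_iff v).1 hv
    exact ⟨z, rfl⟩
  exact Module.Finite.of_injective (Submodule.inclusion h) (Submodule.inclusion_injective h)

/-- A vector with integral inner products with `Λ ∩ U` agrees on it with a vector of `Λ`. -/
theorem exists_leech_inner_eq (U : Submodule ℝ (EuclideanSpace ℝ ProjLine23))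
    (u : EuclideanSpace ℝ ProjLine23)
    (hu : ∀ x ∈ leechLattice, x ∈ U → ∃ n : ℤ, inner ℝ x u = n) :
    ∃ y ∈ leechLattice, ∀ x ∈ leechLattice, x ∈ U → inner ℝ x y = inner ℝ x u := by
  let S : Submodule ℤ leechLattice := (U.restrictScalars ℤ).comap leechLattice.subtype
  have hS : ∀ (n : ℤ) (x : leechLattice), n ≠ 0 → n • x ∈ S → x ∈ S := by
    intro n x hn hx
    have h1 : (n : ℝ) • (x : EuclideanSpace ℝ ProjLine23) ∈ U := by
      rw [Int.cast_smul_eq_zsmul]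
      exact hx
    have h2 := U.smul_mem ((n : ℝ)⁻¹) h1
    rwa [smul_smul, inv_mul_cancel₀ (Int.cast_ne_zero.2 hn), one_smul] at h2
  choose! m hm using hu
  let φ : S →ₗ[ℤ] ℤ := AddMonoidHom.toIntLinearMap
    { toFun := fun x => m (x : leechLattice)
      map_zero' := by
        have := hm 0 leechLattice.zero_mem U.zero_mem
        rw [inner_zero_left] at this
        exact_mod_cast this.symm
      map_add' := by
        intro x y
        have h1 := hm _ (x : leechLattice).2 x.2
        have h2 := hm _ (y : leechLattice).2 y.2
        have h3 := hm _ ((x : leechLattice) + (y : leechLattice)).2 (x + y).2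
        rw [Submodule.coe_add, inner_add_left, h1, h2] at h3
        exact_mod_cast h3.symm }
  obtain ⟨ψ, hψ⟩ := exists_extension_int S hS φ
  obtain ⟨y, hy, h⟩ := leech_functional ψ
  refine ⟨y, hy, fun x hx hxU => ?_⟩
  rw [h ⟨x, hx⟩, hψ ⟨⟨x, hx⟩, hxU⟩, hm x hx hxU]
  rfl

/-! ### Two involutions generating a dihedral group of order six -/

/-- The involutions of a dihedral group of order six are reflections, and a product of two of them
is a rotation, so its cube is trivial. -/
theorem mul_pow_three_of_closure_dihedral {G : Type*} [Group G] {s t : G} (hs : s * s = 1)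
    (ht : t * t = 1) (hs1 : s ≠ 1) (ht1 : t ≠ 1)
    (e : Subgroup.closure {s, t} ≃* DihedralGroup 3) : (s * t) * (s * t) * (s * t) = 1 := by
  have hsm : s ∈ Subgroup.closure {s, t} := Subgroup.subset_closure (by simp)
  have htm : t ∈ Subgroup.closure {s, t} := Subgroup.subset_closure (by simp)
  have key : ∀ a b : DihedralGroup 3, a * a = 1 → b * b = 1 → a ≠ 1 → b ≠ 1 →
      (a * b) * (a * b) * (a * b) = 1 := by decide
  have h := key (e ⟨s, hsm⟩) (e ⟨t, htm⟩)
    (by rw [← map_mul, ← map_one e]; congr 1; exact Subtype.ext hs)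
    (by rw [← map_mul, ← map_one e]; congr 1; exact Subtype.ext ht)
    (fun h => hs1 (congrArg Subtype.val (e.injective (h.trans (map_one e).symm))))
    (fun h => ht1 (congrArg Subtype.val (e.injective (h.trans (map_one e).symm))))
  rw [← map_mul, ← map_mul, ← map_mul, ← map_one e] at h
  exact congrArg Subtype.val (e.injective h)

/-! ### Lattices of type `√2 E₈` -/

/-- The inverse of the Cartan matrix of type `E₈`. -/
def cartanInvE8 : Matrix (Fin 8) (Fin 8) ℤ :=
  !![4, 5, 7, 10, 8, 6, 4, 2;
    5, 8, 10, 15, 12, 9, 6, 3;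
    7, 10, 14, 20, 16, 12, 8, 4;
    10, 15, 20, 30, 24, 18, 12, 6;
    8, 12, 16, 24, 20, 15, 10, 5;
    6, 9, 12, 18, 15, 12, 8, 4;
    4, 6, 8, 12, 10, 8, 6, 3;
    2, 3, 4, 6, 5, 4, 3, 2]

theorem sum_cartanInvE8_mul (i j : Fin 8) :
    ∑ k, cartanInvE8 i k * CartanMatrix.E₈ k j = if i = j then 1 else 0 := by
  revert i j
  decide +kernel

theorem cartanE8_symm (i j : Fin 8) : CartanMatrix.E₈ i j = CartanMatrix.E₈ j i := by
  fin_cases i <;> fin_cases j <;> rfl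

theorem cartanInvE8_symm (i j : Fin 8) : cartanInvE8 i j = cartanInvE8 j i := by
  fin_cases i <;> fin_cases j <;> rfl

section EE8

variable {V : Type*} [NormedAddCommGroup V] [InnerProductSpace ℝ V]

/-- `b` is a basis of the lattice `M`, with Gram matrix twice the Cartan matrix of type `E₈`. -/
structure IsEE8Basis (b : Fin 8 → V) (M : Submodule ℤ V) : Prop where
  gram : ∀ i j, inner ℝ (b i) (b j) = 2 * (CartanMatrix.E₈ i j : ℝ)
  span : Submodule.span ℤ (Set.range b) = M

theorem IsEE8.exists_basis {M : Submodule ℤ V} (h : IsEE8 M) : ∃ b, IsEE8Basis b M := by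
  obtain ⟨b, hb⟩ := h
  refine ⟨fun i => b i, hb, ?_⟩
  have : Set.range (fun i => (b i : V)) = M.subtype '' Set.range b := by
    rw [← Set.range_comp]
    rfl
  rw [this, ← Submodule.map_span, b.span_eq, Submodule.map_subtype_top]

variable {b : Fin 8 → V} {M : Submodule ℤ V} (hb : IsEE8Basis b M)
include hb

theorem IsEE8Basis.mem (i : Fin 8) : b i ∈ M := by
  rw [← hb.span]
  exact Submodule.subset_span ⟨i, rfl⟩

theorem IsEE8Basis.mem_iff (x : V) : x ∈ M ↔ ∃ c : Fin 8 → ℤ, ∑ i, c i • b i = x := by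
  rw [← hb.span, Submodule.mem_span_range_iff_exists_fun]

/-- The sum of `a i` times the dual basis vectors. -/
theorem IsEE8Basis.inner_dual (a : Fin 8 → ℝ) (k : Fin 8) :
    inner ℝ (∑ i, (∑ j, (cartanInvE8 i j : ℝ) * a j) • b i) (b k) = 2 * a k := by
  rw [sum_inner]
  simp only [real_inner_smul_left, hb.gram, Finset.sum_mul]
  rw [Finset.sum_comm]
  have h1 : ∀ j, ∑ i, (cartanInvE8 i j : ℝ) * a j * (2 * (CartanMatrix.E₈ i k : ℝ)) =
      if j = k then 2 * a k else 0 := by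
    intro j
    have h2 := congrArg (Int.cast : ℤ → ℝ) (sum_cartanInvE8_mul j k)
    push_cast at h2
    rw [Finset.sum_congr rfl fun i _ => show (cartanInvE8 i j : ℝ) * a j *
      (2 * (CartanMatrix.E₈ i k : ℝ)) = (cartanInvE8 j i : ℝ) * (CartanMatrix.E₈ i k : ℝ) *
        (2 * a j) by rw [cartanInvE8_symm]; ring, ← Finset.sum_mul, h2]
    split_ifs with h
    · rw [h, one_mul]
    · rw [zero_mul]
  rw [Finset.sum_congr rfl fun j _ => h1 j, Finset.sum_ite_eq' Finset.univ k,
    if_pos (Finset.mem_univ k)]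

theorem IsEE8Basis.ext_span {x : V} (hx : x ∈ Submodule.span ℝ (Set.range b)) {y : V}
    (hy : y ∈ Submodule.span ℝ (Set.range b)) (h : ∀ k, inner ℝ x (b k) = inner ℝ y (b k)) :
    x = y := by
  have h1 : x - y ∈ Submodule.span ℝ (Set.range b) := Submodule.sub_mem _ hx hy
  have h2 : x - y ∈ (Submodule.span ℝ (Set.range b))ᗮ := by
    rw [Submodule.mem_orthogonal']
    intro u hu
    induction hu using Submodule.span_induction with
    | mem u hu =>
      obtain ⟨k, rfl⟩ := hu
      rw [inner_sub_left, h, sub_self]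
    | zero => exact inner_zero_right _
    | add u v _ _ hu hv => rw [inner_add_right, hu, hv, add_zero]
    | smul c u _ hu => rw [real_inner_smul_right, hu, mul_zero]
  have h3 := Submodule.inner_right_of_mem_orthogonal h1 h2
  exact sub_eq_zero.1 (inner_self_eq_zero.1 h3)

theorem IsEE8Basis.sum_dual_mem (a : Fin 8 → ℝ) :
    ∑ i, (∑ j, (cartanInvE8 i j : ℝ) * a j) • b i ∈ Submodule.span ℝ (Set.range b) :=
  Submodule.sum_mem _ fun i _ => Submodule.smul_mem _ _ (Submodule.subset_span ⟨i, rfl⟩)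

theorem IsEE8Basis.sum_dual_int_mem {a : Fin 8 → ℝ} (ha : ∀ i, ∃ n : ℤ, a i = n) :
    ∑ i, (∑ j, (cartanInvE8 i j : ℝ) * a j) • b i ∈ M := by
  choose n hn using ha
  refine Submodule.sum_mem _ fun i _ => ?_
  have : ∑ j, (cartanInvE8 i j : ℝ) * a j = ((∑ j, cartanInvE8 i j * n j : ℤ) : ℝ) := by
    push_cast
    exact Finset.sum_congr rfl fun j _ => by rw [hn]
  rw [this, Int.cast_smul_eq_zsmul]
  exact M.smul_mem _ (hb.mem i)

theorem IsEE8Basis.inner_even {x y : V} (hx : x ∈ M) (hy : y ∈ M) :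
    ∃ n : ℤ, inner ℝ x y = 2 * n := by
  obtain ⟨c, rfl⟩ := (hb.mem_iff x).1 hx
  obtain ⟨d, rfl⟩ := (hb.mem_iff y).1 hy
  refine ⟨∑ i, ∑ j, c i * d j * CartanMatrix.E₈ i j, ?_⟩
  simp only [sum_inner, inner_sum, ← Int.cast_smul_eq_zsmul ℝ, real_inner_smul_left,
    real_inner_smul_right, hb.gram]
  push_cast
  simp only [Finset.mul_sum]
  rw [Finset.sum_comm]
  exact Finset.sum_congr rfl fun i _ => Finset.sum_congr rfl fun j _ => by ring

theorem IsEE8Basis.norm_four_dvd {x : V} (hx : x ∈ M) : ∃ n : ℤ, inner ℝ x x = 4 * n := by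
  rw [← hb.span] at hx
  induction hx using Submodule.span_induction with
  | mem x hx =>
    obtain ⟨i, rfl⟩ := hx
    refine ⟨1, ?_⟩
    have : CartanMatrix.E₈ i i = 2 := by
      revert i
      decide +kernel
    rw [hb.gram, this]
    norm_num
  | zero => exact ⟨0, by simp⟩
  | add x y hx hy ihx ihy =>
    obtain ⟨m, hm⟩ := ihx
    obtain ⟨n, hn⟩ := ihy
    rw [hb.span] at hx hy
    obtain ⟨k, hk⟩ := hb.inner_even hx hy
    refine ⟨m + n + k, ?_⟩
    rw [inner_add_left, inner_add_right, inner_add_right, hm, hn, real_inner_comm x y, hk]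
    push_cast
    ring
  | smul a x _ ih =>
    obtain ⟨m, hm⟩ := ih
    refine ⟨a * a * m, ?_⟩
    rw [← Int.cast_smul_eq_zsmul ℝ, real_inner_smul_left, real_inner_smul_right, hm]
    push_cast
    ring

theorem IsEE8Basis.span_real :
    Submodule.span ℝ (M : Set V) = Submodule.span ℝ (Set.range b) := by
  rw [← hb.span, Submodule.span_span_of_tower]

theorem IsEE8Basis.linearIndependent : LinearIndependent ℝ b := by
  rw [Fintype.linearIndependent_iff]
  intro c hc i
  have h1 : ∀ k, ∑ j, c j * (CartanMatrix.E₈ j k : ℝ) = 0 := by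
    intro k
    have := congrArg (fun v => inner ℝ v (b k)) hc
    simp only [sum_inner, real_inner_smul_left, hb.gram, inner_zero_left] at this
    have h2 : ∑ j, c j * (2 * (CartanMatrix.E₈ j k : ℝ)) =
        2 * ∑ j, c j * (CartanMatrix.E₈ j k : ℝ) := by
      rw [Finset.mul_sum]
      exact Finset.sum_congr rfl fun j _ => by ring
    linarith
  have h2 : ∑ k, (∑ j, c j * (CartanMatrix.E₈ j k : ℝ)) * (cartanInvE8 k i : ℝ) = 0 :=
    Finset.sum_eq_zero fun k _ => by rw [h1, zero_mul]
  simp only [Finset.sum_mul] at h2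
  rw [Finset.sum_comm] at h2
  have h3 : ∀ j, ∑ k, c j * (CartanMatrix.E₈ j k : ℝ) * (cartanInvE8 k i : ℝ) =
      if i = j then c j else 0 := by
    intro j
    have h4 := congrArg (Int.cast : ℤ → ℝ) (sum_cartanInvE8_mul i j)
    push_cast at h4
    rw [Finset.sum_congr rfl fun k _ => show c j * (CartanMatrix.E₈ j k : ℝ) *
      (cartanInvE8 k i : ℝ) = c j * ((cartanInvE8 i k : ℝ) * (CartanMatrix.E₈ k j : ℝ)) by
        rw [cartanInvE8_symm k, cartanE8_symm j]; ring, ← Finset.mul_sum, h4]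
    split_ifs <;> simp
  rwa [Finset.sum_congr rfl fun j _ => h3 j, Finset.sum_ite_eq, if_pos (Finset.mem_univ i)] at h2

variable [FiniteDimensional ℝ V]

/-- The subtracted vector has products 2(x, b_k) with the basis, so it is twice the projection of x
to the span of M. Its coefficients are integral as soon as the products of x with the basis are;
this is why x - t_M x lies in M for x in the Leech lattice. -/
theorem IsEE8Basis.latticeInvolution_apply (x : V) : latticeInvolution M x =
    x - ∑ i, (∑ j, (cartanInvE8 i j : ℝ) * inner ℝ x (b j)) • b i := by
  set w := ∑ i, (∑ j, (cartanInvE8 i j : ℝ) * inner ℝ x (b j)) • b i with hw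
  have hwM : w ∈ Submodule.span ℝ (M : Set V) := by
    rw [hb.span_real]
    exact hb.sum_dual_mem _
  have h1 : latticeInvolution M ((1 / 2 : ℝ) • w) = -((1 / 2 : ℝ) • w) :=
    Submodule.reflection_mem_subspace_orthogonal_precomplement_eq_neg
      (Submodule.smul_mem _ _ hwM)
  have h2 : latticeInvolution M (x - (1 / 2 : ℝ) • w) = x - (1 / 2 : ℝ) • w := by
    refine Submodule.reflection_mem_subspace_eq_self ?_
    rw [hb.span_real, Submodule.mem_orthogonal']
    intro u hu
    induction hu using Submodule.span_induction with
    | mem u hu =>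
      obtain ⟨k, rfl⟩ := hu
      rw [inner_sub_left, real_inner_smul_left, hw, hb.inner_dual]
      ring
    | zero => exact inner_zero_right _
    | add u v _ _ hu hv => rw [inner_add_right, hu, hv, add_zero]
    | smul c u _ hu => rw [real_inner_smul_right, hu, mul_zero]
  have h3 : x = (x - (1 / 2 : ℝ) • w) + (1 / 2 : ℝ) • w := by abel
  conv_lhs => rw [h3, map_add, h1, h2]
  module

theorem IsEE8Basis.latticeInvolution_of_mem_span {x : V}
    (hx : x ∈ Submodule.span ℝ (Set.range b)) : latticeInvolution M x = -x := by
  refine Submodule.reflection_mem_subspace_orthogonal_precomplement_eq_neg ?_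
  rwa [hb.span_real]

theorem IsEE8Basis.latticeInvolution_ne_one : latticeInvolution M ≠ 1 := by
  intro h
  have h1 := hb.latticeInvolution_of_mem_span (Submodule.subset_span ⟨0, rfl⟩)
  rw [h] at h1
  have h2 := hb.gram 0 0
  have h3 : inner ℝ (b 0) (b 0) = -inner ℝ (b 0) (b 0) := by
    conv_lhs => rw [show b 0 = -b 0 from h1, inner_neg_left, ← h1]
    rfl
  rw [show inner ℝ (b 0) (b 0) = (0 : ℝ) by linarith] at h2
  norm_num [CartanMatrix.E₈] at h2

end EE8

theorem latticeInvolution_mul_self {V : Type*} [NormedAddCommGroup V] [InnerProductSpace ℝ V]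
    [FiniteDimensional ℝ V] (M : Submodule ℤ V) :
    latticeInvolution M * latticeInvolution M = 1 :=
  Submodule.reflection_mul_reflection _

/-! ### The fixed sublattice -/

/-- Reducedness gives 3ac ≤ 4ac - b², and the latter divides 9; so ac ≤ 3 and finitely many cases
remain. -/
theorem E8_arith {a b c k : ℤ} (ha : 1 ≤ a) (hc : 1 ≤ c) (h1 : b ≤ a) (h2 : -b ≤ a) (h3 : b ≤ c)
    (h4 : -b ≤ c) (h : k * (4 * a * c - b * b) = 9) : a = 1 ∧ c = 1 ∧ (b = 1 ∨ b = -1) := by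
  have hb : b * b ≤ a * c := by nlinarith
  have hD : 4 * a * c - b * b ∣ 9 := ⟨k, by rw [← h]; ring⟩
  have hD9 : 4 * a * c - b * b ≤ 9 := Int.le_of_dvd (by norm_num) hD
  have hac : a * c ≤ 3 := by nlinarith
  have ha3 : a ≤ 3 := by nlinarith
  have hc3 : c ≤ 3 := by nlinarith
  have hb3 : b ≤ 3 := by omega
  have hb3' : -3 ≤ b := by omega
  interval_cases a <;> interval_cases c <;> interval_cases b <;> simp_all <;> omega

section EE8

variable {V : Type*} [NormedAddCommGroup V] [InnerProductSpace ℝ V] [FiniteDimensional ℝ V]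

/-- The vectors of `M` that are fixed by `t_M t_N`. -/
def fixedSublattice (M N : Submodule ℤ V) : Submodule ℤ V where
  carrier := {x | x ∈ M ∧ latticeInvolution N x = -x}
  zero_mem' := ⟨M.zero_mem, by rw [map_zero, neg_zero]⟩
  add_mem' := by
    rintro x y ⟨hx, hx'⟩ ⟨hy, hy'⟩
    exact ⟨M.add_mem hx hy, by rw [map_add, hx', hy', neg_add]⟩
  smul_mem' := by
    rintro c x ⟨hx, hx'⟩
    refine ⟨M.smul_mem c hx, ?_⟩
    rw [← Int.cast_smul_eq_zsmul ℝ, map_smul, hx', smul_neg]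

theorem latticeInvolution_apply_apply (M : Submodule ℤ V) (x : V) :
    latticeInvolution M (latticeInvolution M x) = x :=
  Submodule.reflection_reflection _ x

theorem inner_latticeInvolution (M : Submodule ℤ V) (x y : V) :
    inner ℝ (latticeInvolution M x) y = inner ℝ x (latticeInvolution M y) := by
  rw [← latticeInvolution_apply_apply M y, LinearIsometryEquiv.inner_map_map,
    latticeInvolution_apply_apply]

theorem IsEE8Basis.neg_of_mem {b : Fin 8 → V} {M : Submodule ℤ V} (hb : IsEE8Basis b M) {x : V}
    (hx : x ∈ M) : latticeInvolution M x = -x :=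
  hb.latticeInvolution_of_mem_span (hb.span_real ▸ Submodule.subset_span hx)

theorem IsEE8Basis.finite {b : Fin 8 → V} {M : Submodule ℤ V} (hb : IsEE8Basis b M) :
    Module.Finite ℤ M := by
  rw [← hb.span]
  exact Module.Finite.iff_fg.2 (Submodule.fg_span (Set.finite_range b))

theorem IsEE8Basis.finrank {b : Fin 8 → V} {M : Submodule ℤ V} (hb : IsEE8Basis b M) :
    Module.finrank ℤ M = 8 := by
  have h1 : LinearIndependent ℤ b := hb.linearIndependent.restrict_scalars fun m n h => by
    simpa using h
  rw [← hb.span, finrank_span_eq_card h1, Fintype.card_fin]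

theorem submodule_int_free {M : Submodule ℤ V} (h : Module.Finite ℤ M) (F : Submodule ℤ V)
    (hF : F ≤ M) : Module.Finite ℤ F ∧ Module.Free ℤ F := by
  have h1 : IsAddTorsionFree V := .of_isTorsionFree ℝ V
  have h2 : Module.IsTorsionFree ℤ V := inferInstance
  have h3 : Module.Finite ℤ F :=
    Module.Finite.of_injective (Submodule.inclusion hF) (Submodule.inclusion_injective hF)
  exact ⟨h3, inferInstance⟩

end EE8

section Leech

variable {M N : Submodule ℤ E24} {b c : Fin 8 → E24}

theorem IsEE8Basis.sub_mem (hb : IsEE8Basis b M) (hM : M ≤ leechLattice) {x : E24}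
    (hx : x ∈ leechLattice) : x - latticeInvolution M x ∈ M := by
  rw [hb.latticeInvolution_apply, sub_sub_cancel]
  exact hb.sum_dual_int_mem fun i => leech_inner_int hx (hM (hb.mem i))

theorem IsEE8Basis.latticeInvolution_mem (hb : IsEE8Basis b M) (hM : M ≤ leechLattice) {x : E24}
    (hx : x ∈ leechLattice) : latticeInvolution M x ∈ leechLattice := by
  have h := leechLattice.sub_mem hx (hM (hb.sub_mem hM hx))
  rwa [sub_sub_cancel] at h

/-- The fixed sublattice lies between M ∩ N and half of it, since 2x = x - t_N x is in N for each of
its vectors x. The intersection has rank 8 + 8 - 14. -/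
theorem finrank_fixedSublattice (hb : IsEE8Basis b M) (hc : IsEE8Basis c N)
    (hM : M ≤ leechLattice) (hN : N ≤ leechLattice)
    (h14 : Module.finrank ℤ (M ⊔ N : Submodule ℤ E24) = 14) :
    Module.finrank ℤ (fixedSublattice M N) = 2 := by
  have hMf := hb.finite
  have hNf := hc.finite
  have h1 := Submodule.rank_sup_add_rank_inf_eq M N
  have hsup : Module.Finite ℤ (M ⊔ N : Submodule ℤ E24) :=
    Module.Finite.iff_fg.2 ((Module.Finite.iff_fg.1 hMf).sup (Module.Finite.iff_fg.1 hNf))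
  have hinf := (submodule_int_free hMf (M ⊓ N) inf_le_left).1
  have hF := (submodule_int_free hMf (fixedSublattice M N) fun x hx => hx.1).1
  rw [← Module.finrank_eq_rank, ← Module.finrank_eq_rank, ← Module.finrank_eq_rank,
    ← Module.finrank_eq_rank, h14, hb.finrank, hc.finrank] at h1
  have h2 : Module.finrank ℤ (M ⊓ N : Submodule ℤ E24) = 2 := by
    have h3 : 14 + Module.finrank ℤ (M ⊓ N : Submodule ℤ E24) = 8 + 8 := by exact_mod_cast h1
    omega
  have hle : M ⊓ N ≤ fixedSublattice M N := fun x hx => ⟨hx.1, hc.neg_of_mem hx.2⟩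
  apply le_antisymm
  · rw [← h2]
    have hmem : ∀ x ∈ fixedSublattice M N, (2 : ℤ) • x ∈ M ⊓ N := by
      intro x hx
      refine ⟨M.smul_mem _ hx.1, ?_⟩
      have h4 := hc.sub_mem hN (hM hx.1)
      rw [hx.2, sub_neg_eq_add] at h4
      rwa [two_smul]
    let φ : fixedSublattice M N →ₗ[ℤ] (M ⊓ N : Submodule ℤ E24) :=
      ((2 : ℤ) • (fixedSublattice M N).subtype).codRestrict _ fun x => hmem x x.2
    refine LinearMap.finrank_le_finrank_of_injective (f := φ) fun x y hxy => ?_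
    have h5 : (2 : ℤ) • (x : E24) = (2 : ℤ) • (y : E24) := congrArg Subtype.val hxy
    rw [← Int.cast_smul_eq_zsmul ℝ, ← Int.cast_smul_eq_zsmul ℝ] at h5
    exact Subtype.ext (smul_right_injective _ (by norm_num) h5)
  · rw [← h2]
    exact LinearMap.finrank_le_finrank_of_injective (f := Submodule.inclusion hle)
      (Submodule.inclusion_injective hle)

/-- The sum over the orbit of a vector of `M` under `t_M t_N`. -/
theorem add_add_mem_fixedSublattice (hb : IsEE8Basis b M) (hc : IsEE8Basis c N)
    (hM : M ≤ leechLattice) (hN : N ≤ leechLattice)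
    (h3 : ∀ x, latticeInvolution M (latticeInvolution N (latticeInvolution M x)) =
      latticeInvolution N (latticeInvolution M (latticeInvolution N x)))
    {x : E24} (hx : x ∈ M) :
    x + latticeInvolution M (latticeInvolution N x) - latticeInvolution N x ∈
      fixedSublattice M N := by
  have h1 : x + latticeInvolution M (latticeInvolution N x) - latticeInvolution N x =
      x - (latticeInvolution N x - latticeInvolution M (latticeInvolution N x)) := by abel
  refine ⟨?_, ?_⟩
  · rw [h1]
    exact M.sub_mem hx (hb.sub_mem hM (hc.latticeInvolution_mem hN (hM hx)))
  · have h2 := h3 x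
    rw [hb.neg_of_mem hx, map_neg, map_neg] at h2
    rw [map_sub, map_add, latticeInvolution_apply_apply, ← h2]
    abel

theorem inner_add_add_eq (hb : IsEE8Basis b M) {f : E24} (hf : f ∈ fixedSublattice M N)
    (x : E24) :
    inner ℝ (x + latticeInvolution M (latticeInvolution N x) - latticeInvolution N x) f =
      3 * inner ℝ x f := by
  rw [inner_sub_left, inner_add_left, inner_latticeInvolution, inner_latticeInvolution,
    inner_latticeInvolution, hb.neg_of_mem hf.1, map_neg, hf.2, inner_neg_right, inner_neg_right]
  ring

/-- The fixed sublattice F is saturated in M, so its coordinate functionals extend to M, where every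
functional is half the product with some m in M. The orbit sum of m lies in F and its products with
F are three times those of m. Thus 2 · 3 = 6 times the dual basis of F lies in F. -/
theorem exists_gram_inverse (hb : IsEE8Basis b M) (hc : IsEE8Basis c N)
    (hM : M ≤ leechLattice) (hN : N ≤ leechLattice)
    (h3 : ∀ x, latticeInvolution M (latticeInvolution N (latticeInvolution M x)) =
      latticeInvolution N (latticeInvolution M (latticeInvolution N x)))
    (h14 : Module.finrank ℤ (M ⊔ N : Submodule ℤ E24) = 14)
    {f : Fin 2 → E24} (hf : Submodule.span ℤ (Set.range f) = fixedSublattice M N) :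
    ∃ k : Fin 2 → Fin 2 → ℤ, ∀ i j,
      ∑ l, (k i l : ℝ) * inner ℝ (f l) (f j) = if i = j then 6 else 0 := by
  have hMf := hb.finite
  have hfm : ∀ i, f i ∈ fixedSublattice M N := fun i => by
    rw [← hf]; exact Submodule.subset_span ⟨i, rfl⟩
  let F : Submodule ℤ M := (fixedSublattice M N).comap M.subtype
  let f' : Fin 2 → F := fun i => ⟨⟨f i, (hfm i).1⟩, hfm i⟩
  have hF : Submodule.map M.subtype F = fixedSublattice M N := by
    rw [Submodule.map_comap_eq, Submodule.range_subtype, inf_eq_right]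
    exact fun x hx => hx.1
  have hfr : Module.finrank ℤ F = 2 := by
    rw [← finrank_fixedSublattice hb hc hM hN h14, ← hF]
    exact (LinearEquiv.finrank_eq (Submodule.equivMapOfInjective _ M.injective_subtype F))
  have hspan : ⊤ ≤ Submodule.span ℤ (Set.range f') := by
    rintro ⟨⟨x, hxM⟩, hx⟩ -
    have hx' : x ∈ fixedSublattice M N := hx
    rw [← hf, Submodule.mem_span_range_iff_exists_fun] at hx'
    obtain ⟨a, rfl⟩ := hx'
    rw [Submodule.mem_span_range_iff_exists_fun]
    refine ⟨a, Subtype.ext (Subtype.ext ?_)⟩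
    simp [f']
  let B := basisOfTopLeSpanOfCardEqFinrank f' hspan (by rw [hfr, Fintype.card_fin])
  have hB : ∀ i, B i = f' i := fun i => by
    rw [coe_basisOfTopLeSpanOfCardEqFinrank]
  have hsat : ∀ (n : ℤ) (x : M), n ≠ 0 → n • x ∈ F → x ∈ F := by
    intro n x hn hx
    refine ⟨x.2, ?_⟩
    have h1 : latticeInvolution N ((n : ℝ) • (x : E24)) = -((n : ℝ) • (x : E24)) := by
      rw [Int.cast_smul_eq_zsmul]
      exact hx.2
    rw [map_smul, ← smul_neg] at h1
    exact smul_right_injective _ (Int.cast_ne_zero.2 hn) h1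
  choose ψ hψ using fun i => exists_extension_int F hsat (B.coord i)
  have hm : ∀ i, ∃ m ∈ M, ∀ j, inner ℝ (f j) m = if i = j then 2 else 0 := by
    intro i
    refine ⟨∑ k, (∑ j, (cartanInvE8 k j : ℝ) * (ψ i ⟨b j, hb.mem j⟩ : ℝ)) • b k,
      hb.sum_dual_int_mem fun j => ⟨_, rfl⟩, fun j => ?_⟩
    have h1 : ∀ x (hx : x ∈ M), inner ℝ
        (∑ k, (∑ j, (cartanInvE8 k j : ℝ) * (ψ i ⟨b j, hb.mem j⟩ : ℝ)) • b k) x =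
        2 * (ψ i ⟨x, hx⟩ : ℝ) := by
      intro x hx
      obtain ⟨a, ha⟩ := (hb.mem_iff x).1 hx
      have h2 : (⟨x, hx⟩ : M) = ∑ j, a j • ⟨b j, hb.mem j⟩ := by
        apply Subtype.ext
        simp [← ha]
      rw [h2, map_sum]
      conv_lhs => rw [← ha, inner_sum]
      push_cast
      rw [Finset.mul_sum]
      refine Finset.sum_congr rfl fun j _ => ?_
      rw [← Int.cast_smul_eq_zsmul ℝ, real_inner_smul_right, hb.inner_dual, map_zsmul, smul_eq_mul]
      push_cast
      ring
    have h3 := hψ i (f' j)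
    rw [← hB, Module.Basis.coord_apply, B.repr_self, hB] at h3
    rw [real_inner_comm, h1 _ (hfm j).1]
    rw [show ψ i ⟨f j, (hfm j).1⟩ = Finsupp.single j 1 i from h3, Finsupp.single_apply]
    by_cases h : i = j
    · simp [h]
    · simp [h, Ne.symm h]
  choose m hmM hm using hm
  have h5 : ∀ i, ∃ k : Fin 2 → ℤ, ∑ l, k l • f l =
      m i + latticeInvolution M (latticeInvolution N (m i)) - latticeInvolution N (m i) := by
    intro i
    rw [← Submodule.mem_span_range_iff_exists_fun, hf]
    exact add_add_mem_fixedSublattice hb hc hM hN h3 (hmM i)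
  choose k hk using h5
  refine ⟨k, fun i j => ?_⟩
  have h6 := inner_add_add_eq hb (hfm j) (m i)
  rw [← hk, real_inner_comm (f j) (m i), sum_inner, hm] at h6
  simp only [← Int.cast_smul_eq_zsmul ℝ, real_inner_smul_left] at h6
  rw [h6]
  split_ifs <;> norm_num

end Leech

/-! ### A reduced basis of the fixed sublattice. -/

theorem span_range_pair_add {V : Type*} [AddCommGroup V] (x y : V) (e : ℤ) :
    Submodule.span ℤ (Set.range ![x + e • y, y]) = Submodule.span ℤ (Set.range ![x, y]) := by
  simp only [Matrix.range_cons, Matrix.range_empty, Set.union_empty, Set.singleton_union]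
  apply le_antisymm
  · rw [Submodule.span_le]
    rintro v (rfl | rfl)
    · exact Submodule.add_mem _ (Submodule.subset_span (by simp))
        (Submodule.smul_mem _ _ (Submodule.subset_span (by simp)))
    · exact Submodule.subset_span (by simp)
  · rw [Submodule.span_le]
    rintro v (rfl | rfl)
    · have h : v = (v + e • y) - e • y := by abel
      rw [h]
      exact Submodule.sub_mem _ (Submodule.subset_span (by simp))
        (Submodule.smul_mem _ _ (Submodule.subset_span (by simp)))
    · exact Submodule.subset_span (by simp)

theorem span_range_pair_swap {V : Type*} [AddCommGroup V] (x y : V) :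
    Submodule.span ℤ (Set.range ![x, y]) = Submodule.span ℤ (Set.range ![y, x]) := by
  simp only [Matrix.range_cons, Matrix.range_empty, Set.union_empty, Set.singleton_union]
  rw [Set.pair_comm]

theorem span_range_pair_neg {V : Type*} [AddCommGroup V] (x y : V) :
    Submodule.span ℤ (Set.range ![x, -y]) = Submodule.span ℤ (Set.range ![x, y]) := by
  simp only [Matrix.range_cons, Matrix.range_empty, Set.union_empty, Set.singleton_union]
  apply le_antisymm <;> rw [Submodule.span_le] <;> rintro v (rfl | rfl)
  · exact Submodule.subset_span (by simp)
  · exact Submodule.neg_mem _ (Submodule.subset_span (by simp))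
  · exact Submodule.subset_span (by simp)
  · have : v = -(-v) := by abel
    rw [this]
    exact Submodule.neg_mem _ (Submodule.subset_span (by simp))

section Leech

variable {M N : Submodule ℤ E24} {b c : Fin 8 → E24}

theorem exists_reduced_pair (hb : IsEE8Basis b M) (hc : IsEE8Basis c N)
    (hM : M ≤ leechLattice) (hN : N ≤ leechLattice)
    (h14 : Module.finrank ℤ (M ⊔ N : Submodule ℤ E24) = 14) :
    ∃ x y : E24, Submodule.span ℤ (Set.range ![x, y]) = fixedSublattice M N ∧
      ∀ x' y', Submodule.span ℤ (Set.range ![x', y']) = fixedSublattice M N →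
        inner ℝ x x + inner ℝ y y ≤ inner ℝ x' x' + inner ℝ y' y' := by
  have hF := submodule_int_free hb.finite (fixedSublattice M N) fun x hx => hx.1
  have := hF.1
  have := hF.2
  let B := Module.finBasisOfFinrankEq ℤ _ (finrank_fixedSublattice hb hc hM hN h14)
  let P : ℤ → Prop := fun n => ∃ x y : E24,
    Submodule.span ℤ (Set.range ![x, y]) = fixedSublattice M N ∧
      inner ℝ x x + inner ℝ y y = n
  have hB : Submodule.span ℤ (Set.range ![(B 0 : E24), (B 1 : E24)]) = fixedSublattice M N := by
    have h1 : Set.range ![(B 0 : E24), (B 1 : E24)] =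
        (fixedSublattice M N).subtype '' Set.range B := by
      rw [← Set.range_comp]
      congr 1
      funext i
      fin_cases i <;> rfl
    rw [h1, ← Submodule.map_span, B.span_eq, Submodule.map_subtype_top]
  have hint : ∀ x y, Submodule.span ℤ (Set.range ![x, y]) = fixedSublattice M N →
      ∃ n : ℤ, inner ℝ x x + inner ℝ y y = n := by
    intro x y hxy
    have hx : x ∈ M := by
      have : x ∈ fixedSublattice M N := by
        rw [← hxy]; exact Submodule.subset_span ⟨0, rfl⟩
      exact this.1
    have hy : y ∈ M := by
      have : y ∈ fixedSublattice M N := by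
        rw [← hxy]; exact Submodule.subset_span ⟨1, rfl⟩
      exact this.1
    obtain ⟨m, hm⟩ := hb.norm_four_dvd hx
    obtain ⟨n, hn⟩ := hb.norm_four_dvd hy
    exact ⟨4 * m + 4 * n, by rw [hm, hn]; push_cast; ring⟩
  obtain ⟨n, ⟨x, y, hxy, hn⟩, hmin⟩ := Int.exists_least_of_bdd (P := P) ⟨0, by
    rintro z ⟨x, y, -, h⟩
    have h1 : (0 : ℝ) ≤ inner ℝ x x := real_inner_self_nonneg
    have h2 : (0 : ℝ) ≤ inner ℝ y y := real_inner_self_nonneg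
    have h3 : (0 : ℝ) ≤ z := by rw [← h]; positivity
    exact_mod_cast h3⟩ (by
    obtain ⟨n, hn⟩ := hint _ _ hB
    exact ⟨n, _, _, hB, hn⟩)
  refine ⟨x, y, hxy, fun x' y' h => ?_⟩
  obtain ⟨m, hm⟩ := hint _ _ h
  rw [hn, hm]
  exact_mod_cast hmin m ⟨x', y', h, hm⟩

/-- The Gram matrix has diagonal 4α, 4γ and off-diagonal entry 2β. Taking determinants in the
relation from `exists_gram_inverse` shows that 4αγ - β² divides 9, and minimality of the sum of the
two norms gives |β| ≤ α and |β| ≤ γ. Only α = γ = 1, β = ±1 is left; the sign is adjusted by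
replacing y with -y. -/
theorem exists_fixed_pair (hb : IsEE8Basis b M) (hc : IsEE8Basis c N)
    (hM : M ≤ leechLattice) (hN : N ≤ leechLattice)
    (h3 : ∀ x, latticeInvolution M (latticeInvolution N (latticeInvolution M x)) =
      latticeInvolution N (latticeInvolution M (latticeInvolution N x)))
    (h14 : Module.finrank ℤ (M ⊔ N : Submodule ℤ E24) = 14) :
    ∃ x y : E24, Submodule.span ℤ (Set.range ![x, y]) = fixedSublattice M N ∧
      inner ℝ x x = (4 : ℝ) ∧ inner ℝ y y = (4 : ℝ) ∧ inner ℝ x y = (-2 : ℝ) := by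
  obtain ⟨x, y, hxy, hmin⟩ := exists_reduced_pair hb hc hM hN h14
  have hx : x ∈ fixedSublattice M N := by
    rw [← hxy]; exact Submodule.subset_span ⟨0, rfl⟩
  have hy : y ∈ fixedSublattice M N := by
    rw [← hxy]; exact Submodule.subset_span ⟨1, rfl⟩
  obtain ⟨k, hk⟩ := exists_gram_inverse hb hc hM hN h3 h14 hxy
  obtain ⟨α, hα⟩ := hb.norm_four_dvd hx.1
  obtain ⟨γ, hγ⟩ := hb.norm_four_dvd hy.1
  obtain ⟨β, hβ⟩ := hb.inner_even hx.1 hy.1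
  have hβ' : inner ℝ y x = 2 * (β : ℝ) := by rw [real_inner_comm, hβ]
  have h00 := hk 0 0
  have h01 := hk 0 1
  have h10 := hk 1 0
  have h11 := hk 1 1
  simp only [Fin.sum_univ_two, Matrix.cons_val_zero, Matrix.cons_val_one, hα, hβ, hγ, hβ', if_true,
    zero_ne_one, one_ne_zero, if_false] at h00 h01 h10 h11
  have e00 : k 0 0 * (4 * α) + k 0 1 * (2 * β) = 6 := by exact_mod_cast h00
  have e01 : k 0 0 * (2 * β) + k 0 1 * (4 * γ) = 0 := by exact_mod_cast h01
  have e10 : k 1 0 * (4 * α) + k 1 1 * (2 * β) = 0 := by exact_mod_cast h10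
  have e11 : k 1 0 * (2 * β) + k 1 1 * (4 * γ) = 6 := by exact_mod_cast h11
  have hdet : (k 0 0 * k 1 1 - k 0 1 * k 1 0) * (4 * α * γ - β * β) = 9 := by
    have : (k 0 0 * (4 * α) + k 0 1 * (2 * β)) * (k 1 0 * (2 * β) + k 1 1 * (4 * γ)) -
      (k 0 0 * (2 * β) + k 0 1 * (4 * γ)) * (k 1 0 * (4 * α) + k 1 1 * (2 * β)) = 36 := by
      rw [e00, e01, e10, e11]; norm_num
    nlinarith
  have hα0 : 0 ≤ α := by
    have : (0 : ℝ) ≤ inner ℝ x x := real_inner_self_nonneg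
    rw [hα] at this
    have : (0 : ℝ) ≤ α := by linarith
    exact_mod_cast this
  have hγ0 : 0 ≤ γ := by
    have : (0 : ℝ) ≤ inner ℝ y y := real_inner_self_nonneg
    rw [hγ] at this
    have : (0 : ℝ) ≤ γ := by linarith
    exact_mod_cast this
  have hα1 : 1 ≤ α := by
    rcases hα0.eq_or_lt with h | h
    · have hx0 : x = 0 := by
        rw [← h] at hα
        exact inner_self_eq_zero.1 (by rw [hα]; simp : inner ℝ x x = (0 : ℝ))
      rw [hx0, inner_zero_left] at hβ
      have : β = 0 := by
        have : (β : ℝ) = 0 := by linarith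
        exact_mod_cast this
      rw [← h, this] at e00
      omega
    · exact h
  have hγ1 : 1 ≤ γ := by
    rcases hγ0.eq_or_lt with h | h
    · have hy0 : y = 0 := by
        rw [← h] at hγ
        exact inner_self_eq_zero.1 (by rw [hγ]; simp : inner ℝ y y = (0 : ℝ))
      rw [hy0, inner_zero_right] at hβ
      have : β = 0 := by
        have : (β : ℝ) = 0 := by linarith
        exact_mod_cast this
      rw [← h, this] at e11
      omega
    · exact h
  -- Replacing x by x ± y keeps the span, so minimality bounds the off-diagonal entry.
  have hm1 : ∀ e : ℤ, e * e = 1 → 0 ≤ γ + e * β := by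
    intro e he
    have h := hmin (x + e • y) y (by rw [span_range_pair_add, hxy])
    rw [← Int.cast_smul_eq_zsmul ℝ, inner_add_left, inner_add_right, inner_add_right,
      real_inner_smul_left, real_inner_smul_left, real_inner_smul_right, real_inner_smul_right,
      hα, hβ, hβ', hγ] at h
    have he' : (e : ℝ) * e = 1 := by exact_mod_cast he
    have hee : (e : ℝ) * e * γ = γ := by rw [he', one_mul]
    have : (0 : ℝ) ≤ γ + e * β := by linarith
    exact_mod_cast this
  have hm2 : ∀ e : ℤ, e * e = 1 → 0 ≤ α + e * β := by
    intro e he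
    have h := hmin x (y + e • x) (by rw [span_range_pair_swap, span_range_pair_add,
      span_range_pair_swap, hxy])
    rw [← Int.cast_smul_eq_zsmul ℝ, inner_add_left, inner_add_right, inner_add_right,
      real_inner_smul_left, real_inner_smul_left, real_inner_smul_right, real_inner_smul_right,
      hα, hβ, hβ', hγ] at h
    have he' : (e : ℝ) * e = 1 := by exact_mod_cast he
    have hee : (e : ℝ) * e * α = α := by rw [he', one_mul]
    have : (0 : ℝ) ≤ α + e * β := by linarith
    exact_mod_cast this
  have a1 := hm1 1 rfl
  have a2 := hm1 (-1) rfl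
  have a3 := hm2 1 rfl
  have a4 := hm2 (-1) rfl
  obtain ⟨rfl, rfl, h⟩ := E8_arith hα1 hγ1 (by omega) (by omega) (by omega) (by omega) hdet
  rcases h with rfl | rfl
  · refine ⟨x, -y, by rw [span_range_pair_neg, hxy], ?_, ?_, ?_⟩
    · rw [hα]; norm_num
    · rw [inner_neg_neg, hγ]; norm_num
    · rw [inner_neg_right, hβ]; norm_num
  · refine ⟨x, y, hxy, ?_, ?_, ?_⟩
    · rw [hα]; norm_num
    · rw [hγ]; norm_num
    · rw [hβ]; norm_num

end Leech

/-! ### A basis adapted to the fixed sublattice -/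

theorem cartanE8_diag (i : Fin 8) : CartanMatrix.E₈ i i = 2 := by
  revert i
  decide +kernel

theorem sum_cartanInvE8_row (k : Fin 8) :
    ∑ i, (∑ j, cartanInvE8 i j) * CartanMatrix.E₈ i k = 1 := by
  revert k
  decide +kernel

section EE8

variable {V : Type*} [NormedAddCommGroup V] [InnerProductSpace ℝ V]

theorem IsEE8Basis.reflect {b : Fin 8 → V} {M : Submodule ℤ V} (hb : IsEE8Basis b M) (k : Fin 8) :
    IsEE8Basis (fun i => b i - CartanMatrix.E₈ i k • b k) M := by
  have hkk := cartanE8_diag k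
  refine ⟨fun i j => ?_, ?_⟩
  · simp only [← Int.cast_smul_eq_zsmul ℝ, inner_sub_left, inner_sub_right, real_inner_smul_left,
      real_inner_smul_right, hb.gram, hkk]
    rw [cartanE8_symm k j]
    push_cast
    ring
  · rw [← hb.span]
    have hsub : ∀ b' : Fin 8 → V, Submodule.span ℤ (Set.range
        fun i => b' i - CartanMatrix.E₈ i k • b' k) ≤ Submodule.span ℤ (Set.range b') := by
      intro b'
      rw [Submodule.span_le]
      rintro _ ⟨i, rfl⟩
      exact Submodule.sub_mem _ (Submodule.subset_span ⟨i, rfl⟩)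
        (Submodule.smul_mem _ _ (Submodule.subset_span ⟨k, rfl⟩))
    refine le_antisymm (hsub b) ?_
    have h := hsub fun i => b i - CartanMatrix.E₈ i k • b k
    have h2 : (fun i => (b i - CartanMatrix.E₈ i k • b k) -
        CartanMatrix.E₈ i k • (b k - CartanMatrix.E₈ k k • b k)) = b := by
      funext i
      rw [hkk]
      module
    rwa [h2] at h

/-- Every vector is dominant for some basis. -/
theorem IsEE8Basis.exists_dominant {b : Fin 8 → V} {M : Submodule ℤ V} (hb : IsEE8Basis b M)
    {x : V} (hx : x ∈ M) : ∃ b', IsEE8Basis b' M ∧ ∀ i, 0 ≤ inner ℝ x (b' i) := by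
  -- These are the coefficients of the Weyl vector. Reflecting the basis in b_k changes the sum of
  -- the ρ_i b_i by -b_k, so a basis for which its product with x is maximal makes x dominant.
  let ρ : Fin 8 → ℤ := fun i => ∑ j, cartanInvE8 i j
  let P : ℤ → Prop := fun n => ∃ b', IsEE8Basis b' M ∧ ∑ i, (ρ i : ℝ) * inner ℝ x (b' i) = n
  have hρ : ∀ i, 0 ≤ ρ i := by decide +kernel
  have hint : ∀ b', IsEE8Basis b' M → ∃ n : ℤ, ∑ i, (ρ i : ℝ) * inner ℝ x (b' i) = n := by
    intro b' hb'
    choose n hn using fun i => hb'.inner_even hx (hb'.mem i)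
    refine ⟨∑ i, ρ i * (2 * n i), ?_⟩
    push_cast
    exact Finset.sum_congr rfl fun i _ => by rw [hn]
  obtain ⟨m, hm⟩ := hb.norm_four_dvd hx
  obtain ⟨n, ⟨b', hb', hn⟩, hmax⟩ := Int.exists_greatest_of_bdd (P := P)
    ⟨∑ i, ρ i * (4 * m + 4), by
      rintro z ⟨b', hb', h⟩
      have h1 : ∑ i, (ρ i : ℝ) * inner ℝ x (b' i) ≤ ∑ i, (ρ i : ℝ) * (4 * m + 4) := by
        refine Finset.sum_le_sum fun i _ => ?_
        refine mul_le_mul_of_nonneg_left ?_ (by exact_mod_cast hρ i)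
        have h2 : (0 : ℝ) ≤ inner ℝ (x - b' i) (x - b' i) := real_inner_self_nonneg
        have h4 : (0 : ℝ) ≤ inner ℝ x x := real_inner_self_nonneg
        have h3 := hb'.gram i i
        rw [cartanE8_diag] at h3
        rw [inner_sub_left, inner_sub_right, inner_sub_right, h3, real_inner_comm x (b' i),
          hm] at h2
        rw [hm] at h4
        push_cast at h2
        linarith
      rw [h] at h1
      exact_mod_cast h1⟩ (by
    obtain ⟨n, hn⟩ := hint b hb
    exact ⟨n, b, hb, hn⟩)
  refine ⟨b', hb', fun k => ?_⟩
  by_contra! hneg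
  obtain ⟨n', hn'⟩ := hint _ (hb'.reflect k)
  have h1 := hmax n' ⟨_, hb'.reflect k, hn'⟩
  have h2 : ((n' : ℤ) : ℝ) ≤ n := by exact_mod_cast h1
  rw [← hn, ← hn'] at h2
  have h3 : ∑ i, ρ i * CartanMatrix.E₈ i k = 1 := sum_cartanInvE8_row k
  have h4 : ∑ i, (ρ i : ℝ) * inner ℝ x (b' i - CartanMatrix.E₈ i k • b' k) =
      ∑ i, (ρ i : ℝ) * inner ℝ x (b' i) - inner ℝ x (b' k) := by
    have h5 := congrArg (Int.cast : ℤ → ℝ) h3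
    push_cast at h5
    rw [show inner ℝ x (b' k) = (1 : ℝ) * inner ℝ x (b' k) by rw [one_mul], ← h5, Finset.sum_mul,
      ← Finset.sum_sub_distrib]
    refine Finset.sum_congr rfl fun i _ => ?_
    rw [inner_sub_right, ← Int.cast_smul_eq_zsmul ℝ, real_inner_smul_right]
    ring
  linarith

/-- Every sublattice `√2 A₂` of `√2 E₈` is spanned by the highest root and the negative of the
adjacent simple root of some basis. -/
theorem IsEE8Basis.exists_adapted {b : Fin 8 → V} {M : Submodule ℤ V} (hb : IsEE8Basis b M)
    {x y : V} (hx : x ∈ M) (hy : y ∈ M) (hxx : inner ℝ x x = (4 : ℝ)) (hyy : inner ℝ y y = (4 : ℝ))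
    (hxy : inner ℝ x y = (-2 : ℝ)) :
    ∃ b', IsEE8Basis b' M ∧ (∀ i, inner ℝ x (b' i) = if i = 7 then (2 : ℝ) else 0) ∧
      x = ∑ i, cartanInvE8 i 7 • b' i ∧ y = -b' 7 := by
  -- The halved products of y with the basis lie between -2 and 2. Hence if 3x + y is dominant, so
  -- is x, and y has nonnegative products with the basis vectors orthogonal to x.
  obtain ⟨b', hb', hdom⟩ := hb.exists_dominant
    (M.add_mem (M.smul_mem (3 : ℤ) hx) hy)
  refine ⟨b', hb', ?_⟩
  choose a ha using fun i => hb'.inner_even hx (hb'.mem i)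
  choose c hc using fun i => hb'.inner_even hy (hb'.mem i)
  have hbb : ∀ i, inner ℝ (b' i) (b' i) = (4 : ℝ) := by
    intro i
    rw [hb'.gram, cartanE8_diag]
    norm_num
  have hdom' : ∀ i, 0 ≤ 3 * a i + c i := by
    intro i
    have h := hdom i
    rw [← Int.cast_smul_eq_zsmul ℝ, inner_add_left, real_inner_smul_left, ha, hc] at h
    push_cast at h
    have : (0 : ℝ) ≤ 3 * a i + c i := by linarith
    exact_mod_cast this
  have hc2 : ∀ i, c i ≤ 2 := by
    intro i
    have h2 : (0 : ℝ) ≤ inner ℝ (y - b' i) (y - b' i) := real_inner_self_nonneg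
    rw [inner_sub_left, inner_sub_right, inner_sub_right, real_inner_comm y (b' i), hc, hbb, hyy] at h2
    have : (c i : ℝ) ≤ 2 := by linarith
    exact_mod_cast this
  have hc2' : ∀ i, -2 ≤ c i := by
    intro i
    have h2 : (0 : ℝ) ≤ inner ℝ (y + b' i) (y + b' i) := real_inner_self_nonneg
    rw [inner_add_left, inner_add_right, inner_add_right, real_inner_comm y (b' i), hc, hbb, hyy] at h2
    have : (-2 : ℝ) ≤ c i := by linarith
    exact_mod_cast this
  have hrepr : ∀ z ∈ M, ∀ d : Fin 8 → ℤ, (∀ i, inner ℝ z (b' i) = 2 * (d i : ℝ)) →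
      z = ∑ i, (∑ j, cartanInvE8 i j * d j) • b' i := by
    intro z hz d hd
    refine hb'.ext_span (hb'.span_real ▸ Submodule.subset_span hz)
      (Submodule.sum_mem _ fun i _ => ?_) fun k => ?_
    · rw [← Int.cast_smul_eq_zsmul ℝ]
      exact Submodule.smul_mem _ _ (Submodule.subset_span ⟨i, rfl⟩)
    · rw [hd, ← hb'.inner_dual fun j => (d j : ℝ)]
      congr 1
      refine Finset.sum_congr rfl fun i _ => ?_
      rw [← Int.cast_smul_eq_zsmul ℝ]
      push_cast
      rfl
  have hinner : ∀ z ∈ M, ∀ w ∈ M, ∀ d e : Fin 8 → ℤ, (∀ i, inner ℝ z (b' i) = 2 * (d i : ℝ)) →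
      (∀ i, inner ℝ w (b' i) = 2 * (e i : ℝ)) →
      inner ℝ z w = 2 * ((∑ i, (∑ j, cartanInvE8 i j * d j) * e i : ℤ) : ℝ) := by
    intro z hz w hw d e hd he
    conv_lhs => rw [hrepr z hz d hd, sum_inner]
    rw [Int.cast_sum, Finset.mul_sum]
    refine Finset.sum_congr rfl fun i _ => ?_
    rw [← Int.cast_smul_eq_zsmul ℝ, real_inner_smul_left, real_inner_comm, he]
    push_cast
    ring
  have hxr := hrepr x hx a ha
  have hyr := hrepr y hy c hc
  have e1 := hinner x hx x hx a a ha ha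
  have e2 := hinner x hx y hy a c ha hc
  have e3 := hinner y hy y hy c c hc hc
  rw [hxx] at e1
  rw [hxy] at e2
  rw [hyy] at e3
  have f1 : ∑ i, (∑ j, cartanInvE8 i j * a j) * a i = 2 := by
    have : ((∑ i, (∑ j, cartanInvE8 i j * a j) * a i : ℤ) : ℝ) = 2 := by linarith
    exact_mod_cast this
  have f2 : ∑ i, (∑ j, cartanInvE8 i j * a j) * c i = -1 := by
    have : ((∑ i, (∑ j, cartanInvE8 i j * a j) * c i : ℤ) : ℝ) = -1 := by linarith
    exact_mod_cast this
  have f3 : ∑ i, (∑ j, cartanInvE8 i j * c j) * c i = 2 := by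
    have : ((∑ i, (∑ j, cartanInvE8 i j * c j) * c i : ℤ) : ℝ) = 2 := by linarith
    exact_mod_cast this
  have ha0 : ∀ i, 0 ≤ a i := fun i => by
    have := hdom' i
    have := hc2 i
    omega
  -- All entries of the inverse Cartan matrix are nonnegative and the last diagonal entry is the
  -- only one not exceeding 2. So a dominant vector of norm 4 is the last fundamental weight, which
  -- is the highest root.
  have hterm : ∀ i, cartanInvE8 i i * (a i * a i) ≤ 2 := by
    intro i
    rw [← f1]
    have hpos : ∀ i j, 0 ≤ cartanInvE8 i j := by
      intro i j
      fin_cases i <;> fin_cases j <;> decide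
    calc cartanInvE8 i i * (a i * a i) = cartanInvE8 i i * a i * a i := by ring
      _ ≤ (∑ j, cartanInvE8 i j * a j) * a i := mul_le_mul_of_nonneg_right
          (Finset.single_le_sum (f := fun j => cartanInvE8 i j * a j)
            (fun j _ => mul_nonneg (hpos i j) (ha0 j)) (Finset.mem_univ i)) (ha0 i)
      _ ≤ _ := Finset.single_le_sum (f := fun i => (∑ j, cartanInvE8 i j * a j) * a i)
          (fun i _ => mul_nonneg (Finset.sum_nonneg fun j _ => mul_nonneg (hpos i j) (ha0 j))
            (ha0 i)) (Finset.mem_univ i)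
  have hai : ∀ i, i ≠ 7 → a i = 0 := by
    intro i hi
    have h1 : 3 ≤ cartanInvE8 i i := by
      fin_cases i <;> first | decide | exact absurd rfl hi
    have h2 := hterm i
    have h3 := ha0 i
    nlinarith
  have ha7 : a = fun i => if i = 7 then 1 else 0 := by
    have h0 := hai 0 (by decide)
    have h1 := hai 1 (by decide)
    have h2 := hai 2 (by decide)
    have h3 := hai 3 (by decide)
    have h4 := hai 4 (by decide)
    have h5 := hai 5 (by decide)
    have h6 := hai 6 (by decide)
    simp only [Fin.sum_univ_eight, h0, h1, h2, h3, h4, h5, h6, mul_zero, zero_add, add_zero] at f1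
    rw [show cartanInvE8 7 7 = 2 from rfl] at f1
    have h7 : a 7 = 1 := by
      have := ha0 7
      nlinarith
    funext i
    by_cases hi : i = 7
    · rw [hi, h7, if_pos rfl]
    · rw [hai i hi, if_neg hi]
  subst ha7
  have hxr' : x = ∑ i, cartanInvE8 i 7 • b' i := by
    rw [hxr]
    refine Finset.sum_congr rfl fun i _ => ?_
    congr 1
    rw [Finset.sum_congr rfl fun j _ => show cartanInvE8 i j * (if j = 7 then 1 else 0) =
      if j = 7 then cartanInvE8 i j else 0 by split_ifs <;> simp, Finset.sum_ite_eq',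
      if_pos (Finset.mem_univ _)]
  have hc0 : ∀ i, i ≠ 7 → 0 ≤ c i := fun i hi => by
    have := hdom' i
    simp only [hi, if_false] at this
    omega
  have h0 := hc0 0 (by decide)
  have h1 := hc0 1 (by decide)
  have h2 := hc0 2 (by decide)
  have h3 := hc0 3 (by decide)
  have h4 := hc0 4 (by decide)
  have h5 := hc0 5 (by decide)
  have h6 := hc0 6 (by decide)
  have h7 := hc2' 7
  simp [Fin.sum_univ_eight, cartanInvE8] at f2 f3
  have key : c = ![0, 0, 0, 0, 0, 0, 1, -2] := by
    have g0 : c 0 = 0 := by omega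
    have g2 : c 2 = 0 := by omega
    have g3 : c 3 = 0 := by omega
    have g4 : c 4 = 0 := by omega
    have g5 : c 5 = 0 := by omega
    have g7 : c 7 = -2 := by omega
    have g16 : c 1 + c 6 = 1 := by omega
    rw [g0, g2, g3, g4, g5, g7] at f3
    have g1 : c 1 = 0 := by
      rcases (show c 1 = 0 ∨ c 1 = 1 by omega) with h | h
      · exact h
      · have : c 6 = 0 := by omega
        rw [h, this] at f3
        norm_num at f3
    have g6 : c 6 = 1 := by omega
    funext i
    fin_cases i <;> simp [*]
  refine ⟨fun i => ?_, hxr', ?_⟩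
  · rw [ha]
    split_ifs <;> simp [*]
  · rw [hyr, key]
    simp [Fin.sum_univ_eight, cartanInvE8]

end EE8

/-! ### Explicit inner products for a dihedral pair. -/

/-- A basis `b` of a sublattice `√2 E₈` of the Leech lattice together with an isometry `g` of
order three, with explicitly given inner products. -/
structure IsDihedralFrame (b : Fin 8 → E24) (g : E24 ≃ₗᵢ[ℝ] E24) : Prop where
  mem : ∀ i, b i ∈ leechLattice
  gram : ∀ i j, inner ℝ (b i) (b j) = ((2 * CartanMatrix.E₈ i j : ℤ) : ℝ)
  map_mem : ∀ x ∈ leechLattice, g x ∈ leechLattice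
  cube : ∀ x, g (g (g x)) = x
  orbit_sum : ∀ i, b i + g (b i) + g (g (b i)) =
    (2 * (if i = 7 then 1 else 0) - CartanMatrix.E₈ i 7) • ∑ k, cartanInvE8 k 7 • b k -
      ((if i = 7 then 1 else 0) - 2 * CartanMatrix.E₈ i 7) • b 7
  inner_map : ∀ i j, inner ℝ (b i) (g (b j)) =
    (((2 * (if j = 7 then 1 else 0) - CartanMatrix.E₈ j 7) * (if i = 7 then 1 else 0) -
      ((if j = 7 then 1 else 0) - 2 * CartanMatrix.E₈ j 7) * CartanMatrix.E₈ i 7 -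
      CartanMatrix.E₈ i j : ℤ) : ℝ)
  map_eq_self : ∀ x, (∀ i, inner ℝ x (b i) = (0 : ℝ) ∧ inner ℝ x (g (b i)) = (0 : ℝ)) → g x = x

/-- Take the basis adapted to the fixed sublattice, spanned by r and s, and g = t_M t_N. The orbit
sum of b_j lies in that sublattice, so its products with r and s determine it. Moreover (b_i, g b_j)
= (b_i, g² b_j), because t_M negates b_i. Hence (b_i, g b_j) is half the difference of (b_i, orbit
sum of b_j) and (b_i, b_j). -/
theorem exists_dihedralFrame {M N : Submodule ℤ E24} (hM : M ≤ leechLattice)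
    (hN : N ≤ leechLattice) (hMN : IsDIHPair 3 14 M N) :
    ∃ b g, IsDihedralFrame b g ∧ ∀ x, (∀ m ∈ M ⊔ N, inner ℝ x m = (0 : ℝ)) ↔
      ∀ i, inner ℝ x (b i) = (0 : ℝ) ∧ inner ℝ x (g (b i)) = (0 : ℝ) := by
  obtain ⟨b₀, hb₀⟩ := hMN.left_isEE8.exists_basis
  obtain ⟨c, hc⟩ := hMN.right_isEE8.exists_basis
  obtain ⟨e⟩ := hMN.dihedral
  have hcube := mul_pow_three_of_closure_dihedral (latticeInvolution_mul_self M)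
    (latticeInvolution_mul_self N) hb₀.latticeInvolution_ne_one hc.latticeInvolution_ne_one e
  have hcube' : ∀ x, latticeInvolution M (latticeInvolution N (latticeInvolution M
      (latticeInvolution N (latticeInvolution M (latticeInvolution N x))))) = x := fun x =>
    congrArg (fun f : E24 ≃ₗᵢ[ℝ] E24 => f x) hcube
  have h3 : ∀ x, latticeInvolution M (latticeInvolution N (latticeInvolution M x)) =
      latticeInvolution N (latticeInvolution M (latticeInvolution N x)) := by
    intro x
    have h := hcube' (latticeInvolution N (latticeInvolution M (latticeInvolution N x)))
    rwa [latticeInvolution_apply_apply, latticeInvolution_apply_apply,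
      latticeInvolution_apply_apply] at h
  obtain ⟨r, s, hrs, hrr, hss, hrs2⟩ := exists_fixed_pair hb₀ hc hM hN h3 hMN.rank_eq
  have hr : r ∈ fixedSublattice M N := by
    rw [← hrs]; exact Submodule.subset_span ⟨0, rfl⟩
  have hs : s ∈ fixedSublattice M N := by
    rw [← hrs]; exact Submodule.subset_span ⟨1, rfl⟩
  obtain ⟨b, hb, hrb, hr', hs'⟩ := hb₀.exists_adapted hr.1 hs.1 hrr hss hrs2
  have hsb : ∀ i, inner ℝ s (b i) = -(2 * (CartanMatrix.E₈ i 7 : ℝ)) := by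
    intro i
    rw [hs', inner_neg_left, hb.gram, cartanE8_symm]
  let g : E24 ≃ₗᵢ[ℝ] E24 := (latticeInvolution N).trans (latticeInvolution M)
  have hg : ∀ x, g x = latticeInvolution M (latticeInvolution N x) := fun x => rfl
  have hgg : ∀ x ∈ M, g (g x) = -latticeInvolution N x := by
    intro x hx
    rw [hg, hg, h3, latticeInvolution_apply_apply, hb.neg_of_mem hx, map_neg]
  have hsum : ∀ i, b i + g (b i) + g (g (b i)) =
      (2 * (if i = 7 then 1 else 0) - CartanMatrix.E₈ i 7) • r +
        ((if i = 7 then 1 else 0) - 2 * CartanMatrix.E₈ i 7) • s := by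
    intro i
    have h1 := add_add_mem_fixedSublattice hb hc hM hN h3 (hb.mem i)
    have h2 := inner_add_add_eq hb hr (b i)
    have h4 := inner_add_add_eq hb hs (b i)
    rw [hgg _ (hb.mem i), ← sub_eq_add_neg, hg]
    rw [← hrs, Submodule.mem_span_range_iff_exists_fun] at h1
    obtain ⟨p, hp⟩ := h1
    simp only [Fin.sum_univ_two, Matrix.cons_val_zero, Matrix.cons_val_one] at hp
    rw [← hp] at h2 h4
    rw [← hp]
    rw [real_inner_comm r (b i), hrb] at h2
    rw [real_inner_comm s (b i), hsb] at h4
    rw [← Int.cast_smul_eq_zsmul ℝ, ← Int.cast_smul_eq_zsmul ℝ, inner_add_left,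
      real_inner_smul_left, real_inner_smul_left] at h2 h4
    rw [hrr, real_inner_comm r s, hrs2] at h2
    rw [hss, hrs2] at h4
    have e0 : p 0 = 2 * (if i = 7 then 1 else 0) - CartanMatrix.E₈ i 7 := by
      have : (p 0 : ℝ) = ((2 * (if i = 7 then 1 else 0) - CartanMatrix.E₈ i 7 : ℤ) : ℝ) := by
        push_cast
        split_ifs at h2 ⊢ <;> linarith
      exact_mod_cast this
    have e1 : p 1 = (if i = 7 then 1 else 0) - 2 * CartanMatrix.E₈ i 7 := by
      have : (p 1 : ℝ) = (((if i = 7 then 1 else 0) - 2 * CartanMatrix.E₈ i 7 : ℤ) : ℝ) := by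
        push_cast
        split_ifs at h2 ⊢ <;> linarith
      exact_mod_cast this
    rw [e0, e1]
  have hperp : ∀ x, (∀ m ∈ M ⊔ N, inner ℝ x m = (0 : ℝ)) →
      latticeInvolution M x = x ∧ latticeInvolution N x = x := by
    intro x hx
    constructor
    · rw [hb.latticeInvolution_apply, sub_eq_self]
      refine Finset.sum_eq_zero fun i _ => ?_
      rw [Finset.sum_eq_zero fun j _ => by
        rw [hx _ (Submodule.mem_sup_left (hb.mem j)), mul_zero], zero_smul]
    · rw [hc.latticeInvolution_apply, sub_eq_self]
      refine Finset.sum_eq_zero fun i _ => ?_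
      rw [Finset.sum_eq_zero fun j _ => by
        rw [hx _ (Submodule.mem_sup_right (hc.mem j)), mul_zero], zero_smul]
  have hiff : ∀ x, (∀ m ∈ M ⊔ N, inner ℝ x m = (0 : ℝ)) ↔
      ∀ i, inner ℝ x (b i) = (0 : ℝ) ∧ inner ℝ x (g (b i)) = (0 : ℝ) := by
    intro x
    constructor
    · intro hx i
      obtain ⟨h1, h2⟩ := hperp x hx
      refine ⟨hx _ (Submodule.mem_sup_left (hb.mem i)), ?_⟩
      rw [hg, ← inner_latticeInvolution, h1, ← inner_latticeInvolution, h2]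
      exact hx _ (Submodule.mem_sup_left (hb.mem i))
    · intro hx
      have hxM : ∀ m ∈ M, inner ℝ x m = (0 : ℝ) := by
        intro m hm
        obtain ⟨a, rfl⟩ := (hb.mem_iff m).1 hm
        rw [inner_sum]
        refine Finset.sum_eq_zero fun i _ => ?_
        rw [← Int.cast_smul_eq_zsmul ℝ, real_inner_smul_right, (hx i).1, mul_zero]
      have hxg : ∀ m ∈ M, inner ℝ x (g m) = (0 : ℝ) := by
        intro m hm
        obtain ⟨a, rfl⟩ := (hb.mem_iff m).1 hm
        rw [map_sum, inner_sum]
        refine Finset.sum_eq_zero fun i _ => ?_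
        rw [← Int.cast_smul_eq_zsmul ℝ, map_smul, real_inner_smul_right, (hx i).2, mul_zero]
      have hxgg : ∀ m ∈ M, inner ℝ x (g (g m)) = (0 : ℝ) := by
        intro m hm
        have h1 := hxM _ (add_add_mem_fixedSublattice hb hc hM hN h3 hm).1
        rw [sub_eq_add_neg, ← hgg m hm, ← hg, inner_add_right, inner_add_right, hxM m hm,
          hxg m hm] at h1
        linarith
      have hxN : ∀ n ∈ N, inner ℝ x n = (0 : ℝ) := by
        intro n hn
        -- Here n + g n = n - t_M n. Since x is orthogonal to M, gM and g²M, it is orthogonal to n +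
        -- gn, gn + g²n and g²n + n, hence to n.
        have h1 : n + g n ∈ M := by
          rw [hg, hc.neg_of_mem hn, map_neg, ← sub_eq_add_neg]
          exact hb.sub_mem hM (hN hn)
        have h2 := hxM _ h1
        have h4 := hxg _ h1
        have h5 := hxgg _ h1
        rw [map_add, inner_add_right] at h4
        rw [map_add, map_add, show g (g (g n)) = n from hcube' n, inner_add_right] at h5
        rw [inner_add_right] at h2
        linarith
      intro m hm
      obtain ⟨y, hy, z, hz, rfl⟩ := Submodule.mem_sup.1 hm
      rw [inner_add_right, hxM y hy, hxN z hz, add_zero]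
  refine ⟨b, g, ⟨fun i => hM (hb.mem i), fun i j => ?_, fun x hx => ?_, hcube', fun i => ?_,
    fun i j => ?_, fun x hx => ?_⟩, hiff⟩
  · rw [hb.gram]
    push_cast
    rfl
  · exact hb.latticeInvolution_mem hM (hc.latticeInvolution_mem hN hx)
  · rw [hsum, ← hr', hs']
    module
  · have h1 := congrArg (fun v => inner ℝ (b i) v) (hsum j)
    simp only [← Int.cast_smul_eq_zsmul ℝ, inner_add_right, real_inner_smul_right] at h1
    have h2 : inner ℝ (b i) (g (b j)) = -inner ℝ (b i) (latticeInvolution N (b j)) := by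
      rw [hg, ← inner_latticeInvolution, hb.neg_of_mem (hb.mem i), inner_neg_left]
    have h4 : inner ℝ (b i) (g (g (b j))) = inner ℝ (b i) (g (b j)) := by
      rw [hgg _ (hb.mem j), h2, inner_neg_right]
    rw [h4, hb.gram, real_inner_comm r (b i), real_inner_comm s (b i), hrb, hsb] at h1
    push_cast at h1 ⊢
    split_ifs at h1 ⊢ <;> linarith
  · obtain ⟨h1, h2⟩ := hperp x ((hiff x).2 hx)
    rw [hg, h2, h1]

/-! ### Six orthogonal minimal vectors -/

/-- Integral combinations of the vectors `b k` and `g (b k)`. -/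
noncomputable def frameComb (b : Fin 8 → E24) (g : E24 ≃ₗᵢ[ℝ] E24) :
    (Fin 8 → ℤ) × (Fin 8 → ℤ) →ₗ[ℤ] E24 :=
  AddMonoidHom.toIntLinearMap
    { toFun := fun v => ∑ k, (v.1 k • b k + v.2 k • g (b k))
      map_zero' := by simp
      map_add' := by
        intro v w
        rw [← Finset.sum_add_distrib]
        refine Finset.sum_congr rfl fun k _ => ?_
        rw [Prod.fst_add, Prod.snd_add, Pi.add_apply, Pi.add_apply, add_smul, add_smul]
        abel }

theorem frameComb_apply (b : Fin 8 → E24) (g : E24 ≃ₗᵢ[ℝ] E24) (v : (Fin 8 → ℤ) × (Fin 8 → ℤ)) :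
    frameComb b g v = ∑ k, (v.1 k • b k + v.2 k • g (b k)) := rfl

/-- The inner products of the vectors `b i` and `g (b j)`. -/
def crossGram (i j : Fin 8) : ℤ :=
  (2 * (if j = 7 then 1 else 0) - CartanMatrix.E₈ j 7) * (if i = 7 then 1 else 0) -
    ((if j = 7 then 1 else 0) - 2 * CartanMatrix.E₈ j 7) * CartanMatrix.E₈ i 7 -
    CartanMatrix.E₈ i j

/-- The inner product of integral combinations. -/
def frameInner (v w : (Fin 8 → ℤ) × (Fin 8 → ℤ)) : ℤ :=
  ∑ i, ∑ j, ((v.1 i * w.1 j + v.2 i * w.2 j) * (2 * CartanMatrix.E₈ i j) +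
    (v.1 i * w.2 j + v.2 i * w.1 j) * crossGram i j)

/-- The coefficients of the sum over the orbit of `b i` under `g`. -/
def orbitCoeff (i k : Fin 8) : ℤ :=
  (2 * (if i = 7 then 1 else 0) - CartanMatrix.E₈ i 7) * cartanInvE8 k 7 -
    ((if i = 7 then 1 else 0) - 2 * CartanMatrix.E₈ i 7) * (if k = 7 then 1 else 0)

/-- The action of `g` on integral combinations. -/
def frameMap (v : (Fin 8 → ℤ) × (Fin 8 → ℤ)) : (Fin 8 → ℤ) × (Fin 8 → ℤ) :=
  (fun k => -v.2 k + ∑ i, v.2 i * orbitCoeff i k, fun k => v.1 k - v.2 k)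

theorem crossGram_symm (i j : Fin 8) : crossGram i j = crossGram j i := by
  rw [crossGram, crossGram, cartanE8_symm i j]
  ring

namespace IsDihedralFrame

variable {b : Fin 8 → E24} {g : E24 ≃ₗᵢ[ℝ] E24} (h : IsDihedralFrame b g)
include h

theorem frameComb_mem (v : (Fin 8 → ℤ) × (Fin 8 → ℤ)) : frameComb b g v ∈ leechLattice := by
  rw [frameComb_apply]
  exact Submodule.sum_mem _ fun k _ => Submodule.add_mem _ (Submodule.smul_mem _ _ (h.mem k))
    (Submodule.smul_mem _ _ (h.map_mem _ (h.mem k)))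

theorem inner_frameComb (v w : (Fin 8 → ℤ) × (Fin 8 → ℤ)) :
    inner ℝ (frameComb b g v) (frameComb b g w) = (frameInner v w : ℝ) := by
  rw [frameComb_apply, frameComb_apply, sum_inner, frameInner, Int.cast_sum]
  refine Finset.sum_congr rfl fun i _ => ?_
  rw [inner_sum, Int.cast_sum]
  refine Finset.sum_congr rfl fun j _ => ?_
  have h1 : inner ℝ (b i) (g (b j)) = (crossGram i j : ℝ) := h.inner_map i j
  have h2 : inner ℝ (g (b i)) (b j) = (crossGram i j : ℝ) := by
    rw [real_inner_comm, crossGram_symm]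
    exact h.inner_map j i
  simp only [← Int.cast_smul_eq_zsmul ℝ, inner_add_left, inner_add_right, real_inner_smul_left,
    real_inner_smul_right, LinearIsometryEquiv.inner_map_map, h.gram, h1, h2]
  push_cast
  ring

/-- Sixteen generators span a lattice of rank 14, so coefficients are not unique. By definiteness of
the ambient form, a difference of norm zero proves equality; this turns every vector identity below
into an integer computation. -/
theorem frameComb_eq {v w : (Fin 8 → ℤ) × (Fin 8 → ℤ)} (hvw : frameInner (v - w) (v - w) = 0) :
    frameComb b g v = frameComb b g w := by
  have h1 := h.inner_frameComb (v - w) (v - w)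
  rw [hvw, Int.cast_zero, inner_self_eq_zero, map_sub] at h1
  exact sub_eq_zero.1 h1

theorem map_frameComb (v : (Fin 8 → ℤ) × (Fin 8 → ℤ)) :
    g (frameComb b g v) = frameComb b g (frameMap v) := by
  have h1 : ∀ i, g (g (b i)) = -b i - g (b i) + ∑ k, orbitCoeff i k • b k := by
    intro i
    have h2 : ∑ k, orbitCoeff i k • b k = b i + g (b i) + g (g (b i)) := by
      rw [h.orbit_sum i, Finset.smul_sum]
      simp only [orbitCoeff, sub_smul (_ * _), Finset.sum_sub_distrib, mul_smul]
      congr 1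
      rw [← Finset.smul_sum]
      congr 1
      simp
    rw [h2]
    abel
  have h3 : ∀ k, g (v.1 k • b k + v.2 k • g (b k)) =
      (-v.2 k) • b k + (v.1 k - v.2 k) • g (b k) + ∑ l, (v.2 k * orbitCoeff k l) • b l := by
    intro k
    rw [map_add, map_zsmul, map_zsmul, h1, smul_add, Finset.smul_sum]
    simp only [mul_smul]
    module
  rw [frameComb_apply, frameComb_apply, map_sum, Finset.sum_congr rfl fun k _ => h3 k,
    Finset.sum_add_distrib, Finset.sum_comm, ← Finset.sum_add_distrib]
  refine Finset.sum_congr rfl fun k _ => ?_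
  rw [← Finset.sum_smul]
  simp only [frameMap]
  module

end IsDihedralFrame

/-- Coefficients of six orthogonal minimal vectors. -/
def hexaCoeff : Fin 6 → (Fin 8 → ℤ) × (Fin 8 → ℤ) :=
  ![(![0, -1, 0, 0, 0, 0, 0, 0], 0), (![0, 0, -1, 0, 0, 0, 0, 0], 0),
    (![0, 0, 0, 0, -1, 0, 0, 0], 0), (![0, 1, 1, 2, 1, 0, 0, 0], 0),
    (![2, 4, 5, 8, 7, 6, 4, 0], ![-4, -5, -7, -10, -8, -6, -4, 0]),
    (![-2, -3, -4, -6, -5, -4, -4, 0], ![4, 5, 7, 10, 8, 6, 4, 0])]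

/-- Coefficients of the highest root. -/
def highestCoeff : (Fin 8 → ℤ) × (Fin 8 → ℤ) := (![2, 3, 4, 6, 5, 4, 3, 2], 0)

/-- Coefficients of the basis vectors. -/
def unitCoeff (k : Fin 8) : (Fin 8 → ℤ) × (Fin 8 → ℤ) := (Pi.single k 1, 0)

/-- Six orthogonal minimal vectors `f i` of the Leech lattice, whose multiples by `ℤ[g]` are glued
along the hexacode, and three vectors `r`, `s`, `t` related to the orthogonal complement. -/
structure IsHexaFrame (g : E24 ≃ₗᵢ[ℝ] E24) (f : Fin 6 → E24) (r s t : E24) : Prop where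
  map_mem : ∀ x ∈ leechLattice, g x ∈ leechLattice
  cube : ∀ x, g (g (g x)) = x
  mem : ∀ i, f i ∈ leechLattice
  gram : ∀ i j, inner ℝ (f i) (f j) = if i = j then (4 : ℝ) else 0
  inner_map : ∀ i j, inner ℝ (f i) (g (f j)) = if i = j then (-2 : ℝ) else 0
  map_map : ∀ i, g (g (f i)) = -f i - g (f i)
  glue₁ : (1 / 2 : ℝ) • (f 0 + f 1 + f 2 + f 3) ∈ leechLattice
  glue₂ : (1 / 2 : ℝ) • (f 2 + f 3 + f 4 + f 5) ∈ leechLattice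
  glue₃ : (1 / 2 : ℝ) • (f 1 + f 3 + g (f 4) + g (g (f 5))) ∈ leechLattice
  left_mem : r ∈ leechLattice
  right_mem : s ∈ leechLattice
  extra_mem : t ∈ leechLattice
  norm_left : inner ℝ r r = (4 : ℝ)
  norm_right : inner ℝ s s = (4 : ℝ)
  inner_left_right : inner ℝ r s = (-2 : ℝ)
  inner_left : ∀ i, inner ℝ r (f i) = (0 : ℝ) ∧ inner ℝ r (g (f i)) = (0 : ℝ)
  inner_right : ∀ i, inner ℝ s (f i) = (0 : ℝ) ∧ inner ℝ s (g (f i)) = (0 : ℝ)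
  inner_extra : ∀ x, (∀ i, inner ℝ x (f i) = (0 : ℝ) ∧ inner ℝ x (g (f i)) = (0 : ℝ)) →
    3 * inner ℝ x t = inner ℝ x r + 2 * inner ℝ x s
  map_eq_self : ∀ x, (∀ i, inner ℝ x (f i) = (0 : ℝ) ∧ inner ℝ x (g (f i)) = (0 : ℝ)) → g x = x

namespace IsDihedralFrame

variable {b : Fin 8 → E24} {g : E24 ≃ₗᵢ[ℝ] E24} (h : IsDihedralFrame b g)
include h

theorem frameComb_unitCoeff (k : Fin 8) : frameComb b g (unitCoeff k) = b k := by
  rw [frameComb_apply, Finset.sum_eq_single k]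
  · simp [unitCoeff]
  · intro i _ hi
    simp [unitCoeff, hi]
  · simp

theorem half_smul_mem {v w : (Fin 8 → ℤ) × (Fin 8 → ℤ)}
    (hvw : frameInner (w - (2 : ℤ) • v) (w - (2 : ℤ) • v) = 0) :
    (1 / 2 : ℝ) • frameComb b g w ∈ leechLattice := by
  rw [h.frameComb_eq hvw, map_smul, ← Int.cast_smul_eq_zsmul ℝ, smul_smul]
  norm_num
  exact h.frameComb_mem v

/-- This expands b_k in the mutually orthogonal planes of f_i, g f_i and of the highest root and
b_7. Their Gram matrices have diagonal 4 and off-diagonal entry -2 or 2, with inverse (1/6) times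
the matrix of diagonal 2 and off-diagonal entry 1 or -1. -/
theorem inner_hexa (x : E24) (k : Fin 8) : 6 * inner ℝ x (b k) =
    ∑ i, (((2 * frameInner (unitCoeff k) (hexaCoeff i) +
          frameInner (unitCoeff k) (frameMap (hexaCoeff i)) : ℤ) : ℝ) *
          inner ℝ x (frameComb b g (hexaCoeff i)) +
        ((frameInner (unitCoeff k) (hexaCoeff i) +
          2 * frameInner (unitCoeff k) (frameMap (hexaCoeff i)) : ℤ) : ℝ) *
          inner ℝ x (g (frameComb b g (hexaCoeff i)))) +
      ((2 * frameInner (unitCoeff k) highestCoeff - frameInner (unitCoeff k) (unitCoeff 7) : ℤ) : ℝ) *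
        inner ℝ x (frameComb b g highestCoeff) +
      ((2 * frameInner (unitCoeff k) (unitCoeff 7) - frameInner (unitCoeff k) highestCoeff : ℤ) : ℝ) *
        inner ℝ x (b 7) := by
  let w : (Fin 8 → ℤ) × (Fin 8 → ℤ) :=
    ∑ i, ((2 * frameInner (unitCoeff k) (hexaCoeff i) +
          frameInner (unitCoeff k) (frameMap (hexaCoeff i))) • hexaCoeff i +
        (frameInner (unitCoeff k) (hexaCoeff i) +
          2 * frameInner (unitCoeff k) (frameMap (hexaCoeff i))) • frameMap (hexaCoeff i)) +
      (2 * frameInner (unitCoeff k) highestCoeff - frameInner (unitCoeff k) (unitCoeff 7)) •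
        highestCoeff +
      (2 * frameInner (unitCoeff k) (unitCoeff 7) - frameInner (unitCoeff k) highestCoeff) •
        unitCoeff 7
  have h1 : frameComb b g ((6 : ℤ) • unitCoeff k) = frameComb b g w := by
    refine h.frameComb_eq ?_
    revert k
    decide +kernel
  have h2 := congrArg (fun v => inner ℝ x v) h1
  simp only [w, map_add, map_sum, map_smul, h.frameComb_unitCoeff] at h2
  simp only [← h.map_frameComb, ← Int.cast_smul_eq_zsmul ℝ, inner_add_right, inner_sum,
    real_inner_smul_right] at h2
  exact_mod_cast h2

theorem map_highest : g (frameComb b g highestCoeff) = frameComb b g highestCoeff := by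
  rw [h.map_frameComb]
  exact h.frameComb_eq (by decide +kernel)

theorem map_b7 : g (b 7) = b 7 := by
  rw [← h.frameComb_unitCoeff, h.map_frameComb]
  exact h.frameComb_eq (by decide +kernel)

theorem inner_highest (i : Fin 6) :
    inner ℝ (frameComb b g highestCoeff) (frameComb b g (hexaCoeff i)) = (0 : ℝ) ∧
      inner ℝ (frameComb b g highestCoeff) (g (frameComb b g (hexaCoeff i))) = (0 : ℝ) := by
  constructor
  · rw [h.inner_frameComb, show frameInner highestCoeff (hexaCoeff i) = 0 by
      revert i; decide +kernel, Int.cast_zero]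
  · rw [h.map_frameComb, h.inner_frameComb,
      show frameInner highestCoeff (frameMap (hexaCoeff i)) = 0 by revert i; decide +kernel,
      Int.cast_zero]

theorem inner_b7 (i : Fin 6) :
    inner ℝ (b 7) (frameComb b g (hexaCoeff i)) = (0 : ℝ) ∧
      inner ℝ (b 7) (g (frameComb b g (hexaCoeff i))) = (0 : ℝ) := by
  have hb7 := h.frameComb_unitCoeff 7
  constructor
  · rw [← hb7, h.inner_frameComb, show frameInner (unitCoeff 7) (hexaCoeff i) = 0 by
      revert i; decide +kernel, Int.cast_zero]
  · rw [← hb7, h.map_frameComb, h.inner_frameComb,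
      show frameInner (unitCoeff 7) (frameMap (hexaCoeff i)) = 0 by revert i; decide +kernel,
      Int.cast_zero]

theorem perp_iff {x : E24} :
    (∀ i, inner ℝ x (b i) = (0 : ℝ) ∧ inner ℝ x (g (b i)) = (0 : ℝ)) ↔
      (∀ i, inner ℝ x (frameComb b g (hexaCoeff i)) = (0 : ℝ) ∧
        inner ℝ x (g (frameComb b g (hexaCoeff i))) = (0 : ℝ)) ∧
      inner ℝ x (frameComb b g highestCoeff) = (0 : ℝ) ∧ inner ℝ x (b 7) = (0 : ℝ) := by
  constructor
  · intro hx
    have h1 : ∀ v, inner ℝ x (frameComb b g v) = (0 : ℝ) := by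
      intro v
      rw [frameComb_apply, inner_sum]
      refine Finset.sum_eq_zero fun i _ => ?_
      rw [← Int.cast_smul_eq_zsmul ℝ, ← Int.cast_smul_eq_zsmul ℝ, inner_add_right,
        real_inner_smul_right, real_inner_smul_right, (hx i).1, (hx i).2, mul_zero, mul_zero,
        add_zero]
    exact ⟨fun i => ⟨h1 _, by rw [h.map_frameComb, h1]⟩, h1 _, (hx 7).1⟩
  · have key : ∀ x : E24, (∀ i, inner ℝ x (frameComb b g (hexaCoeff i)) = (0 : ℝ) ∧
        inner ℝ x (g (frameComb b g (hexaCoeff i))) = (0 : ℝ)) →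
        inner ℝ x (frameComb b g highestCoeff) = (0 : ℝ) → inner ℝ x (b 7) = (0 : ℝ) →
        ∀ k, inner ℝ x (b k) = (0 : ℝ) := by
      intro x hx hr hs k
      have h1 := h.inner_hexa x k
      rw [Finset.sum_eq_zero fun i _ => by rw [(hx i).1, (hx i).2, mul_zero, mul_zero,
        add_zero], hr, hs] at h1
      linarith
    rintro ⟨hx, hr, hs⟩ k
    refine ⟨key x hx hr hs k, ?_⟩
    -- As g has order three, products of x with g b_k are products of g²x with b_k, so the first
    -- case applied to g²x gives the second.
    have hgg : ∀ y, inner ℝ (g (g x)) y = inner ℝ x (g y) := fun y => by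
      rw [← LinearIsometryEquiv.inner_map_map g, h.cube]
    rw [← hgg]
    refine key _ (fun i => ?_) ?_ ?_ k
    · rw [hgg, hgg]
      refine ⟨(hx i).2, ?_⟩
      have h2 : g (g (frameComb b g (hexaCoeff i))) =
          -frameComb b g (hexaCoeff i) - g (frameComb b g (hexaCoeff i)) := by
        rw [h.map_frameComb, h.map_frameComb, ← map_neg, ← map_sub]
        refine h.frameComb_eq ?_
        revert i
        decide +kernel
      rw [h2, inner_sub_right, inner_neg_right, (hx i).1, (hx i).2]
      norm_num
    · rw [hgg, h.map_highest, hr]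
    · rw [hgg, h.map_b7, hs]

theorem isHexaFrame : IsHexaFrame g (fun i => frameComb b g (hexaCoeff i))
    (frameComb b g highestCoeff) (-b 7) (b 6) := by
  have hb7 := h.frameComb_unitCoeff 7
  have hin : ∀ x, (∀ i, inner ℝ x (frameComb b g (hexaCoeff i)) = (0 : ℝ) ∧
      inner ℝ x (g (frameComb b g (hexaCoeff i))) = (0 : ℝ)) → ∀ k, 6 * inner ℝ x (b k) =
      ((2 * frameInner (unitCoeff k) highestCoeff - frameInner (unitCoeff k) (unitCoeff 7) : ℤ) : ℝ) *
        inner ℝ x (frameComb b g highestCoeff) +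
      ((2 * frameInner (unitCoeff k) (unitCoeff 7) - frameInner (unitCoeff k) highestCoeff : ℤ) : ℝ) *
        inner ℝ x (b 7) := by
    intro x hx k
    rw [h.inner_hexa, Finset.sum_eq_zero fun i _ => by rw [(hx i).1, (hx i).2, mul_zero, mul_zero,
      add_zero], zero_add]
  refine ⟨h.map_mem, h.cube, fun i => h.frameComb_mem _, fun i j => ?_, fun i j => ?_, fun i => ?_,
    ?_, ?_, ?_, h.frameComb_mem _, Submodule.neg_mem _ (h.mem 7), h.mem 6, ?_, ?_, ?_,
    fun i => ⟨?_, ?_⟩, fun i => ⟨?_, ?_⟩, fun x hx => ?_, fun x hx => ?_⟩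
  · rw [h.inner_frameComb, show frameInner (hexaCoeff i) (hexaCoeff j) = if i = j then 4 else 0 by
      revert i j; decide +kernel]
    split_ifs <;> norm_num
  · rw [h.map_frameComb, h.inner_frameComb, show frameInner (hexaCoeff i) (frameMap (hexaCoeff j)) =
      if i = j then -2 else 0 by revert i j; decide +kernel]
    split_ifs <;> norm_num
  · rw [h.map_frameComb, h.map_frameComb, ← map_neg, ← map_sub]
    refine h.frameComb_eq ?_
    revert i
    decide +kernel
  · simp only [← map_add]
    exact h.half_smul_mem (v := unitCoeff 3) (by decide +kernel)
  · simp only [← map_add]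
    exact h.half_smul_mem (v := unitCoeff 5 + hexaCoeff 3) (by decide +kernel)
  · simp only [h.map_frameComb, ← map_add]
    exact h.half_smul_mem (v := (![-11, -17, -23, -34, -29, -24, -18, 0],
      ![12, 18, 24, 36, 30, 24, 18, 0])) (by decide +kernel)
  · rw [h.inner_frameComb, show frameInner highestCoeff highestCoeff = 4 by decide +kernel]
    norm_num
  · rw [inner_neg_neg, h.gram, cartanE8_diag]
    norm_num
  · rw [← hb7, inner_neg_right, h.inner_frameComb,
      show frameInner highestCoeff (unitCoeff 7) = 2 by decide +kernel]
    norm_num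
  · exact (h.inner_highest i).1
  · exact (h.inner_highest i).2
  · rw [inner_neg_left, (h.inner_b7 i).1, neg_zero]
  · rw [inner_neg_left, (h.inner_b7 i).2, neg_zero]
  · have h1 := hin x hx 6
    rw [show 2 * frameInner (unitCoeff 6) highestCoeff - frameInner (unitCoeff 6) (unitCoeff 7) = 2
      by decide +kernel, show 2 * frameInner (unitCoeff 6) (unitCoeff 7) -
      frameInner (unitCoeff 6) highestCoeff = -4 by decide +kernel] at h1
    push_cast at h1
    rw [inner_neg_right]
    linarith
  · have hr := h.map_highest
    have hs := h.map_b7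
    have e1 : inner ℝ (frameComb b g highestCoeff) (frameComb b g highestCoeff) = (4 : ℝ) := by
      rw [h.inner_frameComb, show frameInner highestCoeff highestCoeff = 4 by decide +kernel]
      norm_num
    have e2 : inner ℝ (frameComb b g highestCoeff) (b 7) = (2 : ℝ) := by
      rw [← hb7, h.inner_frameComb, show frameInner highestCoeff (unitCoeff 7) = 2 by
        decide +kernel]
      norm_num
    have e3 : inner ℝ (b 7) (frameComb b g highestCoeff) = (2 : ℝ) := by rw [real_inner_comm, e2]
    have e4 : inner ℝ (b 7) (b 7) = (4 : ℝ) := by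
      rw [h.gram, cartanE8_diag]
      norm_num
    have key := h.map_eq_self (x -
      ((2 * inner ℝ x (frameComb b g highestCoeff) - inner ℝ x (b 7)) / 6 : ℝ) •
        frameComb b g highestCoeff -
      ((2 * inner ℝ x (b 7) - inner ℝ x (frameComb b g highestCoeff)) / 6 : ℝ) • b 7)
      (h.perp_iff.2 ⟨fun i => ?_, ?_, ?_⟩)
    · rw [map_sub, map_sub, map_smul, map_smul, hr, hs] at key
      simpa using key
    · obtain ⟨a1, a2⟩ := h.inner_highest i
      obtain ⟨a3, a4⟩ := h.inner_b7 i
      constructor <;> simp only [inner_sub_left, real_inner_smul_left, a1, a2, a3, a4, hx i] <;>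
        ring
    · simp only [inner_sub_left, real_inner_smul_left, e1, e3]
      ring
    · simp only [inner_sub_left, real_inner_smul_left, e2, e4]
      ring

end IsDihedralFrame

theorem exists_hexaFrame {M N : Submodule ℤ E24} (hM : M ≤ leechLattice)
    (hN : N ≤ leechLattice) (hMN : IsDIHPair 3 14 M N) :
    ∃ g f r s t, IsHexaFrame g f r s t ∧ ∀ x, (∀ m ∈ M ⊔ N, inner ℝ x m = (0 : ℝ)) ↔
      (∀ i, inner ℝ x (f i) = (0 : ℝ) ∧ inner ℝ x (g (f i)) = (0 : ℝ)) ∧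
        inner ℝ x r = (0 : ℝ) ∧ inner ℝ x s = (0 : ℝ) := by
  obtain ⟨b, g, h, hperp⟩ := exists_dihedralFrame hM hN hMN
  refine ⟨g, _, _, _, _, h.isHexaFrame, fun x => ?_⟩
  rw [hperp, h.perp_iff, inner_neg_right, neg_eq_zero]

/-! ### The lattice glued along the hexacode -/

/-- `x + y ω` reduces to a word of the hexacode modulo `2`. -/
structure InHexacode (x y : Fin 6 → ℤ) : Prop where
  left_three : 2 ∣ x 3 - (x 0 + x 1 + x 2)
  right_three : 2 ∣ y 3 - (y 0 + y 1 + y 2)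
  left_four : 2 ∣ x 4 - (x 0 + x 2 - y 0 - y 1)
  right_four : 2 ∣ y 4 - (y 2 + x 0 + x 1 - y 1)
  left_five : 2 ∣ x 5 - (x 2 + y 0 + y 1 - x 1)
  right_five : 2 ∣ y 5 - (y 0 + y 2 - x 0 - x 1)

/-- The norm of `x + y ω`. -/
def eisensteinNorm (x y : Fin 6 → ℤ) : ℤ := ∑ i, (x i * x i + y i * y i - x i * y i)

/-- Half of a linear combination of the vectors `f i` and `g (f i)`. -/
noncomputable def hexaComb (g : E24 ≃ₗᵢ[ℝ] E24) (f : Fin 6 → E24) (x y : Fin 6 → ℤ) : E24 :=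
  (1 / 2 : ℝ) • ∑ i, ((x i : ℝ) • f i + (y i : ℝ) • g (f i))

/-- The span of the vectors `f i` and `g (f i)`. -/
def hexaSpan (g : E24 ≃ₗᵢ[ℝ] E24) (f : Fin 6 → E24) : Submodule ℝ E24 :=
  Submodule.span ℝ (Set.range (Sum.elim f fun i => g (f i)))

theorem mem_hexaSpan_orthogonal {g : E24 ≃ₗᵢ[ℝ] E24} {f : Fin 6 → E24} {x : E24} :
    x ∈ (hexaSpan g f)ᗮ ↔ ∀ i, inner ℝ x (f i) = (0 : ℝ) ∧ inner ℝ x (g (f i)) = (0 : ℝ) := by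
  rw [Submodule.mem_orthogonal']
  constructor
  · intro h i
    exact ⟨h _ (Submodule.subset_span ⟨Sum.inl i, rfl⟩), h _ (Submodule.subset_span ⟨Sum.inr i, rfl⟩)⟩
  · intro h u hu
    induction hu using Submodule.span_induction with
    | mem u hu =>
      obtain ⟨i | i, rfl⟩ := hu
      · exact (h i).1
      · exact (h i).2
    | zero => exact inner_zero_right _
    | add u v _ _ hu hv => rw [inner_add_right, hu, hv, add_zero]
    | smul c u _ hu => rw [real_inner_smul_right, hu, mul_zero]

/-- The vector of the span of the `f i` and `g (f i)` with given inner products. -/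
noncomputable def hexaDual (g : E24 ≃ₗᵢ[ℝ] E24) (f : Fin 6 → E24) (m n : Fin 6 → ℝ) : E24 :=
  ∑ i, (((2 * m i + n i) / 6) • f i + ((m i + 2 * n i) / 6) • g (f i))

/-- The hexacode words have few zeros and nonzeros in common with any prescribed set. -/
theorem exists_hexacode_support (S : Fin 6 → Bool) : ∃ a b : Fin 3 → Fin 2,
    let x : Fin 6 → ℕ := ![a 0, a 1, a 2, a 0 + a 1 + a 2, a 0 + a 2 + b 0 + b 1,
      a 2 + b 0 + b 1 + a 1]
    let y : Fin 6 → ℕ := ![b 0, b 1, b 2, b 0 + b 1 + b 2, b 2 + a 0 + a 1 + b 1,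
      b 0 + b 2 + a 0 + a 1]
    ∑ i, (if x i % 2 = 0 ∧ y i % 2 = 0 then (if S i then 4 else 0) else (if S i then 1 else 3)) ≤
      8 := by
  revert S
  decide +kernel

/-- Representatives of smallest norm modulo `2 (1 - ω)`. -/
theorem exists_eisenstein_lift (x y c : ℤ) : ∃ x' y' : ℤ, 2 ∣ x' - x ∧ 2 ∣ y' - y ∧
    3 ∣ x' + y' - c ∧ x' * x' + y' * y' - x' * y' =
      if 2 ∣ x ∧ 2 ∣ y then (if 3 ∣ c then 0 else 4) else (if 3 ∣ c then 3 else 1) := by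
  rcases (show 3 ∣ c ∨ 3 ∣ c - 1 ∨ 3 ∣ c + 1 by omega) with hc | hc | hc <;>
    rcases (show 2 ∣ x ∨ 2 ∣ x - 1 by omega) with hx | hx <;>
    rcases (show 2 ∣ y ∨ 2 ∣ y - 1 by omega) with hy | hy
  · exact ⟨0, 0, by omega, by omega, by omega, by simp [hx, hy, hc]⟩
  · exact ⟨2, 1, by omega, by omega, by omega, by
      rw [if_neg (by omega), if_pos hc]; norm_num⟩
  · exact ⟨1, 2, by omega, by omega, by omega, by
      rw [if_neg (by omega), if_pos hc]; norm_num⟩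
  · exact ⟨1, -1, by omega, by omega, by omega, by
      rw [if_neg (by omega), if_pos hc]; norm_num⟩
  · exact ⟨-2, 0, by omega, by omega, by omega, by
      rw [if_pos ⟨hx, hy⟩, if_neg (by omega)]; norm_num⟩
  · exact ⟨0, 1, by omega, by omega, by omega, by
      rw [if_neg (by omega), if_neg (by omega)]; norm_num⟩
  · exact ⟨1, 0, by omega, by omega, by omega, by
      rw [if_neg (by omega), if_neg (by omega)]; norm_num⟩
  · exact ⟨-1, -1, by omega, by omega, by omega, by
      rw [if_neg (by omega), if_neg (by omega)]; norm_num⟩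
  · exact ⟨2, 0, by omega, by omega, by omega, by
      rw [if_pos ⟨hx, hy⟩, if_neg (by omega)]; norm_num⟩
  · exact ⟨0, -1, by omega, by omega, by omega, by
      rw [if_neg (by omega), if_neg (by omega)]; norm_num⟩
  · exact ⟨-1, 0, by omega, by omega, by omega, by
      rw [if_neg (by omega), if_neg (by omega)]; norm_num⟩
  · exact ⟨1, 1, by omega, by omega, by omega, by
      rw [if_neg (by omega), if_neg (by omega)]; norm_num⟩

/-- Every residue class modulo `1 - ω` contains a vector of norm at most `8`. -/
theorem exists_hexacode_lift (c : Fin 6 → ℤ) :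
    ∃ x y, InHexacode x y ∧ (∀ i, 3 ∣ x i + y i - c i) ∧ eisensteinNorm x y ≤ 8 := by
  -- The costs 0, 4, 3, 1 in `exists_hexacode_support` are the smallest norms of a coordinate with
  -- given residues modulo 2 and modulo 1 - ω; the set S records where the second residue is
  -- nonzero.
  obtain ⟨a, b, hab⟩ := exists_hexacode_support fun i => decide ¬ 3 ∣ c i
  set X : Fin 6 → ℕ := ![a 0, a 1, a 2, a 0 + a 1 + a 2, a 0 + a 2 + b 0 + b 1,
      a 2 + b 0 + b 1 + a 1] with hX
  set Y : Fin 6 → ℕ := ![b 0, b 1, b 2, b 0 + b 1 + b 2, b 2 + a 0 + a 1 + b 1,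
      b 0 + b 2 + a 0 + a 1] with hY
  choose x y hx hy hc hN using fun i => exists_eisenstein_lift (X i) (Y i) (c i)
  refine ⟨x, y, ?_, hc, ?_⟩
  · have h0 := hx 0
    have h1 := hx 1
    have h2 := hx 2
    have h3 := hx 3
    have h4 := hx 4
    have h5 := hx 5
    have k0 := hy 0
    have k1 := hy 1
    have k2 := hy 2
    have k3 := hy 3
    have k4 := hy 4
    have k5 := hy 5
    simp only [hX, hY, Matrix.cons_val, Nat.cast_add] at h0 h1 h2 h3 h4 h5 k0 k1 k2 k3 k4 k5
    constructor <;> omega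
  · rw [eisensteinNorm, Finset.sum_congr rfl fun i _ => hN i]
    simp only at hab
    have : (∑ i, (if (2 : ℤ) ∣ X i ∧ (2 : ℤ) ∣ Y i then (if 3 ∣ c i then (0 : ℤ) else 4) else
        (if 3 ∣ c i then 3 else 1))) = ((∑ i, (if X i % 2 = 0 ∧ Y i % 2 = 0 then
          (if decide (¬ 3 ∣ c i) then 4 else 0) else
          (if decide (¬ 3 ∣ c i) then 1 else 3)) : ℕ) : ℤ) := by
      rw [Nat.cast_sum]
      refine Finset.sum_congr rfl fun i _ => ?_
      have e1 : (2 : ℤ) ∣ (X i : ℤ) ↔ X i % 2 = 0 := by omega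
      have e2 : (2 : ℤ) ∣ (Y i : ℤ) ↔ Y i % 2 = 0 := by omega
      simp only [e1, e2]
      by_cases h1 : X i % 2 = 0 ∧ Y i % 2 = 0 <;> by_cases h2 : 3 ∣ c i <;> simp [h1, h2]
    rw [this]
    exact_mod_cast hab

theorem InHexacode.congr {x y x' y' : Fin 6 → ℤ} (h : InHexacode x y)
    (hx : ∀ i, 2 ∣ x' i - x i) (hy : ∀ i, 2 ∣ y' i - y i) : InHexacode x' y' where
  left_three := by have := h.1; have := hx 0; have := hx 1; have := hx 2; have := hx 3; omega
  right_three := by have := h.2; have := hy 0; have := hy 1; have := hy 2; have := hy 3; omega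
  left_four := by
    have := h.3; have := hx 0; have := hx 2; have := hy 0; have := hy 1; have := hx 4; omega
  right_four := by
    have := h.4; have := hy 2; have := hx 0; have := hx 1; have := hy 1; have := hy 4; omega
  left_five := by
    have := h.5; have := hx 2; have := hy 0; have := hy 1; have := hx 1; have := hx 5; omega
  right_five := by
    have := h.6; have := hy 0; have := hy 2; have := hx 0; have := hx 1; have := hy 5; omega

theorem InHexacode.sub {x y x' y' : Fin 6 → ℤ} (h : InHexacode x y) (h' : InHexacode x' y') :
    InHexacode (x - x') (y - y') where
  left_three := by have := h.1; have := h'.1; simp only [Pi.sub_apply]; omega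
  right_three := by have := h.2; have := h'.2; simp only [Pi.sub_apply]; omega
  left_four := by have := h.3; have := h'.3; simp only [Pi.sub_apply]; omega
  right_four := by have := h.4; have := h'.4; simp only [Pi.sub_apply]; omega
  left_five := by have := h.5; have := h'.5; simp only [Pi.sub_apply]; omega
  right_five := by have := h.6; have := h'.6; simp only [Pi.sub_apply]; omega

theorem InHexacode.map {x y : Fin 6 → ℤ} (h : InHexacode x y) :
    InHexacode (fun i => -y i) (fun i => x i - y i) := by
  obtain ⟨⟨k3, h3⟩, ⟨l3, h3'⟩, ⟨k4, h4⟩, ⟨l4, h4'⟩, ⟨k5, h5⟩, ⟨l5, h5'⟩⟩ := h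
  constructor <;> omega

/-- The last condition says that x + yω differs from x' + y'ω by (1 - ω)(p + qω). The quotient stays
in the code because modulo 2 the inverse of 1 - ω is ω. -/
theorem exists_hexacode_sub {x y : Fin 6 → ℤ} (h : InHexacode x y) :
    ∃ x' y' p q, InHexacode x' y' ∧ InHexacode p q ∧ eisensteinNorm x' y' ≤ 8 ∧
      (∀ i, x i = x' i + (p i + q i) ∧ y i = y' i + (2 * q i - p i)) := by
  obtain ⟨x', y', h', hc, hN⟩ := exists_hexacode_lift fun i => x i + y i
  choose q hq using hc
  have e : ∀ i, x i = x' i + ((x i - x' i + q i) + -q i) ∧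
      y i = y' i + (2 * -q i - (x i - x' i + q i)) := by
    intro i
    have := hq i
    constructor <;> linarith
  refine ⟨x', y', fun i => x i - x' i + q i, fun i => -q i, h', ?_, hN, e⟩
  refine ((h.sub h').map).congr (fun i => ?_) fun i => ?_
  · have := hq i
    simp only [Pi.sub_apply]
    omega
  · have := hq i
    simp only [Pi.sub_apply]
    omega

theorem eisensteinNorm_modEq (x y : Fin 6 → ℤ) :
    3 ∣ eisensteinNorm x y - ∑ i, (x i + y i) * (x i + y i) := by
  rw [eisensteinNorm, ← Finset.sum_sub_distrib]
  exact Finset.dvd_sum fun i _ => ⟨-(x i * y i), by ring⟩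

namespace IsHexaFrame

variable {g : E24 ≃ₗᵢ[ℝ] E24} {f : Fin 6 → E24} {r s t : E24} (h : IsHexaFrame g f r s t)
include h

theorem inner_map' (i j : Fin 6) : inner ℝ (g (f i)) (f j) = if i = j then (-2 : ℝ) else 0 := by
  rw [real_inner_comm, h.inner_map]
  simp only [eq_comm]

theorem hexaComb_mem {x y : Fin 6 → ℤ} (hxy : InHexacode x y) :
    hexaComb g f x y ∈ leechLattice := by
  obtain ⟨⟨k3, h3⟩, ⟨l3, h3'⟩, ⟨k4, h4⟩, ⟨l4, h4'⟩, ⟨k5, h5⟩, ⟨l5, h5'⟩⟩ := hxy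
  have g1 := h.map_mem _ h.glue₁
  have g2 := h.map_mem _ h.glue₂
  have g3 := h.map_mem _ h.glue₃
  have e5 := h.map_map 5
  have e4 := h.map_map 4
  have c5 := h.cube (f 5)
  have key : hexaComb g f x y = x 0 • ((1 / 2 : ℝ) • (f 0 + f 1 + f 2 + f 3)) +
      y 0 • g ((1 / 2 : ℝ) • (f 0 + f 1 + f 2 + f 3)) +
      (x 2 - x 0) • ((1 / 2 : ℝ) • (f 2 + f 3 + f 4 + f 5)) +
      (y 2 - y 0) • g ((1 / 2 : ℝ) • (f 2 + f 3 + f 4 + f 5)) +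
      (x 1 - x 0) • ((1 / 2 : ℝ) • (f 1 + f 3 + g (f 4) + g (g (f 5)))) +
      (y 1 - y 0) • g ((1 / 2 : ℝ) • (f 1 + f 3 + g (f 4) + g (g (f 5)))) +
      ((k3 + x 0) • f 3 + (l3 + y 0) • g (f 3) + (k4 + x 0 - y 0) • f 4 + (l4 + x 0) • g (f 4) +
        (k5 + y 0) • f 5 + (l5 + y 0 - x 0) • g (f 5)) := by
    have h3 : x 3 = x 0 + x 1 + x 2 + 2 * k3 := by linarith
    have h3' : y 3 = y 0 + y 1 + y 2 + 2 * l3 := by linarith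
    have h4 : x 4 = x 0 + x 2 - y 0 - y 1 + 2 * k4 := by linarith
    have h4' : y 4 = y 2 + x 0 + x 1 - y 1 + 2 * l4 := by linarith
    have h5 : x 5 = x 2 + y 0 + y 1 - x 1 + 2 * k5 := by linarith
    have h5' : y 5 = y 0 + y 2 - x 0 - x 1 + 2 * l5 := by linarith
    simp only [← Int.cast_smul_eq_zsmul ℝ, hexaComb, Fin.sum_univ_six, h3, h3', h4, h4', h5, h5',
      map_smul, map_add, e4, e5, map_neg, map_sub, c5]
    push_cast
    module
  rw [key]
  refine Submodule.add_mem _ (Submodule.add_mem _ (Submodule.add_mem _ (Submodule.add_mem _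
    (Submodule.add_mem _ (Submodule.add_mem _ ?_ ?_) ?_) ?_) ?_) ?_) (Submodule.add_mem _
    (Submodule.add_mem _ (Submodule.add_mem _ (Submodule.add_mem _ (Submodule.add_mem _
    ?_ ?_) ?_) ?_) ?_) ?_) <;> apply Submodule.smul_mem
  exacts [h.glue₁, g1, h.glue₂, g2, h.glue₃, g3, h.mem _, h.map_mem _ (h.mem _), h.mem _,
    h.map_mem _ (h.mem _), h.mem _, h.map_mem _ (h.mem _)]

theorem inner_hexaComb_left (x y : Fin 6 → ℤ) (j : Fin 6) :
    inner ℝ (hexaComb g f x y) (f j) = ((2 * x j - y j : ℤ) : ℝ) ∧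
      inner ℝ (hexaComb g f x y) (g (f j)) = ((2 * y j - x j : ℤ) : ℝ) := by
  constructor
  · rw [hexaComb, real_inner_smul_left, sum_inner, Finset.sum_eq_single j]
    · rw [inner_add_left, real_inner_smul_left, real_inner_smul_left, h.gram, h.inner_map', if_pos rfl,
        if_pos rfl]
      push_cast
      ring
    · intro i _ hi
      rw [inner_add_left, real_inner_smul_left, real_inner_smul_left, h.gram, h.inner_map',
        if_neg hi, if_neg hi]
      ring
    · exact fun hj => absurd (Finset.mem_univ j) hj
  · rw [hexaComb, real_inner_smul_left, sum_inner, Finset.sum_eq_single j]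
    · rw [inner_add_left, real_inner_smul_left, real_inner_smul_left,
        LinearIsometryEquiv.inner_map_map, h.gram, h.inner_map, if_pos rfl, if_pos rfl]
      push_cast
      ring
    · intro i _ hi
      rw [inner_add_left, real_inner_smul_left, real_inner_smul_left,
        LinearIsometryEquiv.inner_map_map, h.gram, h.inner_map, if_neg hi, if_neg hi]
      ring
    · exact fun hj => absurd (Finset.mem_univ j) hj

theorem inner_hexaComb (x y x' y' : Fin 6 → ℤ) :
    2 * inner ℝ (hexaComb g f x y) (hexaComb g f x' y') =
      ((∑ i, (2 * (x i * x' i + y i * y' i) - x i * y' i - y i * x' i) : ℤ) : ℝ) := by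
  rw [hexaComb.eq_def g f x' y', real_inner_smul_right, inner_sum, Int.cast_sum]
  rw [show ∀ a : ℝ, 2 * (1 / 2 * a) = a by intro a; ring]
  refine Finset.sum_congr rfl fun i _ => ?_
  rw [inner_add_right, real_inner_smul_right, real_inner_smul_right,
    (h.inner_hexaComb_left x y i).1, (h.inner_hexaComb_left x y i).2]
  push_cast
  ring

theorem norm_hexaComb (x y : Fin 6 → ℤ) :
    inner ℝ (hexaComb g f x y) (hexaComb g f x y) = (eisensteinNorm x y : ℝ) := by
  have h1 := h.inner_hexaComb x y x y
  rw [show (∑ i, (2 * (x i * x i + y i * y i) - x i * y i - y i * x i)) =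
    2 * eisensteinNorm x y by
      rw [eisensteinNorm, Finset.mul_sum]
      exact Finset.sum_congr rfl fun i _ => by ring] at h1
  push_cast at h1
  linarith

theorem map_hexaComb (x y : Fin 6 → ℤ) :
    g (hexaComb g f x y) = hexaComb g f (fun i => -y i) (fun i => x i - y i) := by
  rw [hexaComb, hexaComb, map_smul, map_sum]
  congr 1
  refine Finset.sum_congr rfl fun i _ => ?_
  rw [map_add, map_smul, map_smul, h.map_map]
  push_cast
  module

omit h in
theorem hexaComb_mem_span (x y : Fin 6 → ℤ) : hexaComb g f x y ∈ hexaSpan g f :=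
  Submodule.smul_mem _ _ (Submodule.sum_mem _ fun i _ => Submodule.add_mem _
    (Submodule.smul_mem _ _ (Submodule.subset_span ⟨Sum.inl i, rfl⟩))
    (Submodule.smul_mem _ _ (Submodule.subset_span ⟨Sum.inr i, rfl⟩)))

omit h in
theorem hexaComb_sub (x y x' y' : Fin 6 → ℤ) :
    hexaComb g f x y - hexaComb g f x' y' = hexaComb g f (x - x') (y - y') := by
  rw [hexaComb, hexaComb, hexaComb, ← smul_sub, ← Finset.sum_sub_distrib]
  congr 1
  refine Finset.sum_congr rfl fun i _ => ?_
  simp only [Pi.sub_apply]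
  push_cast
  module

/-- The component of a vector in the span of the frame. -/
theorem sub_hexaDual_mem (v : E24) :
    v - hexaDual g f (fun i => inner ℝ v (f i)) (fun i => inner ℝ v (g (f i))) ∈
      (hexaSpan g f)ᗮ := by
  rw [mem_hexaSpan_orthogonal]
  intro j
  constructor
  · rw [inner_sub_left, hexaDual, sum_inner, Finset.sum_eq_single j]
    · rw [inner_add_left, real_inner_smul_left, real_inner_smul_left, h.gram, h.inner_map', if_pos rfl,
        if_pos rfl]
      ring
    · intro i _ hi
      rw [inner_add_left, real_inner_smul_left, real_inner_smul_left, h.gram, h.inner_map',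
        if_neg hi, if_neg hi]
      ring
    · exact fun hj => absurd (Finset.mem_univ j) hj
  · rw [inner_sub_left, hexaDual, sum_inner, Finset.sum_eq_single j]
    · rw [inner_add_left, real_inner_smul_left, real_inner_smul_left,
        LinearIsometryEquiv.inner_map_map, h.gram, h.inner_map, if_pos rfl, if_pos rfl]
      ring
    · intro i _ hi
      rw [inner_add_left, real_inner_smul_left, real_inner_smul_left,
        LinearIsometryEquiv.inner_map_map, h.gram, h.inner_map, if_neg hi, if_neg hi]
      ring
    · exact fun hj => absurd (Finset.mem_univ j) hj

omit h in
theorem hexaDual_mem_span (m n : Fin 6 → ℝ) : hexaDual g f m n ∈ hexaSpan g f :=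
  Submodule.sum_mem _ fun i _ => Submodule.add_mem _
    (Submodule.smul_mem _ _ (Submodule.subset_span ⟨Sum.inl i, rfl⟩))
    (Submodule.smul_mem _ _ (Submodule.subset_span ⟨Sum.inr i, rfl⟩))

theorem starProjection_eq (v : E24) : (hexaSpan g f).starProjection v =
    hexaDual g f (fun i => inner ℝ v (f i)) (fun i => inner ℝ v (g (f i))) :=
  Submodule.eq_starProjection_of_mem_orthogonal (hexaDual_mem_span _ _) (h.sub_hexaDual_mem v)

theorem map_eq_of_mem_orthogonal {v : E24} (hv : v ∈ (hexaSpan g f)ᗮ) : g v = v :=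
  h.map_eq_self v (mem_hexaSpan_orthogonal.1 hv)

/-- The map `1 - g` takes the Leech lattice to the lattice glued along the hexacode. -/
theorem exists_sub_map_eq {v : E24} (hv : v ∈ leechLattice) :
    ∃ x y, InHexacode x y ∧ v - g v = hexaComb g f x y ∧
      ‖(hexaSpan g f).starProjection v‖ ^ 2 = (eisensteinNorm x y : ℝ) / 3 ∧
      ∀ i, inner ℝ v (f i) = ((x i - y i : ℤ) : ℝ) := by
  choose m hm using fun i => leech_inner_int hv (h.mem i)
  choose n hn using fun i => leech_inner_int hv (h.map_mem _ (h.mem i))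
  obtain ⟨k1, e1⟩ := leech_inner_int hv h.glue₁
  obtain ⟨k2, e2⟩ := leech_inner_int hv h.glue₂
  obtain ⟨k3, e3⟩ := leech_inner_int hv h.glue₃
  obtain ⟨l1, e1'⟩ := leech_inner_int hv (h.map_mem _ h.glue₁)
  obtain ⟨l2, e2'⟩ := leech_inner_int hv (h.map_mem _ h.glue₂)
  obtain ⟨l3, e3'⟩ := leech_inner_int hv (h.map_mem _ h.glue₃)
  simp only [map_smul, map_add, h.map_map, map_sub, map_neg, h.cube, real_inner_smul_right,
    inner_add_right, inner_sub_right, inner_neg_right, hm, hn] at e1 e2 e3 e1' e2' e3'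
  have d1 : m 0 + m 1 + m 2 + m 3 = 2 * k1 := by
    have : (m 0 + m 1 + m 2 + m 3 : ℝ) = 2 * k1 := by linarith
    exact_mod_cast this
  have d2 : m 2 + m 3 + m 4 + m 5 = 2 * k2 := by
    have : (m 2 + m 3 + m 4 + m 5 : ℝ) = 2 * k2 := by linarith
    exact_mod_cast this
  have d3 : m 1 + m 3 + n 4 - m 5 - n 5 = 2 * k3 := by
    have : (m 1 + m 3 + n 4 - m 5 - n 5 : ℝ) = 2 * k3 := by linarith
    exact_mod_cast this
  have d1' : n 0 + n 1 + n 2 + n 3 = 2 * l1 := by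
    have : (n 0 + n 1 + n 2 + n 3 : ℝ) = 2 * l1 := by linarith
    exact_mod_cast this
  have d2' : n 2 + n 3 + n 4 + n 5 = 2 * l2 := by
    have : (n 2 + n 3 + n 4 + n 5 : ℝ) = 2 * l2 := by linarith
    exact_mod_cast this
  have d3' : n 1 + n 3 - m 4 - n 4 + m 5 = 2 * l3 := by
    have : (n 1 + n 3 - m 4 - n 4 + m 5 : ℝ) = 2 * l3 := by linarith
    exact_mod_cast this
  have hproj := h.starProjection_eq v
  simp only [hm, hn] at hproj
  refine ⟨fun i => m i + n i, n, ?_, ?_, ?_, fun i => by rw [hm, add_sub_cancel_right]⟩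
  · clear e1 e2 e3 e1' e2' e3' hm hn hproj
    constructor <;> omega
  · have h1 := h.map_eq_of_mem_orthogonal (h.sub_hexaDual_mem v)
    simp only [hm, hn] at h1
    rw [map_sub] at h1
    have h2 : v - g v = hexaDual g f (fun i => (m i : ℝ)) (fun i => (n i : ℝ)) -
        g (hexaDual g f (fun i => (m i : ℝ)) fun i => (n i : ℝ)) := by
      rw [sub_eq_sub_iff_sub_eq_sub]
      exact h1.symm
    rw [h2, hexaDual, map_sum, ← Finset.sum_sub_distrib, hexaComb, Finset.smul_sum]
    refine Finset.sum_congr rfl fun i _ => ?_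
    rw [map_add, map_smul, map_smul, h.map_map]
    push_cast
    module
  · have h1 : ‖(hexaSpan g f).starProjection v‖ ^ 2 =
        inner ℝ v ((hexaSpan g f).starProjection v) := by
      have h2 := Submodule.starProjection_inner_eq_zero (K := hexaSpan g f) v _
        (Submodule.starProjection_apply_mem _ v)
      rw [inner_sub_left, real_inner_self_eq_norm_sq] at h2
      linarith
    rw [h1, hproj, hexaDual, inner_sum, eisensteinNorm, Int.cast_sum, Finset.sum_div]
    refine Finset.sum_congr rfl fun i _ => ?_
    rw [inner_add_right, real_inner_smul_right, real_inner_smul_right, hm, hn]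
    push_cast
    ring

end IsHexaFrame

/-! ### Minimal vectors in the span of the frame and in its complement. -/

theorem card_sum_sq_eq_one :
    (Finset.univ.filter fun c : Fin 6 → ZMod 3 => ∑ i, c i * c i = 1).card = 252 := by
  decide +kernel

/-- Mutually orthogonal pairs spanning copies of `AA₂` are linearly independent. -/
theorem linearIndependent_of_orthogonal_pairs {ι : Type*} [Fintype ι] [DecidableEq ι]
    {u v : ι → E24} (huu : ∀ i j, inner ℝ (u i) (u j) = if i = j then (4 : ℝ) else 0)
    (hvv : ∀ i j, inner ℝ (v i) (v j) = if i = j then (4 : ℝ) else 0)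
    (huv : ∀ i j, inner ℝ (u i) (v j) = if i = j then (-2 : ℝ) else 0) :
    LinearIndependent ℝ (Sum.elim u v) := by
  have hvu : ∀ i j, inner ℝ (v i) (u j) = if i = j then (-2 : ℝ) else 0 := fun i j => by
    rw [real_inner_comm, huv]
    exact if_congr eq_comm rfl rfl
  rw [Fintype.linearIndependent_iff]
  intro c hc
  rw [Fintype.sum_sum_type] at hc
  simp only [Sum.elim_inl, Sum.elim_inr] at hc
  have h1 : ∀ j, 4 * c (Sum.inl j) - 2 * c (Sum.inr j) = 0 := by
    intro j
    have := congrArg (fun w => inner ℝ w (u j)) hc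
    simp only [inner_add_left, sum_inner, real_inner_smul_left, huu, hvu, mul_ite,
      mul_zero, Finset.sum_ite_eq', Finset.mem_univ, if_true, inner_zero_left] at this
    linarith
  have h2 : ∀ j, -2 * c (Sum.inl j) + 4 * c (Sum.inr j) = 0 := by
    intro j
    have := congrArg (fun w => inner ℝ w (v j)) hc
    simp only [inner_add_left, sum_inner, real_inner_smul_left, hvv, huv, mul_ite,
      mul_zero, Finset.sum_ite_eq', Finset.mem_univ, if_true, inner_zero_left] at this
    linarith
  rintro (j | j) <;> linarith [h1 j, h2 j]

namespace IsHexaFrame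

variable {g : E24 ≃ₗᵢ[ℝ] E24} {f : Fin 6 → E24} {r s t : E24} (h : IsHexaFrame g f r s t)
include h

theorem finrank_hexaSpan : Module.finrank ℝ (hexaSpan g f) = 12 := by
  have hli : LinearIndependent ℝ (Sum.elim f fun i => g (f i)) :=
    linearIndependent_of_orthogonal_pairs h.gram
      (fun i j => (g.inner_map_map _ _).trans (h.gram i j)) h.inner_map
  rw [hexaSpan, finrank_span_eq_card hli]
  rfl

/-- Subtracting a vector of the glued lattice makes the component in the span small. -/
theorem exists_small_component {v : E24} (hv : v ∈ leechLattice) :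
    ∃ p q x y, InHexacode p q ∧ InHexacode x y ∧ eisensteinNorm x y ≤ 8 ∧
      ‖(hexaSpan g f).starProjection (v - hexaComb g f p q)‖ ^ 2 =
        (eisensteinNorm x y : ℝ) / 3 := by
  obtain ⟨x, y, hxy, hvg, -⟩ := h.exists_sub_map_eq hv
  obtain ⟨x', y', p, q, hxy', hpq, hN, he⟩ := exists_hexacode_sub hxy
  obtain ⟨x'', y'', -, hvg'', hnorm, -⟩ :=
    h.exists_sub_map_eq (leechLattice.sub_mem hv (h.hexaComb_mem hpq))
  refine ⟨p, q, x', y', hpq, hxy', hN, ?_⟩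
  have h1 : hexaComb g f x'' y'' = hexaComb g f x' y' := by
    rw [← hvg'', map_sub, sub_sub_sub_comm, hvg, h.map_hexaComb, hexaComb_sub, hexaComb_sub]
    congr 1
    · funext i
      simp only [Pi.sub_apply, (he i).1]
      ring
    · funext i
      simp only [Pi.sub_apply, (he i).2]
      ring
  rw [hnorm, ← h.norm_hexaComb, h1, h.norm_hexaComb]

/-- Modulo the glued lattice, a vector of the span can be made to have norm at most 8/3, which is
below the minimum 4; so it becomes zero. -/
theorem mem_span_iff {v : E24} : v ∈ leechLattice ∧ v ∈ hexaSpan g f ↔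
    ∃ x y, InHexacode x y ∧ v = hexaComb g f x y := by
  constructor
  · rintro ⟨hv, hvJ⟩
    obtain ⟨p, q, x, y, hpq, hxy, hN, hnorm⟩ := h.exists_small_component hv
    refine ⟨p, q, hpq, ?_⟩
    have h1 : v - hexaComb g f p q ∈ hexaSpan g f :=
      Submodule.sub_mem _ hvJ (hexaComb_mem_span _ _)
    rw [Submodule.starProjection_eq_self_iff.2 h1, ← real_inner_self_eq_norm_sq] at hnorm
    by_contra hne
    have h2 := leech_norm_ge (leechLattice.sub_mem hv (h.hexaComb_mem hpq)) (sub_ne_zero.2 hne)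
    have h3 : (eisensteinNorm x y : ℝ) ≤ 8 := by exact_mod_cast hN
    linarith
  · rintro ⟨x, y, hxy, rfl⟩
    exact ⟨h.hexaComb_mem hxy, hexaComb_mem_span _ _⟩

/-- Subtracting a vector of the span leaves the orthogonal component unchanged and makes the other
one at most 8/3, out of a total of at least 4. -/
theorem norm_orthogonal_ge {v : E24} (hv : v ∈ leechLattice) (hvJ : v ∉ hexaSpan g f) :
    4 / 3 ≤ ‖(hexaSpan g f)ᗮ.starProjection v‖ ^ 2 := by
  obtain ⟨p, q, x, y, hpq, hxy, hN, hnorm⟩ := h.exists_small_component hv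
  have hne : v - hexaComb g f p q ≠ 0 := by
    intro h0
    rw [sub_eq_zero] at h0
    exact hvJ (h0 ▸ hexaComb_mem_span _ _)
  have h2 := leech_norm_ge (leechLattice.sub_mem hv (h.hexaComb_mem hpq)) hne
  rw [real_inner_self_eq_norm_sq,
    Submodule.norm_sq_eq_add_norm_sq_starProjection _ (hexaSpan g f), hnorm, map_sub,
    Submodule.starProjection_orthogonal_apply_eq_zero (hexaComb_mem_span p q), sub_zero] at h2
  have h3 : (eisensteinNorm x y : ℝ) ≤ 8 := by exact_mod_cast hN
  linarith

theorem eisensteinNorm_even {x y : Fin 6 → ℤ} (hxy : InHexacode x y) :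
    2 ∣ eisensteinNorm x y ∧ (eisensteinNorm x y = 0 ∨ 4 ≤ eisensteinNorm x y) := by
  have h1 := h.norm_hexaComb x y
  have h2 := h.hexaComb_mem hxy
  constructor
  · obtain ⟨n, hn⟩ := leech_norm_even h2
    rw [hn] at h1
    exact ⟨n, by exact_mod_cast h1.symm⟩
  · by_cases h0 : hexaComb g f x y = 0
    · rw [h0, inner_zero_left] at h1
      exact Or.inl (by exact_mod_cast h1.symm)
    · have h3 := leech_norm_ge h2 h0
      rw [h1] at h3
      exact Or.inr (by exact_mod_cast h3)

/-- The component in the span has norm n/3 with n even, n = 0 or 4 ≤ n ≤ 12. The value n = 10 would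
leave 2/3 for the orthogonal component, against the bound 4/3. So the hypotheses of
`card_minimalVectors_eq` hold. -/
theorem card_minimalVectors_span_eq :
    Nat.card {x // x ∈ minimalVectors ∧ x ∈ hexaSpan g f} =
      Nat.card {x // x ∈ minimalVectors ∧ x ∈ (hexaSpan g f)ᗮ} := by
  refine card_minimalVectors_eq _ h.finrank_hexaSpan fun v hv => ?_
  obtain ⟨hv, hv4⟩ := (mem_minimalVectors v).1 hv
  obtain ⟨x, y, hxy, -, hnorm, -⟩ := h.exists_sub_map_eq hv
  have hsum := Submodule.norm_sq_eq_add_norm_sq_starProjection v (hexaSpan g f)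
  rw [← real_inner_self_eq_norm_sq, hv4, hnorm] at hsum
  obtain ⟨⟨n, hn⟩, hge⟩ := h.eisensteinNorm_even hxy
  have h12 : eisensteinNorm x y ≤ 12 := by
    have : (eisensteinNorm x y : ℝ) ≤ 12 := by
      have : 0 ≤ ‖(hexaSpan g f)ᗮ.starProjection v‖ ^ 2 := by positivity
      linarith
    exact_mod_cast this
  have h10 : eisensteinNorm x y ≠ 10 := by
    intro h10
    have hvJ : v ∉ hexaSpan g f := by
      intro hvJ
      rw [Submodule.starProjection_orthogonal_apply_eq_zero hvJ, norm_zero, h10] at hsum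
      norm_num at hsum
    have := h.norm_orthogonal_ge hv hvJ
    rw [h10] at hsum
    push_cast at hsum
    linarith
  have hcases : eisensteinNorm x y = 0 ∨ eisensteinNorm x y = 4 ∨ eisensteinNorm x y = 6 ∨
      eisensteinNorm x y = 8 ∨ eisensteinNorm x y = 12 := by omega
  rw [hnorm]
  rcases hcases with h' | h' | h' | h' | h' <;> rw [h'] <;> norm_num

theorem add_map_add_map_map {w : E24} (hw : w ∈ hexaSpan g f) : w + g w + g (g w) = 0 := by
  induction hw using Submodule.span_induction with
  | mem u hu =>
    obtain ⟨i | i, rfl⟩ := hu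
    · simp only [Sum.elim_inl, h.map_map]
      abel
    · simp only [Sum.elim_inr, h.map_map, map_sub, map_neg, h.cube]
      abel
  | zero => simp
  | add u v _ _ hu hv =>
    rw [map_add, map_add]
    calc _ = (u + g u + g (g u)) + (v + g v + g (g v)) := by abel
      _ = 0 := by rw [hu, hv, add_zero]
  | smul c u _ hu =>
    rw [map_smul, map_smul, ← smul_add, ← smul_add, hu, smul_zero]

theorem map_mem_span {w : E24} (hw : w ∈ hexaSpan g f) : g w ∈ hexaSpan g f := by
  induction hw using Submodule.span_induction with
  | mem u hu =>
    obtain ⟨i | i, rfl⟩ := hu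
    · exact Submodule.subset_span ⟨Sum.inr i, rfl⟩
    · simp only [Sum.elim_inr, h.map_map]
      exact Submodule.sub_mem _ (Submodule.neg_mem _ (Submodule.subset_span ⟨Sum.inl i, rfl⟩))
        (Submodule.subset_span ⟨Sum.inr i, rfl⟩)
  | zero => rw [map_zero]; exact Submodule.zero_mem _
  | add u v _ _ hu hv => rw [map_add]; exact Submodule.add_mem _ hu hv
  | smul c u _ hu => rw [map_smul]; exact Submodule.smul_mem _ _ hu

/-- In each of the 252 classes c modulo 1 - ω with sum of squares 1 there is a vector of norm at
most 8. Its norm is even, at least 4 and congruent to 1 modulo 3, hence equal to 4. The isometry g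
preserves the class, and the three vectors of an orbit are distinct. -/
theorem card_minimalVectors_span_ge :
    756 ≤ Nat.card {x // x ∈ minimalVectors ∧ x ∈ hexaSpan g f} := by
  have hlift : ∀ c : {c : Fin 6 → ZMod 3 // ∑ i, c i * c i = 1}, ∃ v : E24, v ∈ leechLattice ∧
      v ∈ hexaSpan g f ∧ inner ℝ v v = (4 : ℝ) ∧
      ∀ i, ∃ m : ℤ, inner ℝ v (f i) = m ∧ (m : ZMod 3) = -c.1 i := by
    rintro ⟨c, hc⟩
    choose z hz using fun i => ZMod.intCast_surjective (c i)
    obtain ⟨x, y, hxy, hres, hN⟩ := exists_hexacode_lift z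
    obtain ⟨heven, hge⟩ := h.eisensteinNorm_even hxy
    have hmod : 3 ∣ eisensteinNorm x y - 1 := by
      have h1 := eisensteinNorm_modEq x y
      have h2 : 3 ∣ ∑ i, (x i + y i) * (x i + y i) - 1 := by
        refine (ZMod.intCast_zmod_eq_zero_iff_dvd _ 3).1 ?_
        push_cast
        rw [← hc, sub_eq_zero]
        refine Finset.sum_congr rfl fun i _ => ?_
        have h3 := (ZMod.intCast_zmod_eq_zero_iff_dvd _ 3).2 (hres i)
        push_cast at h3
        rw [hz, sub_eq_zero] at h3
        rw [h3]
      have := dvd_add h1 h2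
      rwa [sub_add_sub_cancel] at this
    refine ⟨hexaComb g f x y, h.hexaComb_mem hxy, hexaComb_mem_span _ _, ?_, fun i => ?_⟩
    · rw [h.norm_hexaComb, show eisensteinNorm x y = 4 by omega]
      norm_num
    · refine ⟨_, (h.inner_hexaComb_left x y i).1, ?_⟩
      have h3 := (ZMod.intCast_zmod_eq_zero_iff_dvd _ 3).2 (hres i)
      push_cast at h3 ⊢
      rw [hz] at h3
      have h4 : (2 : ZMod 3) = -1 := by decide
      rw [h4]
      linear_combination -h3
  choose v hvL hvJ hv4 hvc using hlift
  have hg3 := fun (w : E24) (hw : w ∈ hexaSpan g f) => h.add_map_add_map_map hw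
  have hgJ := fun (w : E24) (hw : w ∈ hexaSpan g f) => h.map_mem_span hw
  have hginv : ∀ (w : E24), w ∈ hexaSpan g f → w ∈ leechLattice → ∀ (i : Fin 6), ∃ k : ℤ,
      inner ℝ (g w) (f i) = inner ℝ w (f i) + 3 * k := by
    intro w hw hwL i
    obtain ⟨x, y, hxy, rfl⟩ := h.mem_span_iff.1 ⟨hwL, hw⟩
    refine ⟨-x i, ?_⟩
    rw [h.map_hexaComb, (h.inner_hexaComb_left _ _ i).1, (h.inner_hexaComb_left _ _ i).1]
    push_cast
    ring
  let F : {c : Fin 6 → ZMod 3 // ∑ i, c i * c i = 1} × Fin 3 →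
      {x // x ∈ minimalVectors ∧ x ∈ hexaSpan g f} := fun p =>
    ⟨![v p.1, g (v p.1), g (g (v p.1))] p.2, by
      have h1 := hvJ p.1
      have h2 := hvL p.1
      have h3 := hv4 p.1
      rw [mem_minimalVectors]
      obtain ⟨c, k⟩ := p
      fin_cases k
      · exact ⟨⟨h2, h3⟩, h1⟩
      · exact ⟨⟨h.map_mem _ h2, (g.inner_map_map _ _).trans h3⟩, hgJ _ h1⟩
      · exact ⟨⟨h.map_mem _ (h.map_mem _ h2),
          (g.inner_map_map _ _).trans ((g.inner_map_map _ _).trans h3)⟩, hgJ _ (hgJ _ h1)⟩⟩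
  have hFres : ∀ p i, ∃ m : ℤ, inner ℝ ((F p).1) (f i) = m ∧ (m : ZMod 3) = -p.1.1 i := by
    rintro ⟨c, k⟩ i
    obtain ⟨m, hm, hmc⟩ := hvc c i
    obtain ⟨a, ha⟩ := hginv _ (hvJ c) (hvL c) i
    obtain ⟨b, hb⟩ := hginv _ (hgJ _ (hvJ c)) (h.map_mem _ (hvL c)) i
    have h3 : (3 : ZMod 3) = 0 := by decide
    fin_cases k
    · exact ⟨m, hm, hmc⟩
    · refine ⟨m + 3 * a, ?_, ?_⟩
      · rw [hm] at ha
        push_cast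
        exact ha
      · push_cast
        rw [h3, zero_mul, add_zero]
        exact hmc
    · refine ⟨m + 3 * a + 3 * b, ?_, ?_⟩
      · rw [ha, hm] at hb
        push_cast
        exact hb
      · push_cast
        rw [h3, zero_mul, zero_mul, add_zero, add_zero]
        exact hmc
  have hF : Function.Injective F := by
    intro p p' hpp
    have h1 : p.1 = p'.1 := by
      apply Subtype.ext
      funext i
      obtain ⟨m, hm, hmc⟩ := hFres p i
      obtain ⟨m', hm', hmc'⟩ := hFres p' i
      rw [hpp, hm'] at hm
      have : m' = m := by exact_mod_cast hm
      rw [← neg_inj, ← hmc, ← hmc', this]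
    obtain ⟨c, k⟩ := p
    obtain ⟨c', k'⟩ := p'
    obtain rfl : c = c' := h1
    have h2 : ![v c, g (v c), g (g (v c))] k = ![v c, g (v c), g (g (v c))] k' :=
      congrArg Subtype.val hpp
    have h3 := hg3 _ (hvJ c)
    have hin : inner ℝ (v c) (g (v c)) = (-2 : ℝ) := by
      have h4 := congrArg (fun w => inner ℝ w (g (v c))) h3
      simp only [inner_add_left, LinearIsometryEquiv.inner_map_map, hv4, inner_zero_left] at h4
      rw [real_inner_comm (v c) (g (v c))] at h4
      linarith
    have hin2 : inner ℝ (v c) (g (g (v c))) = (-2 : ℝ) := by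
      have h4 := congrArg (fun w => inner ℝ (v c) w) h3
      simp only [inner_add_right, hv4, hin, inner_zero_right] at h4
      linarith
    have n1 : v c ≠ g (v c) := fun e => by
      rw [← e, hv4] at hin
      norm_num at hin
    have n2 : v c ≠ g (g (v c)) := fun e => by
      rw [← e, hv4] at hin2
      norm_num at hin2
    have n3 : g (v c) ≠ g (g (v c)) := fun e => n1 (g.injective e)
    fin_cases k <;> fin_cases k' <;>
      first
        | rfl
        | exact absurd h2 n1
        | exact absurd h2 n2
        | exact absurd h2 n3
        | exact absurd h2.symm n1
        | exact absurd h2.symm n2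
        | exact absurd h2.symm n3
  have hfin : Finite {x // x ∈ minimalVectors ∧ x ∈ hexaSpan g f} :=
    Finite.of_injective (fun x => (⟨x.1, x.2.1⟩ : minimalVectors)) fun x y hxy =>
      Subtype.ext (congrArg (fun z : minimalVectors => z.1) hxy)
  have h1 := Nat.card_le_card_of_injective F hF
  rw [Nat.card_prod, Nat.card_eq_fintype_card, Nat.card_eq_fintype_card, Fintype.card_fin,
    Fintype.card_subtype, card_sum_sq_eq_one] at h1
  exact h1

end IsHexaFrame

/-! ### Symmetric forms over the field with three elements -/

section FormsModThree

variable {K : Type*} [AddCommGroup K]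

/-- The radical contains 3K and 3^m elements that are distinct modulo 3K. Representatives of the
classes modulo the radical, shifted by these, stay distinct in K/3K, which has at most 3^(n + m)
elements. -/
theorem card_quotient_ker_le [Module.Free ℤ K] [Module.Finite ℤ K] {n m : ℕ}
    (B : K →+ K →+ ZMod 3) (hrank : Module.finrank ℤ K ≤ n + m) (κ : (Fin m → ZMod 3) → K)
    (hκ : ∀ c, κ c ∈ B.ker) (hinj : ∀ c d k, κ c - κ d = (3 : ℤ) • k → c = d) :
    Finite (K ⧸ B.ker) ∧ Nat.card (K ⧸ B.ker) ≤ 3 ^ n := by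
  have h3 : ∀ k : K, B ((3 : ℤ) • k) = 0 := by
    intro k
    rw [map_zsmul]
    ext y
    rw [AddMonoidHom.smul_apply, zsmul_eq_mul, AddMonoidHom.zero_apply]
    have : ((3 : ℤ) : ZMod 3) = 0 := by decide
    rw [this, zero_mul]
  let F : (K ⧸ B.ker) × (Fin m → ZMod 3) → ModN K 3 := fun p =>
    ModN.mkQ 3 (p.1.out + κ p.2)
  have hF : Function.Injective F := by
    rintro ⟨p, c⟩ ⟨q, d⟩ hpq
    have h1 : ∃ k, (3 : ℤ) • k = (p.out + κ c) - (q.out + κ d) := by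
      have h2 := (Submodule.Quotient.eq _).1 hpq
      obtain ⟨k, hk⟩ := h2
      exact ⟨k, by rw [← hk]; simp⟩
    obtain ⟨k, hk⟩ := h1
    have hB := h3 k
    rw [hk, map_sub, map_add, map_add, (AddMonoidHom.mem_ker).1 (hκ c),
      (AddMonoidHom.mem_ker).1 (hκ d), add_zero, add_zero, sub_eq_zero] at hB
    have hpq' : p = q := by
      rw [← QuotientAddGroup.out_eq' p, ← QuotientAddGroup.out_eq' q, QuotientAddGroup.eq,
        AddMonoidHom.mem_ker, map_add, map_neg, hB, neg_add_cancel]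
    subst hpq'
    rw [add_sub_add_left_eq_sub] at hk
    rw [hinj c d k hk.symm]
  have hcard := ModN.natCard_eq (G := K) (n := 3)
  have hfin : Finite (ModN K 3) := by
    apply Nat.finite_of_card_ne_zero
    rw [hcard]
    positivity
  have h1 := Nat.card_le_card_of_injective F hF
  have hfin2 : Finite (K ⧸ B.ker) :=
    Finite.of_injective (fun p => F (p, 0)) fun p q hpq => (Prod.ext_iff.1 (hF hpq)).1
  refine ⟨hfin2, ?_⟩
  rw [Nat.card_prod, hcard, Nat.card_fun, Nat.card_zmod, Nat.card_fin] at h1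
  have h2 : 3 ^ Module.finrank ℤ K ≤ 3 ^ n * 3 ^ m := by
    rw [← pow_add]
    exact Nat.pow_le_pow_right (by norm_num) hrank
  exact Nat.le_of_mul_le_mul_right (h1.trans h2) (by positivity)

theorem exists_orthogonal_coordinates {n : ℕ} (B : K →+ K →+ ZMod 3) (hB : ∀ x y, B x y = B y x)
    (hfin : Finite (K ⧸ B.ker)) (hcard : Nat.card (K ⧸ B.ker) ≤ 3 ^ n) :
    ∃ m ≤ n, ∃ (π : K →+ (Fin m → ZMod 3)) (w : Fin m → ZMod 3), (∀ i, w i ≠ 0) ∧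
      ∀ x y, B x y = ∑ i, w i * (π x i * π y i) := by
  let W := K ⧸ B.ker
  let β₀ : W →+ K →+ ZMod 3 := QuotientAddGroup.kerLift B
  let β : W →+ W →+ ZMod 3 := QuotientAddGroup.lift B.ker β₀.flip (by
    intro x hx
    ext y
    change B y x = 0
    rw [hB, (AddMonoidHom.mem_ker).1 hx, AddMonoidHom.zero_apply])
  have hβ : ∀ x y : K, β (x : W) (y : W) = B x y := fun x y => hB y x
  let _ : Module (ZMod 3) W := AddCommGroup.zmodModule (n := 3) (by
    intro w
    induction w using QuotientAddGroup.induction_on with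
    | H x =>
      rw [← QuotientAddGroup.mk_nsmul, QuotientAddGroup.eq_zero_iff, AddMonoidHom.mem_ker,
        map_nsmul]
      ext y
      rw [AddMonoidHom.smul_apply, nsmul_eq_mul]
      have : ((3 : ℕ) : ZMod 3) = 0 := by decide
      rw [this, zero_mul, AddMonoidHom.zero_apply])
  have hfinW : Finite W := hfin
  have : Module.Finite (ZMod 3) W := Module.Finite.of_finite
  let β' : LinearMap.BilinForm (ZMod 3) W :=
    { toFun := fun x => (β x).toZModLinearMap 3
      map_add' := fun x y => by ext z; simp
      map_smul' := fun c x => by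
        ext z
        obtain ⟨k, rfl⟩ := ZMod.intCast_surjective c
        simp only [AddMonoidHom.coe_toZModLinearMap, LinearMap.smul_apply, RingHom.id_apply]
        rw [Int.cast_smul_eq_zsmul, Int.cast_smul_eq_zsmul, map_zsmul, AddMonoidHom.smul_apply] }
  have hβ' : ∀ x y : K, β' (x : W) (y : W) = B x y := hβ
  have hsymm : LinearMap.IsSymm β' := ⟨fun x y => by
    induction x using QuotientAddGroup.induction_on with
    | H x =>
      induction y using QuotientAddGroup.induction_on with
      | H y => exact (hβ' x y).trans ((hB x y).trans (hβ' y x).symm)⟩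
  have _ : Invertible (2 : ZMod 3) := ⟨2, by decide, by decide⟩
  obtain ⟨v, hv⟩ := LinearMap.BilinForm.exists_orthogonal_basis (K := ZMod 3) (V := W) (B := β') hsymm
  have hexp : ∀ x y : W, β' x y = ∑ i, β' (v i) (v i) * (v.repr x i * v.repr y i) := by
    intro x y
    conv_lhs => rw [← v.sum_repr x, ← v.sum_repr y]
    rw [LinearMap.map_sum₂]
    refine Finset.sum_congr rfl fun i _ => ?_
    rw [map_sum, Finset.sum_eq_single i]
    · rw [LinearMap.map_smul₂, map_smul, smul_eq_mul, smul_eq_mul]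
      ring
    · intro j _ hj
      rw [LinearMap.map_smul₂, map_smul, hv hj.symm, smul_zero, smul_zero]
    · exact fun hi => absurd (Finset.mem_univ i) hi
  refine ⟨Module.finrank (ZMod 3) W, ?_, ?_⟩
  · have h1 := Module.natCard_eq_pow_finrank (K := ZMod 3) (V := W)
    rw [Nat.card_zmod] at h1
    rw [h1] at hcard
    exact (Nat.pow_le_pow_iff_right (by norm_num)).1 hcard
  · refine ⟨(v.equivFun.toLinearMap.toAddMonoidHom).comp (QuotientAddGroup.mk' B.ker),
      fun i => β' (v i) (v i), fun i hi => ?_, fun x y => (hβ' x y).symm.trans (hexp _ _)⟩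
    have h0 : ∀ y, β' (v i) y = 0 := by
      intro y
      rw [hexp]
      refine Finset.sum_eq_zero fun j _ => ?_
      rw [v.repr_self, Finsupp.single_apply]
      by_cases hij : i = j
      · subst hij
        exact (congrArg (· * _) hi).trans (zero_mul _)
      · rw [if_neg hij, zero_mul, mul_zero]
    have h1 : v i = 0 := by
      generalize v i = x at h0
      induction x using QuotientAddGroup.induction_on with
      | H x =>
        rw [QuotientAddGroup.eq_zero_iff, AddMonoidHom.mem_ker]
        ext y
        exact (hβ' x y).symm.trans (h0 y)
    exact v.ne_zero i h1

/-- A nondegenerate senary form over this field takes the value 1 either 252 or 234 times, according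
to whether its discriminant is a square. In the first case the entry 2 occurs an even number of
times, so sorted entries come in equal pairs. -/
theorem card_norm_one_le : ∀ w : Fin 6 → ZMod 3, (∀ i, w i ≠ 0) →
    (∀ i : Fin 5, (w i.castSucc).val ≤ (w i.succ).val) →
    252 ≤ (Finset.univ.filter fun c : Fin 6 → ZMod 3 => ∑ i, w i * (c i * c i) = 1).card →
    (Finset.univ.filter fun c : Fin 6 → ZMod 3 => ∑ i, w i * (c i * c i) = 1).card = 252 ∧
      w 0 = w 1 ∧ w 2 = w 3 ∧ w 4 = w 5 := by
  decide +kernel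

/-- An orthonormal basis for a diagonal form with pairs of equal entries. -/
def orthonormalRows (w : Fin 6 → ZMod 3) : Fin 6 → Fin 6 → ZMod 3 :=
  ![![1, w 0 - 1, 0, 0, 0, 0], ![w 0 - 1, w 0, 0, 0, 0, 0], ![0, 0, 1, w 2 - 1, 0, 0],
    ![0, 0, w 2 - 1, w 2, 0, 0], ![0, 0, 0, 0, 1, w 4 - 1], ![0, 0, 0, 0, w 4 - 1, w 4]]

theorem orthonormalRows_spec : ∀ w : Fin 6 → ZMod 3, (∀ i, w i ≠ 0) → w 0 = w 1 → w 2 = w 3 →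
    w 4 = w 5 → ∀ j k, ∑ i, w i * (orthonormalRows w j i * orthonormalRows w k i) =
      if j = k then 1 else 0 := by
  decide +kernel

/-- Equal pairs of entries give an orthonormal basis P. The reflection in v = ρ - εP_5 takes εP_5 to
ρ, so it takes the other five basis vectors to an orthonormal basis of the complement of ρ. -/
theorem exists_orthonormal_complement (w : Fin 6 → ZMod 3) (hw : ∀ i, w i ≠ 0) (h01 : w 0 = w 1)
    (h23 : w 2 = w 3) (h45 : w 4 = w 5) (ρ : Fin 6 → ZMod 3)
    (hρ : ∑ i, w i * (ρ i * ρ i) = 1) : ∃ C : Fin 5 → Fin 6 → ZMod 3,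
      (∀ j k, ∑ i, w i * (C j i * C k i) = if j = k then 1 else 0) ∧
      ∀ j, ∑ i, w i * (C j i * ρ i) = 0 := by
  have hP := orthonormalRows_spec w hw h01 h23 h45
  generalize orthonormalRows w = P at hP
  let b : (Fin 6 → ZMod 3) → (Fin 6 → ZMod 3) → ZMod 3 := fun x y => ∑ i, w i * (x i * y i)
  have badd : ∀ (c : ZMod 3) x y z, b (fun i => x i + c * y i) z = b x z + c * b y z := by
    intro c x y z
    simp only [b, Finset.mul_sum, ← Finset.sum_add_distrib]
    exact Finset.sum_congr rfl fun i _ => by ring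
  have bcomm : ∀ x y, b x y = b y x := fun x y =>
    Finset.sum_congr rfl fun i _ => by rw [mul_comm (x i)]
  have badd' : ∀ (c : ZMod 3) x y z, b z (fun i => x i + c * y i) = b z x + c * b z y := by
    intro c x y z
    rw [bcomm, badd, bcomm x, bcomm y]
  have hP' : ∀ j k, b (P j) (P k) = if j = k then 1 else 0 := hP
  have hρ' : b ρ ρ = 1 := hρ
  -- The sign is chosen so that v is not isotropic. Its norm is then its own inverse, which is how
  -- the reflection avoids division.
  have hε : ∀ t : ZMod 3, ∃ ε : ZMod 3, ε * ε = 1 ∧ (2 - 2 * ε * t) * (2 - 2 * ε * t) = 1 := by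
    decide
  obtain ⟨ε, hε1, hε2⟩ := hε (b (P 5) ρ)
  set v : Fin 6 → ZMod 3 := fun i => ρ i + (-ε) * P 5 i with hv
  have hq : b v v = 2 - 2 * ε * b (P 5) ρ := by
    rw [hv, badd, badd', badd', hρ', hP' 5 5, if_pos rfl, bcomm ρ]
    linear_combination hε1
  have hvρ : b v ρ = 1 - ε * b (P 5) ρ := by
    rw [hv, badd, hρ']
    ring
  rw [← hq] at hε2
  have hne : ∀ j : Fin 5, b (P j.castSucc) (P 5) = 0 := by
    intro j
    rw [hP', if_neg]
    exact (Fin.castSucc_lt_last j).ne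
  refine ⟨fun j i => P j.castSucc i + (-2 * b v v * b (P j.castSucc) v) * v i, fun j k => ?_,
    fun j => ?_⟩
  · change b (fun i => _) (fun i => _) = _
    rw [badd, badd' _ (P k.castSucc) v (P j.castSucc), badd' _ (P k.castSucc) v v, hP',
      bcomm v (P k.castSucc)]
    have : (if j.castSucc = k.castSucc then (1 : ZMod 3) else 0) = if j = k then 1 else 0 := by
      simp only [Fin.castSucc_inj]
    rw [this]
    linear_combination (4 * b v v * b (P j.castSucc) v * b (P k.castSucc) v) * hε2
  · change b (fun i => _) ρ = 0
    rw [badd, hvρ]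
    have h1 : b (P j.castSucc) v = b (P j.castSucc) ρ := by
      rw [hv, badd', hne, mul_zero, add_zero]
    rw [h1]
    linear_combination (-b (P j.castSucc) ρ) * hε2 + (b (P j.castSucc) ρ * b v v) * hq

/-- Counting by fibers bounds the set; when the bound is attained no fiber over a value of norm one
can be smaller than k. -/
theorem card_fiber_eq {m k : ℕ} {S : Finset K} (π : K → (Fin m → ZMod 3))
    (w : Fin m → ZMod 3) (hS : ∀ x ∈ S, ∑ i, w i * (π x i * π x i) = 1)
    (hfib : ∀ x ∈ S, (S.filter fun y => π y = π x).card ≤ k) :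
    S.card ≤ (Finset.univ.filter fun c : Fin m → ZMod 3 => ∑ i, w i * (c i * c i) = 1).card * k ∧
    ((Finset.univ.filter fun c : Fin m → ZMod 3 => ∑ i, w i * (c i * c i) = 1).card * k ≤ S.card →
      ∀ c : Fin m → ZMod 3, ∑ i, w i * (c i * c i) = 1 →
        (S.filter fun y => π y = c).card = k) := by
  set T := Finset.univ.filter fun c : Fin m → ZMod 3 => ∑ i, w i * (c i * c i) = 1 with hT
  have hmap : ∀ x ∈ S, π x ∈ T := fun x hx => by
    rw [hT, Finset.mem_filter]
    exact ⟨Finset.mem_univ _, hS x hx⟩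
  have hsum := Finset.card_eq_sum_card_fiberwise hmap
  have hle : ∀ c ∈ T, (S.filter fun y => π y = c).card ≤ k := by
    intro c _
    rcases (S.filter fun y => π y = c).eq_empty_or_nonempty with h0 | ⟨x, hx⟩
    · rw [h0, Finset.card_empty]
      exact Nat.zero_le _
    · rw [Finset.mem_filter] at hx
      rw [← hx.2]
      exact hfib x hx.1
  have hsum' : S.card ≤ T.card * k := by
    rw [hsum, ← smul_eq_mul, ← Finset.sum_const]
    exact Finset.sum_le_sum hle
  refine ⟨hsum', fun h c hc => ?_⟩
  have hcT : c ∈ T := by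
    rw [hT, Finset.mem_filter]
    exact ⟨Finset.mem_univ _, hc⟩
  have heq : ∑ c ∈ T, (S.filter fun y => π y = c).card = ∑ _c ∈ T, k := by
    rw [← hsum, Finset.sum_const, smul_eq_mul]
    exact le_antisymm hsum' h
  exact (Finset.sum_eq_sum_iff_of_le hle).1 heq c hcT

/-- A set of vectors of norm `1` that is as large as possible meets every class. -/
theorem exists_classes (B : K →+ K →+ ZMod 3) (hB : ∀ x y, B x y = B y x)
    (hfin : Finite (K ⧸ B.ker)) (hcard : Nat.card (K ⧸ B.ker) ≤ 3 ^ 6) (S : Finset K)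
    (hS : ∀ x ∈ S, B x x = 1) (hfib : ∀ x ∈ S, ∀ T ⊆ S, (∀ y ∈ T, B y = B x) → T.card ≤ 3)
    (h756 : 756 ≤ S.card) (r : K) (hr : B r r = 1) :
    ∃ cls : (Fin 5 → ZMod 3) → Finset K, ∀ a, ∑ i, a i * a i = 1 → (cls a).card = 3 ∧
      (∀ x ∈ cls a, x ∈ S ∧ B x r = 0) ∧ (∀ x ∈ cls a, ∀ y ∈ cls a, B x = B y) ∧
      ∀ b, ∑ i, b i * b i = 1 → ∀ x ∈ cls a, ∀ y ∈ cls b, B x y = ∑ i, a i * b i := by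
  obtain ⟨n, hn, π, w, hw, hπ⟩ := exists_orthogonal_coordinates B hB hfin hcard
  have hπB : ∀ x y, π x = π y → B x = B y := fun x y hxy => by
    ext z
    rw [hπ, hπ, hxy]
  have hfib' : ∀ {m : ℕ} (p : K → Fin m → ZMod 3), (∀ x y, p x = p y → B x = B y) →
      ∀ x ∈ S, (S.filter fun y => p y = p x).card ≤ 3 := fun p hp x hx =>
    hfib x hx _ (Finset.filter_subset _ _) fun y hy => hp y x (Finset.mem_filter.1 hy).2
  -- In dimension at most 5 there would be at most 3 · 3⁵ = 729 vectors, fewer than 756.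
  obtain rfl : n = 6 := by
    by_contra hne
    have h1 := (card_fiber_eq π w (fun x hx => by rw [← hπ, hS x hx]) (hfib' _ hπB)).1
    have h2 := Finset.card_filter_le (Finset.univ : Finset (Fin n → ZMod 3))
      fun c => ∑ i, w i * (c i * c i) = 1
    rw [Finset.card_univ, Fintype.card_fun, ZMod.card, Fintype.card_fin] at h2
    have h3 : 3 ^ n ≤ 3 ^ 5 := Nat.pow_le_pow_right (by norm_num) (by omega)
    omega
  let σ := Tuple.sort fun i => (w i).val
  have hmono := Tuple.monotone_sort fun i => (w i).val
  let p : K → Fin 6 → ZMod 3 := fun x i => π x (σ i)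
  have hp : ∀ x y, B x y = ∑ i, w (σ i) * (p x i * p y i) := fun x y => by
    rw [hπ]
    exact (Equiv.sum_comp σ fun i => w i * (π x i * π y i)).symm
  have hpB : ∀ x y, p x = p y → B x = B y := fun x y hxy => by
    ext z
    rw [hp, hp, hxy]
  have hw' : ∀ i, w (σ i) ≠ 0 := fun i => hw _
  generalize hwσ : (fun i => w (σ i)) = w' at *
  have hwi : ∀ i, w (σ i) = w' i := fun i => congrFun hwσ i
  simp only [hwi] at hp hw'
  have hcount := card_fiber_eq p w' (fun x hx => by rw [← hp, hS x hx]) (hfib' p hpB)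
  have h252 := card_norm_one_le w' hw' (fun i => by
    rw [← hwi, ← hwi]
    exact hmono i.castSucc_lt_succ.le) (by omega)
  -- Since 252 · 3 = 756, there is no slack and each class of norm one contains exactly three of the
  -- vectors.
  have hc3 := hcount.2 (by omega)
  obtain ⟨C, hC, hCr⟩ := exists_orthonormal_complement w' hw' h252.2.1 h252.2.2.1 h252.2.2.2 (p r)
    (by rw [← hp, hr])
  let word : (Fin 5 → ZMod 3) → Fin 6 → ZMod 3 := fun a i => ∑ k, a k * C k i
  have hword : ∀ a (d : Fin 6 → ZMod 3), ∑ i, w' i * (word a i * d i) =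
      ∑ k, a k * ∑ i, w' i * (C k i * d i) := by
    intro a d
    simp only [word, Finset.sum_mul, Finset.mul_sum]
    rw [Finset.sum_comm]
    exact Finset.sum_congr rfl fun k _ => Finset.sum_congr rfl fun i _ => by ring
  have hword2 : ∀ a b, ∑ i, w' i * (word a i * word b i) = ∑ k, a k * b k := by
    intro a b
    rw [hword]
    refine Finset.sum_congr rfl fun k _ => ?_
    congr 1
    rw [Finset.sum_congr rfl fun i _ => show w' i * (C k i * word b i) =
      w' i * (word b i * C k i) by rw [mul_comm (C k i)], hword]
    simp only [hC, mul_ite, mul_one, mul_zero, Finset.sum_ite_eq', Finset.mem_univ, if_true]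
  refine ⟨fun a => S.filter fun y => p y = word a, fun a ha => ⟨hc3 _ (by rw [hword2, ha]), ?_,
    ?_, ?_⟩⟩
  · intro x hx
    rw [Finset.mem_filter] at hx
    refine ⟨hx.1, ?_⟩
    rw [hp, hx.2, hword]
    exact Finset.sum_eq_zero fun k _ => by rw [hCr, mul_zero]
  · intro x hx y hy
    rw [Finset.mem_filter] at hx hy
    exact hpB x y (hx.2.trans hy.2.symm)
  · intro b _ x hx y hy
    rw [Finset.mem_filter] at hx hy
    rw [hp, hx.2, hy.2, hword2]

end FormsModThree

/-! ### The annihilator of the lattice glued along the hexacode -/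

/-- The vectors of the Leech lattice orthogonal to all `f i` and `g (f i)`. -/
noncomputable def hexaAnn (g : E24 ≃ₗᵢ[ℝ] E24) (f : Fin 6 → E24) : Submodule ℤ E24 :=
  leechLattice ⊓ (hexaSpan g f)ᗮ.restrictScalars ℤ

theorem mem_hexaAnn {g : E24 ≃ₗᵢ[ℝ] E24} {f : Fin 6 → E24} {x : E24} :
    x ∈ hexaAnn g f ↔ x ∈ leechLattice ∧ x ∈ (hexaSpan g f)ᗮ := Iff.rfl

/-- The inner product of two vectors of the Leech lattice as an integer. -/
noncomputable def leechInner (x y : E24) : ℤ := ⌊inner ℝ x y⌋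

theorem leechInner_eq {x y : E24} {n : ℤ} (h : inner ℝ x y = (n : ℝ)) : leechInner x y = n := by
  rw [leechInner, h, Int.floor_intCast]

theorem leechInner_cast {x y : E24} (hx : x ∈ leechLattice) (hy : y ∈ leechLattice) :
    (leechInner x y : ℝ) = inner ℝ x y := by
  obtain ⟨n, hn⟩ := leech_inner_int hx hy
  rw [leechInner_eq hn, hn]

theorem leechInner_add_left {x y z : E24} (hx : x ∈ leechLattice) (hy : y ∈ leechLattice)
    (hz : z ∈ leechLattice) : leechInner (x + y) z = leechInner x z + leechInner y z := by
  apply leechInner_eq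
  rw [inner_add_left, Int.cast_add, leechInner_cast hx hz, leechInner_cast hy hz]

theorem leechInner_comm (x y : E24) : leechInner x y = leechInner y x := by
  rw [leechInner, real_inner_comm, leechInner]

/-- The reduction modulo `3` of the inner product. -/
noncomputable def hexaForm (g : E24 ≃ₗᵢ[ℝ] E24) (f : Fin 6 → E24) :
    hexaAnn g f →+ hexaAnn g f →+ ZMod 3 :=
  AddMonoidHom.mk' (fun x => AddMonoidHom.mk' (fun y => ((leechInner x y : ℤ) : ZMod 3))
    fun y z => by
      rw [leechInner_comm, Submodule.coe_add, leechInner_add_left y.2.1 z.2.1 x.2.1, Int.cast_add,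
        leechInner_comm _ (x : E24), leechInner_comm _ (x : E24)]) fun x y => by
    ext z
    change ((leechInner (x + y : E24) z : ℤ) : ZMod 3) = (leechInner x z : ZMod 3) + leechInner y z
    rw [leechInner_add_left x.2.1 y.2.1 z.2.1, Int.cast_add]

theorem hexaForm_apply {g : E24 ≃ₗᵢ[ℝ] E24} {f : Fin 6 → E24} (x y : hexaAnn g f) :
    hexaForm g f x y = ((leechInner x y : ℤ) : ZMod 3) := rfl

theorem mem_ker_hexaForm {g : E24 ≃ₗᵢ[ℝ] E24} {f : Fin 6 → E24} {x : hexaAnn g f} :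
    x ∈ (hexaForm g f).ker ↔ ∀ y ∈ hexaAnn g f, ∃ n : ℤ, inner ℝ (x : E24) y = 3 * n := by
  rw [AddMonoidHom.mem_ker]
  constructor
  · intro h y hy
    have h1 := DFunLike.congr_fun h ⟨y, hy⟩
    rw [hexaForm_apply, AddMonoidHom.zero_apply, ZMod.intCast_zmod_eq_zero_iff_dvd] at h1
    obtain ⟨n, hn⟩ := h1
    refine ⟨n, ?_⟩
    rw [← leechInner_cast x.2.1 hy.1, hn]
    push_cast
    rfl
  · intro h
    ext y
    rw [hexaForm_apply, AddMonoidHom.zero_apply]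
    obtain ⟨n, hn⟩ := h y y.2
    rw [leechInner_eq (n := 3 * n) (by rw [hn]; push_cast; rfl)]
    exact (ZMod.intCast_zmod_eq_zero_iff_dvd _ 3).2 ⟨n, rfl⟩

/-- The lower bound on norms makes the lattice discrete, and for discrete subgroups the integral and
real ranks agree. -/
theorem finrank_le_of_le_leechLattice {L : Submodule ℤ E24} (hL : L ≤ leechLattice)
    {U : Submodule ℝ E24} (hU : ∀ x ∈ L, x ∈ U) : Module.finrank ℤ L ≤ Module.finrank ℝ U := by
  have hd : DiscreteTopology (Submodule.span ℤ (L : Set E24)) := by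
    rw [Submodule.span_eq]
    refine DiscreteTopology.of_forall_le_norm (r := 1) one_pos fun x hx => ?_
    have h1 := leech_norm_ge (hL x.2) (by simpa using hx)
    rw [real_inner_self_eq_norm_sq] at h1
    rw [Submodule.coe_norm]
    nlinarith [norm_nonneg (x : E24)]
  have h1 := Real.finrank_eq_int_finrank_of_discrete hd
  rw [Set.finrank, Set.finrank, Submodule.span_eq] at h1
  rw [← h1]
  exact Submodule.finrank_mono (Submodule.span_le.2 hU)

theorem card_norm_four_hexaAnn (g : E24 ≃ₗᵢ[ℝ] E24) (f : Fin 6 → E24) :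
    Nat.card {x : hexaAnn g f // inner ℝ (x : E24) x = (4 : ℝ)} =
      Nat.card {x // x ∈ minimalVectors ∧ x ∈ (hexaSpan g f)ᗮ} := by
  have hp : ∀ x : E24, (x ∈ minimalVectors ∧ x ∈ (hexaSpan g f)ᗮ) ↔
      (x ∈ hexaAnn g f ∧ inner ℝ x x = (4 : ℝ)) := fun x => by
    rw [mem_minimalVectors, mem_hexaAnn, and_right_comm]
  rw [Nat.card_congr (Equiv.subtypeEquivRight hp)]
  exact Nat.card_congr (Equiv.subtypeSubtypeEquivSubtypeInter (fun x => x ∈ hexaAnn g f)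
    fun x => inner ℝ x x = (4 : ℝ))

namespace IsHexaFrame

variable {g : E24 ≃ₗᵢ[ℝ] E24} {f : Fin 6 → E24} {r s t : E24} (h : IsHexaFrame g f r s t)
include h

/-- The sum over an orbit is three times the component in the annihilator. -/
theorem orbit_sum_mem {v : E24} (hv : v ∈ leechLattice) : v + g v + g (g v) ∈ hexaAnn g f ∧
    v + g v + g (g v) = (3 : ℝ) • (hexaSpan g f)ᗮ.starProjection v := by
  have h1 : v = (hexaSpan g f).starProjection v + (hexaSpan g f)ᗮ.starProjection v :=
    (Submodule.starProjection_add_starProjection_orthogonal v).symm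
  have hP : (hexaSpan g f).starProjection v ∈ hexaSpan g f := Submodule.starProjection_apply_mem _ _
  have hQ : (hexaSpan g f)ᗮ.starProjection v ∈ (hexaSpan g f)ᗮ :=
    Submodule.starProjection_apply_mem _ _
  have h2 := h.add_map_add_map_map hP
  have h3 := h.map_eq_of_mem_orthogonal hQ
  have h4 : v + g v + g (g v) = (3 : ℝ) • (hexaSpan g f)ᗮ.starProjection v := by
    generalize (hexaSpan g f).starProjection v = P at *
    generalize (hexaSpan g f)ᗮ.starProjection v = Q at *
    rw [h1, map_add, map_add, h3, h3]
    calc _ = (P + g P + g (g P)) + (3 : ℝ) • Q := by module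
      _ = _ := by rw [h2, zero_add]
  refine ⟨⟨leechLattice.add_mem (leechLattice.add_mem hv (h.map_mem _ hv))
    (h.map_mem _ (h.map_mem _ hv)), ?_⟩, h4⟩
  rw [h4]
  exact Submodule.smul_mem _ _ hQ

theorem inner_orbit_sum {v y : E24} (hv : v ∈ leechLattice) (hy : y ∈ hexaAnn g f) :
    inner ℝ (v + g v + g (g v)) y = 3 * inner ℝ v y := by
  rw [(h.orbit_sum_mem hv).2, real_inner_smul_left]
  congr 1
  have h1 := Submodule.starProjection_add_starProjection_orthogonal (K := hexaSpan g f) v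
  conv_rhs => rw [← h1, inner_add_left]
  have h2 := Submodule.inner_right_of_mem_orthogonal
    (Submodule.starProjection_apply_mem (hexaSpan g f) v) hy.2
  rw [h2, zero_add]

/-- The vector x/3 is in the dual of the annihilator, which by unimodularity is the projection of
the Leech lattice. So x is three times the component of a lattice vector outside the span, and 9 ·
4/3 = 12. -/
theorem norm_ge_of_forall_inner {x : E24} (hx : x ∈ hexaAnn g f) (hx0 : x ≠ 0)
    (h3 : ∀ y ∈ hexaAnn g f, ∃ n : ℤ, inner ℝ x y = 3 * n) : 12 ≤ inner ℝ x x := by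
  obtain ⟨v, hv, hvx⟩ := exists_leech_inner_eq (hexaSpan g f)ᗮ ((1 / 3 : ℝ) • x) (by
    intro y hy hyU
    obtain ⟨n, hn⟩ := h3 y ⟨hy, hyU⟩
    refine ⟨n, ?_⟩
    rw [real_inner_smul_right, real_inner_comm x y, hn]
    ring)
  obtain ⟨hmem, heq⟩ := h.orbit_sum_mem hv
  have hxv : v + g v + g (g v) = x := by
    rw [← sub_eq_zero, ← inner_self_eq_zero (𝕜 := ℝ)]
    have hd := Submodule.sub_mem _ hmem hx
    rw [inner_sub_left, h.inner_orbit_sum hv hd, real_inner_comm _ v, hvx _ hd.1 hd.2,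
      real_inner_smul_right, real_inner_comm x]
    ring
  have hvJ : v ∉ hexaSpan g f := by
    intro hvJ
    rw [Submodule.starProjection_orthogonal_apply_eq_zero hvJ, smul_zero, hxv] at heq
    exact hx0 heq
  have hge := h.norm_orthogonal_ge hv hvJ
  rw [← hxv, heq, real_inner_smul_left, real_inner_smul_right, real_inner_self_eq_norm_sq]
  linarith

/-- On the span, (1 - g)(1 - g²) = 3. Given ψ in the glued lattice, u = (ψ - g²ψ)/3 therefore
satisfies u - gu = ψ. Its products with the glued lattice are integral, so it is the component of a
vector of the Leech lattice. Hence every class modulo 1 - ω is reached by some v - gv. -/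
theorem exists_orbit_sum (c : Fin 6 → ZMod 3) : ∃ v ∈ leechLattice, ∃ x y : Fin 6 → ℤ,
    v - g v = hexaComb g f x y ∧ ∀ i, ((x i + y i : ℤ) : ZMod 3) = c i := by
  choose z hz using fun i => ZMod.intCast_surjective (c i)
  obtain ⟨x, y, hxy, hres, -⟩ := exists_hexacode_lift z
  have hJ := hexaComb_mem_span (g := g) (f := f) x y
  have hint : ∀ m ∈ leechLattice, m ∈ hexaSpan g f → ∃ n : ℤ,
      inner ℝ m ((1 / 3 : ℝ) • (hexaComb g f x y - g (g (hexaComb g f x y)))) = n := by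
    intro m hm hmJ
    obtain ⟨p, q, hpq, rfl⟩ := h.mem_span_iff.1 ⟨hm, hmJ⟩
    have hL := h.hexaComb_mem hxy
    obtain ⟨k, hk⟩ := leech_inner_int hm hL
    obtain ⟨l, hl⟩ := leech_inner_int hm (h.map_mem _ hL)
    have e1 := h.inner_hexaComb p q x y
    have e2 := h.inner_hexaComb p q (fun i => -y i) (fun i => x i - y i)
    have e3 := h.inner_hexaComb p q (fun i => -(x i - y i)) (fun i => -y i - (x i - y i))
    rw [← h.map_hexaComb] at e2
    rw [← h.map_hexaComb (fun i => -y i), ← h.map_hexaComb] at e3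
    rw [hk] at e1
    rw [hl] at e2
    have e1' : 2 * k = ∑ i, (2 * (p i * x i + q i * y i) - p i * y i - q i * x i) := by
      exact_mod_cast e1
    have e2' : 2 * l = ∑ i, (2 * (p i * -y i + q i * (x i - y i)) - p i * (x i - y i) -
      q i * -y i) := by exact_mod_cast e2
    have hA : ∃ A D : ℤ, A = ∑ i, (p i * x i + q i * y i) ∧ D = ∑ i, (p i * y i) := ⟨_, _, rfl, rfl⟩
    obtain ⟨A, D, hA, hD⟩ := hA
    obtain ⟨F, hF⟩ : ∃ F : ℤ, F = ∑ i, (q i * x i) := ⟨_, rfl⟩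
    have e1'' : 2 * k = 2 * A - D - F := by
      rw [e1', hA, hD, hF, Finset.mul_sum, ← Finset.sum_sub_distrib, ← Finset.sum_sub_distrib]
    have e2'' : 2 * l = -D + 2 * F - A := by
      rw [e2', hA, hD, hF, Finset.mul_sum, ← Finset.sum_neg_distrib, ← Finset.sum_add_distrib,
        ← Finset.sum_sub_distrib]
      exact Finset.sum_congr rfl fun i _ => by ring
    have e3' : (∑ i, (2 * (p i * -(x i - y i) + q i * (-y i - (x i - y i))) -
        p i * (-y i - (x i - y i)) - q i * -(x i - y i))) = -F + 2 * D - A := by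
      rw [hA, hD, hF, Finset.mul_sum, ← Finset.sum_neg_distrib, ← Finset.sum_add_distrib,
        ← Finset.sum_sub_distrib]
      exact Finset.sum_congr rfl fun i _ => by ring
    rw [e3'] at e3
    refine ⟨(A - D) / 2, ?_⟩
    -- The parity comes from the integrality of the product with gψ, which says that A + D is even.
    obtain ⟨j, hj⟩ : ∃ j, A - D = 2 * j := ⟨(A - D) / 2, by omega⟩
    rw [hj, Int.mul_ediv_cancel_left _ two_ne_zero, real_inner_smul_right, inner_sub_right, hk]
    have e1r : (2 * k : ℝ) = 2 * A - D - F := by exact_mod_cast e1''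
    have hjr : (A - D : ℝ) = 2 * j := by exact_mod_cast hj
    push_cast at e3
    linarith
  obtain ⟨v, hv, hvu⟩ := exists_leech_inner_eq (hexaSpan g f) _ hint
  set ψ := hexaComb g f x y with hψ
  set u := (1 / 3 : ℝ) • (ψ - g (g ψ)) with hu
  have hort : v - u ∈ (hexaSpan g f)ᗮ := by
    rw [mem_hexaSpan_orthogonal]
    intro i
    have h1 := hvu _ (h.mem i) (Submodule.subset_span ⟨Sum.inl i, rfl⟩)
    have h2 := hvu _ (h.map_mem _ (h.mem i)) (Submodule.subset_span ⟨Sum.inr i, rfl⟩)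
    rw [inner_sub_left, inner_sub_left, real_inner_comm _ v, real_inner_comm _ u, h1,
      real_inner_comm _ v, real_inner_comm _ u, h2, sub_self, sub_self]
    exact ⟨rfl, rfl⟩
  refine ⟨v, hv, x, y, ?_, fun i => ?_⟩
  · have h1 := h.map_eq_of_mem_orthogonal hort
    rw [map_sub] at h1
    have h2 : v - g v = u - g u := by
      rw [sub_eq_sub_iff_sub_eq_sub, h1]
    have h3 := h.add_map_add_map_map hJ
    rw [h2, hu, map_smul, map_sub, h.cube]
    have h4 : g (g ψ) = -ψ - g ψ := by
      rw [← sub_eq_zero, ← h3]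
      abel
    rw [h4]
    module
  · rw [← hz, ← sub_eq_zero, ← Int.cast_sub]
    exact (ZMod.intCast_zmod_eq_zero_iff_dvd _ 3).2 (hres i)

/-- Orbit sums v + gv + g²v have products divisible by 3 with the annihilator, so they lie in the
radical. If two of them agree modulo 3 then, up to an element of the annihilator, the vectors differ
by some μ with zero orbit sum; μ is in the glued lattice, and the classes of v - gv modulo 1 - ω
coincide. This gives 3⁶ elements in a lattice of rank at most 12. -/
theorem card_quotient_ker_hexaForm : Finite (hexaAnn g f ⧸ (hexaForm g f).ker) ∧
    Nat.card (hexaAnn g f ⧸ (hexaForm g f).ker) ≤ 3 ^ 6 := by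
  choose v hv x y hxy hc using h.exists_orbit_sum
  obtain ⟨h1, h2⟩ := submodule_int_free (M := leechLattice) inferInstance (hexaAnn g f) inf_le_left
  have hrank : Module.finrank ℤ (hexaAnn g f) ≤ 6 + 6 := by
    have h3 := finrank_le_of_le_leechLattice (L := hexaAnn g f) (U := (hexaSpan g f)ᗮ) inf_le_left
      fun x hx => hx.2
    have h4 := Submodule.finrank_add_finrank_orthogonal (hexaSpan g f)
    rw [h.finrank_hexaSpan, finrank_euclideanSpace, Fintype.card_option, ZMod.card] at h4
    omega
  refine card_quotient_ker_le (hexaForm g f) hrank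
    (fun c => ⟨_, (h.orbit_sum_mem (hv c)).1⟩) (fun c => ?_) fun c d k hk => ?_
  · rw [mem_ker_hexaForm]
    intro z hz
    obtain ⟨n, hn⟩ := leech_inner_int (hv c) hz.1
    exact ⟨n, by rw [← hn]; exact h.inner_orbit_sum (hv c) hz⟩
  · have hk' : (v c + g (v c) + g (g (v c))) - (v d + g (v d) + g (g (v d))) = (3 : ℝ) • (k : E24) := by
      have h5 : _ = (((3 : ℤ) • k : hexaAnn g f) : E24) := congrArg Subtype.val hk
      rw [Submodule.coe_smul, ← Int.cast_smul_eq_zsmul ℝ, Int.cast_ofNat] at h5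
      exact h5
    set μ := v c - v d - (k : E24) with hμ
    have hμL : μ ∈ leechLattice :=
      leechLattice.sub_mem (leechLattice.sub_mem (hv c) (hv d)) k.2.1
    have hgk : g (k : E24) = k := h.map_eq_of_mem_orthogonal k.2.2
    have h0 : μ + g μ + g (g μ) = 0 := by
      rw [hμ]
      simp only [map_sub, hgk]
      calc _ = ((v c + g (v c) + g (g (v c))) - (v d + g (v d) + g (g (v d)))) -
            (3 : ℝ) • (k : E24) := by module
        _ = 0 := by rw [hk', sub_self]
    rw [(h.orbit_sum_mem hμL).2, smul_eq_zero_iff_right (by norm_num)] at h0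
    have hμJ : μ ∈ hexaSpan g f := by
      have h5 := Submodule.starProjection_add_starProjection_orthogonal (K := hexaSpan g f) μ
      rw [h0, add_zero] at h5
      rw [← h5]
      exact Submodule.starProjection_apply_mem _ _
    obtain ⟨p, q, hpq, hμpq⟩ := h.mem_span_iff.1 ⟨hμL, hμJ⟩
    have h6 : hexaComb g f (x c) (y c) - hexaComb g f (x d) (y d) =
        hexaComb g f p q - g (hexaComb g f p q) := by
      rw [← hμpq, ← hxy, ← hxy, hμ]
      simp only [map_sub, hgk]
      abel
    rw [h.map_hexaComb, hexaComb_sub, hexaComb_sub] at h6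
    funext i
    have h7 := congrArg (fun w => inner ℝ w (f i)) h6
    replace h7 := ((h.inner_hexaComb_left _ _ i).1.symm.trans h7).trans
      (h.inner_hexaComb_left _ _ i).1
    rw [Int.cast_inj] at h7
    rw [← hc c i, ← hc d i, ← sub_eq_zero, ← Int.cast_sub]
    refine (ZMod.intCast_zmod_eq_zero_iff_dvd _ 3).2 ?_
    simp only [Pi.sub_apply] at h7
    omega

/-- Distinct norm 4 vectors of one class differ by a radical vector of norm at least 12, so their
product is at most -2. Four of them would have a sum of norm at most 16 - 24 < 0. This supplies the
bound three required by `exists_classes`. -/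
theorem exists_norm_four_classes : ∃ cls : (Fin 5 → ZMod 3) → Finset (hexaAnn g f),
    ∀ a, ∑ i, a i * a i = 1 → (cls a).card = 3 ∧
      (∀ x ∈ cls a, inner ℝ (x : E24) x = (4 : ℝ) ∧ ∃ n : ℤ, inner ℝ (x : E24) r = 3 * n) ∧
      (∀ x ∈ cls a, ∀ y ∈ cls a, hexaForm g f x = hexaForm g f y) ∧
      ∀ b, ∑ i, b i * b i = 1 → ∀ x ∈ cls a, ∀ y ∈ cls b,
        hexaForm g f x y = ∑ i, a i * b i := by
  obtain ⟨hfin, hcard⟩ := h.card_quotient_ker_hexaForm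
  have h756 := h.card_minimalVectors_span_ge
  rw [h.card_minimalVectors_span_eq, ← card_norm_four_hexaAnn] at h756
  have hfin4 : Finite {x : hexaAnn g f // inner ℝ (x : E24) x = (4 : ℝ)} :=
    Nat.finite_of_card_ne_zero (by omega)
  have hset : {x : hexaAnn g f | inner ℝ (x : E24) x = (4 : ℝ)}.Finite := hfin4
  set S := hset.toFinset with hSdef
  have hS : ∀ x, x ∈ S ↔ inner ℝ (x : E24) x = (4 : ℝ) := fun x => hset.mem_toFinset
  have hScard : 756 ≤ S.card := by
    rw [hSdef, ← Set.ncard_eq_toFinset_card _ hset]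
    exact h756
  have hnorm : ∀ x : hexaAnn g f, inner ℝ (x : E24) x = (4 : ℝ) → hexaForm g f x x = 1 := by
    intro x hx
    rw [hexaForm_apply, leechInner_eq (n := 4) (by rw [hx]; norm_num)]
    decide
  have hrK : r ∈ hexaAnn g f := ⟨h.left_mem, mem_hexaSpan_orthogonal.2 h.inner_left⟩
  have hfib : ∀ x ∈ S, ∀ T ⊆ S, (∀ y ∈ T, hexaForm g f y = hexaForm g f x) → T.card ≤ 3 := by
    intro x hx T hT hTx
    by_contra! hcon
    have hip : ∀ y ∈ T, ∀ z ∈ T, y ≠ z → inner ℝ (y : E24) (z : E24) ≤ (-2 : ℝ) := by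
      intro y hy z hz hyz
      have h1 : y - z ∈ (hexaForm g f).ker := by
        rw [AddMonoidHom.mem_ker, map_sub, hTx y hy, hTx z hz, sub_self]
      have h2 := h.norm_ge_of_forall_inner (y - z).2
        (fun h0 => hyz (sub_eq_zero.1 (Subtype.ext h0))) (mem_ker_hexaForm.1 h1)
      rw [Submodule.coe_sub, inner_sub_left, inner_sub_right, inner_sub_right,
        (hS y).1 (hT hy), (hS z).1 (hT hz), real_inner_comm (y : E24) z] at h2
      linarith
    obtain ⟨U, hUT, hU⟩ := Finset.exists_subset_card_eq (Nat.succ_le_of_lt hcon)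
    have h3 : 0 ≤ inner ℝ (∑ y ∈ U, (y : E24)) (∑ y ∈ U, (y : E24)) := real_inner_self_nonneg
    rw [sum_inner] at h3
    have h4 : ∀ y ∈ U, inner ℝ (y : E24) (∑ z ∈ U, (z : E24)) ≤ -2 := by
      intro y hy
      rw [inner_sum, ← Finset.add_sum_erase U _ hy, (hS y).1 (hT (hUT hy))]
      have h5 : ∑ z ∈ U.erase y, inner ℝ (y : E24) (z : E24) ≤ ∑ _z ∈ U.erase y, (-2 : ℝ) :=
        Finset.sum_le_sum fun z hz =>
          hip y (hUT hy) z (hUT (Finset.mem_of_mem_erase hz)) (Finset.ne_of_mem_erase hz).symm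
      rw [Finset.sum_const, Finset.card_erase_of_mem hy, hU] at h5
      norm_num at h5
      linarith
    have h6 := Finset.sum_le_sum h4
    rw [Finset.sum_const, hU] at h6
    norm_num at h6
    linarith
  obtain ⟨cls, hcls⟩ := exists_classes (hexaForm g f)
    (fun x y => by rw [hexaForm_apply, hexaForm_apply, leechInner_comm]) hfin hcard S
    (fun x hx => hnorm x ((hS x).1 hx)) hfib hScard ⟨r, hrK⟩ (hnorm _ h.norm_left)
  refine ⟨cls, fun a ha => ?_⟩
  obtain ⟨h1, h2, h3, h4⟩ := hcls a ha
  refine ⟨h1, fun x hx => ⟨(hS x).1 (h2 x hx).1, ?_⟩, h3, h4⟩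
  have h5 := (h2 x hx).2
  rw [hexaForm_apply, ZMod.intCast_zmod_eq_zero_iff_dvd] at h5
  obtain ⟨n, hn⟩ := h5
  refine ⟨n, ?_⟩
  rw [← leechInner_cast x.2.1 h.left_mem, hn]
  push_cast
  rfl

end IsHexaFrame

/-! ### Orthogonal triples of minimal vectors -/

theorem leech_inner_cases {x y : E24} (hx : x ∈ leechLattice) (hy : y ∈ leechLattice)
    (hx4 : inner ℝ x x = (4 : ℝ)) (hy4 : inner ℝ y y = (4 : ℝ)) : ∃ n : ℤ, inner ℝ x y = n ∧
      (x = y ∨ (x = -y ∧ n = -4) ∨ (-2 ≤ n ∧ n ≤ 2)) := by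
  obtain ⟨n, hn⟩ := leech_inner_int hx hy
  refine ⟨n, hn, ?_⟩
  by_cases h1 : x = y
  · exact Or.inl h1
  by_cases h2 : x = -y
  · subst h2
    rw [inner_neg_left, hy4] at hn
    refine Or.inr (Or.inl ⟨rfl, ?_⟩)
    exact_mod_cast hn.symm
  · have h3 := leech_norm_ge (leechLattice.sub_mem hx hy) (sub_ne_zero.2 h1)
    have h4 := leech_norm_ge (leechLattice.add_mem hx hy) (fun h => h2 (eq_neg_of_add_eq_zero_left h))
    rw [inner_sub_left, inner_sub_right, inner_sub_right, hx4, hy4, real_inner_comm x y, hn] at h3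
    rw [inner_add_left, inner_add_right, inner_add_right, hx4, hy4, real_inner_comm x y, hn] at h4
    refine Or.inr (Or.inr ⟨?_, ?_⟩)
    · have : (-2 : ℝ) ≤ n := by linarith
      exact_mod_cast this
    · have : (n : ℝ) ≤ 2 := by linarith
      exact_mod_cast this

/-- A family of orthogonal triples, as given by the five copies of `AA₂`, together with the glue. -/
structure IsTripleFrame (X : Fin 5 → ZMod 3 → E24) : Prop where
  mem : ∀ i k, X i k ∈ leechLattice
  inner_eq : ∀ i j k l, inner ℝ (X i k) (X j l) =
    if i = j then (if k = l then (4 : ℝ) else -2) else 0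
  sum_eq : ∀ i, X i 0 + X i 1 + X i 2 = 0
  glue₁ : ∀ k, (1 / 2 : ℝ) • (X 0 k + X 1 k + X 2 k + X 3 k) ∈ leechLattice
  glue₂ : ∀ k, (1 / 2 : ℝ) • (X 0 k + X 2 (k + 1) + X 3 (k + 2) + X 4 k) ∈ leechLattice

theorem derangement_cases : ∀ β γ : ZMod 3 → ZMod 3, (∀ k, k ≠ β k ∧ k ≠ γ k ∧ β k ≠ γ k) →
    (∀ k l, k ≠ l → β k ≠ β l) → (∀ k, β k = k + 1 ∧ γ k = k + 2) ∨
      (∀ k, β k = k + 2 ∧ γ k = k + 1) := by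
  decide +kernel

theorem count_hits {a b c : ZMod 3} (h : ∀ j : ZMod 3, (if j = a then 1 else 0) +
    (if j = b then 1 else 0) + (if j = c then (1 : ℕ) else 0) = 1) : a ≠ b ∧ a ≠ c ∧ b ≠ c := by
  revert a b c
  decide

/-- A family of triples with the glue in any relative position can be relabelled. -/
theorem exists_isTripleFrame {X : Fin 5 → ZMod 3 → E24} (hmem : ∀ i k, X i k ∈ leechLattice)
    (hinner : ∀ i j k l, inner ℝ (X i k) (X j l) =
      if i = j then (if k = l then (4 : ℝ) else -2) else 0)
    (hsum : ∀ i, X i 0 + X i 1 + X i 2 = 0) {ℓ ℓ' : Fin 5 → ZMod 3 → ZMod 3}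
    (hℓ : ∀ i, i ≠ 4 → Function.Injective (ℓ i)) (hℓ' : ∀ i, i ≠ 1 → Function.Injective (ℓ' i))
    (h1 : ∀ k, (1 / 2 : ℝ) • (X 0 (ℓ 0 k) + X 1 (ℓ 1 k) + X 2 (ℓ 2 k) + X 3 (ℓ 3 k)) ∈ leechLattice)
    (h2 : ∀ k, (1 / 2 : ℝ) • (X 0 (ℓ' 0 k) + X 2 (ℓ' 2 k) + X 3 (ℓ' 3 k) + X 4 (ℓ' 4 k)) ∈
      leechLattice) :
    ∃ σ : Fin 5 → Equiv.Perm (ZMod 3), IsTripleFrame fun i k => X i (σ i k) := by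
  have hbij : ∀ {p : ZMod 3 → ZMod 3}, Function.Injective p → Function.Bijective p :=
    fun hp => Finite.injective_iff_bijective.1 hp
  let e0 := Equiv.ofBijective _ (hbij (hℓ 0 (by decide)))
  let e1 := Equiv.ofBijective _ (hbij (hℓ 1 (by decide)))
  let e2 := Equiv.ofBijective _ (hbij (hℓ 2 (by decide)))
  let e3 := Equiv.ofBijective _ (hbij (hℓ 3 (by decide)))
  let d0 := Equiv.ofBijective _ (hbij (hℓ' 0 (by decide)))
  let d2 := Equiv.ofBijective _ (hbij (hℓ' 2 (by decide)))
  let d3 := Equiv.ofBijective _ (hbij (hℓ' 3 (by decide)))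
  let d4 := Equiv.ofBijective _ (hbij (hℓ' 4 (by decide)))
  let α : Equiv.Perm (ZMod 3) := d0.trans e0.symm
  let β : Equiv.Perm (ZMod 3) := (α.symm.trans d2).trans e2.symm
  let γ : Equiv.Perm (ZMod 3) := (α.symm.trans d3).trans e3.symm
  let δ : Equiv.Perm (ZMod 3) := α.symm.trans d4
  have h1' : ∀ k, (1 / 2 : ℝ) • (X 0 (e0 k) + X 1 (e1 k) + X 2 (e2 k) + X 3 (e3 k)) ∈ leechLattice :=
    h1
  have h2' : ∀ k, (1 / 2 : ℝ) • (X 0 (e0 k) + X 2 (e2 (β k)) + X 3 (e3 (γ k)) + X 4 (δ k)) ∈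
      leechLattice := by
    intro k
    have h3 := h2 (α.symm k)
    have e0' : ℓ' 0 (α.symm k) = e0 k := by
      have h4 : α (α.symm k) = k := α.apply_symm_apply k
      conv_rhs => rw [← h4]
      exact (e0.apply_symm_apply _).symm
    have e2' : ℓ' 2 (α.symm k) = e2 (β k) := (e2.apply_symm_apply _).symm
    have e3' : ℓ' 3 (α.symm k) = e3 (γ k) := (e3.apply_symm_apply _).symm
    rw [e0', e2', e3'] at h3
    exact h3
  -- Two glue vectors of norm 4 that agree in 3, 2, 1 or 0 of the common triples have product 3,
  -- 3/2, 0 or -3/2. Integrality excludes 3/2 and -3/2, and 3 would give a difference of norm 2; so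
  -- each j agrees exactly once.
  have hdist : ∀ k, k ≠ β k ∧ k ≠ γ k ∧ β k ≠ γ k := by
    intro k
    apply count_hits
    intro j
    obtain ⟨n, hn⟩ := leech_inner_int (h1' j) (h2' k)
    have hnorm := leech_norm_ge (leechLattice.sub_mem (h1' j) (h2' k))
    have hx : inner ℝ (X 0 (e0 j) + X 1 (e1 j) + X 2 (e2 j) + X 3 (e3 j))
        (X 0 (e0 k) + X 2 (e2 (β k)) + X 3 (e3 (γ k)) + X 4 (δ k)) =
        (if j = k then (4 : ℝ) else -2) + (if j = β k then (4 : ℝ) else -2) +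
          (if j = γ k then (4 : ℝ) else -2) := by
      simp only [inner_add_left, inner_add_right, hinner, EmbeddingLike.apply_eq_iff_eq]
      norm_num [Fin.ext_iff]
    have hp : inner ℝ (X 0 (e0 j) + X 1 (e1 j) + X 2 (e2 j) + X 3 (e3 j))
        (X 0 (e0 j) + X 1 (e1 j) + X 2 (e2 j) + X 3 (e3 j)) = (16 : ℝ) := by
      simp only [inner_add_left, inner_add_right, hinner]
      norm_num [Fin.ext_iff]
    have hq : inner ℝ (X 0 (e0 k) + X 2 (e2 (β k)) + X 3 (e3 (γ k)) + X 4 (δ k))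
        (X 0 (e0 k) + X 2 (e2 (β k)) + X 3 (e3 (γ k)) + X 4 (δ k)) = (16 : ℝ) := by
      simp only [inner_add_left, inner_add_right, hinner]
      norm_num [Fin.ext_iff]
    generalize X 0 (e0 j) + X 1 (e1 j) + X 2 (e2 j) + X 3 (e3 j) = p at *
    generalize X 0 (e0 k) + X 2 (e2 (β k)) + X 3 (e3 (γ k)) + X 4 (δ k) = q at *
    rw [← smul_sub, smul_ne_zero_iff_right (by norm_num), real_inner_smul_left,
      real_inner_smul_right, inner_sub_left, inner_sub_right, inner_sub_right, hp, hq,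
      real_inner_comm p q, hx] at hnorm
    rw [real_inner_smul_left, real_inner_smul_right, hx] at hn
    split_ifs at hn hnorm hx ⊢ <;> try rfl
    · exfalso
      have hpq : p - q ≠ 0 := by
        intro h0
        rw [sub_eq_zero] at h0
        rw [h0, hq] at hx
        norm_num at hx
      have := hnorm hpq
      norm_num at this
    all_goals
      exfalso
      ring_nf at hn
      first
        | (have h3 : (3 : ℝ) = 2 * n := by linarith
           have h4 : (3 : ℤ) = 2 * n := by exact_mod_cast h3
           omega)
        | (have h3 : (-3 : ℝ) = 2 * n := by linarith
           have h4 : (-3 : ℤ) = 2 * n := by exact_mod_cast h3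
           omega)
  have key : ∀ ν : Equiv.Perm (ZMod 3), (∀ k, β (ν k) = ν (k + 1)) → (∀ k, γ (ν k) = ν (k + 2)) →
      IsTripleFrame fun i k => X i ((![e0, e1, e2, e3, δ] i) (ν k)) := by
    intro ν hβ hγ
    refine ⟨fun i k => hmem _ _, fun i j k l => ?_, fun i => ?_, fun k => h1' (ν k), fun k => ?_⟩
    · rw [hinner]
      by_cases hij : i = j
      · subst hij
        simp only [EmbeddingLike.apply_eq_iff_eq]
      · rw [if_neg hij, if_neg hij]
    · have h3 := Equiv.sum_comp (ν.trans (![e0, e1, e2, e3, δ] i)) (X i)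
      have h4 : ∀ F : ZMod 3 → E24, ∑ k, F k = F 0 + F 1 + F 2 := fun F => Fin.sum_univ_three F
      rw [h4, h4, hsum] at h3
      exact h3
    · have h3 := h2' (ν k)
      rw [hβ, hγ] at h3
      exact h3
  rcases derangement_cases β γ hdist fun k l hkl hβ => hkl (β.injective hβ) with hc | hc
  · exact ⟨_, key (Equiv.refl _) (fun k => (hc k).1) fun k => (hc k).2⟩
  -- Negating all indices exchanges the cyclic shifts by 1 and 2, so the second orientation reduces
  -- to the first.
  · refine ⟨fun i => (Equiv.neg _).trans (![e0, e1, e2, e3, δ] i), key (Equiv.neg _) (fun k => ?_)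
      fun k => ?_⟩
    · refine ((hc _).1).trans ?_
      revert k
      decide
    · refine ((hc _).2).trans ?_
      revert k
      decide

/-- A minimal vector with product `1` modulo `3` with four of the triples. -/
theorem exists_labels {Y : ZMod 3 → E24} {X : Fin 5 → ZMod 3 → E24} {S : Finset (Fin 5)}
    (hS : S.card = 4) (hYL : ∀ k, Y k ∈ leechLattice)
    (hY4 : ∀ k, inner ℝ (Y k) (Y k) = (4 : ℝ)) (hYsum : Y 0 + Y 1 + Y 2 = 0)
    (hmem : ∀ i k, X i k ∈ leechLattice)
    (hinner : ∀ i j k l, inner ℝ (X i k) (X j l) =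
      if i = j then (if k = l then (4 : ℝ) else -2) else 0)
    (hsum : ∀ i, X i 0 + X i 1 + X i 2 = 0)
    (hres : ∀ i ∈ S, ∀ k l, ∃ n : ℤ, inner ℝ (Y k) (X i l) = n ∧ (n : ZMod 3) = 1) :
    ∃ ℓ : Fin 5 → ZMod 3 → ZMod 3, (∀ i ∈ S, Function.Injective (ℓ i)) ∧
      ∀ k, (1 / 2 : ℝ) • ∑ i ∈ S, X i (ℓ i k) ∈ leechLattice := by
  -- The value 4 would mean Y_k = X_{i,l}, which is orthogonal to the other triples of S instead of
  -- having product 1 modulo 3 with them.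
  have hcase : ∀ i ∈ S, ∀ k l, inner ℝ (Y k) (X i l) = (1 : ℝ) ∨ inner ℝ (Y k) (X i l) = (-2 : ℝ) := by
    intro i hi k l
    obtain ⟨n, hn, hn1⟩ := hres i hi k l
    have hmod : 3 ∣ n - 1 := by
      refine (ZMod.intCast_zmod_eq_zero_iff_dvd _ 3).1 ?_
      rw [Int.cast_sub, hn1, Int.cast_one, sub_self]
    obtain ⟨m, hm, hc⟩ := leech_inner_cases (hYL k) (hmem i l) (hY4 k)
      ((hinner i i l l).trans (by rw [if_pos rfl, if_pos rfl]))
    obtain rfl : m = n := by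
      rw [hn] at hm
      exact_mod_cast hm.symm
    rcases hc with h1 | ⟨-, h1⟩ | h1
    · obtain ⟨j, hj, hji⟩ := Finset.exists_mem_ne (by omega : 1 < S.card) i
      obtain ⟨n', hn', hn1'⟩ := hres j hj k l
      rw [h1, hinner, if_neg hji.symm] at hn'
      have : n' = 0 := by exact_mod_cast hn'.symm
      rw [this, Int.cast_zero] at hn1'
      exact absurd hn1' (by decide)
    · omega
    · have h2 : m = 1 ∨ m = -2 := by omega
      rw [hm]
      rcases h2 with rfl | rfl
      · exact Or.inl (by norm_num)
      · exact Or.inr (by norm_num)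
  have hex : ∀ i k, ∃ l, i ∈ S → inner ℝ (Y k) (X i l) = (-2 : ℝ) := by
    intro i k
    by_contra! hcon
    have h1 : ∀ l, inner ℝ (Y k) (X i l) = (1 : ℝ) := fun l =>
      (hcase i (hcon l).1 k l).resolve_right (hcon l).2
    have h2 := congrArg (fun w => inner ℝ (Y k) w) (hsum i)
    simp only [inner_add_right, h1, inner_zero_right] at h2
    norm_num at h2
  choose ℓ hℓ using hex
  have hcol : ∀ i l, inner ℝ (Y 0) (X i l) + inner ℝ (Y 1) (X i l) + inner ℝ (Y 2) (X i l) =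
      (0 : ℝ) := by
    intro i l
    rw [← inner_add_left, ← inner_add_left, hYsum, inner_zero_left]
  refine ⟨ℓ, fun i hi k k' hkk => ?_, fun k => ?_⟩
  · by_contra hne
    have h1 := hℓ i k hi
    have h2 := hℓ i k' hi
    rw [← hkk] at h2
    have h3 := hcol i (ℓ i k)
    have h0 := hcase i hi 0 (ℓ i k)
    have h0' := hcase i hi 1 (ℓ i k)
    have h0'' := hcase i hi 2 (ℓ i k)
    generalize ℓ i k = l at *
    change Fin 3 at k k'
    fin_cases k <;> fin_cases k' <;>
      first
        | exact hne rfl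
        | (change inner ℝ (Y 0) (X i l) = (-2 : ℝ) at h1
           change inner ℝ (Y 1) (X i l) = (-2 : ℝ) at h2
           rcases h0'' with h | h <;> linarith)
        | (change inner ℝ (Y 0) (X i l) = (-2 : ℝ) at h1
           change inner ℝ (Y 2) (X i l) = (-2 : ℝ) at h2
           rcases h0' with h | h <;> linarith)
        | (change inner ℝ (Y 1) (X i l) = (-2 : ℝ) at h1
           change inner ℝ (Y 2) (X i l) = (-2 : ℝ) at h2
           rcases h0 with h | h <;> linarith)
        | (change inner ℝ (Y 1) (X i l) = (-2 : ℝ) at h1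
           change inner ℝ (Y 0) (X i l) = (-2 : ℝ) at h2
           rcases h0'' with h | h <;> linarith)
        | (change inner ℝ (Y 2) (X i l) = (-2 : ℝ) at h1
           change inner ℝ (Y 0) (X i l) = (-2 : ℝ) at h2
           rcases h0' with h | h <;> linarith)
        | (change inner ℝ (Y 2) (X i l) = (-2 : ℝ) at h1
           change inner ℝ (Y 1) (X i l) = (-2 : ℝ) at h2
           rcases h0 with h | h <;> linarith)
  · set W := ∑ i ∈ S, X i (ℓ i k) with hW
    have h1 : inner ℝ (Y k) W = (-8 : ℝ) := by
      rw [hW, inner_sum, Finset.sum_congr rfl fun i hi => hℓ i k hi, Finset.sum_const, hS]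
      norm_num
    have h2 : inner ℝ W W = (16 : ℝ) := by
      rw [hW, sum_inner]
      simp only [inner_sum, hinner, Finset.sum_ite_eq, if_true]
      rw [Finset.sum_ite_mem, Finset.inter_self, Finset.sum_const, hS]
      norm_num
    -- The norm of W/2 + Y_k is 4 - 8 + 4 = 0.
    have h3 : (1 / 2 : ℝ) • W = -Y k := by
      rw [← sub_eq_zero, ← inner_self_eq_zero (𝕜 := ℝ), sub_neg_eq_add, inner_add_left,
        inner_add_right, inner_add_right, real_inner_smul_left, real_inner_smul_left,
        real_inner_smul_right, real_inner_smul_right, hY4, h1, h2, real_inner_comm (Y k) W, h1]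
      norm_num
    rw [h3]
    exact leechLattice.neg_mem (hYL k)

namespace IsHexaFrame

variable {g : E24 ≃ₗᵢ[ℝ] E24} {f : Fin 6 → E24} {r s t : E24} (h : IsHexaFrame g f r s t)
include h

/-- A minimal vector whose product with `r` is divisible by `3` is orthogonal to `r` and `s`. -/
theorem inner_eq_zero_of_dvd {x : E24} (hx : x ∈ hexaAnn g f) (hx4 : inner ℝ x x = (4 : ℝ))
    (hr : ∃ n : ℤ, inner ℝ x r = 3 * n) : inner ℝ x r = (0 : ℝ) ∧ inner ℝ x s = (0 : ℝ) := by
  obtain ⟨n, hn⟩ := hr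
  obtain ⟨m, hm, hcr⟩ := leech_inner_cases hx.1 h.left_mem hx4 h.norm_left
  have hmn : m = 3 * n := by
    rw [hm] at hn
    exact_mod_cast hn
  have hm0 : m = 0 := by
    rcases hcr with rfl | ⟨-, h1⟩ | h1
    · rw [hx4] at hm
      have : (4 : ℤ) = m := by exact_mod_cast hm
      omega
    · omega
    · omega
  have hr0 : inner ℝ x r = (0 : ℝ) := by rw [hm, hm0, Int.cast_zero]
  refine ⟨hr0, ?_⟩
  -- The component of t is (r + 2s)/3, so orthogonality to r makes the product with s divisible by 3
  -- as well.
  have h1 := h.inner_extra x (mem_hexaSpan_orthogonal.1 hx.2)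
  obtain ⟨k, hk⟩ := leech_inner_int hx.1 h.extra_mem
  obtain ⟨l, hl, hcs⟩ := leech_inner_cases hx.1 h.right_mem hx4 h.norm_right
  rw [hr0, hk, hl, zero_add] at h1
  have hkl : 3 * k = 2 * l := by exact_mod_cast h1
  have hl0 : l = 0 := by
    rcases hcs with rfl | ⟨-, h2⟩ | h2
    · rw [real_inner_comm, h.inner_left_right] at hr0
      norm_num at hr0
    · omega
    · omega
  rw [hl, hl0, Int.cast_zero]

/-- The three vectors of a class have pairwise products at most -2. Their sum has norm 12 plus twice
those products, which is nonnegative; so all products are -2 and the sum vanishes. -/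
theorem exists_triples : ∃ Y : (Fin 5 → ZMod 3) → ZMod 3 → E24, ∀ a, ∑ i, a i * a i = 1 →
    (∀ k, Y a k ∈ hexaAnn g f ∧ inner ℝ (Y a k) (Y a k) = (4 : ℝ) ∧
      inner ℝ (Y a k) r = (0 : ℝ) ∧ inner ℝ (Y a k) s = (0 : ℝ)) ∧
    (∀ k l, k ≠ l → inner ℝ (Y a k) (Y a l) = (-2 : ℝ)) ∧ Y a 0 + Y a 1 + Y a 2 = 0 ∧
    (∀ x ∈ hexaAnn g f, ∀ k l, ∃ n : ℤ, inner ℝ x (Y a k) - inner ℝ x (Y a l) = 3 * n) ∧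
    ∀ b, ∑ i, b i * b i = 1 → ∀ k l, ∃ n : ℤ, inner ℝ (Y a k) (Y b l) = n ∧
      (n : ZMod 3) = ∑ i, a i * b i := by
  obtain ⟨cls, hcls⟩ := h.exists_norm_four_classes
  have hY : ∀ a : Fin 5 → ZMod 3, ∃ Y : ZMod 3 → hexaAnn g f, ∑ i, a i * a i = 1 →
      (∀ k, Y k ∈ cls a) ∧ ∀ k l, k ≠ l → Y k ≠ Y l := by
    intro a
    by_cases ha : ∑ i, a i * a i = 1
    · obtain ⟨x, y, z, hxy, hxz, hyz, hc⟩ := Finset.card_eq_three.1 (hcls a ha).1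
      refine ⟨(![x, y, z] : Fin 3 → hexaAnn g f), fun _ => ⟨fun k => ?_, fun k l hkl => ?_⟩⟩
      · rw [hc]
        change Fin 3 at k
        fin_cases k <;> simp
      · change Fin 3 at k l
        fin_cases k <;> fin_cases l <;>
          first
            | exact absurd rfl hkl
            | exact hxy
            | exact hxz
            | exact hyz
            | exact hxy.symm
            | exact hxz.symm
            | exact hyz.symm
    · exact ⟨fun _ => 0, fun h1 => absurd h1 ha⟩
  choose Y hY using hY
  refine ⟨fun a k => Y a k, fun a ha => ?_⟩
  obtain ⟨hYc, hYne⟩ := hY a ha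
  obtain ⟨-, hn, hsame, hcross⟩ := hcls a ha
  have h4 : ∀ k, inner ℝ (Y a k : E24) (Y a k) = (4 : ℝ) := fun k => (hn _ (hYc k)).1
  have hip : ∀ k l, k ≠ l → inner ℝ (Y a k : E24) (Y a l) ≤ (-2 : ℝ) := by
    intro k l hkl
    have h1 : Y a k - Y a l ∈ (hexaForm g f).ker := by
      rw [AddMonoidHom.mem_ker, map_sub, hsame _ (hYc k) _ (hYc l), sub_self]
    have h2 := h.norm_ge_of_forall_inner (Y a k - Y a l).2
      (fun h0 => hYne k l hkl (sub_eq_zero.1 (Subtype.ext h0))) (mem_ker_hexaForm.1 h1)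
    rw [Submodule.coe_sub, inner_sub_left, inner_sub_right, inner_sub_right, h4, h4,
      real_inner_comm (Y a k : E24) (Y a l)] at h2
    linarith
  have i01 := hip 0 1 (by decide)
  have i02 := hip 0 2 (by decide)
  have i12 := hip 1 2 (by decide)
  have hsum : inner ℝ ((Y a 0 : E24) + Y a 1 + Y a 2) ((Y a 0 : E24) + Y a 1 + Y a 2) =
      12 + 2 * (inner ℝ (Y a 0 : E24) (Y a 1) + inner ℝ (Y a 0 : E24) (Y a 2) +
        inner ℝ (Y a 1 : E24) (Y a 2)) := by
    simp only [inner_add_left, inner_add_right, h4]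
    rw [real_inner_comm (Y a 0 : E24) (Y a 1), real_inner_comm (Y a 0 : E24) (Y a 2),
      real_inner_comm (Y a 1 : E24) (Y a 2)]
    ring
  have hpos : (0 : ℝ) ≤ inner ℝ ((Y a 0 : E24) + Y a 1 + Y a 2) ((Y a 0 : E24) + Y a 1 + Y a 2) :=
    real_inner_self_nonneg
  have j01 : inner ℝ (Y a 0 : E24) (Y a 1) = (-2 : ℝ) := by linarith
  have j02 : inner ℝ (Y a 0 : E24) (Y a 2) = (-2 : ℝ) := by linarith
  have j12 : inner ℝ (Y a 1 : E24) (Y a 2) = (-2 : ℝ) := by linarith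
  refine ⟨fun k => ⟨(Y a k).2, h4 k, h.inner_eq_zero_of_dvd (Y a k).2 (h4 k) (hn _ (hYc k)).2⟩,
    fun k l hkl => ?_, ?_, fun x hx k l => ?_, fun b hb k l => ?_⟩
  · change Fin 3 at k l
    fin_cases k <;> fin_cases l <;>
      first
        | exact absurd rfl hkl
        | exact j01
        | exact j02
        | exact j12
        | exact (real_inner_comm _ _).trans j01
        | exact (real_inner_comm _ _).trans j02
        | exact (real_inner_comm _ _).trans j12
  · rw [← inner_self_eq_zero (𝕜 := ℝ), hsum, j01, j02, j12]
    norm_num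
  · have h1 : Y a k - Y a l ∈ (hexaForm g f).ker := by
      rw [AddMonoidHom.mem_ker, map_sub, hsame _ (hYc k) _ (hYc l), sub_self]
    obtain ⟨n, hn⟩ := mem_ker_hexaForm.1 h1 x hx
    refine ⟨n, ?_⟩
    rw [← inner_sub_right, real_inner_comm, ← hn, Submodule.coe_sub]
  · refine ⟨_, (leechInner_cast (Y a k).2.1 (Y b l).2.1).symm, ?_⟩
    rw [← hexaForm_apply]
    exact hcross b hb _ (hYc k) _ ((hY b hb).1 l)

/-- The unit vectors give five triples. Products between them are divisible by 3 and at most 2 in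
absolute value, hence zero. Two further classes of norm one consist of the negatives of glue
vectors. -/
theorem exists_tripleFrame : ∃ X, IsTripleFrame X ∧
    (∀ i k, X i k ∈ hexaAnn g f ∧ inner ℝ (X i k) r = (0 : ℝ) ∧ inner ℝ (X i k) s = (0 : ℝ)) ∧
    ∀ x ∈ hexaAnn g f, ∀ i k l, ∃ n : ℤ, inner ℝ x (X i k) - inner ℝ x (X i l) = 3 * n := by
  obtain ⟨Y, hY⟩ := h.exists_triples
  let u : Fin 5 → Fin 5 → ZMod 3 := fun i => Pi.single i 1
  have hu : ∀ i, ∑ k, u i k * u i k = 1 := by decide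
  have hu2 : ∀ i j, i ≠ j → ∑ k, u i k * u j k = 0 := by decide
  -- Both words have four entries 1, and 4 = 1 modulo 3, so they have norm one and product 1 with
  -- each unit vector in their support.
  let w : Fin 5 → ZMod 3 := ![1, 1, 1, 1, 0]
  let w' : Fin 5 → ZMod 3 := ![1, 0, 1, 1, 1]
  have hw : ∑ k, w k * w k = 1 := by decide
  have hw' : ∑ k, w' k * w' k = 1 := by decide
  have hwu : ∀ i ∈ ({0, 1, 2, 3} : Finset (Fin 5)), ∑ k, w k * u i k = 1 := by decide
  have hwu' : ∀ i ∈ ({0, 2, 3, 4} : Finset (Fin 5)), ∑ k, w' k * u i k = 1 := by decide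
  let X : Fin 5 → ZMod 3 → E24 := fun i k => Y (u i) k
  have hmem : ∀ i k, X i k ∈ leechLattice := fun i k => ((hY _ (hu i)).1 k).1.1
  have hinner : ∀ i j k l, inner ℝ (X i k) (X j l) =
      if i = j then (if k = l then (4 : ℝ) else -2) else 0 := by
    intro i j k l
    by_cases hij : i = j
    · subst hij
      rw [if_pos rfl]
      by_cases hkl : k = l
      · subst hkl
        rw [if_pos rfl]
        exact ((hY _ (hu i)).1 k).2.1
      · rw [if_neg hkl]
        exact (hY _ (hu i)).2.1 k l hkl
    · rw [if_neg hij]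
      have h1 : ∀ k l, ∃ n : ℤ, inner ℝ (X i k) (X j l) = n ∧ 3 ∣ n := fun k l => by
        obtain ⟨n, hn, hn0⟩ := (hY _ (hu i)).2.2.2.2 _ (hu j) k l
        rw [hu2 i j hij] at hn0
        exact ⟨n, hn, (ZMod.intCast_zmod_eq_zero_iff_dvd _ 3).1 hn0⟩
      obtain ⟨n, hn, hn3⟩ := h1 k l
      obtain ⟨m, hm, hc⟩ := leech_inner_cases (hmem i k) (hmem j l) ((hY _ (hu i)).1 k).2.1
        ((hY _ (hu j)).1 l).2.1
      obtain rfl : m = n := by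
        rw [hn] at hm
        exact_mod_cast hm.symm
      rcases hc with h2 | ⟨-, h2⟩ | h2
      · have h3 : inner ℝ (X i k) (X j l) = (4 : ℝ) := by
          rw [← h2]
          exact ((hY _ (hu i)).1 k).2.1
        rw [hm] at h3
        have : m = 4 := by exact_mod_cast h3
        omega
      · omega
      · rw [hm, show m = 0 by omega, Int.cast_zero]
  have hsum : ∀ i, X i 0 + X i 1 + X i 2 = 0 := fun i => (hY _ (hu i)).2.2.1
  obtain ⟨ℓ, hℓ, h1⟩ := exists_labels (Y := Y w) (S := {0, 1, 2, 3}) (by decide)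
    (fun k => ((hY _ hw).1 k).1.1) (fun k => ((hY _ hw).1 k).2.1) (hY _ hw).2.2.1 hmem hinner hsum
    (fun i hi k l => by
      obtain ⟨n, hn, hn1⟩ := (hY _ hw).2.2.2.2 _ (hu i) k l
      exact ⟨n, hn, by rw [hn1, hwu i hi]⟩)
  obtain ⟨ℓ', hℓ', h2⟩ := exists_labels (Y := Y w') (S := {0, 2, 3, 4}) (by decide)
    (fun k => ((hY _ hw').1 k).1.1) (fun k => ((hY _ hw').1 k).2.1) (hY _ hw').2.2.1 hmem hinner hsum
    (fun i hi k l => by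
      obtain ⟨n, hn, hn1⟩ := (hY _ hw').2.2.2.2 _ (hu i) k l
      exact ⟨n, hn, by rw [hn1, hwu' i hi]⟩)
  obtain ⟨σ, hσ⟩ := exists_isTripleFrame hmem hinner hsum
    (fun i hi => hℓ i (by revert i; decide)) (fun i hi => hℓ' i (by revert i; decide))
    (fun k => by
      have := h1 k
      rwa [Finset.sum_insert (by decide), Finset.sum_insert (by decide),
        Finset.sum_insert (by decide), Finset.sum_singleton, ← add_assoc, ← add_assoc] at this)
    (fun k => by
      have := h2 k
      rwa [Finset.sum_insert (by decide), Finset.sum_insert (by decide),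
        Finset.sum_insert (by decide), Finset.sum_singleton, ← add_assoc, ← add_assoc] at this)
  refine ⟨_, hσ, fun i k => ?_, fun x hx i k l => (hY _ (hu i)).2.2.2.1 x hx _ _⟩
  have h3 := (hY _ (hu i)).1 (σ i k)
  exact ⟨h3.1, h3.2.2⟩

end IsHexaFrame

/-! ### The glued lattice over the Eisenstein integers -/

/-- The Eisenstein integers. -/
abbrev Eis : Type := QuadraticAlgebra ℤ (-1) (-1)

/-- The primitive third root of unity. -/
def eisω : Eis := ⟨0, 1⟩

/-- The coordinates of a combination of the two code words and three of the vectors `2 eᵢ`. -/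
def glueCoord : (Fin 5 → Eis) →ₗ[Eis] (Fin 5 → Eis) := Matrix.mulVecLin
  !![1, 1, 2, 0, 0; 1, 0, 0, 0, 0; 1, eisω, 0, 2, 0; 1, eisω * eisω, 0, 0, 2; 0, 1, 0, 0, 0]

theorem glueCoord_apply (c : Fin 5 → Eis) : glueCoord c = ![c 0 + c 1 + 2 * c 2, c 0,
    c 0 + eisω * c 1 + 2 * c 3, c 0 + eisω * eisω * c 1 + 2 * c 4, c 1] := by
  funext i
  fin_cases i <;> simp [glueCoord, Matrix.mulVec, dotProduct, Fin.sum_univ_five]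

theorem exists_norm_sub_two_mul_le (z : Eis) : ∃ c : Eis, (z - 2 * c).norm ≤ 1 := by
  refine ⟨⟨z.re / 2, z.im / 2⟩, ?_⟩
  have h1 : (z - 2 * ⟨z.re / 2, z.im / 2⟩ : Eis) = ⟨z.re % 2, z.im % 2⟩ := by
    ext
    · simp [QuadraticAlgebra.re_sub, QuadraticAlgebra.re_mul, QuadraticAlgebra.re_ofNat,
        QuadraticAlgebra.im_ofNat]
      omega
    · simp [QuadraticAlgebra.im_sub, QuadraticAlgebra.im_mul, QuadraticAlgebra.re_ofNat,
        QuadraticAlgebra.im_ofNat]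
      omega
  rw [h1, QuadraticAlgebra.norm_def]
  rcases Int.emod_two_eq_zero_or_one z.re with h | h <;>
    rcases Int.emod_two_eq_zero_or_one z.im with h' | h' <;> rw [h, h'] <;> norm_num

theorem eq_sum_of_orthogonal_pairs {ι : Type*} [Fintype ι] [DecidableEq ι]
    (hι : Fintype.card ι = 12) {u v : ι → E24}
    (huu : ∀ i j, inner ℝ (u i) (u j) = if i = j then (4 : ℝ) else 0)
    (hvv : ∀ i j, inner ℝ (v i) (v j) = if i = j then (4 : ℝ) else 0)
    (huv : ∀ i j, inner ℝ (u i) (v j) = if i = j then (-2 : ℝ) else 0) (x : E24) :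
    x = ∑ i, (((2 * inner ℝ x (u i) + inner ℝ x (v i)) / 6) • u i +
      ((inner ℝ x (u i) + 2 * inner ℝ x (v i)) / 6) • v i) := by
  have hvu : ∀ i j, inner ℝ (v i) (u j) = if i = j then (-2 : ℝ) else 0 := fun i j => by
    rw [real_inner_comm, huv]
    exact if_congr eq_comm rfl rfl
  have hspan : Submodule.span ℝ (Set.range (Sum.elim u v)) = ⊤ := by
    apply (linearIndependent_of_orthogonal_pairs huu hvv huv).span_eq_top_of_card_eq_finrank'
    rw [Fintype.card_sum, hι, finrank_euclideanSpace, Fintype.card_option, ZMod.card]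
  rw [← sub_eq_zero]
  set y := x - _ with hy
  have hz : y ∈ (Submodule.span ℝ (Set.range (Sum.elim u v)))ᗮ := by
    rw [Submodule.mem_orthogonal']
    intro w hw
    induction hw using Submodule.span_induction with
    | mem w hw =>
      obtain ⟨j | j, rfl⟩ := hw <;>
      · simp only [hy, Sum.elim_inl, Sum.elim_inr, inner_sub_left, sum_inner, inner_add_left,
          real_inner_smul_left, huu, hvv, huv, hvu, mul_ite, mul_zero, Finset.sum_add_distrib,
          Finset.sum_ite_eq', Finset.mem_univ, if_true]
        ring
    | zero => exact inner_zero_right _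
    | add w w' _ _ h1 h2 => rw [inner_add_right, h1, h2, add_zero]
    | smul c w _ h1 => rw [real_inner_smul_right, h1, mul_zero]
  rwa [hspan, Submodule.top_orthogonal_eq_bot, Submodule.mem_bot] at hz

/-- Half of the Eisenstein combination of the triples with given coefficients. -/
noncomputable def tripleComb (X : Fin 5 → ZMod 3 → E24) : (Fin 5 → Eis) →+ E24 :=
  AddMonoidHom.mk' (fun a => (1 / 2 : ℝ) • ∑ i, (((a i).re : ℝ) • X i 0 + ((a i).im : ℝ) • X i 1))
    fun a b => by
      rw [← smul_add, ← Finset.sum_add_distrib]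
      congr 1
      refine Finset.sum_congr rfl fun i _ => ?_
      rw [Pi.add_apply, QuadraticAlgebra.re_add, QuadraticAlgebra.im_add]
      push_cast
      module

namespace IsTripleFrame

variable {X : Fin 5 → ZMod 3 → E24} (hX : IsTripleFrame X)
include hX

theorem inner_tripleComb (a b : Fin 5 → Eis) : 2 * inner ℝ (tripleComb X a) (tripleComb X b) =
    ((∑ i, a i * star (b i)).trace : ℝ) := by
  have h01 : (0 : ZMod 3) ≠ 1 := by decide
  change 2 * inner ℝ ((1 / 2 : ℝ) • ∑ i, (((a i).re : ℝ) • X i 0 + ((a i).im : ℝ) • X i 1))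
    ((1 / 2 : ℝ) • ∑ i, (((b i).re : ℝ) • X i 0 + ((b i).im : ℝ) • X i 1)) = _
  rw [real_inner_smul_left, real_inner_smul_right, sum_inner]
  simp only [inner_sum, inner_add_left, inner_add_right, real_inner_smul_left,
    real_inner_smul_right, hX.inner_eq, if_true, if_neg h01, if_neg h01.symm, mul_ite, mul_zero,
    Finset.sum_add_distrib, Finset.sum_ite_eq, Finset.mem_univ, map_sum,
    QuadraticAlgebra.trace_def, QuadraticAlgebra.re_mul, QuadraticAlgebra.im_mul,
    QuadraticAlgebra.re_star, QuadraticAlgebra.im_star, Finset.mul_sum]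
  push_cast
  simp only [Fin.sum_univ_five]
  ring

theorem tripleComb_glueCoord_mem (c : Fin 5 → Eis) :
    tripleComb X (glueCoord c) ∈ leechLattice := by
  have h2 : ∀ i, X i 2 = -X i 0 - X i 1 := fun i => by
    rw [← sub_eq_zero, ← hX.sum_eq i]
    abel
  have h1 : tripleComb X (glueCoord c) =
      (c 0).re • ((1 / 2 : ℝ) • (X 0 0 + X 1 0 + X 2 0 + X 3 0)) +
      (c 0).im • ((1 / 2 : ℝ) • (X 0 1 + X 1 1 + X 2 1 + X 3 1)) +
      ((c 1).re • ((1 / 2 : ℝ) • (X 0 0 + X 2 1 + X 3 2 + X 4 0)) +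
      (c 1).im • ((1 / 2 : ℝ) • (X 0 1 + X 2 2 + X 3 0 + X 4 1))) +
      ((c 2).re • X 0 0 + (c 2).im • X 0 1) + ((c 3).re • X 2 0 + (c 3).im • X 2 1) +
      ((c 4).re • X 3 0 + (c 4).im • X 3 1) := by
    change (1 / 2 : ℝ) • ∑ i, (((glueCoord c i).re : ℝ) • X i 0 +
      ((glueCoord c i).im : ℝ) • X i 1) = _
    simp only [Fin.sum_univ_five, glueCoord_apply, Matrix.cons_val, h2, eisω,
      ← Int.cast_smul_eq_zsmul ℝ, QuadraticAlgebra.re_add, QuadraticAlgebra.im_add,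
      QuadraticAlgebra.re_mul, QuadraticAlgebra.im_mul, QuadraticAlgebra.re_ofNat,
      QuadraticAlgebra.im_ofNat]
    push_cast
    module
  rw [h1]
  refine add_mem (add_mem (add_mem (add_mem (add_mem ?_ ?_) (add_mem ?_ ?_)) (add_mem ?_ ?_))
    (add_mem ?_ ?_)) (add_mem ?_ ?_) <;> apply leechLattice.smul_mem
  exacts [hX.glue₁ 0, hX.glue₁ 1, hX.glue₂ 0, hX.glue₂ 1, hX.mem _ _, hX.mem _ _, hX.mem _ _,
    hX.mem _ _, hX.mem _ _, hX.mem _ _]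

/-- The two code words clear the coordinates 1 and 4, and multiples of 2 bring the other three to
norm at most 1. The remaining lattice vector has norm at most 3, so it is zero. -/
theorem exists_glueCoord {a : Fin 5 → Eis} (ha : tripleComb X a ∈ leechLattice) :
    ∃ c, tripleComb X (glueCoord c) = tripleComb X a := by
  have hred : ∀ b : Fin 5 → Eis, ∃ c : Eis, (b 0 - 2 * c).norm ≤ 1 := fun b =>
    exists_norm_sub_two_mul_le _
  obtain ⟨c2, h2⟩ := exists_norm_sub_two_mul_le (a 0 - a 1 - a 4)
  obtain ⟨c3, h3⟩ := exists_norm_sub_two_mul_le (a 2 - a 1 - eisω * a 4)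
  obtain ⟨c4, h4⟩ := exists_norm_sub_two_mul_le (a 3 - a 1 - eisω * eisω * a 4)
  set c : Fin 5 → Eis := ![a 1, a 4, c2, c3, c4] with hc
  refine ⟨c, ?_⟩
  have hmem := leechLattice.sub_mem ha (hX.tripleComb_glueCoord_mem c)
  rw [← map_sub] at hmem
  symm
  rw [← sub_eq_zero, ← map_sub]
  by_contra hne
  have hge := leech_norm_ge hmem hne
  have hn := hX.inner_tripleComb (a - glueCoord c) (a - glueCoord c)
  have hd : a - glueCoord c = ![a 0 - a 1 - a 4 - 2 * c2, 0, a 2 - a 1 - eisω * a 4 - 2 * c3,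
      a 3 - a 1 - eisω * eisω * a 4 - 2 * c4, 0] := by
    funext i
    rw [Pi.sub_apply, glueCoord_apply]
    fin_cases i <;> simp [hc, sub_sub]
  rw [hd] at hn hge
  have ht : (∑ i, (![a 0 - a 1 - a 4 - 2 * c2, 0, a 2 - a 1 - eisω * a 4 - 2 * c3,
      a 3 - a 1 - eisω * eisω * a 4 - 2 * c4, 0] : Fin 5 → Eis) i *
      star ((![a 0 - a 1 - a 4 - 2 * c2, 0, a 2 - a 1 - eisω * a 4 - 2 * c3,
      a 3 - a 1 - eisω * eisω * a 4 - 2 * c4, 0] : Fin 5 → Eis) i)).trace ≤ 6 := by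
    simp only [← QuadraticAlgebra.algebraMap_norm_eq_mul_star, Fin.sum_univ_five, Matrix.cons_val,
      map_add, QuadraticAlgebra.trace_algebraMap, QuadraticAlgebra.norm_zero, map_zero]
    linarith
  have ht' : ((∑ i, (![a 0 - a 1 - a 4 - 2 * c2, 0, a 2 - a 1 - eisω * a 4 - 2 * c3,
      a 3 - a 1 - eisω * eisω * a 4 - 2 * c4, 0] : Fin 5 → Eis) i *
      star ((![a 0 - a 1 - a 4 - 2 * c2, 0, a 2 - a 1 - eisω * a 4 - 2 * c3,
      a 3 - a 1 - eisω * eisω * a 4 - 2 * c4, 0] : Fin 5 → Eis) i)).trace : ℝ) ≤ 6 := by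
    exact_mod_cast ht
  linarith

end IsTripleFrame

/-- The annihilator consists of the combinations of the triples with coefficients in the code. -/
theorem IsHexaFrame.exists_annihilator_eq {g : E24 ≃ₗᵢ[ℝ] E24} {f : Fin 6 → E24} {r s t : E24}
    (h : IsHexaFrame g f r s t) : ∃ X, IsTripleFrame X ∧ ∀ x,
      (x ∈ hexaAnn g f ∧ inner ℝ x r = (0 : ℝ) ∧ inner ℝ x s = (0 : ℝ)) ↔
        ∃ c, tripleComb X (glueCoord c) = x := by
  obtain ⟨X, hX, hXr, hX3⟩ := h.exists_tripleFrame
  have hXf := fun i k => mem_hexaSpan_orthogonal.1 (hXr i k).1.2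
  refine ⟨X, hX, fun x => ⟨?_, ?_⟩⟩
  · rintro ⟨hxK, hxr, hxs⟩
    -- Six pairs f_i, g f_i, the pair r, s and five pairs from the triples: twelve orthogonal planes
    -- fill the space.
    have hx := eq_sum_of_orthogonal_pairs (ι := Fin 6 ⊕ Option (Fin 5)) (by decide)
      (u := Sum.elim f fun o => o.elim r fun i => X i 0)
      (v := Sum.elim (fun i => g (f i)) fun o => o.elim s fun i => X i 1) (by
        rintro (i | _ | i) (j | _ | j)
        · simpa using h.gram i j
        · simpa using (real_inner_comm _ _).trans (h.inner_left i).1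
        · simpa using (real_inner_comm _ _).trans (hXf j 0 i).1
        · simpa using (h.inner_left j).1
        · simpa using h.norm_left
        · simpa using (real_inner_comm _ _).trans (hXr j 0).2.1
        · simpa using (hXf i 0 j).1
        · simpa using (hXr i 0).2.1
        · simpa using hX.inner_eq i j 0 0) (by
        rintro (i | _ | i) (j | _ | j)
        · simpa using h.gram i j
        · simpa using (real_inner_comm _ _).trans (h.inner_right i).2
        · simpa using (real_inner_comm _ _).trans (hXf j 1 i).2
        · simpa using (h.inner_right j).2
        · simpa using h.norm_right
        · simpa using (real_inner_comm _ _).trans (hXr j 1).2.2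
        · simpa using (hXf i 1 j).2
        · simpa using (hXr i 1).2.2
        · simpa using hX.inner_eq i j 1 1) (by
        rintro (i | _ | i) (j | _ | j)
        · simpa using h.inner_map i j
        · simpa using (real_inner_comm _ _).trans (h.inner_right i).1
        · simpa using (real_inner_comm _ _).trans (hXf j 1 i).1
        · simpa using (h.inner_left j).2
        · simpa using h.inner_left_right
        · simpa using (real_inner_comm _ _).trans (hXr j 1).2.1
        · simpa using (hXf i 0 j).2
        · simpa using (hXr i 0).2.2
        · have h01 : (0 : ZMod 3) ≠ 1 := by decide
          simpa [h01] using hX.inner_eq i j 0 1) x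
    have h0 := mem_hexaSpan_orthogonal.1 hxK.2
    choose m hm using fun i => leech_inner_int hxK.1 (hX.mem i 0)
    choose n hn using fun i => leech_inner_int hxK.1 (hX.mem i 1)
    have hmod : ∀ i, ∃ k, m i - n i = 3 * k := fun i => by
      obtain ⟨k, hk⟩ := hX3 x hxK i 0 1
      rw [hm, hn] at hk
      exact ⟨k, by exact_mod_cast hk⟩
    choose k hk using hmod
    -- The expansion has denominators 6; since the products with two members of a triple agree
    -- modulo 3, only the denominator 2 remains.
    have hxa : tripleComb X (fun i => ⟨n i + 2 * k i, n i + k i⟩) = x := by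
      rw [hx, Fintype.sum_sum_type, Fintype.sum_option]
      simp only [Sum.elim_inl, Sum.elim_inr, Option.elim, h0, hxr, hxs, hm, hn, mul_zero, add_zero,
        zero_div, zero_smul, Finset.sum_const_zero, zero_add]
      change (1 / 2 : ℝ) • ∑ i, (((n i + 2 * k i : ℤ) : ℝ) • X i 0 +
        ((n i + k i : ℤ) : ℝ) • X i 1) = _
      rw [Finset.smul_sum]
      refine Finset.sum_congr rfl fun i _ => ?_
      have hk' : (m i : ℝ) = n i + 3 * k i := by
        have : (m i - n i : ℝ) = 3 * k i := by exact_mod_cast hk i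
        linarith
      rw [hk']
      push_cast
      module
    obtain ⟨c, hc⟩ := hX.exists_glueCoord (hxa ▸ hxK.1)
    exact ⟨c, hc.trans hxa⟩
  · rintro ⟨c, rfl⟩
    have hort : ∀ y : E24, (∀ i k, inner ℝ (X i k) y = (0 : ℝ)) →
        ∀ a, inner ℝ (tripleComb X a) y = (0 : ℝ) := by
      intro y hy a
      change inner ℝ ((1 / 2 : ℝ) • ∑ i, (((a i).re : ℝ) • X i 0 + ((a i).im : ℝ) • X i 1)) y = 0
      simp only [real_inner_smul_left, sum_inner, inner_add_left, hy, mul_zero, add_zero,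
        Finset.sum_const_zero]
    refine ⟨⟨hX.tripleComb_glueCoord_mem c, mem_hexaSpan_orthogonal.2 fun i => ⟨hort _ ?_ _,
      hort _ ?_ _⟩⟩, hort _ (fun i k => (hXr i k).2.1) _, hort _ (fun i k => (hXr i k).2.2) _⟩
    · exact fun j k => (hXf j k i).1
    · exact fun j k => (hXf j k i).2

/-! ### The Hermitian form and the two realizations of the glued lattice -/

/-- The Gram matrix of the two code words and three of the vectors `2 eᵢ` for half of the standard
Hermitian form. -/
def glueGram : Matrix (Fin 5) (Fin 5) Eis :=
  !![2, 0, 1, 1, 1; 0, 2, 1, eisω, eisω * eisω; 1, 1, 2, 0, 0; 1, eisω * eisω, 0, 2, 0;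
    1, eisω, 0, 0, 2]

/-- Half of the standard Hermitian form on the lattice given by the code. -/
def glueHerm (c d : Fin 5 → Eis) : Eis := ∑ i, ∑ j, c i * glueGram i j * star (d j)

theorem two_mul_glueHerm (c d : Fin 5 → Eis) :
    2 * glueHerm c d = ∑ i, glueCoord c i * star (glueCoord d i) := by
  have hω : eisω * eisω * eisω = 1 := by decide
  have hs : star eisω = eisω * eisω := by decide
  have h0 : 1 + eisω + eisω * eisω = 0 := by decide
  simp only [glueHerm, glueGram, glueCoord_apply, Fin.sum_univ_five, Matrix.cons_val, Matrix.of_apply,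
    star_add, star_mul', star_ofNat, hs]
  linear_combination (-(c 0 * star (d 1)) - c 1 * star (d 0)) * h0 +
    (-(2 * c 1 * star (d 1)) - c 1 * star (d 1) * eisω * eisω * eisω -
      c 0 * star (d 1) * eisω - 2 * c 4 * star (d 1) * eisω) * hω

theorem glueHerm_self (c : Fin 5 → Eis) :
    (glueHerm c c).trace = ∑ i, (glueCoord c i).norm := by
  have h := congrArg QuadraticAlgebra.trace (two_mul_glueHerm c c)
  simp only [← QuadraticAlgebra.algebraMap_norm_eq_mul_star, map_sum,
    QuadraticAlgebra.trace_algebraMap, ← Finset.mul_sum] at h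
  rw [two_mul, map_add] at h
  omega

theorem eisNorm_nonneg (z : Eis) : 0 ≤ z.norm := by
  rw [QuadraticAlgebra.norm_def]
  nlinarith [sq_nonneg (z.re - z.im), sq_nonneg z.re, sq_nonneg z.im]

theorem eisNorm_eq_zero {z : Eis} (h : z.norm = 0) : z = 0 := by
  rw [QuadraticAlgebra.norm_def] at h
  have h1 : z.re = 0 := by nlinarith [sq_nonneg (z.re - 2 * z.im), sq_nonneg z.re]
  have h2 : z.im = 0 := by nlinarith [sq_nonneg z.im]
  exact QuadraticAlgebra.ext h1 h2

theorem glueHerm_self_eq_zero {c : Fin 5 → Eis} (h : (glueHerm c c).trace = 0) : c = 0 := by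
  rw [glueHerm_self, Finset.sum_eq_zero_iff_of_nonneg fun i _ => eisNorm_nonneg _] at h
  have h0 : ∀ i, glueCoord c i = 0 := fun i => eisNorm_eq_zero (h i (Finset.mem_univ i))
  have h2 : ∀ z : Eis, 2 * z = 0 → z = 0 := fun z hz => by
    have h3 := congrArg QuadraticAlgebra.re hz
    have h4 := congrArg QuadraticAlgebra.im hz
    simp [QuadraticAlgebra.re_mul, QuadraticAlgebra.im_mul, QuadraticAlgebra.re_ofNat,
      QuadraticAlgebra.im_ofNat] at h3 h4
    exact QuadraticAlgebra.ext h3 h4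
  simp only [glueCoord_apply] at h0
  have e0 : c 0 = 0 := h0 1
  have e1 : c 1 = 0 := h0 4
  have e2 := h0 0
  have e3 := h0 2
  have e4 := h0 3
  simp only [Matrix.cons_val, e0, e1, mul_zero, zero_add] at e2 e3 e4
  funext i
  fin_cases i
  exacts [e0, e1, h2 _ e2, h2 _ e3, h2 _ e4]

/-- Additive parametrizations of a lattice that respect the forms are injective. -/
theorem exists_glue_equiv {W : Type*} [AddCommGroup W] (F : (Fin 5 → Eis) →+ W)
    (S : Submodule ℤ W) (hS : ∀ x, x ∈ S ↔ ∃ c, F c = x)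
    (hF : ∀ c, F c = 0 → (glueHerm c c).trace = 0) :
    ∃ e : (Fin 5 → Eis) ≃ₗ[ℤ] S, ∀ c, (e c : W) = F c := by
  have hinj : Function.Injective F.toIntLinearMap :=
    (injective_iff_map_eq_zero _).2 fun c hc => glueHerm_self_eq_zero (hF c hc)
  have hr : LinearMap.range F.toIntLinearMap = S := by
    ext x
    rw [hS]
    rfl
  exact ⟨(LinearEquiv.ofInjective _ hinj).trans (LinearEquiv.ofEq _ _ hr), fun c => rfl⟩

theorem IsTripleFrame.inner_glue {X : Fin 5 → ZMod 3 → E24} (hX : IsTripleFrame X)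
    (c d : Fin 5 → Eis) : inner ℝ (tripleComb X (glueCoord c)) (tripleComb X (glueCoord d)) =
      ((glueHerm c d).trace : ℝ) := by
  have h := hX.inner_tripleComb (glueCoord c) (glueCoord d)
  rw [← two_mul_glueHerm, two_mul (glueHerm c d), map_add] at h
  push_cast at h
  linarith

theorem eisensteinOmega_sq : eisensteinOmega * eisensteinOmega =
    -1 - eisensteinOmega := by
  have h3 : ((√3 : ℝ) : ℂ) * ((√3 : ℝ) : ℂ) = 3 := by
    rw [← Complex.ofReal_mul, Real.mul_self_sqrt (by norm_num)]
    norm_num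
  rw [eisensteinOmega]
  linear_combination (Complex.I * Complex.I / 4) * h3 + (3 / 4 : ℂ) * Complex.I_mul_I

/-- The embedding of the Eisenstein integers in the complex numbers. -/
noncomputable def eisToComplex : Eis →ₐ[ℤ] ℂ :=
  QuadraticAlgebra.lift ⟨eisensteinOmega, by
    rw [eisensteinOmega_sq, neg_smul, neg_smul, one_smul, one_smul, sub_eq_add_neg]⟩

theorem eisToComplex_apply (z : Eis) : eisToComplex z = z.re + z.im * eisensteinOmega := by
  simp [eisToComplex, QuadraticAlgebra.lift]

theorem eisToComplex_omega : eisToComplex eisω = eisensteinOmega := by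
  simp [eisToComplex_apply, eisω]

theorem eisToComplex_re (z : Eis) : 2 * (eisToComplex z).re = z.trace := by
  rw [eisToComplex_apply, QuadraticAlgebra.trace_def, eisensteinOmega]
  simp
  ring

theorem eisToComplex_star (z : Eis) :
    eisToComplex (star z) = (starRingEnd ℂ) (eisToComplex z) := by
  have hc : (starRingEnd ℂ) eisensteinOmega = -1 - eisensteinOmega := by
    rw [eisensteinOmega, map_div₀, map_add, map_neg, map_one, map_mul, Complex.conj_ofReal,
      Complex.conj_I, map_ofNat]
    ring
  rw [eisToComplex_apply, eisToComplex_apply, map_add, map_mul, map_intCast, map_intCast, hc,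
    QuadraticAlgebra.re_star, QuadraticAlgebra.im_star]
  push_cast
  ring

theorem mem_eisensteinIntegers {z : ℂ} : z ∈ eisensteinIntegers ↔ ∃ w, eisToComplex w = z := by
  constructor
  · intro hz
    have h : eisensteinIntegers ≤ eisToComplex.range :=
      Algebra.adjoin_le (Set.singleton_subset_iff.2 ⟨eisω, eisToComplex_omega⟩)
    exact h hz
  · rintro ⟨w, rfl⟩
    rw [eisToComplex_apply]
    have hω : eisensteinOmega ∈ eisensteinIntegers := Algebra.self_mem_adjoin_singleton ℤ _
    exact add_mem (intCast_mem _ _) (mul_mem (intCast_mem _ _) hω)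

/-- The parametrization of the glued lattice by coefficients. -/
noncomputable def glueVector : (Fin 5 → Eis) →+ EuclideanSpace ℂ (Fin 5) :=
  AddMonoidHom.mk' (fun c => WithLp.toLp 2 fun i => eisToComplex (glueCoord c i)) fun c d => by
    ext i
    simp [map_add]

theorem glueVector_apply (c : Fin 5 → Eis) (i : Fin 5) :
    glueVector c i = eisToComplex (glueCoord c i) := rfl

theorem mem_gluedAA2Lattice (x : EuclideanSpace ℂ (Fin 5)) :
    x ∈ gluedAA2Lattice ↔ ∃ c, glueVector c = x := by
  have h2 : eisToComplex 2 = 2 := map_ofNat _ _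
  constructor
  · intro hx
    change x ∈ Submodule.span eisensteinIntegers _ at hx
    induction hx using Submodule.span_induction with
    | mem x hx =>
      rcases hx with (rfl | rfl) | ⟨i, rfl⟩
      · refine ⟨![1, 0, 0, 0, 0], ?_⟩
        ext i
        rw [glueVector_apply, glueCoord_apply]
        fin_cases i <;> simp
      · refine ⟨![0, 1, 0, 0, 0], ?_⟩
        ext i
        rw [glueVector_apply, glueCoord_apply]
        fin_cases i <;> simp [eisToComplex_omega, pow_two]
      · refine ⟨(![![0, 0, 1, 0, 0], ![2, 0, -1, -1, -1], ![0, 0, 0, 1, 0], ![0, 0, 0, 0, 1],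
          ![0, 2, -1, -eisω, -eisω * eisω]] : Fin 5 → Fin 5 → Eis) i, ?_⟩
        ext j
        rw [glueVector_apply, glueCoord_apply]
        fin_cases i <;> fin_cases j <;> simp [eisToComplex_omega, h2] <;> ring
    | zero => exact ⟨0, map_zero _⟩
    | add x y _ _ hx hy =>
      obtain ⟨c, rfl⟩ := hx
      obtain ⟨d, rfl⟩ := hy
      exact ⟨c + d, map_add _ _ _⟩
    | smul a x _ hx =>
      obtain ⟨c, rfl⟩ := hx
      obtain ⟨w, hw⟩ := mem_eisensteinIntegers.1 a.2
      refine ⟨w • c, ?_⟩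
      ext i
      rw [glueVector_apply, map_smul, Pi.smul_apply, smul_eq_mul, map_mul, hw]
      rfl
  · rintro ⟨c, rfl⟩
    change _ ∈ Submodule.span eisensteinIntegers _
    have hsm : ∀ (w : Eis) (v : EuclideanSpace ℂ (Fin 5)), v ∈ Submodule.span eisensteinIntegers
        (({!₂[1, 1, 1, 1, 0], !₂[1, 0, eisensteinOmega, eisensteinOmega ^ 2, 1]} ∪
          Set.range fun i : Fin 5 => EuclideanSpace.single i (2 : ℂ)) :
            Set (EuclideanSpace ℂ (Fin 5))) →
        eisToComplex w • v ∈ Submodule.span eisensteinIntegers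
        (({!₂[1, 1, 1, 1, 0], !₂[1, 0, eisensteinOmega, eisensteinOmega ^ 2, 1]} ∪
          Set.range fun i : Fin 5 => EuclideanSpace.single i (2 : ℂ)) :
            Set (EuclideanSpace ℂ (Fin 5))) := fun w v hv =>
      Submodule.smul_mem _ (⟨_, mem_eisensteinIntegers.2 ⟨w, rfl⟩⟩ : eisensteinIntegers) hv
    have h1 : glueVector c = eisToComplex (c 0) • !₂[1, 1, 1, 1, 0] +
        eisToComplex (c 1) • !₂[1, 0, eisensteinOmega, eisensteinOmega ^ 2, 1] +
        eisToComplex (c 2) • EuclideanSpace.single 0 (2 : ℂ) +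
        eisToComplex (c 3) • EuclideanSpace.single 2 (2 : ℂ) +
        eisToComplex (c 4) • EuclideanSpace.single 3 (2 : ℂ) := by
      ext i
      rw [glueVector_apply, glueCoord_apply]
      fin_cases i <;> simp [eisToComplex_omega, h2] <;> ring
    rw [h1]
    refine add_mem (add_mem (add_mem (add_mem ?_ ?_) ?_) ?_) ?_ <;> apply hsm <;>
      apply Submodule.subset_span
    · exact Or.inl (Or.inl rfl)
    · exact Or.inl (Or.inr rfl)
    · exact Or.inr ⟨0, rfl⟩
    · exact Or.inr ⟨2, rfl⟩
    · exact Or.inr ⟨3, rfl⟩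

theorem inner_glueVector (c d : Fin 5 → Eis) :
    (inner ℂ (glueVector c) (glueVector d)).re = ((glueHerm c d).trace : ℝ) := by
  have h1 : inner ℂ (glueVector c) (glueVector d) =
      (starRingEnd ℂ) (eisToComplex (2 * glueHerm c d)) := by
    rw [two_mul_glueHerm, map_sum, map_sum, PiLp.inner_apply]
    refine Finset.sum_congr rfl fun i _ => ?_
    rw [map_mul, map_mul, eisToComplex_star, Complex.conj_conj]
    exact mul_comm _ _
  have h2 := eisToComplex_re (2 * glueHerm c d)
  rw [h1, Complex.conj_re]
  rw [two_mul (glueHerm c d), map_add QuadraticAlgebra.trace] at h2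
  rw [two_mul (glueHerm c d)]
  push_cast at h2
  linarith

/-! ### Isometries of the glued lattice are linear or antilinear -/

theorem glueHerm_add_left (c c' d : Fin 5 → Eis) :
    glueHerm (c + c') d = glueHerm c d + glueHerm c' d := by
  simp only [glueHerm, Pi.add_apply, add_mul, Finset.sum_add_distrib]

theorem glueHerm_smul_left (w : Eis) (c d : Fin 5 → Eis) :
    glueHerm (w • c) d = w * glueHerm c d := by
  simp only [glueHerm, Pi.smul_apply, smul_eq_mul, Finset.mul_sum, mul_assoc]

theorem star_glueHerm (c d : Fin 5 → Eis) : star (glueHerm c d) = glueHerm d c := by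
  have h : ∀ i j, star (glueGram i j) = glueGram j i := by decide
  simp only [glueHerm, star_sum, star_mul', star_star, h]
  rw [Finset.sum_comm]
  exact Finset.sum_congr rfl fun i _ => Finset.sum_congr rfl fun j _ => by ring

theorem glueHerm_smul_right (w : Eis) (c d : Fin 5 → Eis) :
    glueHerm c (w • d) = star w * glueHerm c d := by
  rw [← star_glueHerm, glueHerm_smul_left, star_mul', star_glueHerm]

theorem glueHerm_sub_left (c c' d : Fin 5 → Eis) :
    glueHerm (c - c') d = glueHerm c d - glueHerm c' d := by
  rw [eq_sub_iff_add_eq, ← glueHerm_add_left, sub_add_cancel]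

/-- The bilinear form of the glued lattice. -/
def glueForm (c d : Fin 5 → Eis) : ℤ := (glueHerm c d).trace

theorem glueForm_add_left (c c' d : Fin 5 → Eis) :
    glueForm (c + c') d = glueForm c d + glueForm c' d := by
  rw [glueForm, glueHerm_add_left, map_add, glueForm, glueForm]

theorem glueForm_comm (c d : Fin 5 → Eis) : glueForm c d = glueForm d c := by
  rw [glueForm, ← star_glueHerm, QuadraticAlgebra.trace_star, glueForm]

theorem glueForm_sub_left (c c' d : Fin 5 → Eis) :
    glueForm (c - c') d = glueForm c d - glueForm c' d := by
  rw [eq_sub_iff_add_eq, ← glueForm_add_left, sub_add_cancel]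

theorem glueForm_sub_right (c d d' : Fin 5 → Eis) :
    glueForm c (d - d') = glueForm c d - glueForm c d' := by
  rw [glueForm_comm, glueForm_sub_left, glueForm_comm d, glueForm_comm d']

theorem glueForm_sub_self (c d : Fin 5 → Eis) :
    glueForm (c - d) (c - d) = glueForm c c + glueForm d d - 2 * glueForm c d := by
  rw [glueForm_sub_left, glueForm_sub_right, glueForm_sub_right, glueForm_comm d c]
  ring

theorem glueForm_smul_smul (w : Eis) (c : Fin 5 → Eis) :
    glueForm (w • c) (w • c) = w.norm * glueForm c c := by
  rw [glueForm, glueHerm_smul_left, glueHerm_smul_right, ← mul_assoc,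
    ← QuadraticAlgebra.algebraMap_norm_eq_mul_star, ← Algebra.smul_def, map_smul, smul_eq_mul,
    glueForm]

/-- The field with four elements. -/
abbrev F4 : Type := QuadraticAlgebra (ZMod 2) 1 1

instance : Fintype F4 := Fintype.ofEquiv _ (QuadraticAlgebra.equivProd 1 1).symm

/-- Reduction of the Eisenstein integers modulo `2`. -/
def eisMod : Eis →+* F4 where
  toFun z := ⟨z.re, z.im⟩
  map_one' := by decide
  map_zero' := by decide
  map_add' z w := by ext <;> simp
  map_mul' z w := by
    have h : (-1 : ZMod 2) = 1 := by decide
    ext <;> simp [QuadraticAlgebra.re_mul, QuadraticAlgebra.im_mul, h]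

theorem eisMod_star (z : Eis) : eisMod (star z) = star (eisMod z) := by
  have h : (-1 : ZMod 2) = 1 := by decide
  ext <;> simp [eisMod, h]

theorem eisMod_eq_zero {z : Eis} (h : eisMod z = 0) : ∃ y, z = 2 * y := by
  have h1 : ((z.re : ℤ) : ZMod 2) = 0 := congrArg QuadraticAlgebra.re h
  have h2 : ((z.im : ℤ) : ZMod 2) = 0 := congrArg QuadraticAlgebra.im h
  obtain ⟨a, ha⟩ := (ZMod.intCast_zmod_eq_zero_iff_dvd _ 2).1 h1
  obtain ⟨b, hb⟩ := (ZMod.intCast_zmod_eq_zero_iff_dvd _ 2).1 h2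
  refine ⟨⟨a, b⟩, ?_⟩
  ext <;> simp [QuadraticAlgebra.re_mul, QuadraticAlgebra.im_mul, QuadraticAlgebra.re_ofNat,
    QuadraticAlgebra.im_ofNat, ha, hb]

theorem norm_two_mul (y : Eis) : (2 * y).norm = 4 * y.norm := by
  rw [map_mul]
  rfl

theorem eisNorm_pos {z : Eis} (h : z ≠ 0) : 1 ≤ z.norm := by
  have h1 := eisNorm_nonneg z
  have h2 : z.norm ≠ 0 := fun h0 => h (eisNorm_eq_zero h0)
  omega

/-- The norm is at least the number of coordinates that do not vanish modulo `2`. -/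
theorem sum_norm_cases (a : Fin 5 → Eis) :
    ((Finset.univ.filter fun i => eisMod (a i) ≠ 0).card : ℤ) ≤ ∑ i, (a i).norm ∧
    ((∀ i, eisMod (a i) = 0) → ∃ k, ∑ i, (a i).norm = 4 * k) := by
  constructor
  · rw [Finset.card_filter, Nat.cast_sum]
    refine Finset.sum_le_sum fun i _ => ?_
    split_ifs with h
    · exact eisNorm_pos fun h0 => h (by rw [h0, map_zero])
    · exact eisNorm_nonneg _
  · intro h
    choose y hy using fun i => eisMod_eq_zero (h i)
    exact ⟨∑ i, (y i).norm, by simp only [hy, norm_two_mul, Finset.mul_sum]⟩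

/-- The combinations of the two code words. -/
def glueWord (x y : F4) : Fin 5 → F4 :=
  ![x + y, x, x + eisMod eisω * y, x + eisMod eisω * eisMod eisω * y, y]

theorem glueWord_cases : ∀ x y : F4, (∀ i, glueWord x y i = 0) ∨
    4 ≤ (Finset.univ.filter fun i => glueWord x y i ≠ 0).card := by
  decide +kernel

theorem eisMod_glueCoord (c : Fin 5 → Eis) (i : Fin 5) :
    eisMod (glueCoord c i) = glueWord (eisMod (c 0)) (eisMod (c 1)) i := by
  have h20 : eisMod 2 = 0 := by decide
  rw [glueCoord_apply, glueWord]
  fin_cases i <;> simp [h20]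

/-- Nonzero code words have weight at least 4. If the word is zero, all coordinates are divisible by
2 and the norm is a multiple of 4. -/
theorem four_le_glueForm {c : Fin 5 → Eis} (hc : c ≠ 0) : 4 ≤ glueForm c c := by
  have hpos : glueForm c c ≠ 0 := fun h => hc (glueHerm_self_eq_zero h)
  rw [glueForm, glueHerm_self] at hpos ⊢
  have hnn : 0 ≤ ∑ i, (glueCoord c i).norm := Finset.sum_nonneg fun i _ => eisNorm_nonneg _
  obtain ⟨h1, h2⟩ := sum_norm_cases (glueCoord c)
  simp only [eisMod_glueCoord] at h1 h2
  rcases glueWord_cases (eisMod (c 0)) (eisMod (c 1)) with h | h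
  · obtain ⟨k, hk⟩ := h2 h
    omega
  · exact le_trans (by exact_mod_cast h) h1

/-- A vector with all products divisible by `3` is divisible by `1 - ω`. -/
theorem exists_eq_smul_of_dvd {c : Fin 5 → Eis} (h : ∀ d, 3 ∣ glueForm c d) :
    ∃ y, c = (1 - eisω) • y := by
  have hz : ∀ z : Eis, 3 ∣ z.trace → ∃ w, z = (1 - eisω) * w := by
    intro z hz
    rw [QuadraticAlgebra.trace_def] at hz
    obtain ⟨k, hk⟩ := hz
    have h1 : (1 - eisω : Eis) = ⟨1, -1⟩ := by decide
    refine ⟨⟨k, z.re - k⟩, ?_⟩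
    rw [h1]
    ext <;> simp [QuadraticAlgebra.re_mul, QuadraticAlgebra.im_mul] <;> omega
  choose w hw using fun d => hz _ (h d)
  -- Twice the inverse Gram matrix: from the divisibility of all products it yields that 2c is
  -- divisible by 1 - ω. As 3 is divisible too, so is c.
  let K : Matrix (Fin 5) (Fin 5) Eis := !![4, 0, -2, -2, -2; 0, 4, -2, -2 * eisω, 2 + 2 * eisω;
    -2, -2, 3, 1 + eisω, -eisω; -2, 2 + 2 * eisω, -eisω, 3, 1 + eisω;
    -2, -2 * eisω, 1 + eisω, -eisω, 3]
  have hK : glueGram * K = 2 := by decide +kernel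
  have hc : ∀ j, glueHerm c (Pi.single j 1) = Matrix.vecMul c glueGram j := by
    intro j
    rw [glueHerm, Matrix.vecMul, dotProduct]
    refine Finset.sum_congr rfl fun i _ => ?_
    rw [Finset.sum_eq_single j (fun k _ hk => by rw [Pi.single_eq_of_ne hk, star_zero, mul_zero])
      (fun hj => absurd (Finset.mem_univ j) hj), Pi.single_eq_same, star_one, mul_one]
  have h2 : Matrix.vecMul (fun j => (1 - eisω) * w (Pi.single j 1)) K = (2 : Eis) • c := by
    have h3 : (fun j => (1 - eisω) * w (Pi.single j 1)) = Matrix.vecMul c glueGram := by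
      funext j
      rw [← hw, hc]
    rw [h3, Matrix.vecMul_vecMul, hK]
    have h4 : (2 : Matrix (Fin 5) (Fin 5) Eis) = (2 : Eis) • 1 := by decide +kernel
    rw [h4, Matrix.vecMul_smul, Matrix.vecMul_one]
  have h3 : (3 : Eis) = (1 - eisω) * (2 + eisω) := by decide
  refine ⟨(2 + eisω) • c - Matrix.vecMul (fun j => w (Pi.single j 1)) K, ?_⟩
  have h5 : Matrix.vecMul (fun j => (1 - eisω) * w (Pi.single j 1)) K =
      (1 - eisω) • Matrix.vecMul (fun j => w (Pi.single j 1)) K :=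
    Matrix.smul_vecMul (1 - eisω) (fun j => w (Pi.single j 1)) K
  rw [smul_sub, ← h5, h2, smul_smul, ← h3, ← sub_smul]
  norm_num

/-- The isometry group of the glued lattice. -/
def glueO : Subgroup ((Fin 5 → Eis) ≃ₗ[ℤ] (Fin 5 → Eis)) where
  carrier := {f | ∀ c d, glueForm (f c) (f d) = glueForm c d}
  one_mem' := fun _ _ => rfl
  mul_mem' := fun {f g} hf hg c d => (hf (g c) (g d)).trans (hg c d)
  inv_mem' := fun {f} hf c d => by
    have h := hf (f.symm c) (f.symm d)
    rw [f.apply_symm_apply, f.apply_symm_apply] at h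
    exact h.symm

theorem glueForm_map {f : (Fin 5 → Eis) ≃ₗ[ℤ] (Fin 5 → Eis)} (hf : f ∈ glueO)
    (c d : Fin 5 → Eis) : glueForm (f c) (f d) = glueForm c d := hf c d

theorem eisω_mul (w : Eis) : w = w.re • 1 + w.im • eisω := by
  ext <;> simp [eisω]

theorem smul_eq_re_add_im (w : Eis) (c : Fin 5 → Eis) : w • c = w.re • c + w.im • (eisω • c) := by
  conv_lhs => rw [eisω_mul w, add_smul, smul_assoc, smul_assoc, one_smul]

/-- The hypothesis puts Je - e, hence also Je - ωe and Je - ω²e, in (1 - ω)L. Such a difference, if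
not zero, has norm at least 3 · 4, which forces a product at most -2. The products of Je with e, ωe
and ω²e add up to zero, so one difference vanishes; Je = e contradicts J² + J + 1 = 0. -/
theorem omega_cases {J : (Fin 5 → Eis) →+ (Fin 5 → Eis)} (hJJ : ∀ c, J (J c) = -c - J c)
    (hJ : ∀ c d, glueForm (J c) (J d) = glueForm c d)
    (hθ : ∀ c d, 3 ∣ glueForm (J c - c) d) {e : Fin 5 → Eis} (he : glueForm e e = 4) :
    J e = eisω • e ∨ J e = (eisω * eisω) • e := by
  have hge : ∀ k : Eis, (∃ y, J e - k • e = (1 - eisω) • y) → k.norm = 1 → J e ≠ k • e →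
      glueForm (J e) (k • e) ≤ -2 := by
    rintro k ⟨y, hy⟩ hk hne
    have h1 := glueForm_sub_self (J e) (k • e)
    rw [hJ, he, glueForm_smul_smul, he, hk, hy, glueForm_smul_smul] at h1
    have hy0 : y ≠ 0 := fun h0 => hne (by rw [← sub_eq_zero, hy, h0, smul_zero])
    have h2 := four_le_glueForm hy0
    have h3 : (1 - eisω : Eis).norm = 3 := by decide
    rw [h3] at h1
    omega
  obtain ⟨y, hy⟩ := exists_eq_smul_of_dvd (hθ e)
  by_contra! hcon
  have h0 := hge 1 ⟨y, by rw [one_smul, hy]⟩ (by decide) fun h => by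
    rw [one_smul] at h
    have h1 := hJJ e
    rw [h, h] at h1
    have h2 : (3 : Eis) • e = 0 := by
      calc (3 : Eis) • e = e - (-e - e) := by module
        _ = 0 := by rw [← h1, sub_self]
    have h3 := congrArg (fun v => glueForm v v) h2
    simp only [glueForm_smul_smul, he] at h3
    exact absurd h3 (by decide)
  have h1 := hge eisω ⟨y + e, by rw [smul_add, ← hy]; module⟩ (by decide) hcon.1
  have h2 := hge (eisω * eisω) ⟨y + (1 + eisω) • e, by rw [smul_add, ← hy]; module⟩ (by decide)
    hcon.2
  have h3 : glueForm (J e) ((1 : Eis) • e) + glueForm (J e) (eisω • e) +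
      glueForm (J e) ((eisω * eisω) • e) = 0 := by
    rw [glueForm_comm, glueForm_comm _ (eisω • e), glueForm_comm _ ((eisω * eisω) • e),
      ← glueForm_add_left, ← glueForm_add_left, ← add_smul, ← add_smul,
      show (1 + eisω + eisω * eisω : Eis) = 0 by decide, zero_smul, ← sub_self e, glueForm_sub_left,
      sub_self]
  omega

theorem map_smul_of_omega {J : (Fin 5 → Eis) →+ (Fin 5 → Eis)} (hJJ : ∀ c, J (J c) = -c - J c)
    {e : Fin 5 → Eis} {μ : Eis} (hμ : μ = eisω ∨ μ = eisω * eisω) (he : J e = μ • e) (w : Eis) :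
    J (w • e) = μ • (w • e) := by
  have h1 : J (eisω • e) = μ • (eisω • e) := by
    have h2 := hJJ e
    rcases hμ with rfl | rfl
    · rw [← he, h2, he, smul_smul, ← neg_one_smul Eis e, ← sub_smul]
      congr 1
    · have h3 : eisω • e = -e - J e := by
        rw [he, ← neg_one_smul Eis e, ← sub_smul]
        congr 1
      rw [h3, ← h2, hJJ (J e), h2, ← h3, smul_smul, show (eisω * eisω * eisω : Eis) = 1 by decide,
        one_smul, he, ← neg_smul, ← sub_smul, show (-(eisω * eisω) - eisω : Eis) = 1 by decide,
        one_smul]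
  rw [smul_eq_re_add_im w, map_add, map_zsmul, map_zsmul, h1, he, smul_add, smul_comm μ w.re, smul_comm μ w.im]

theorem eq_sum_smul_single (c : Fin 5 → Eis) :
    c = ∑ j, c j • (Pi.single j 1 : Fin 5 → Eis) := by
  funext i
  simp [Finset.sum_apply, Pi.single_apply]

/-- An isometry commutes with `ω` up to conjugation. -/
theorem map_omega_cases {f : (Fin 5 → Eis) ≃ₗ[ℤ] (Fin 5 → Eis)} (hf : f ∈ glueO) :
    (∀ c, f (eisω • c) = eisω • f c) ∨ ∀ c, f (eisω • c) = (eisω * eisω) • f c := by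
  -- The conjugate of multiplication by ω under f is a second structure of the same kind on the
  -- lattice.
  let J : (Fin 5 → Eis) →+ (Fin 5 → Eis) := AddMonoidHom.mk' (fun c => f (eisω • f.symm c))
    fun c d => by rw [map_add, smul_add, map_add]
  have hJf : ∀ c, J (f c) = f (eisω • c) := fun c => by
    change f (eisω • f.symm (f c)) = _
    rw [f.symm_apply_apply]
  have hsymm : ∀ c, ∃ c', c = f c' := fun c => ⟨f.symm c, (f.apply_symm_apply c).symm⟩
  have hJJ : ∀ c, J (J c) = -c - J c := by
    intro c
    obtain ⟨c, rfl⟩ := hsymm c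
    rw [hJf, hJf, ← map_neg, ← map_sub, smul_smul, ← neg_one_smul Eis c, ← sub_smul]
    congr 2
  have hJ : ∀ c d, glueForm (J c) (J d) = glueForm c d := by
    intro c d
    obtain ⟨c, rfl⟩ := hsymm c
    obtain ⟨d, rfl⟩ := hsymm d
    rw [hJf, hJf, glueForm_map hf, glueForm_map hf, glueForm, glueHerm_smul_left,
      glueHerm_smul_right, ← mul_assoc, show (eisω * star eisω : Eis) = 1 by decide, one_mul,
      glueForm]
  have hθ : ∀ c d, 3 ∣ glueForm (J c - c) d := by
    intro c d
    obtain ⟨c, rfl⟩ := hsymm c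
    obtain ⟨d, rfl⟩ := hsymm d
    have h1 : (eisω • c - c) = (eisω - 1) • c := by module
    rw [hJf, ← map_sub, glueForm_map hf, h1, glueForm, glueHerm_smul_left]
    have h2 : (eisω - 1 : Eis) = ⟨-1, 1⟩ := by decide
    rw [h2, QuadraticAlgebra.trace_def, QuadraticAlgebra.re_mul, QuadraticAlgebra.im_mul]
    exact ⟨-(glueHerm c d).re, by ring⟩
  let e : Fin 5 → Fin 5 → Eis := fun j => Pi.single j 1
  have he : ∀ j, glueForm (e j) (e j) = 4 := by decide +kernel
  have hcase := fun j => omega_cases hJJ hJ hθ (he j)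
  -- If J acted by ω on e_i and by ω² on e_j, their Hermitian product z would satisfy Tr z = Tr ωz =
  -- Tr ω²z; these add up to zero, so the trace vanishes. The nonzero products connect all basis
  -- vectors.
  have hconn : ∀ i j, glueForm (e i) (e j) ≠ 0 → J (e i) = eisω • e i →
      J (e j) = (eisω * eisω) • e j → False := by
    intro i j hne hi hj
    have h1 := hJ (e i) (e j)
    have h2 := hJ (J (e i)) (J (e j))
    have h3 := map_smul_of_omega hJJ (Or.inl rfl) hi eisω
    have h4 := map_smul_of_omega hJJ (Or.inr rfl) hj (eisω * eisω)
    rw [h1, hi, hj, h3, h4, smul_smul, smul_smul] at h2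
    rw [hi, hj] at h1
    apply hne
    rw [glueForm, glueHerm_smul_left, glueHerm_smul_right, ← mul_assoc] at h1 h2
    rw [show (eisω * star (eisω * eisω) : Eis) = ⟨-1, -1⟩ by decide] at h1
    rw [show (eisω * eisω * star (eisω * eisω * (eisω * eisω)) : Eis) = ⟨0, 1⟩ by decide] at h2
    rw [QuadraticAlgebra.trace_def, QuadraticAlgebra.re_mul, QuadraticAlgebra.im_mul, glueForm,
      QuadraticAlgebra.trace_def] at h1 h2
    rw [glueForm, QuadraticAlgebra.trace_def]
    simp only at h1 h2
    omega
  have hall : ∀ μ : Eis, (μ = eisω ∨ μ = eisω * eisω) → (∀ j, J (e j) = μ • e j) →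
      ∀ c, f (eisω • c) = μ • f c := by
    intro μ hμ h c
    rw [← hJf]
    generalize f c = c
    conv_lhs => rw [eq_sum_smul_single c, map_sum]
    conv_rhs => rw [eq_sum_smul_single c, Finset.smul_sum]
    exact Finset.sum_congr rfl fun j _ => map_smul_of_omega hJJ hμ (h j) _
  have h02 : glueForm (e 0) (e 2) ≠ 0 := by decide +kernel
  have h03 : glueForm (e 0) (e 3) ≠ 0 := by decide +kernel
  have h04 : glueForm (e 0) (e 4) ≠ 0 := by decide +kernel
  have h12 : glueForm (e 1) (e 2) ≠ 0 := by decide +kernel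
  have hbij : ∀ i j, glueForm (e i) (e j) ≠ 0 → (J (e i) = eisω • e i ↔ J (e j) = eisω • e j) :=
    fun i j hij => ⟨fun hi => (hcase j).resolve_right fun hj => hconn i j hij hi hj,
      fun hj => (hcase i).resolve_right fun hi =>
        hconn j i (by rwa [glueForm_comm]) hj hi⟩
  by_cases h0 : J (e 0) = eisω • e 0
  · refine Or.inl (hall _ (Or.inl rfl) fun j => ?_)
    have h2 := (hbij 0 2 h02).1 h0
    fin_cases j
    exacts [h0, (hbij 1 2 h12).2 h2, h2, (hbij 0 3 h03).1 h0, (hbij 0 4 h04).1 h0]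
  · refine Or.inr (hall _ (Or.inr rfl) fun j => (hcase j).resolve_left fun hj => h0 ?_)
    fin_cases j
    exacts [hj, (hbij 0 2 h02).2 ((hbij 1 2 h12).1 hj), (hbij 0 2 h02).2 hj, (hbij 0 3 h03).2 hj,
      (hbij 0 4 h04).2 hj]

/-! ### Reduction of the Hermitian isometries modulo `2` -/

/-- The isometries that are linear over the Eisenstein integers. -/
def glueU : Subgroup glueO where
  carrier := {f | ∀ c, f.1 (eisω • c) = eisω • f.1 c}
  one_mem' := fun _ => rfl
  mul_mem' := fun {f g} hf hg c => by
    change f.1 (g.1 (eisω • c)) = eisω • f.1 (g.1 c)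
    rw [hg, hf]
  inv_mem' := fun {f} hf c => by
    change f.1.symm (eisω • c) = eisω • f.1.symm c
    rw [LinearEquiv.symm_apply_eq, hf, f.1.apply_symm_apply]

theorem glueU_map_omega (f : glueU) (c : Fin 5 → Eis) : f.1.1 (eisω • c) = eisω • f.1.1 c := f.2 c

theorem glueU_map_smul (f : glueU) (w : Eis) (c : Fin 5 → Eis) : f.1.1 (w • c) = w • f.1.1 c := by
  rw [smul_eq_re_add_im, map_add, map_zsmul, map_zsmul, glueU_map_omega, ← smul_eq_re_add_im]

theorem eis_ext_trace {z w : Eis} (h : z.trace = w.trace)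
    (h' : (eisω * z).trace = (eisω * w).trace) : z = w := by
  simp only [QuadraticAlgebra.trace_def, QuadraticAlgebra.re_mul, QuadraticAlgebra.im_mul,
    eisω] at h h'
  ext <;> omega

/-- An element z of Z[ω] is determined by Tr z and Tr ωz, so a linear isometry of the trace form
preserves the Hermitian form. -/
theorem glueHerm_map (f : glueU) (c d : Fin 5 → Eis) :
    glueHerm (f.1.1 c) (f.1.1 d) = glueHerm c d := by
  refine eis_ext_trace (f.1.2 c d) ?_
  have h := f.1.2 (eisω • c) d
  rwa [glueU_map_omega, glueForm, glueHerm_smul_left, glueForm, glueHerm_smul_left] at h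

theorem mem_glueU_of_glueHerm {f : (Fin 5 → Eis) ≃ₗ[Eis] (Fin 5 → Eis)}
    (h : ∀ c d, glueHerm (f c) (f d) = glueHerm c d) :
    ∃ g : glueU, ∀ c, g.1.1 c = f c :=
  ⟨⟨⟨f.restrictScalars ℤ, fun c d => congrArg QuadraticAlgebra.trace (h c d)⟩,
    fun c => f.map_smul eisω c⟩, fun _ => rfl⟩

theorem glueU_ext {f g : glueU} (h : ∀ c, f.1.1 c = g.1.1 c) : f = g :=
  Subtype.ext (Subtype.ext (LinearEquiv.ext h))

/-- Reduction modulo `2` of the glued lattice onto its nondegenerate quotient. -/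
def glueRedMat : Matrix (Fin 4) (Fin 5) F4 :=
  !![0, 1, 0, 1, ⟨0, 1⟩; 0, 1, 1, ⟨0, 1⟩, 0; 1, 0, 0, ⟨1, 1⟩, 1; 1, 0, 1, ⟨0, 1⟩, 0]

/-- Reduction modulo `2` of the glued lattice onto its nondegenerate quotient. -/
def glueRed : (Fin 5 → Eis) →+ (Fin 4 → F4) :=
  AddMonoidHom.mk' (fun c => glueRedMat.mulVec (eisMod ∘ c)) fun c d => by
    rw [← Matrix.mulVec_add]
    congr 1
    funext i
    exact map_add eisMod _ _

theorem glueRed_apply (c : Fin 5 → Eis) : glueRed c = glueRedMat.mulVec (eisMod ∘ c) := rfl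

theorem glueRed_smul (w : Eis) (c : Fin 5 → Eis) : glueRed (w • c) = eisMod w • glueRed c := by
  rw [glueRed_apply, glueRed_apply, ← Matrix.mulVec_smul]
  congr 1
  funext i
  exact map_mul eisMod _ _

/-- Modulo 2 the Gram matrix factors through the 4 × 5 matrix `glueRedMat`, so the reduced form is
the pullback of the standard Hermitian form in dimension 4. -/
theorem eisMod_glueHerm (c d : Fin 5 → Eis) :
    eisMod (glueHerm c d) = glueRed c ⬝ᵥ star (glueRed d) := by
  have h1 : glueGram.map eisMod = glueRedMat.transpose * glueRedMat.map star := by decide +kernel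
  have h2 : eisMod (glueHerm c d) = (eisMod ∘ c) ⬝ᵥ (glueGram.map eisMod).mulVec
      (star (eisMod ∘ d)) := by
    simp only [glueHerm, map_sum, map_mul, dotProduct, Matrix.mulVec, Finset.mul_sum, mul_assoc,
      eisMod_star, Matrix.map_apply, Pi.star_apply, Function.comp_apply]
  have h3 : glueRedMat.map star = glueRedMat.conjTranspose.transpose := rfl
  rw [h2, h1, glueRed_apply, glueRed_apply, Matrix.star_mulVec, ← Matrix.mulVec_mulVec,
    Matrix.mulVec_transpose, h3, Matrix.mulVec_transpose, dotProduct_comm, ← Matrix.dotProduct_mulVec,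
    dotProduct_comm]

/-- Lifts of the standard basis under the reduction. -/
def glueLift : Fin 4 → Fin 5 → Eis :=
  ![![⟨0, 1⟩, ⟨0, 1⟩, 0, 1, 1], ![⟨0, 1⟩, ⟨-1, -1⟩, 0, 1, 1],
    ![⟨-1, -1⟩, ⟨-1, -1⟩, 0, ⟨0, 1⟩, ⟨-1, -1⟩], ![⟨0, 1⟩, ⟨-1, -1⟩, 0, ⟨0, 1⟩, ⟨-1, -1⟩]]

theorem glueRed_glueLift : ∀ j, glueRed (glueLift j) = Pi.single j 1 := by decide +kernel

/-- The kernel is the radical modulo 2 and so does not depend on coordinates; this is why linear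
isometries act on the quotient. -/
theorem glueRed_eq_zero_iff {c : Fin 5 → Eis} :
    glueRed c = 0 ↔ ∀ d, eisMod (glueHerm c d) = 0 := by
  refine ⟨fun h d => by rw [eisMod_glueHerm, h, zero_dotProduct], fun h => ?_⟩
  funext k
  have h1 := h (glueLift k)
  rwa [eisMod_glueHerm, glueRed_glueLift, Pi.star_single, star_one, dotProduct_single_one] at h1

theorem glueRed_map_eq_zero (f : glueU) {c : Fin 5 → Eis} (hc : glueRed c = 0) :
    glueRed (f.1.1 c) = 0 := by
  rw [glueRed_eq_zero_iff] at hc ⊢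
  intro d
  rw [← f.1.1.apply_symm_apply d, glueHerm_map, hc]

theorem eisMod_surjective : Function.Surjective eisMod := by
  have h : ∀ x : F4, ∃ y ∈ ({0, 1, eisω, 1 + eisω} : Finset Eis), eisMod y = x := by decide
  exact fun x => let ⟨y, _, hy⟩ := h x; ⟨y, hy⟩

/-- The matrix of an isometry modulo `2`. -/
def glueMatrix (f : glueU) : Matrix (Fin 4) (Fin 4) F4 :=
  Matrix.of fun k j => glueRed (f.1.1 (glueLift j)) k

theorem glueRed_map (f : glueU) (c : Fin 5 → Eis) :
    glueRed (f.1.1 c) = (glueMatrix f).mulVec (glueRed c) := by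
  choose l hl using fun k => eisMod_surjective (glueRed c k)
  have h1 : glueRed (∑ k, l k • glueLift k) = glueRed c := by
    simp only [map_sum, glueRed_smul, glueRed_glueLift, hl]
    funext k
    simp [Finset.sum_apply, Pi.single_apply]
  have h2 : glueRed (f.1.1 (c - ∑ k, l k • glueLift k)) = 0 :=
    glueRed_map_eq_zero f (by rw [map_sub, h1, sub_self])
  rw [map_sub, map_sub, sub_eq_zero] at h2
  rw [h2, map_sum, map_sum]
  simp only [glueU_map_smul, glueRed_smul, hl]
  funext k
  simp [Finset.sum_apply, Matrix.mulVec, dotProduct, glueMatrix, mul_comm]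

theorem glueMatrix_conjTranspose_mul (f : glueU) :
    (glueMatrix f).conjTranspose * glueMatrix f = 1 := by
  ext1 i j
  have h := eisMod_glueHerm (f.1.1 (glueLift j)) (f.1.1 (glueLift i))
  rw [glueHerm_map, eisMod_glueHerm, glueRed_glueLift, glueRed_glueLift, Pi.star_single, star_one,
    dotProduct_single_one, dotProduct_comm] at h
  exact h.symm.trans (Matrix.one_apply.trans (Pi.single_apply _ _ _).symm).symm

/-- The action of the linear isometries modulo `2`. -/
def glueRep : glueU →* Matrix.unitaryGroup (Fin 4) F4 :=
  MonoidHom.mk' (fun f => ⟨glueMatrix f, Matrix.mem_unitaryGroup_iff'.2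
    (glueMatrix_conjTranspose_mul f)⟩) fun f g => by
      refine Subtype.ext (Matrix.ext fun k j => ?_)
      exact congrFun (glueRed_map f (g.1.1 (glueLift j))) k

theorem glueRed_map_glueRep (f : glueU) (c : Fin 5 → Eis) :
    glueRed (f.1.1 c) = (glueRep f).1.mulVec (glueRed c) := glueRed_map f c

theorem glueRep_eq {f : glueU} {A : Matrix (Fin 4) (Fin 4) F4}
    (h : ∀ c, glueRed (f.1.1 c) = A.mulVec (glueRed c)) : (glueRep f).1 = A := by
  ext1 k j
  have h1 := congrFun (h (glueLift j)) k
  rwa [glueRed_glueLift, Matrix.mulVec_single_one] at h1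

theorem glueRed_kernel_coord : ∀ a b c d e : F4, glueRedMat.mulVec ![a, b, c, d, e] = 0 →
    a = 0 ∧ b = 0 ∧ d = ⟨1, 1⟩ * c ∧ e = ⟨0, 1⟩ * c := by
  decide +kernel

theorem glueRed_kernel_weight : ∀ x y c : F4,
    (∀ i, (![x + y + c, x, x + ⟨0, 1⟩ * y + ⟨1, 1⟩ * c, x + ⟨1, 1⟩ * y + ⟨0, 1⟩ * c, y] :
      Fin 5 → F4) i = 0) ∨
    3 ≤ (Finset.univ.filter fun i => (![x + y + c, x, x + ⟨0, 1⟩ * y + ⟨1, 1⟩ * c,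
      x + ⟨1, 1⟩ * y + ⟨0, 1⟩ * c, y] : Fin 5 → F4) i ≠ 0).card := by
  decide +kernel

/-- In the kernel all coordinates are divisible by 2. The norm 8 would leave a vector of norm 2
whose reduction modulo 2 has weight 0 or at least 3: the first gives a multiple of 4, the second at
least 3. -/
theorem glueForm_ne_eight {c : Fin 5 → Eis} (hc : glueRed c = 0) : glueForm c c ≠ 8 := by
  have h1 : (eisMod ∘ c) = ![eisMod (c 0), eisMod (c 1), eisMod (c 2), eisMod (c 3),
      eisMod (c 4)] := by
    funext i
    fin_cases i <;> rfl
  rw [glueRed_apply, h1] at hc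
  obtain ⟨h0, h1, h3, h4⟩ := glueRed_kernel_coord _ _ _ _ _ hc
  obtain ⟨x, hx⟩ := eisMod_eq_zero h0
  obtain ⟨y, hy⟩ := eisMod_eq_zero h1
  let a : Fin 5 → Eis := ![x + y + c 2, x, x + eisω * y + c 3, x + eisω * eisω * y + c 4, y]
  have ha : ∀ i, glueCoord c i = 2 * a i := by
    intro i
    rw [glueCoord_apply]
    fin_cases i <;> simp [a, hx, hy] <;> ring
  have hred : ∀ i, eisMod (a i) = (![eisMod x + eisMod y + eisMod (c 2), eisMod x,
      eisMod x + ⟨0, 1⟩ * eisMod y + ⟨1, 1⟩ * eisMod (c 2),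
      eisMod x + ⟨1, 1⟩ * eisMod y + ⟨0, 1⟩ * eisMod (c 2), eisMod y] : Fin 5 → F4) i := by
    have hω : eisMod eisω = ⟨0, 1⟩ := by decide
    have hω' : (⟨0, 1⟩ * ⟨0, 1⟩ : F4) = ⟨1, 1⟩ := by decide
    intro i
    fin_cases i <;> simp [a, h3, h4, hω, hω']
  intro h8
  rw [glueForm, glueHerm_self] at h8
  simp only [ha, norm_two_mul, ← Finset.mul_sum] at h8
  obtain ⟨hw1, hw2⟩ := sum_norm_cases a
  simp only [hred] at hw1 hw2
  rcases glueRed_kernel_weight (eisMod x) (eisMod y) (eisMod (c 2)) with h | h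
  · obtain ⟨k, hk⟩ := hw2 h
    omega
  · have := (Nat.cast_le (α := ℤ)).2 h
    push_cast at this
    omega

theorem eis_eq_one_or {b : Eis} (hb : b.norm = 1) (hb' : eisMod b = 1) : b = 1 ∨ b = -1 := by
  have h1 : ((b.im : ℤ) : ZMod 2) = 0 := congrArg QuadraticAlgebra.im hb'
  obtain ⟨k, hk⟩ := (ZMod.intCast_zmod_eq_zero_iff_dvd _ 2).1 h1
  rw [QuadraticAlgebra.norm_def, hk] at hb
  push_cast at hb hk
  have h2 : (b.re - k) ^ 2 + 3 * k ^ 2 = 1 := by linarith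
  have hk0 : k = 0 := by
    have : k ^ 2 < 1 := by nlinarith [sq_nonneg (b.re - k)]
    rwa [sq_lt_one_iff_abs_lt_one, Int.abs_lt_one_iff] at this
  rw [hk0] at h2 hk
  have h3 : b.re = 1 ∨ b.re = -1 := by
    rw [← sq_eq_one_iff]
    linarith
  rcases h3 with h3 | h3
  · exact Or.inl (QuadraticAlgebra.ext (by simp [h3, QuadraticAlgebra.re_one])
      (by simp [hk, QuadraticAlgebra.im_one]))
  · exact Or.inr (QuadraticAlgebra.ext (by simp [h3, QuadraticAlgebra.re_one])
      (by simp [hk, QuadraticAlgebra.im_one]))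

/-- The Hermitian product of fe and e is 2b for some b, and fe - be has norm 4 - 4N(b). If this
vector is zero, b is a unit congruent to 1 modulo 2, that is ±1. Otherwise b = 0, and fe - e is a
kernel vector of norm 8, which does not exist. -/
theorem map_single_of_glueRed {f : glueU} (hf : ∀ c, glueRed (f.1.1 c) = glueRed c)
    {e : Fin 5 → Eis} (he : glueForm e e = 4) (he2 : eisMod (glueHerm e e) = 0)
    (he' : ∃ i, glueRed e i ≠ 0) : f.1.1 e = (1 : Eis) • e ∨ f.1.1 e = (-1 : Eis) • e := by
  have ht : glueRed (f.1.1 e - e) = 0 := by rw [map_sub, hf, sub_self]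
  obtain ⟨b, hb⟩ : ∃ b, glueHerm (f.1.1 e) e = 2 * b := by
    refine eisMod_eq_zero ?_
    have h1 := glueRed_eq_zero_iff.1 ht e
    rwa [glueHerm_sub_left, map_sub, he2, sub_zero] at h1
  have hN : (glueForm (f.1.1 e) (b • e) : ℤ) = 4 * b.norm := by
    rw [glueForm, glueHerm_smul_right, hb, QuadraticAlgebra.trace_def, QuadraticAlgebra.norm_def]
    simp [QuadraticAlgebra.re_mul, QuadraticAlgebra.im_mul, QuadraticAlgebra.re_ofNat,
      QuadraticAlgebra.im_ofNat]
    ring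
  have h1 := glueForm_sub_self (f.1.1 e) (b • e)
  rw [hN, glueForm_smul_smul, glueForm_map f.1.2, he] at h1
  have hb0 := eisNorm_nonneg b
  by_cases hfe : f.1.1 e = b • e
  · have hb1 : b.norm = 1 := by
      have h2 : glueForm (f.1.1 e) (f.1.1 e) = 4 := by rw [glueForm_map f.1.2, he]
      rw [hfe, glueForm_smul_smul, he] at h2
      omega
    have hb2 : eisMod b = 1 := by
      obtain ⟨i, hi⟩ := he'
      have h2 := congrFun (hf e) i
      rw [hfe, glueRed_smul, Pi.smul_apply, smul_eq_mul] at h2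
      have h4 : ∀ x y : F4, y ≠ 0 → x * y = y → x = 1 := by decide +kernel
      exact h4 _ _ hi h2
    rcases eis_eq_one_or hb1 hb2 with h | h <;> rw [h] at hfe
    exacts [Or.inl hfe, Or.inr hfe]
  · have h2 := four_le_glueForm (sub_ne_zero.2 hfe)
    have h3 : b = 0 := eisNorm_eq_zero (by omega)
    have h4 := glueForm_sub_self (f.1.1 e) e
    rw [glueForm_map f.1.2, he, glueForm.eq_1 _ e, hb, h3, mul_zero, map_zero] at h4
    exact absurd h4 (glueForm_ne_eight ht)

/-- The linear isometries that are trivial modulo `2` are the signs. -/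
theorem eq_sign_of_glueRed {f : glueU} (hf : ∀ c, glueRed (f.1.1 c) = glueRed c) :
    (∀ c, f.1.1 c = c) ∨ ∀ c, f.1.1 c = -c := by
  let e : Fin 5 → Fin 5 → Eis := fun j => Pi.single j 1
  have he : ∀ j, glueForm (e j) (e j) = 4 := by decide +kernel
  have he2 : ∀ j, eisMod (glueHerm (e j) (e j)) = 0 := by decide +kernel
  have he' : ∀ j, ∃ i, glueRed (e j) i ≠ 0 := by decide +kernel
  have hcase := fun j => map_single_of_glueRed hf (he j) (he2 j) (he' j)
  have hconn : ∀ i j, glueForm (e i) (e j) ≠ 0 → f.1.1 (e i) = (1 : Eis) • e i →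
      f.1.1 (e j) = (-1 : Eis) • e j → False := by
    intro i j hne hi hj
    have h1 := glueForm_map f.1.2 (e i) (e j)
    rw [hi, hj, glueForm, glueHerm_smul_left, glueHerm_smul_right, star_neg, star_one, one_mul,
      neg_one_mul, map_neg, ← glueForm] at h1
    omega
  have hall : ∀ μ : Eis, (∀ j, f.1.1 (e j) = μ • e j) → ∀ c, f.1.1 c = μ • c := by
    intro μ h c
    conv_lhs => rw [eq_sum_smul_single c, map_sum]
    conv_rhs => rw [eq_sum_smul_single c, Finset.smul_sum]
    exact Finset.sum_congr rfl fun j _ => by rw [glueU_map_smul, h, smul_comm]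
  have h02 : glueForm (e 0) (e 2) ≠ 0 := by decide +kernel
  have h03 : glueForm (e 0) (e 3) ≠ 0 := by decide +kernel
  have h04 : glueForm (e 0) (e 4) ≠ 0 := by decide +kernel
  have h12 : glueForm (e 1) (e 2) ≠ 0 := by decide +kernel
  have hbij : ∀ i j, glueForm (e i) (e j) ≠ 0 →
      (f.1.1 (e i) = (1 : Eis) • e i ↔ f.1.1 (e j) = (1 : Eis) • e j) :=
    fun i j hij => ⟨fun hi => (hcase j).resolve_right fun hj => hconn i j hij hi hj,
      fun hj => (hcase i).resolve_right fun hi =>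
        hconn j i (by rwa [glueForm_comm]) hj hi⟩
  by_cases h0 : f.1.1 (e 0) = (1 : Eis) • e 0
  · refine Or.inl fun c => (hall _ (fun j => ?_) c).trans (one_smul _ c)
    have h2 := (hbij 0 2 h02).1 h0
    fin_cases j
    exacts [h0, (hbij 1 2 h12).2 h2, h2, (hbij 0 3 h03).1 h0, (hbij 0 4 h04).1 h0]
  · refine Or.inr fun c => (hall _ (fun j => (hcase j).resolve_left fun hj => h0 ?_) c).trans
      (neg_one_smul _ c)
    fin_cases j
    exacts [hj, (hbij 0 2 h02).2 ((hbij 1 2 h12).1 hj), (hbij 0 2 h02).2 hj, (hbij 0 3 h03).2 hj,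
      (hbij 0 4 h04).2 hj]

/-! ### The Hermitian isometries induce the full unitary group modulo `2` -/

/-- The Hermitian reflection in a vector of norm `2`. -/
def glueReflection (v : Fin 5 → Eis) : (Fin 5 → Eis) →ₗ[Eis] (Fin 5 → Eis) where
  toFun c := c - glueHerm c v • v
  map_add' c d := by rw [glueHerm_add_left, add_smul]; abel
  map_smul' w c := by
    rw [glueHerm_smul_left, mul_smul, RingHom.id_apply, smul_sub]

theorem glueReflection_apply (v c : Fin 5 → Eis) : glueReflection v c = c - glueHerm c v • v := rfl

theorem glueReflection_involutive {v : Fin 5 → Eis} (hv : glueHerm v v = 2) :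
    Function.Involutive (glueReflection v) := by
  intro c
  rw [glueReflection_apply, glueReflection_apply, glueHerm_sub_left, glueHerm_smul_left, hv]
  module

theorem glueHerm_glueReflection {v : Fin 5 → Eis} (hv : glueHerm v v = 2) (c d : Fin 5 → Eis) :
    glueHerm (glueReflection v c) (glueReflection v d) = glueHerm c d := by
  have h1 : ∀ a, glueHerm a (glueReflection v d) = glueHerm a d - star (glueHerm d v) * glueHerm a v
      := fun a => by
    rw [← star_glueHerm, glueReflection_apply, glueHerm_sub_left, glueHerm_smul_left, star_sub,
      star_mul', star_glueHerm, star_glueHerm _ a]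
  rw [h1, glueReflection_apply, glueHerm_sub_left, glueHerm_sub_left, glueHerm_smul_left,
    glueHerm_smul_left, hv, star_glueHerm]
  ring

/-- The matrices induced by the linear isometries modulo `2`. -/
def glueImage : Submonoid (Matrix (Fin 4) (Fin 4) F4) :=
  MonoidHom.mrange ((Matrix.unitaryGroup (Fin 4) F4).subtype.comp glueRep)

theorem mem_glueImage {A : Matrix (Fin 4) (Fin 4) F4} :
    A ∈ glueImage ↔ ∃ f, (glueRep f).1 = A := MonoidHom.mem_mrange

theorem conjTranspose_mul_of_mem_glueImage {A : Matrix (Fin 4) (Fin 4) F4} (hA : A ∈ glueImage) :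
    A.conjTranspose * A = 1 := by
  obtain ⟨f, rfl⟩ := mem_glueImage.1 hA
  exact Matrix.mem_unitaryGroup_iff'.1 (glueRep f).2

/-- The unitary transvection of a vector over the field with four elements. -/
def unitaryTransvection (w : Fin 4 → F4) : Matrix (Fin 4) (Fin 4) F4 :=
  1 + Matrix.vecMulVec w (star w)

/-- The Hermitian reflection in v reduces modulo 2 to the transvection of its image, as signs
disappear. -/
theorem unitaryTransvection_mem {w : Fin 4 → F4} (v : Fin 5 → Eis) (hv : glueHerm v v = 2)
    (hw : glueRed v = w) : unitaryTransvection w ∈ glueImage := by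
  obtain ⟨g, hg⟩ := mem_glueU_of_glueHerm
    (f := LinearEquiv.ofInvolutive (glueReflection v) (glueReflection_involutive hv))
    (glueHerm_glueReflection hv)
  refine mem_glueImage.2 ⟨g, glueRep_eq fun c => ?_⟩
  have h2 : ∀ x : F4, -x = x := by decide
  have h1 : g.1.1 c = c - glueHerm c v • v := hg c
  rw [h1, map_sub, glueRed_smul, eisMod_glueHerm, hw, unitaryTransvection, Matrix.add_mulVec,
    Matrix.one_mulVec, sub_eq_add_neg, Matrix.vecMulVec_mulVec, dotProduct_comm]
  congr 1
  funext i
  rw [Pi.neg_apply, h2]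
  exact mul_comm _ _

/-- Multiplication by a unit of the Eisenstein integers. -/
theorem exists_glueU_smul {μ : Eis} (hμ : μ * star μ = 1) :
    ∃ g : glueU, ∀ c, g.1.1 c = μ • c := by
  refine mem_glueU_of_glueHerm (f := LinearEquiv.smulOfUnit ⟨μ, star μ, hμ, by rw [mul_comm, hμ]⟩)
    fun c d => ?_
  change glueHerm (μ • c) (μ • d) = _
  rw [glueHerm_smul_left, glueHerm_smul_right, ← mul_assoc, hμ, one_mul]

theorem glueRep_smul {μ : Eis} {g : glueU} (hg : ∀ c, g.1.1 c = μ • c) :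
    (glueRep g).1 = eisMod μ • 1 :=
  glueRep_eq fun c => by rw [hg, glueRed_smul, Matrix.smul_mulVec, Matrix.one_mulVec]

/-- The transposition of two coordinates. -/
def unitarySwap (i j : Fin 4) : Matrix (Fin 4) (Fin 4) F4 := (Equiv.swap i j).permMatrix F4

/-- In characteristic 2 the transvection of a sum of two coordinate vectors is their transposition.
-/
theorem unitarySwap_mem_base : unitarySwap 0 1 ∈ glueImage ∧ unitarySwap 1 2 ∈ glueImage ∧
    unitarySwap 2 3 ∈ glueImage := by
  have h1 := unitaryTransvection_mem (w := ![1, 1, 0, 0]) ![0, 1, 0, 0, 0] (by decide +kernel)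
    (by decide +kernel)
  have h2 := unitaryTransvection_mem (w := ![0, 1, 1, 0]) ![1, 0, -1, 0, 0] (by decide +kernel)
    (by decide +kernel)
  have h3 := unitaryTransvection_mem (w := ![0, 0, 1, 1]) ![1, 0, 0, 0, 0] (by decide +kernel)
    (by decide +kernel)
  have e1 : unitaryTransvection ![1, 1, 0, 0] = unitarySwap 0 1 := by decide +kernel
  have e2 : unitaryTransvection ![0, 1, 1, 0] = unitarySwap 1 2 := by decide +kernel
  have e3 : unitaryTransvection ![0, 0, 1, 1] = unitarySwap 2 3 := by decide +kernel
  exact ⟨e1 ▸ h1, e2 ▸ h2, e3 ▸ h3⟩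

theorem unitarySwap_mem (i j : Fin 4) : unitarySwap i j ∈ glueImage := by
  obtain ⟨h1, h2, h3⟩ := unitarySwap_mem_base
  have h02 : unitarySwap 0 2 ∈ glueImage := by
    rw [show unitarySwap 0 2 = unitarySwap 0 1 * unitarySwap 1 2 * unitarySwap 0 1 by
      decide +kernel]
    exact mul_mem (mul_mem h1 h2) h1
  have h13 : unitarySwap 1 3 ∈ glueImage := by
    rw [show unitarySwap 1 3 = unitarySwap 1 2 * unitarySwap 2 3 * unitarySwap 1 2 by
      decide +kernel]
    exact mul_mem (mul_mem h2 h3) h2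
  have h03 : unitarySwap 0 3 ∈ glueImage := by
    rw [show unitarySwap 0 3 = unitarySwap 0 2 * unitarySwap 2 3 * unitarySwap 0 2 by
      decide +kernel]
    exact mul_mem (mul_mem h02 h3) h02
  have hsymm : ∀ i j, unitarySwap i j = unitarySwap j i := fun i j => by
    rw [unitarySwap, Equiv.swap_comm, unitarySwap]
  have hself : ∀ i, unitarySwap i i = 1 := by decide +kernel
  have hlt : ∀ i j : Fin 4, i < j → unitarySwap i j ∈ glueImage := by
    intro i j hij
    fin_cases i <;> fin_cases j <;> first | exact absurd hij (by decide) | assumption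
  rcases lt_trichotomy i j with h | h | h
  · exact hlt i j h
  · rw [h, hself]
    exact one_mem _
  · exact hsymm i j ▸ hlt j i h

theorem omega_smul_mem : (⟨0, 1⟩ : F4) • (1 : Matrix (Fin 4) (Fin 4) F4) ∈ glueImage := by
  obtain ⟨g, hg⟩ := exists_glueU_smul (μ := eisω) (by decide)
  exact mem_glueImage.2 ⟨g, glueRep_smul hg⟩

/-- A transvection times a transposition is diagonal with entries ω², ω, 1, 1. Its conjugates have
determinant one; the scalar ω has determinant ω⁴ = ω and supplies the missing factor. -/
theorem diagonal_omega_mem : Matrix.diagonal ![(⟨0, 1⟩ : F4), 1, 1, 1] ∈ glueImage := by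
  have h1 : Matrix.diagonal ![(⟨1, 1⟩ : F4), ⟨0, 1⟩, 1, 1] ∈ glueImage := by
    rw [show Matrix.diagonal ![(⟨1, 1⟩ : F4), ⟨0, 1⟩, 1, 1] =
      unitaryTransvection ![1, ⟨0, 1⟩, 0, 0] * unitarySwap 0 1 by decide +kernel]
    exact mul_mem (unitaryTransvection_mem ![1, ⟨1, 1⟩, -1, 0, -1] (by decide +kernel)
      (by decide +kernel)) (unitarySwap_mem 0 1)
  have h2 : Matrix.diagonal ![(⟨1, 1⟩ : F4), 1, ⟨0, 1⟩, 1] ∈ glueImage := by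
    rw [show Matrix.diagonal ![(⟨1, 1⟩ : F4), 1, ⟨0, 1⟩, 1] = unitarySwap 1 2 *
      Matrix.diagonal ![(⟨1, 1⟩ : F4), ⟨0, 1⟩, 1, 1] * unitarySwap 1 2 by decide +kernel]
    exact mul_mem (mul_mem (unitarySwap_mem 1 2) h1) (unitarySwap_mem 1 2)
  have h3 : Matrix.diagonal ![1, (⟨1, 1⟩ : F4), ⟨0, 1⟩, 1] ∈ glueImage := by
    rw [show Matrix.diagonal ![1, (⟨1, 1⟩ : F4), ⟨0, 1⟩, 1] = unitarySwap 0 1 *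
      Matrix.diagonal ![(⟨1, 1⟩ : F4), 1, ⟨0, 1⟩, 1] * unitarySwap 0 1 by decide +kernel]
    exact mul_mem (mul_mem (unitarySwap_mem 0 1) h2) (unitarySwap_mem 0 1)
  have h4 : Matrix.diagonal ![1, (⟨1, 1⟩ : F4), 1, ⟨0, 1⟩] ∈ glueImage := by
    rw [show Matrix.diagonal ![1, (⟨1, 1⟩ : F4), 1, ⟨0, 1⟩] = unitarySwap 2 3 *
      Matrix.diagonal ![1, (⟨1, 1⟩ : F4), ⟨0, 1⟩, 1] * unitarySwap 2 3 by decide +kernel]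
    exact mul_mem (mul_mem (unitarySwap_mem 2 3) h3) (unitarySwap_mem 2 3)
  have h5 : Matrix.diagonal ![1, 1, (⟨1, 1⟩ : F4), ⟨0, 1⟩] ∈ glueImage := by
    rw [show Matrix.diagonal ![1, 1, (⟨1, 1⟩ : F4), ⟨0, 1⟩] = unitarySwap 1 2 *
      Matrix.diagonal ![1, (⟨1, 1⟩ : F4), 1, ⟨0, 1⟩] * unitarySwap 1 2 by decide +kernel]
    exact mul_mem (mul_mem (unitarySwap_mem 1 2) h4) (unitarySwap_mem 1 2)
  rw [show Matrix.diagonal ![(⟨0, 1⟩ : F4), 1, 1, 1] = (⟨0, 1⟩ : F4) • (1 : Matrix _ _ F4) *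
    Matrix.diagonal ![1, (⟨1, 1⟩ : F4), ⟨0, 1⟩, 1] *
    (Matrix.diagonal ![1, 1, (⟨1, 1⟩ : F4), ⟨0, 1⟩] *
      Matrix.diagonal ![1, 1, (⟨1, 1⟩ : F4), ⟨0, 1⟩]) by decide +kernel]
  exact mul_mem (mul_mem omega_smul_mem h3) (mul_mem h5 h5)

theorem diagonal_mem {d : Fin 4 → F4} (hd : ∀ i, d i ≠ 0) : Matrix.diagonal d ∈ glueImage := by
  have hx : ∀ x : F4, x ≠ 0 → Matrix.diagonal ![x, 1, 1, 1] ∈ glueImage := by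
    intro x hx
    have h1 : ∀ x : F4, x ≠ 0 → x = 1 ∨ x = ⟨0, 1⟩ ∨ x = ⟨1, 1⟩ := by decide
    rcases h1 x hx with rfl | rfl | rfl
    · rw [show Matrix.diagonal ![(1 : F4), 1, 1, 1] = 1 by decide +kernel]
      exact one_mem _
    · exact diagonal_omega_mem
    · rw [show Matrix.diagonal ![(⟨1, 1⟩ : F4), 1, 1, 1] = Matrix.diagonal ![(⟨0, 1⟩ : F4), 1, 1, 1] *
        Matrix.diagonal ![(⟨0, 1⟩ : F4), 1, 1, 1] by decide +kernel]
      exact mul_mem diagonal_omega_mem diagonal_omega_mem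
  have hs : ∀ i x, unitarySwap 0 i * Matrix.diagonal ![x, 1, 1, 1] * unitarySwap 0 i =
    Matrix.diagonal (Function.update 1 i x) := by decide +kernel
  have hi : ∀ i, Matrix.diagonal (Function.update (1 : Fin 4 → F4) i (d i)) ∈ glueImage :=
    fun i => by
      rw [← hs]
      exact mul_mem (mul_mem (unitarySwap_mem 0 i) (hx _ (hd i))) (unitarySwap_mem 0 i)
  have h2 : Matrix.diagonal d = Matrix.diagonal (Function.update 1 0 (d 0)) *
      Matrix.diagonal (Function.update 1 1 (d 1)) * Matrix.diagonal (Function.update 1 2 (d 2)) *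
      Matrix.diagonal (Function.update 1 3 (d 3)) := by
    rw [Matrix.diagonal_mul_diagonal, Matrix.diagonal_mul_diagonal, Matrix.diagonal_mul_diagonal]
    congr 1
    funext i
    fin_cases i <;> simp [Function.update]
  rw [h2]
  exact mul_mem (mul_mem (mul_mem (hi 0) (hi 1)) (hi 2)) (hi 3)

/-- A unitary matrix without zeros off the diagonal. -/
def unitaryT : Matrix (Fin 4) (Fin 4) F4 := !![0, 1, 1, 1; 1, 0, 1, 1; 1, 1, 0, 1; 1, 1, 1, 0]

theorem unitaryT_mem : unitaryT ∈ glueImage := by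
  rw [show unitaryT = unitaryTransvection ![1, 1, 1, 1] by decide +kernel]
  exact unitaryTransvection_mem ![1, 1, -1, ⟨-1, -1⟩, ⟨0, 1⟩] (by decide +kernel) (by decide +kernel)

/-- A unitary matrix fixing the first coordinate. -/
def unitaryH : Matrix (Fin 4) (Fin 4) F4 :=
  !![1, 0, 0, 0; 0, 1, ⟨0, 1⟩, ⟨0, 1⟩; 0, 1, 1, ⟨1, 1⟩; 0, 1, ⟨1, 1⟩, 1]

theorem unitaryH_mem : unitaryH ∈ glueImage := by
  let X : Matrix (Fin 4) (Fin 4) F4 := !![0, 1, ⟨0, 1⟩, ⟨1, 1⟩; 1, 0, ⟨0, 1⟩, ⟨1, 1⟩;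
    ⟨0, 1⟩, ⟨0, 1⟩, ⟨1, 1⟩, 0; ⟨1, 1⟩, ⟨1, 1⟩, 0, ⟨0, 1⟩]
  have hX : X ∈ glueImage := by
    rw [show X = unitaryT * Matrix.diagonal ![1, 1, ⟨0, 1⟩, ⟨1, 1⟩] * unitaryT by decide +kernel]
    exact mul_mem (mul_mem unitaryT_mem (diagonal_mem (by decide))) unitaryT_mem
  rw [show unitaryH = Matrix.diagonal ![1, ⟨1, 1⟩, 1, ⟨1, 1⟩] *
    (X * Matrix.diagonal ![⟨0, 1⟩, 1, ⟨1, 1⟩, ⟨0, 1⟩] * unitaryT) by decide +kernel]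
  exact mul_mem (diagonal_mem (by decide)) (mul_mem (mul_mem hX (diagonal_mem (by decide)))
    unitaryT_mem)

/-! ### Generation and order of the unitary group, one column at a time. -/

/-- The unitary matrices fixing the first `k` coordinate vectors. -/
def unitaryFixing (k : ℕ) : Set (Matrix (Fin 4) (Fin 4) F4) :=
  {A | A.conjTranspose * A = 1 ∧ ∀ i, i.val < k → A.col i = Pi.single i 1}

theorem mul_mem_unitaryFixing {k : ℕ} {A B : Matrix (Fin 4) (Fin 4) F4} (hA : A ∈ unitaryFixing k)
    (hB : B ∈ unitaryFixing k) : A * B ∈ unitaryFixing k := by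
  refine ⟨?_, fun i hi => ?_⟩
  · rw [Matrix.conjTranspose_mul, Matrix.mul_assoc, ← Matrix.mul_assoc _ A B, hA.1, Matrix.one_mul,
      hB.1]
  · rw [← Matrix.mulVec_single_one, ← Matrix.mulVec_mulVec, Matrix.mulVec_single_one, hB.2 i hi,
      Matrix.mulVec_single_one, hA.2 i hi]

theorem conjTranspose_mem_unitaryFixing {k : ℕ} {A : Matrix (Fin 4) (Fin 4) F4}
    (hA : A ∈ unitaryFixing k) : A.conjTranspose ∈ unitaryFixing k := by
  refine ⟨?_, fun i hi => ?_⟩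
  · rw [Matrix.conjTranspose_conjTranspose]
    exact mul_eq_one_comm.1 hA.1
  · have h := hA.2 i hi
    rw [← Matrix.mulVec_single_one] at h ⊢
    conv_lhs => rw [← h]
    rw [Matrix.mulVec_mulVec, hA.1, Matrix.one_mulVec]

/-- The vectors of norm one orthogonal to the first `k` coordinate vectors. -/
def unitVectors (k : ℕ) : Finset (Fin 4 → F4) :=
  Finset.univ.filter fun u => (∀ i, i.val < k → u i = 0) ∧ ∑ i, star (u i) * u i = 1

theorem col_mem_unitVectors {A : Matrix (Fin 4) (Fin 4) F4} {k : Fin 4}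
    (hA : A ∈ unitaryFixing k) : A.col k ∈ unitVectors k := by
  refine Finset.mem_filter.2 ⟨Finset.mem_univ _, fun i hi => ?_, ?_⟩
  · have h1 := congrFun (congrFun hA.1 i) k
    rw [Matrix.one_apply_ne (by rintro rfl; exact lt_irrefl _ hi)] at h1
    change ∑ j, A.conjTranspose i j * A j k = 0 at h1
    have h2 : ∀ j, A.conjTranspose i j = (Pi.single i 1 : Fin 4 → F4) j := fun j => by
      rw [Matrix.conjTranspose_apply, ← Matrix.col_apply A i j, hA.2 i hi, Pi.single_apply]
      split_ifs <;> simp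
    simp only [h2, Pi.single_apply, ite_mul, one_mul, zero_mul, Finset.sum_ite_eq',
      Finset.mem_univ, if_true] at h1
    exact h1
  · have h1 := congrFun (congrFun hA.1 k) k
    rwa [Matrix.one_apply_eq] at h1

/-- A vector has norm one exactly when its support is odd, and diagonal matrices adjust the nonzero
entries; so one matrix for each stage k and each odd support outside the first k places is enough.
-/
theorem exists_col_eq_indicator : ∀ (k : Fin 4) (χ : Fin 4 → Bool),
    (∀ i, i.val < k.val → χ i = false) → (∑ i, if χ i then (1 : ZMod 2) else 0) = 1 →
    ∃ A ∈ [1, unitarySwap 0 1, unitarySwap 0 2, unitarySwap 0 3, unitarySwap 1 2, unitarySwap 1 3,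
      unitarySwap 2 3, unitaryT, unitarySwap 0 1 * unitaryT, unitarySwap 0 2 * unitaryT,
      unitarySwap 0 3 * unitaryT, unitaryH],
      (∀ i, i.val < k.val → A.col i = Pi.single i 1) ∧ ∀ i, A i k = if χ i then 1 else 0 := by
  decide +kernel

/-- The induced matrices act transitively on the vectors of norm one. -/
theorem exists_mem_glueImage_col {k : Fin 4} {u : Fin 4 → F4} (hu : u ∈ unitVectors k) :
    ∃ A ∈ glueImage, A ∈ unitaryFixing k ∧ A.col k = u := by
  obtain ⟨-, hu0, hu1⟩ := Finset.mem_filter.1 hu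
  have hsum : (∑ i, if (fun i => decide (u i ≠ 0)) i then (1 : ZMod 2) else 0) = 1 := by
    have h1 : ∀ x : F4, star x * x = ⟨if decide (x ≠ 0) then 1 else 0, 0⟩ := by decide
    have h2 := congrArg QuadraticAlgebra.re hu1
    simp only [h1, Fin.sum_univ_four] at h2
    rw [Fin.sum_univ_four]
    exact h2
  obtain ⟨A, hA, hA1, hA2⟩ := exists_col_eq_indicator k (fun i => decide (u i ≠ 0))
    (fun i hi => by simp [hu0 i hi]) hsum
  have hAm : A ∈ glueImage := by
    simp only [List.mem_cons, List.not_mem_nil, or_false] at hA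
    rcases hA with rfl | rfl | rfl | rfl | rfl | rfl | rfl | rfl | rfl | rfl | rfl | rfl
    exacts [one_mem _, unitarySwap_mem _ _, unitarySwap_mem _ _, unitarySwap_mem _ _,
      unitarySwap_mem _ _, unitarySwap_mem _ _, unitarySwap_mem _ _, unitaryT_mem,
      mul_mem (unitarySwap_mem _ _) unitaryT_mem, mul_mem (unitarySwap_mem _ _) unitaryT_mem,
      mul_mem (unitarySwap_mem _ _) unitaryT_mem, unitaryH_mem]
  have hD := diagonal_mem (d := fun i => if u i = 0 then 1 else u i) fun i => by
    split_ifs with h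
    exacts [one_ne_zero, h]
  have hm := mul_mem hD hAm
  refine ⟨_, hm, ⟨conjTranspose_mul_of_mem_glueImage hm, fun i hi => ?_⟩, ?_⟩
  · funext j
    rw [Matrix.col_apply, Matrix.diagonal_mul, ← Matrix.col_apply A, hA1 i hi]
    rcases eq_or_ne j i with rfl | hj
    · rw [if_pos (hu0 j hi), one_mul]
    · rw [Pi.single_eq_of_ne hj, mul_zero]
  · funext j
    rw [Matrix.col_apply, Matrix.diagonal_mul, hA2]
    by_cases h : u j = 0 <;> simp [h]

theorem unitaryFixing_four : unitaryFixing 4 = {1} := by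
  ext A
  constructor
  · intro hA
    refine Matrix.ext fun i j => ?_
    have h := congrFun (hA.2 j j.isLt) i
    rw [Matrix.col_apply] at h
    rw [h, Matrix.one_apply, Pi.single_apply]
  · rintro rfl
    refine ⟨by simp, fun i _ => ?_⟩
    rw [← Matrix.mulVec_single_one, Matrix.one_mulVec]

theorem mem_unitaryFixing_succ {k : Fin 4} {A : Matrix (Fin 4) (Fin 4) F4} :
    A ∈ unitaryFixing (k + 1) ↔ A ∈ unitaryFixing k ∧ A.col k = Pi.single k 1 := by
  refine ⟨fun h => ⟨⟨h.1, fun i hi => h.2 i (by omega)⟩, h.2 k (by omega)⟩, fun h => ⟨h.1.1, ?_⟩⟩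
  intro i hi
  rcases Nat.lt_succ_iff_lt_or_eq.1 hi with hi | hi
  · exact h.1.2 i hi
  · rw [Fin.ext hi, h.2]

theorem conjTranspose_mul_mem_succ {k : Fin 4} {N A : Matrix (Fin 4) (Fin 4) F4}
    (hN : N ∈ unitaryFixing k) (hA : A ∈ unitaryFixing k) (hNA : N.col k = A.col k) :
    N.conjTranspose * A ∈ unitaryFixing (k + 1) := by
  refine mem_unitaryFixing_succ.2
    ⟨mul_mem_unitaryFixing (conjTranspose_mem_unitaryFixing hN) hA, ?_⟩
  rw [← Matrix.mulVec_single_one, ← Matrix.mulVec_mulVec, Matrix.mulVec_single_one, ← hNA,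
    ← Matrix.mulVec_single_one, Matrix.mulVec_mulVec, hN.1, Matrix.one_mulVec]

/-- Orbit and stabilizer: a matrix is determined by its column k, realized by a chosen N, and by the
remaining factor N*A, which fixes one more coordinate vector. -/
theorem card_unitaryFixing_succ (k : Fin 4) : Nat.card (unitaryFixing k) =
    (unitVectors k).card * Nat.card (unitaryFixing (k + 1)) := by
  choose N hN hN' using fun u : unitVectors k => exists_mem_glueImage_col u.2
  have hinv : ∀ u, N u * (N u).conjTranspose = 1 := fun u => mul_eq_one_comm.1 (hN' u).1.1
  have hcard : (unitVectors k).card = Nat.card (unitVectors k) := by simp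
  rw [hcard, ← Nat.card_prod]
  refine Nat.card_congr ⟨fun A => (⟨_, col_mem_unitVectors A.2⟩, ⟨_, conjTranspose_mul_mem_succ
    (hN' ⟨_, col_mem_unitVectors A.2⟩).1 A.2 (hN' ⟨_, col_mem_unitVectors A.2⟩).2⟩),
    fun p => ⟨N p.1 * p.2.1, mul_mem_unitaryFixing (hN' p.1).1 (mem_unitaryFixing_succ.1 p.2.2).1⟩,
    fun A => Subtype.ext ?_, fun p => ?_⟩
  · change N _ * ((N _).conjTranspose * A.1) = A.1
    rw [← Matrix.mul_assoc, hinv, Matrix.one_mul]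
  · obtain ⟨u, B, hB⟩ := p
    have hu : (N u * B).col k = u := by
      rw [← Matrix.mulVec_single_one, ← Matrix.mulVec_mulVec, Matrix.mulVec_single_one,
        (mem_unitaryFixing_succ.1 hB).2, Matrix.mulVec_single_one, (hN' u).2]
    have hu' : (⟨(N u * B).col k, col_mem_unitVectors
        (mul_mem_unitaryFixing (hN' u).1 (mem_unitaryFixing_succ.1 hB).1)⟩ : unitVectors k) = u :=
      Subtype.ext hu
    refine Prod.ext hu' (Subtype.ext ?_)
    change (N ⟨(N u * B).col k, _⟩).conjTranspose * (N u * B) = B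
    rw [hu', ← Matrix.mul_assoc, (hN' u).1.1, Matrix.one_mul]

/-- Descending from the trivial group at k = 4: an induced matrix with the same column k strips that
column off. -/
theorem unitaryFixing_subset_glueImage {k : ℕ} (hk : k ≤ 4) :
    unitaryFixing k ⊆ glueImage := by
  induction hk using Nat.decreasingInduction with
  | self =>
    rw [unitaryFixing_four]
    exact Set.singleton_subset_iff.2 (one_mem glueImage)
  | of_succ k hk ih =>
    intro A hA
    obtain ⟨N, hN, hN1, hN2⟩ := exists_mem_glueImage_col (col_mem_unitVectors (k := ⟨k, hk⟩) hA)
    have h := ih (conjTranspose_mul_mem_succ hN1 hA hN2)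
    have h1 : N * (N.conjTranspose * A) = A := by
      rw [← Matrix.mul_assoc, mul_eq_one_comm.1 hN1.1, Matrix.one_mul]
    exact h1 ▸ mul_mem hN h

theorem glueRep_surjective : Function.Surjective glueRep := by
  intro A
  obtain ⟨f, hf⟩ := mem_glueImage.1 (unitaryFixing_subset_glueImage (Nat.zero_le 4)
    (show A.1 ∈ unitaryFixing 0 from ⟨Matrix.mem_unitaryGroup_iff'.1 A.2, fun i hi =>
      absurd hi (Nat.not_lt_zero _)⟩))
  exact ⟨f, Subtype.ext hf⟩

theorem card_unitVectors : (unitVectors 0).card = 120 ∧ (unitVectors 1).card = 36 ∧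
    (unitVectors 2).card = 6 ∧ (unitVectors 3).card = 3 := by
  decide +kernel

theorem card_unitaryGroup : Nat.card (Matrix.unitaryGroup (Fin 4) F4) = 77760 := by
  have h0 : Nat.card (Matrix.unitaryGroup (Fin 4) F4) = Nat.card (unitaryFixing 0) :=
    Nat.card_congr (Equiv.subtypeEquivRight fun A => Matrix.mem_unitaryGroup_iff'.trans
      ⟨fun h => ⟨h, fun i hi => absurd hi (Nat.not_lt_zero _)⟩, fun h => h.1⟩)
  obtain ⟨h1, h2, h3, h4⟩ := card_unitVectors
  have e0 := card_unitaryFixing_succ 0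
  have e1 := card_unitaryFixing_succ 1
  have e2 := card_unitaryFixing_succ 2
  have e3 := card_unitaryFixing_succ 3
  have e4 : Nat.card (unitaryFixing 4) = 1 := by
    rw [unitaryFixing_four]
    simp
  change Nat.card (unitaryFixing 3) = (unitVectors 3).card * Nat.card (unitaryFixing 4) at e3
  change Nat.card (unitaryFixing 2) = (unitVectors 2).card * Nat.card (unitaryFixing 3) at e2
  change Nat.card (unitaryFixing 1) = (unitVectors 1).card * Nat.card (unitaryFixing 2) at e1
  change Nat.card (unitaryFixing 0) = (unitVectors 0).card * Nat.card (unitaryFixing 1) at e0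
  rw [h0, e0, e1, e2, e3, e4, h1, h2, h3, h4]

/-! ### The shape of the isometry group of the glued lattice -/

theorem map_smul_cases (f : glueO) : (∀ (w : Eis) c, f.1 (w • c) = w • f.1 c) ∨
    ∀ (w : Eis) c, f.1 (w • c) = star w • f.1 c := by
  rcases map_omega_cases f.2 with h | h
  · exact Or.inl fun w c => glueU_map_smul ⟨f, h⟩ w c
  · refine Or.inr fun w c => ?_
    rw [smul_eq_re_add_im, map_add, map_zsmul, map_zsmul, h, smul_eq_re_add_im (star w)]
    have h1 : (eisω * eisω : Eis) = -1 - eisω := by decide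
    have h2 : (star w).re = w.re - w.im := by simp [QuadraticAlgebra.re_star, sub_eq_add_neg]
    have h3 : (star w).im = -w.im := QuadraticAlgebra.im_star w
    rw [h1, h2, h3, sub_smul (-1 : Eis), neg_one_smul]
    module

/-- The semilinear isometry given by conjugation. -/
def glueConj : (Fin 5 → Eis) →+ (Fin 5 → Eis) where
  toFun c i := star (c (Equiv.swap 3 4 i))
  map_zero' := by funext i; simp
  map_add' c d := by funext i; simp

theorem glueConj_apply (c : Fin 5 → Eis) (i : Fin 5) :
    glueConj c i = star (c (Equiv.swap 3 4 i)) := rfl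

theorem glueConj_involutive : Function.Involutive glueConj := fun c => by
  funext i
  rw [glueConj_apply, glueConj_apply, star_star, Equiv.swap_apply_self]

theorem glueConj_smul (w : Eis) (c : Fin 5 → Eis) : glueConj (w • c) = star w • glueConj c := by
  funext i
  rw [glueConj_apply, Pi.smul_apply, smul_eq_mul, star_mul', Pi.smul_apply, smul_eq_mul,
    glueConj_apply]

theorem glueHerm_glueConj (c d : Fin 5 → Eis) :
    glueHerm (glueConj c) (glueConj d) = star (glueHerm c d) := by
  have hG : ∀ i j, glueGram (Equiv.swap 3 4 i) (Equiv.swap 3 4 j) = star (glueGram i j) := by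
    decide
  simp only [glueHerm, star_sum, star_mul', ← hG, glueConj_apply]
  rw [← Equiv.sum_comp (Equiv.swap (3 : Fin 5) 4)]
  refine Finset.sum_congr rfl fun i _ => ?_
  rw [← Equiv.sum_comp (Equiv.swap (3 : Fin 5) 4)]
  simp only [Equiv.swap_apply_self]

/-- Conjugating coordinates turns ω, ω² in the second code word into ω², ω, and exchanging the two
coordinates undoes this. Composition with this antilinear isometry interchanges linear and
antilinear isometries, which are disjoint classes. -/
theorem index_glueU : glueU.index = 2 := by
  let κ : glueO := ⟨LinearEquiv.ofInvolutive glueConj.toIntLinearMap glueConj_involutive,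
    fun c d => by
      change (glueHerm (glueConj c) (glueConj d)).trace = _
      rw [glueHerm_glueConj, QuadraticAlgebra.trace_star, glueForm]⟩
  have hκ : ∀ c, κ.1 c = glueConj c := fun _ => rfl
  have hnot : ∀ f : glueO, (∀ c, f.1 (eisω • c) = eisω • f.1 c) →
      ¬ ∀ c, f.1 (eisω • c) = star eisω • f.1 c := by
    intro f h1 h2
    have h3 := (h1 (f.1.symm (Pi.single 0 1))).symm.trans (h2 _)
    rw [f.1.apply_symm_apply] at h3
    exact absurd (congrFun h3 0) (by decide)
  refine Subgroup.index_eq_two_iff.2 ⟨κ, fun f => ?_⟩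
  have hmul : ∀ c, (f * κ).1 c = f.1 (glueConj c) := fun _ => rfl
  rcases map_smul_cases f with h | h
  · refine Or.inr ⟨h eisω, fun h' => hnot _ h' fun c => ?_⟩
    rw [hmul, glueConj_smul, h, hmul]
  · refine Or.inl ⟨fun c => ?_, fun h' => hnot _ h' (h eisω)⟩
    rw [hmul, glueConj_smul, h, star_star, hmul]

instance : glueU.Normal := Subgroup.normal_of_index_eq_two index_glueU

theorem glueRep_eq_one_iff {f : glueU} :
    glueRep f = 1 ↔ (∀ c, f.1.1 c = c) ∨ ∀ c, f.1.1 c = -c := by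
  constructor
  · intro h
    refine eq_sign_of_glueRed fun c => ?_
    rw [glueRed_map_glueRep, h]
    exact Matrix.one_mulVec _
  · intro h
    refine Subtype.ext (glueRep_eq fun c => ?_)
    have h2 : ∀ x : F4, -x = x := by decide
    change _ = Matrix.mulVec 1 _
    rw [Matrix.one_mulVec]
    rcases h with h | h
    · rw [h]
    · rw [h, map_neg]
      exact funext fun i => h2 _

theorem card_glueU : Nat.card glueU = 2 * 77760 := by
  obtain ⟨g, hg⟩ := exists_glueU_smul (μ := -1) (by decide)
  have hker : (glueRep.ker : Set glueU) = {1, g} := by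
    ext f
    rw [SetLike.mem_coe, MonoidHom.mem_ker, glueRep_eq_one_iff]
    constructor
    · rintro (h | h)
      · exact Or.inl (glueU_ext h)
      · exact Or.inr (glueU_ext fun c => by rw [h, hg, neg_one_smul])
    · rintro (rfl | rfl)
      · exact Or.inl fun _ => rfl
      · exact Or.inr fun c => by rw [hg, neg_one_smul]
  have hne : (1 : glueU) ≠ g := fun h => by
    have h1 := hg (Pi.single 0 1)
    rw [← h] at h1
    exact absurd (congrFun h1 0) (by decide)
  have h2 : Nat.card glueRep.ker = 2 :=
    (congrArg (fun s : Set glueU => Nat.card s) hker).trans (Set.ncard_pair hne)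
  rw [← Subgroup.card_mul_index glueRep.ker, h2, Subgroup.index_ker,
    MonoidHom.range_eq_top.2 glueRep_surjective, Subgroup.card_top, card_unitaryGroup]

theorem card_glueO : Nat.card glueO = 2 ^ 8 * 3 ^ 5 * 5 := by
  rw [← Subgroup.card_mul_index glueU, index_glueU, card_glueU]
  norm_num

/-! ### The scalars of norm one. -/

/-- The scalar isometries. -/
def glueScalars : Subgroup glueO where
  carrier := {f | ∃ μ : Eis, μ * star μ = 1 ∧ ∀ c, f.1 c = μ • c}
  one_mem' := ⟨1, by decide, fun c => (one_smul _ c).symm⟩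
  mul_mem' := by
    rintro f g ⟨μ, hμ, hf⟩ ⟨ν, hν, hg⟩
    refine ⟨μ * ν, ?_, fun c => ?_⟩
    · rw [star_mul', mul_mul_mul_comm, hμ, hν, one_mul]
    · change f.1 (g.1 c) = _
      rw [hf, hg, smul_smul]
  inv_mem' := by
    rintro f ⟨μ, hμ, hf⟩
    refine ⟨star μ, by rw [star_star, mul_comm, hμ], fun c => ?_⟩
    change f.1.symm c = _
    rw [LinearEquiv.symm_apply_eq, hf, smul_smul, hμ, one_smul]

theorem glueScalars_le : glueScalars ≤ glueU := by
  rintro f ⟨μ, -, hf⟩ c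
  rw [hf, hf, smul_comm]

instance : glueScalars.Normal where
  conj_mem := by
    rintro z ⟨μ, hμ, hz⟩ f
    have h1 : ∀ c, (f * z * f⁻¹).1 c = f.1 (z.1 (f.1.symm c)) := fun _ => rfl
    rcases map_smul_cases f with h | h
    · exact ⟨μ, hμ, fun c => by rw [h1, hz, h, f.1.apply_symm_apply]⟩
    · exact ⟨star μ, by rw [star_star, mul_comm, hμ],
        fun c => by rw [h1, hz, h, f.1.apply_symm_apply]⟩

theorem exists_eq_pow_of_mul_star {μ : Eis} (hμ : μ * star μ = 1) :
    ∃ n : ℕ, μ = (-eisω) ^ n := by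
  have h1 : μ.norm = 1 := by
    have h := congrArg QuadraticAlgebra.re hμ
    rw [← QuadraticAlgebra.algebraMap_norm_eq_mul_star] at h
    simpa [QuadraticAlgebra.re_one] using h
  rw [QuadraticAlgebra.norm_def] at h1
  obtain ⟨a, b⟩ := μ
  simp only at h1
  have ha : a ^ 2 < 2 := by nlinarith [sq_nonneg (2 * b - a)]
  have hb : b ^ 2 < 2 := by nlinarith [sq_nonneg (2 * a - b)]
  have ha1 : a < 2 := by nlinarith
  have ha2 : -2 < a := by nlinarith
  have hb1 : b < 2 := by nlinarith
  have hb2 : -2 < b := by nlinarith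
  have h3 : ∀ a ∈ Finset.Icc (-1 : ℤ) 1, ∀ b ∈ Finset.Icc (-1 : ℤ) 1,
      a * a + -1 * a * b - -1 * b * b = 1 →
      ∃ n ∈ Finset.range 6, (⟨a, b⟩ : Eis) = (-eisω) ^ n := by decide +kernel
  obtain ⟨n, -, hn⟩ := h3 a (Finset.mem_Icc.2 ⟨by omega, by omega⟩) b
    (Finset.mem_Icc.2 ⟨by omega, by omega⟩) h1
  exact ⟨n, hn⟩

theorem exists_generator_glueScalars :
    ∃ g : glueO, orderOf g = 6 ∧ glueScalars = Subgroup.zpowers g := by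
  obtain ⟨g', hg'⟩ := exists_glueU_smul (μ := -eisω) (by decide)
  let g : glueO := g'.1
  have hg : ∀ c, g.1 c = -eisω • c := hg'
  have hpow : ∀ (n : ℕ) c, (g ^ n).1 c = (-eisω) ^ n • c := by
    intro n
    induction n with
    | zero => exact fun c => by rw [pow_zero, pow_zero, one_smul]; rfl
    | succ n ih =>
      intro c
      rw [pow_succ, pow_succ, mul_smul, ← ih, ← hg]
      rfl
  refine ⟨g, (orderOf_eq_iff (by norm_num)).2 ⟨?_, fun m hm hm0 h => ?_⟩, le_antisymm ?_ ?_⟩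
  · refine Subtype.ext (LinearEquiv.ext fun c => ?_)
    rw [hpow, show (-eisω : Eis) ^ 6 = 1 by decide +kernel, one_smul]
    rfl
  · have h1 := hpow m (Pi.single 0 1)
    rw [h] at h1
    have h2 := congrFun h1 0
    have h3 : ∀ m ∈ Finset.Ico 1 6, (Pi.single 0 1 : Fin 5 → Eis) 0 ≠
        ((-eisω) ^ m • (Pi.single 0 1 : Fin 5 → Eis)) 0 := by decide +kernel
    exact h3 m (Finset.mem_Ico.2 ⟨hm0, hm⟩) h2
  · rintro f ⟨μ, hμ, hf⟩
    obtain ⟨n, rfl⟩ := exists_eq_pow_of_mul_star hμ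
    exact Subgroup.mem_zpowers_iff.2 ⟨n, (zpow_natCast g n).trans
      (Subtype.ext (LinearEquiv.ext fun c => by rw [hpow, hf]))⟩
  · rw [Subgroup.zpowers_le]
    exact ⟨-eisω, by decide, hg⟩

theorem isCyclic_glueScalars : IsCyclic glueScalars := by
  obtain ⟨g, -, h⟩ := exists_generator_glueScalars
  rw [h]
  infer_instance

theorem card_glueScalars : Nat.card glueScalars = 6 := by
  obtain ⟨g, h, h'⟩ := exists_generator_glueScalars
  rw [h', Nat.card_zpowers, h]

/-! ### From the unitary group to the projective special unitary group. -/

instance : Fact (∀ r : ZMod 2, r ^ 2 ≠ 1 + 1 * r) := ⟨by decide⟩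

theorem exists_f4_equiv : Nonempty (F4 ≃+* GaloisField 2 2) :=
  ⟨(GaloisField.algEquivGaloisField 2 2 (K := F4) (by
    rw [Nat.card_eq_fintype_card]
    decide +kernel)).toRingEquiv⟩

/-- An isomorphism between the two models of the field with four elements. -/
noncomputable def f4Equiv : F4 ≃+* GaloisField 2 2 := exists_f4_equiv.some

theorem frobeniusAdjoint_map (A : Matrix (Fin 4) (Fin 4) F4) :
    frobeniusAdjoint (p := 2) (A.map f4Equiv) = A.conjTranspose.map f4Equiv := by
  have h : ∀ x : F4, star x = x ^ 2 := by decide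
  refine Matrix.ext fun i j => ?_
  change frobenius (GaloisField 2 2) 2 (f4Equiv (A j i)) = f4Equiv (star (A j i))
  rw [h, map_pow, frobenius_def]

theorem det_map_f4Equiv (A : Matrix (Fin 4) (Fin 4) F4) :
    (A.map f4Equiv).det = f4Equiv A.det :=
  (RingHom.map_det (f4Equiv : F4 →+* GaloisField 2 2) A).symm

theorem map_mul_f4Equiv (A B : Matrix (Fin 4) (Fin 4) F4) :
    (A * B).map f4Equiv = A.map f4Equiv * B.map f4Equiv :=
  Matrix.map_mul (f := (f4Equiv : F4 →+* GaloisField 2 2))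

theorem map_one_f4Equiv : (1 : Matrix (Fin 4) (Fin 4) F4).map f4Equiv = 1 :=
  Matrix.map_one _ (map_zero _) (map_one _)

theorem map_f4Equiv_injective :
    Function.Injective fun A : Matrix (Fin 4) (Fin 4) F4 => A.map f4Equiv :=
  Matrix.map_injective f4Equiv.injective

/-- The special unitary matrix with given entries. -/
noncomputable def toSU (A : Matrix (Fin 4) (Fin 4) F4) (h1 : A.det = 1)
    (h2 : A.conjTranspose * A = 1) : SUGroup 4 2 :=
  ⟨⟨A.map f4Equiv, by rw [det_map_f4Equiv, h1, map_one]⟩, by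
    change frobeniusAdjoint (A.map f4Equiv) * A.map f4Equiv = 1
    rw [frobeniusAdjoint_map, ← map_mul_f4Equiv, h2, map_one_f4Equiv]⟩

theorem toSU_val (A : Matrix (Fin 4) (Fin 4) F4) (h1 : A.det = 1)
    (h2 : A.conjTranspose * A = 1) : (toSU A h1 h2).1.1 = A.map f4Equiv := rfl

theorem exists_toSU_eq (S : SUGroup 4 2) : ∃ A h1 h2, toSU A h1 h2 = S := by
  let A : Matrix (Fin 4) (Fin 4) F4 := S.1.1.map f4Equiv.symm
  have hA : A.map f4Equiv = S.1.1 := Matrix.ext fun i j => f4Equiv.apply_symm_apply _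
  refine ⟨A, ?_, ?_, Subtype.ext (Subtype.ext hA)⟩
  · refine f4Equiv.injective ?_
    rw [← det_map_f4Equiv, hA, map_one]
    exact S.1.2
  · refine map_f4Equiv_injective ?_
    change (A.conjTranspose * A).map f4Equiv = (1 : Matrix _ _ _).map f4Equiv
    rw [map_mul_f4Equiv, ← frobeniusAdjoint_map, hA, map_one_f4Equiv]
    exact S.2

theorem star_det_mul_det {A : Matrix (Fin 4) (Fin 4) F4} (hA : A.conjTranspose * A = 1) :
    star A.det * A.det = 1 := by
  rw [← Matrix.det_conjTranspose, ← Matrix.det_mul, hA, Matrix.det_one]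

/-- In dimension 4 a scalar x of the field with four elements has determinant x⁴ = x, so dividing a
unitary matrix by its determinant gives determinant one. -/
theorem det_star_det_smul {A : Matrix (Fin 4) (Fin 4) F4} (hA : A.conjTranspose * A = 1) :
    (star A.det • A).det = 1 := by
  have h : ∀ x : F4, star x * x = 1 → star x ^ 4 * x = 1 := by decide
  rw [Matrix.det_smul, Fintype.card_fin]
  exact h _ (star_det_mul_det hA)

theorem conjTranspose_star_det_smul {A : Matrix (Fin 4) (Fin 4) F4}
    (hA : A.conjTranspose * A = 1) : (star A.det • A).conjTranspose * (star A.det • A) = 1 := by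
  rw [Matrix.conjTranspose_smul, star_star, Matrix.smul_mul, Matrix.mul_smul, smul_smul, hA,
    mul_comm, star_det_mul_det hA, one_smul]

/-- A unitary matrix, rescaled to determinant one. -/
noncomputable def unitaryToSU : Matrix.unitaryGroup (Fin 4) F4 →* SUGroup 4 2 :=
  MonoidHom.mk' (fun A => toSU _ (det_star_det_smul (Matrix.mem_unitaryGroup_iff'.1 A.2))
    (conjTranspose_star_det_smul (Matrix.mem_unitaryGroup_iff'.1 A.2))) fun A B => by
      refine Subtype.ext (Subtype.ext ?_)
      change (star (A.1 * B.1).det • (A.1 * B.1)).map f4Equiv =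
        (star A.1.det • A.1).map f4Equiv * (star B.1.det • B.1).map f4Equiv
      rw [← map_mul_f4Equiv, Matrix.det_mul, star_mul', Matrix.smul_mul, Matrix.mul_smul, smul_smul]

theorem unitaryToSU_val (A : Matrix.unitaryGroup (Fin 4) F4) :
    (unitaryToSU A).1.1 = (star A.1.det • A.1).map f4Equiv := rfl

theorem unitaryToSU_surjective : Function.Surjective unitaryToSU := by
  intro S
  obtain ⟨A, h1, h2, rfl⟩ := exists_toSU_eq S
  refine ⟨⟨A, Matrix.mem_unitaryGroup_iff'.2 h2⟩, Subtype.ext (Subtype.ext ?_)⟩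
  rw [unitaryToSU_val, toSU_val, h1, star_one, one_smul]

/-- The action of the linear isometries of the glued lattice on the projective unitary space. -/
noncomputable def gluePSU : glueU →* PSUGroup 4 2 :=
  (QuotientGroup.mk' (Subgroup.center (SUGroup 4 2))).comp (unitaryToSU.comp glueRep)

theorem gluePSU_surjective : Function.Surjective gluePSU :=
  (QuotientGroup.mk'_surjective _).comp (unitaryToSU_surjective.comp glueRep_surjective)

theorem gluePSU_eq_one_iff {f : glueU} :
    gluePSU f = 1 ↔ unitaryToSU (glueRep f) ∈ Subgroup.center (SUGroup 4 2) :=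
  QuotientGroup.eq_one_iff _

theorem commute_of_mem_center {A : Matrix.unitaryGroup (Fin 4) F4}
    (hA : unitaryToSU A ∈ Subgroup.center (SUGroup 4 2)) {C : Matrix (Fin 4) (Fin 4) F4}
    (h1 : C.det = 1) (h2 : C.conjTranspose * C = 1) : C * A.1 = A.1 * C := by
  have h := congrArg (fun S : SUGroup 4 2 => S.1.1)
    (Subgroup.mem_center_iff.1 hA (toSU C h1 h2))
  change C.map f4Equiv * (star A.1.det • A.1).map f4Equiv =
    (star A.1.det • A.1).map f4Equiv * C.map f4Equiv at h
  rw [← map_mul_f4Equiv, ← map_mul_f4Equiv] at h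
  have h3 := congrArg (fun B : Matrix (Fin 4) (Fin 4) F4 => A.1.det • B) (map_f4Equiv_injective h)
  simp only [Matrix.mul_smul, Matrix.smul_mul, smul_smul, mul_comm A.1.det,
    star_det_mul_det (Matrix.mem_unitaryGroup_iff'.1 A.2), one_smul] at h3
  exact h3

/-- Commuting with diagonal matrices of determinant one kills the entries off the diagonal;
commuting with transpositions, which have determinant -1 = 1, makes the diagonal constant. -/
theorem eq_smul_one_of_mem_center {A : Matrix.unitaryGroup (Fin 4) F4}
    (hA : unitaryToSU A ∈ Subgroup.center (SUGroup 4 2)) : A.1 = A.1 0 0 • 1 := by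
  have hdiag : ∀ d : Fin 4 → F4, d 0 * d 1 * d 2 * d 3 = 1 → (∀ i, d i ≠ 0) →
      ∀ i j, d i ≠ d j → A.1 i j = 0 := by
    intro d h1 h2 i j hij
    have h := commute_of_mem_center hA (C := Matrix.diagonal d)
      (by rw [Matrix.det_diagonal, Fin.prod_univ_four, h1])
      (conjTranspose_mul_of_mem_glueImage (diagonal_mem h2))
    have h3 := congrFun (congrFun h i) j
    rw [Matrix.diagonal_mul, Matrix.mul_diagonal, mul_comm, ← sub_eq_zero, ← mul_sub] at h3
    exact (mul_eq_zero.1 h3).resolve_right (sub_ne_zero.2 hij)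
  have hoff : ∀ i j, i ≠ j → A.1 i j = 0 := by
    -- No single choice of diagonal with determinant one and four nonzero entries can have them all
    -- distinct, as there are only three; two together separate every pair.
    have hd : ∀ i j : Fin 4, i ≠ j → (![1, ⟨0, 1⟩, ⟨1, 1⟩, 1] : Fin 4 → F4) i ≠
        (![1, ⟨0, 1⟩, ⟨1, 1⟩, 1] : Fin 4 → F4) j ∨ (![⟨0, 1⟩, ⟨1, 1⟩, 1, 1] : Fin 4 → F4) i ≠
        (![⟨0, 1⟩, ⟨1, 1⟩, 1, 1] : Fin 4 → F4) j := by decide +kernel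
    intro i j hij
    rcases hd i j hij with h | h
    · exact hdiag _ (by decide +kernel) (by decide +kernel) i j h
    · exact hdiag _ (by decide +kernel) (by decide +kernel) i j h
  have hon : ∀ i, A.1 i i = A.1 0 0 := by
    intro i
    rcases eq_or_ne i 0 with rfl | hi
    · rfl
    have hdet : ∀ i : Fin 4, i ≠ 0 → (unitarySwap 0 i).det = 1 := by
      intro i hi
      rw [unitarySwap, Matrix.det_permutation, Equiv.Perm.sign_swap hi.symm]
      decide
    have h := commute_of_mem_center hA (hdet i hi)
      (conjTranspose_mul_of_mem_glueImage (unitarySwap_mem 0 i))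
    have h1 := congrFun (congrFun h 0) i
    have hs : ∀ i k, unitarySwap 0 i 0 k = if k = i then 1 else 0 := by decide +kernel
    have hs' : ∀ i k, unitarySwap 0 i k i = if k = 0 then 1 else 0 := by decide +kernel
    change ∑ k, unitarySwap 0 i 0 k * A.1 k i = ∑ k, A.1 0 k * unitarySwap 0 i k i at h1
    simpa [hs, hs'] using h1
  refine Matrix.ext fun i j => ?_
  rw [Matrix.smul_apply, smul_eq_mul]
  rcases eq_or_ne i j with rfl | hij
  · rw [hon, Matrix.one_apply_eq, mul_one]
  · rw [hoff i j hij, Matrix.one_apply_ne hij, mul_zero]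

/-- An isometry in the kernel is scalar modulo 2. Every nonzero scalar modulo 2 lifts to a power of
ω; after dividing by it the isometry is trivial modulo 2, hence ±1. -/
theorem ker_gluePSU : gluePSU.ker = glueScalars.subgroupOf glueU := by
  ext f
  rw [MonoidHom.mem_ker, gluePSU_eq_one_iff, Subgroup.mem_subgroupOf]
  constructor
  · intro h
    have h1 := eq_smul_one_of_mem_center h
    have h2 : ∀ x : F4, ∃ μ ∈ ({1, eisω, eisω * eisω} : Finset Eis), μ * star μ = 1 ∧
        (x ≠ 0 → eisMod (star μ) * x = 1) := by decide +kernel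
    obtain ⟨μ, -, hμ, hx⟩ := h2 ((glueRep f).1 0 0)
    have h3 := hx fun h0 => by
      rw [h0, zero_smul] at h1
      have h4 := Matrix.mem_unitaryGroup_iff'.1 (glueRep f).2
      rw [h1, mul_zero] at h4
      exact zero_ne_one h4
    obtain ⟨g, hg⟩ := exists_glueU_smul (μ := star μ) (by rw [star_star, mul_comm, hμ])
    have hgf : ∀ c, (g * f).1.1 c = star μ • f.1.1 c := fun c => hg _
    have h5 : glueRep (g * f) = 1 := by
      refine Subtype.ext (glueRep_eq fun c => ?_)
      rw [hgf, glueRed_smul, glueRed_map_glueRep, h1, Matrix.smul_mulVec, smul_smul, h3, one_smul]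
      rfl
    rcases glueRep_eq_one_iff.1 h5 with h6 | h6
    · refine ⟨μ, hμ, fun c => ?_⟩
      have h7 := h6 c
      rw [hgf] at h7
      rw [← h7, smul_smul, hμ, one_smul, h7]
    · refine ⟨-μ, by rw [star_neg, neg_mul_neg, hμ], fun c => ?_⟩
      have h7 := h6 c
      rw [hgf] at h7
      rw [neg_smul, ← smul_neg, ← h7, smul_smul, hμ, one_smul]
  · rintro ⟨μ, hμ, hf⟩
    have h1 := glueRep_smul hf
    have h2 : unitaryToSU (glueRep f) = 1 := by
      refine Subtype.ext (Subtype.ext ?_)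
      rw [unitaryToSU_val, h1, Matrix.det_smul, Matrix.det_one, mul_one, Fintype.card_fin, smul_smul]
      have h3 : ∀ x : F4, x * star x = 1 → star (x ^ 4) * x = 1 := by decide
      rw [h3 _ (by rw [← eisMod_star, ← map_mul, hμ, map_one]), one_smul, map_one_f4Equiv]
      rfl
    rw [h2]
    exact one_mem _

theorem hasShape_glueO : HasShape glueO 6 (PSUGroup 4 2) 2 := by
  refine ⟨glueScalars, glueU, inferInstance, inferInstance, glueScalars_le, isCyclic_glueScalars,
    card_glueScalars, ⟨(QuotientGroup.quotientMulEquivOfEq ker_gluePSU.symm).trans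
      (QuotientGroup.quotientKerEquivOfSurjective _ gluePSU_surjective)⟩, ?_, index_glueU⟩
  have : Fact (Nat.Prime 2) := ⟨Nat.prime_two⟩
  exact isCyclic_of_prime_card (p := 2) index_glueU

/-! ### Transport to the annihilator. -/

theorem HasShape.of_mulEquiv {G G' : Type*} [Group G] [Group G'] (e : G ≃* G') {m k : ℕ}
    {H : Type*} [Group H] (h : HasShape G m H k) : HasShape G' m H k := by
  obtain ⟨Z, B, hZ, hB, hZB, hc, hm, ⟨ψ⟩, hq, hk⟩ := h
  have hZ' : (Z.map (e : G →* G')).Normal := hZ.map _ e.surjective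
  have hB' : (B.map (e : G →* G')).Normal := hB.map _ e.surjective
  let eq := QuotientGroup.congr B (B.map (e : G →* G')) e rfl
  have hsub : (Z.subgroupOf B).map ((e.subgroupMap B : B ≃* B.map (e : G →* G')) : B →* _) =
      (Z.map (e : G →* G')).subgroupOf (B.map (e : G →* G')) := by
    ext ⟨x, hx⟩
    simp only [Subgroup.mem_map, Subgroup.mem_subgroupOf]
    constructor
    · rintro ⟨b, hb, hbx⟩
      exact ⟨b, hb, congrArg Subtype.val hbx⟩
    · rintro ⟨z, hz, rfl⟩
      exact ⟨⟨z, hZB hz⟩, hz, rfl⟩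
  exact ⟨Z.map (e : G →* G'), B.map (e : G →* G'), hZ', hB', Subgroup.map_mono hZB,
    (e.subgroupMap Z).isCyclic.1 hc, (Nat.card_congr (e.subgroupMap Z).toEquiv).symm.trans hm,
    ⟨(QuotientGroup.congr _ _ (e.subgroupMap B) hsub).symm.trans ψ⟩, eq.isCyclic.1 hq,
    (Nat.card_congr eq.toEquiv).symm.trans hk⟩

/-- The annihilator of a dihedral pair in Eisenstein coordinates. -/
theorem exists_latticeAnn_equiv {M N : Submodule ℤ E24} (hM : M ≤ leechLattice)
    (hN : N ≤ leechLattice) (hMN : IsDIHPair 3 14 M N) :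
    ∃ e : (Fin 5 → Eis) ≃ₗ[ℤ] latticeAnn leechLattice (M ⊔ N),
      ∀ c d, inner ℝ (e c : E24) (e d : E24) = (glueForm c d : ℝ) := by
  obtain ⟨g, f, r, s, t, h, hperp⟩ := exists_hexaFrame hM hN hMN
  obtain ⟨X, hX, hXann⟩ := h.exists_annihilator_eq
  let F : (Fin 5 → Eis) →+ E24 := (tripleComb X).comp glueCoord.toAddMonoidHom
  have hF : ∀ c, F c = tripleComb X (glueCoord c) := fun _ => rfl
  obtain ⟨e, he⟩ := exists_glue_equiv F (latticeAnn leechLattice (M ⊔ N)) (fun x => by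
    change x ∈ leechLattice ∧ (∀ m ∈ M ⊔ N, inner ℝ x m = (0 : ℝ)) ↔ ∃ c, tripleComb X (glueCoord c) = x
    rw [hperp, ← hXann, mem_hexaAnn, mem_hexaSpan_orthogonal, and_assoc]) fun c hc => by
      have h1 := hX.inner_glue c c
      rw [← hF, hc, inner_zero_left] at h1
      exact_mod_cast h1.symm
  exact ⟨e, fun c d => by rw [he, he, hF, hF, hX.inner_glue, glueForm]⟩

theorem exists_gluedAA2Lattice_equiv : ∃ e : (Fin 5 → Eis) ≃ₗ[ℤ] gluedAA2Lattice, ∀ c d,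
    (inner ℂ (e c : EuclideanSpace ℂ (Fin 5)) (e d : EuclideanSpace ℂ (Fin 5))).re =
      (glueForm c d : ℝ) := by
  obtain ⟨e, he⟩ := exists_glue_equiv glueVector gluedAA2Lattice mem_gluedAA2Lattice fun c hc => by
    have h1 := inner_glueVector c c
    rw [hc, inner_zero_left] at h1
    exact_mod_cast h1.symm
  exact ⟨e, fun c d => by rw [he, he, inner_glueVector, glueForm]⟩

/-- Conjugation of isometries by a linear equivalence compatible with the forms. -/
noncomputable def latticeOEquiv {R : Submodule ℤ E24} (e : (Fin 5 → Eis) ≃ₗ[ℤ] R)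
    (he : ∀ c d, inner ℝ (e c : E24) (e d : E24) = (glueForm c d : ℝ)) : glueO ≃* latticeO R where
  toFun f := ⟨e.symm.trans (f.1.trans e), fun x y => by
    change inner ℝ (e (f.1 (e.symm x)) : E24) (e (f.1 (e.symm y)) : E24) = _
    rw [he, glueForm_map f.2, ← he, e.apply_symm_apply, e.apply_symm_apply]⟩
  invFun f := ⟨e.trans (f.1.trans e.symm), fun c d => by
    have h : (glueForm (e.symm (f.1 (e c))) (e.symm (f.1 (e d))) : ℝ) = glueForm c d := by
      rw [← he, e.apply_symm_apply, e.apply_symm_apply, ← he]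
      exact f.2 _ _
    exact_mod_cast h⟩
  left_inv f := Subtype.ext (LinearEquiv.ext fun c => by
    change e.symm (e (f.1 (e.symm (e c)))) = f.1 c
    rw [e.symm_apply_apply, e.symm_apply_apply])
  right_inv f := Subtype.ext (LinearEquiv.ext fun x => by
    change e (e.symm (f.1 (e (e.symm x)))) = f.1 x
    rw [e.apply_symm_apply, e.apply_symm_apply])
  map_mul' f g := Subtype.ext (LinearEquiv.ext fun x => by
    change e (f.1 (g.1 (e.symm x))) = e (f.1 (e.symm (e (g.1 (e.symm x)))))
    rw [e.symm_apply_apply])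

theorem mainTheorem11 (M N : Submodule ℤ (EuclideanSpace ℝ ProjLine23))
    (hM : M ≤ leechLattice) (hN : N ≤ leechLattice) (hMN : IsDIHPair 3 14 M N) :
    let R := latticeAnn leechLattice (M ⊔ N)
    Module.finrank ℤ R = 10 ∧
    (∃ e : R ≃ₗ[ℤ] gluedAA2Lattice, ∀ x y : R,
      (inner ℂ (e x : EuclideanSpace ℂ (Fin 5)) (e y : EuclideanSpace ℂ (Fin 5))).re =
        inner ℝ (x : EuclideanSpace ℝ ProjLine23) (y : EuclideanSpace ℝ ProjLine23)) ∧
    Nat.card (latticeO R) = 2 ^ 8 * 3 ^ 5 * 5 ∧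
    HasShape (latticeO R) 6 (PSUGroup 4 2) 2 := by
  intro R
  obtain ⟨e, he⟩ := exists_latticeAnn_equiv hM hN hMN
  obtain ⟨e', he'⟩ := exists_gluedAA2Lattice_equiv
  refine ⟨?_, ⟨e.symm.trans e', fun x y => ?_⟩, ?_, hasShape_glueO.of_mulEquiv (latticeOEquiv e he)⟩
  · rw [← e.finrank_eq, Module.finrank_pi_fintype]
    simp [QuadraticAlgebra.finrank_eq_two]
  · rw [LinearEquiv.trans_apply, LinearEquiv.trans_apply, he', ← he, e.apply_symm_apply,
      e.apply_symm_apply]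
  · rw [← Nat.card_congr (latticeOEquiv e he).toEquiv, card_glueO]
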